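/- Let $\mathbb T=\mathbb R/\mathbb Z$, $e_n(x)=e^{2\pi i n x}$, $\langle x\rangle=(1+|x|^2)^{1/2}$, and $S(t)=e^{-it\partial_x^2}$, so that $\widehat{S(t)f}(n)=e^{it(2\pi n)^2}\widehat f(n)$. For $s\in\mathbb R$, $1\le p<\infty$ let $\|f\|_{\mathcal FL^{s,p}}=\|\langle n\rangle^s\widehat f(n)\|_{\ell^p_n(\mathbb Z)}$, and let $\gamma(L^2(\mathbb T);\mathcal FL^{s,p}(\mathbb T))$ be the set of bounded linear operators $\phi:L^2(\mathbb T)\to\mathcal FL^{s,p}(\mathbb T)$ with $$\Big\|\Big(\sum_{k\in\mathbb Z}|\langle n\rangle^s\widehat{\phi(e_k)}(n)|^2\Big)^{1/2}\Big\|_{\ell^p_n(\mathbb Z)}<\infty .$$ Let $X^{s,b}_p(\mathbb R\times\mathbb T)$ be the completion of the Schwartz functions on $\mathbb R\times\mathbb T$ in the norm $\|\langle n\rangle^s\langle\tau-(2\pi n)^2\rangle^b\,\widehat v(\tau,n)\|_{\ell^p_nL^p_\tau}$, where $\widehat v(\tau,n)=\int_{\mathbb R}e^{-it\tau}\widehat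 v(t,n)\,dt$, and let $\|u\|_{X^{s,b}_p([0,T])}$ be the infimum of $\|v\|_{X^{s,b}_p}$ over all $v$ with $v|_{[0,T]}=u$. Let $W=\sum_{k\in\mathbb Z}\beta_ke_k$ be a cylindrical Wiener process on $L^2(\mathbb T)$, where the $\beta_k$ are independent complex Brownian motions with $\mathbb E|\beta_k(t)|^2=t$, and let $$\Psi(t)=\int_0^tS(t-t')\phi\,dW(t')=\sum_{k\in\mathbb Z}\int_0^tS(t-t')\phi(e_k)\,d\beta_k(t')$$ be the stochastic convolution. More precisely, every Fourier coefficient $\widehat\Psi(t,n)$ is the sum in $L^2(\Omega)$ of the corresponding series of Wiener integrals, in a version that is continuous in time. Consider the Wick ordered stochastic NLS with noise $\phi\xi=\phi\,\partial_tW$, $$i\partial_tu-\partial_x^2u+\Big(|u|^2-2\int_{\mathbb T}|u|^2dx\Big)u=\phi\xi,\qquad u|_{t=0}=u_0,$$ in its mild form $$u(t)=S(t)u_0+i\int_0^tS(t-t')\mathcal N(u)(t')\,dt'-i\Psi(t),\qquad \mathcal N(u)=\Big(|u|^2-2\int_{\mathbb T}|u|^2dx\Big)u .$$ Here the Duhamel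 term is understood, at each time and each spatial frequency, as the limit for $M\to\infty$ of the Duhamel terms of $\mathcal N(P_Mu)$, where $P_M$ is the projection onto the frequencies $|n|\le M$. **Theorem.** Let $s>0$ and $1<p<\infty$. There is $b>0$ with $(b-1)p<-1$ such that, for every $\phi\in\gamma(L^2(\mathbb T);\mathcal FL^{s,p}(\mathbb T))$, the stochastic convolution $\Psi$ exists and the Wick ordered stochastic NLS is pathwise locally well-posed in $\mathcal FL^{s,p}(\mathbb T)$, in the following sense. For every $R\ge0$ there is a random time $T=T(R,\Psi)$, a function of $R$ and of the path of $\Psi$ only, which is a stopping time for every filtration that satisfies the usual conditions and to which all $\beta_k$ are adapted. Almost surely, for every $R\ge 0$: 1. $T(R,\Psi)>0$; 2. for every $u_0$ with $\|u_0\|_{\mathcal FL^{s,p}}\le R$ (in particular, for a given $u_0$, with $R=\|u_0\|_{\mathcal FL^{s,p}}$) there is a unique solution $u$ in the class $C([0,T];\mathcal FL^{s,p}(\mathbb T))\cap X^{s,b}_p([0,T])$; 3. the solution map $u_0\mapsto u$ is continuous from $\{\|u_0\|_{\mathcal FL^{s,p}}\le R\}$, with the $\mathcal FL^{s,p}$-norm,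 to $C([0,T];\mathcal FL^{s,p}(\mathbb T))$ and to $X^{s,b}_p([0,T])$. Moreover, for $\alpha,s\in\mathbb R$ and $1\le p<\infty$, the Bessel potential $\phi=\langle\partial_x\rangle^{-\alpha}$ (the Fourier multiplier with symbol $\langle n\rangle^{-\alpha}$) belongs to $\gamma(L^2(\mathbb T);\mathcal FL^{s,p}(\mathbb T))$ if and only if $s<\alpha-\frac1p$. In particular, for every $\alpha>0$ there are $s>0$ and $1<p<\infty$ for which the above applies to $\phi=\langle\partial_x\rangle^{-\alpha}$ (almost space-time white noise). -/

import Mathlib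

open Complex Filter Topology MeasureTheory ProbabilityTheory
open scoped NNReal ENNReal

noncomputable section

namespace WickSNLS

/-! A distribution `f` on the torus `𝕋 = ℝ/ℤ` is represented by the family of its Fourier
coefficients `n ↦ f̂(n)`, relative to `eₙ(x) = exp(2πinx)`, an element of `ℤ → ℂ`. -/

/-- The square-integrable functions on the torus `ℝ/ℤ`. -/
abbrev L2Torus : Type := Lp ℂ 2 (AddCircle.haarAddCircle : Measure UnitAddCircle)

/-- The Japanese bracket `⟨x⟩ = (1 + |x|²)^{1/2}`. -/
def jb (x : ℝ) : ℝ := Real.sqrt (1 + x ^ 2)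

/-- The symbol of `-∂ₓ²` on `ℝ/ℤ`: `-∂ₓ² eₙ = (2πn)² eₙ`. Hence the propagator
`S(t) = exp(-it∂ₓ²)` multiplies the `n`-th Fourier coefficient by `exp(i t (2πn)²)`. -/
def disp (n : ℤ) : ℝ := (2 * Real.pi * n) ^ 2

/-- The norm of `FL^{s,p}(𝕋)`, that is `‖⟨n⟩^s f̂(n)‖_{ℓ^p_n}` (possibly infinite). -/
def eFL (s p : ℝ) (f : ℤ → ℂ) : ℝ≥0∞ :=
  (∑' n : ℤ, (ENNReal.ofReal (jb n ^ s) * ‖f n‖ₑ) ^ p) ^ (1 / p)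

/-- The norm `‖ (∑ₖ |⟨n⟩^s (φ eₖ)^(n)|²)^{1/2} ‖_{ℓ^p_n}` (possibly infinite) of a linear map
`φ` from `L²(𝕋)` to distributions on `𝕋`. -/
def gammaNorm (s p : ℝ) (φ : L2Torus →ₗ[ℂ] (ℤ → ℂ)) : ℝ≥0∞ :=
  (∑' n : ℤ, ((∑' k : ℤ, (ENNReal.ofReal (jb n ^ s) * ‖φ (fourierLp 2 k) n‖ₑ) ^ (2 : ℝ))
    ^ (1 / 2 : ℝ)) ^ p) ^ (1 / p)

/-- `φ ∈ γ(L²(𝕋); FL^{s,p}(𝕋))`: the linear map `φ` is bounded from `L²(𝕋)` to `FL^{s,p}(𝕋)`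
and its `γ`-norm is finite. -/
structure IsGammaRadonifying (s p : ℝ) (φ : L2Torus →ₗ[ℂ] (ℤ → ℂ)) : Prop where
  bounded : ∃ C : ℝ≥0, ∀ f : L2Torus, eFL s p (φ f) ≤ C * ‖f‖ₑ
  finite_norm : gammaNorm s p φ < ∞

/-- The Bessel potential `⟨∂ₓ⟩^{-α}`, the Fourier multiplier with symbol `⟨n⟩^{-α}`. -/
def besselPotential (α : ℝ) : L2Torus →ₗ[ℂ] (ℤ → ℂ) where
  toFun f n := ((jb n ^ (-α) : ℝ) : ℂ) * fourierCoeff f n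
  map_add' f g := by
    funext n
    simp only [← fourierBasis_repr, map_add, lp.coeFn_add, Pi.add_apply, mul_add]
  map_smul' c f := by
    funext n
    simp only [← fourierBasis_repr, map_smul, lp.coeFn_smul, Pi.smul_apply, smul_eq_mul,
      RingHom.id_apply]
    ring

/-! ### The noise and the stochastic convolution -/

section Noise

variable {Ω : Type*} {m : MeasurableSpace Ω}

/-- The coordinates `βₖ` of a cylindrical Wiener process `W = ∑ₖ βₖ eₖ` on `L²(𝕋)`: mutually
independent complex Brownian motions, with `E|βₖ(t)|² = t`. That is, all the processes
`√2 Re βₖ` and `√2 Im βₖ` are standard real Brownian motions, and they are jointly independent. -/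
structure IsCylindricalWiener (β : ℤ → ℝ≥0 → Ω → ℂ) (P : Measure Ω) : Prop where
  re_brownian : ∀ k, IsBrownianReal (fun t ω => Real.sqrt 2 * (β k t ω).re) P
  im_brownian : ∀ k, IsBrownianReal (fun t ω => Real.sqrt 2 * (β k t ω).im) P
  indep : iIndepFun (fun (i : ℤ × Bool) (ω : Ω) (t : ℝ≥0) =>
    if i.2 then (β i.1 t ω).re else (β i.1 t ω).im) P

/-- The usual conditions: right continuity, and every `P`-null set lies in `𝓕 0`. -/
structure UsualConditions (𝓕 : Filtration ℝ≥0 m) (P : Measure Ω) : Prop where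
  right_cont : 𝓕.IsRightContinuous
  complete : ∀ N : Set Ω, P N = 0 → MeasurableSet[𝓕 0] N

/-- The Wiener integral `∫₀ᵗ g dB` of a deterministic smooth function `g` along a continuous path
`B` starting at `0` (Paley-Wiener-Zygmund): `g(t) B(t) - ∫₀ᵗ g'(r) B(r) dr`. -/
def wienerIntegral (g : ℝ → ℂ) (B : ℝ≥0 → ℂ) (t : ℝ≥0) : ℂ :=
  g t * B t - ∫ r in (0 : ℝ)..t, deriv g r * B r.toNNReal

/-- `Ψ` is (a version, with continuous Fourier coefficients, of) the stochastic convolution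
`Ψ(t) = ∫₀ᵗ S(t - r) φ dW(r) = ∑ₖ ∫₀ᵗ S(t - r) φ(eₖ) dβₖ(r)`:
for all `t` and `n`, the series
`∑ₖ (φ eₖ)^(n) ∫₀ᵗ exp(i (t - r) (2πn)²) dβₖ(r)` converges in `L²(P)` to `Ψ(t)^(n)`. -/
structure IsStochasticConvolution (φ : L2Torus →ₗ[ℂ] (ℤ → ℂ)) (β : ℤ → ℝ≥0 → Ω → ℂ)
    (P : Measure Ω) (Ψ : ℝ≥0 → Ω → ℤ → ℂ) : Prop where
  aestronglyMeasurable : ∀ t n, AEStronglyMeasurable (fun ω => Ψ t ω n) P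
  tendsto_L2 : ∀ (t : ℝ≥0) (n : ℤ), Tendsto (fun F : Finset ℤ =>
    eLpNorm (fun ω => Ψ t ω n - ∑ k ∈ F, φ (fourierLp 2 k) n *
      wienerIntegral (fun r => cexp (I * (t - r) * disp n)) (fun r => β k r ω) t) 2 P)
    atTop (𝓝 0)
  continuous_paths : ∀ᵐ ω ∂P, ∀ n, Continuous (fun t => Ψ t ω n)

end Noise

/-! ### Function spaces on `[0, T]`

A function `u` of time with values in the distributions on `𝕋` is an element of `ℝ → ℤ → ℂ`, the
number `u t n` being the `n`-th Fourier coefficient of `u(t)`. -/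

/-- The norm of `X^{s,b}_p(ℝ × 𝕋)`, that is `‖⟨n⟩^s ⟨τ - (2πn)²⟩^b v̂(τ, n)‖_{ℓ^p_n L^p_τ}`,
as a function of the space-time Fourier transform `f n τ = v̂(τ, n)`. For `p < ∞` the completion of
the Schwartz class in this norm consists of the `v` whose space-time Fourier transform is a
measurable function for which the norm is finite. -/
def eX (s b p : ℝ) (f : ℤ → ℝ → ℂ) : ℝ≥0∞ :=
  (∑' n : ℤ, ∫⁻ τ : ℝ,
    (ENNReal.ofReal (jb n ^ s * jb (τ - disp n) ^ b) * ‖f n τ‖ₑ) ^ p) ^ (1 / p)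

/-- The distribution `v` on `ℝ × 𝕋` with space-time Fourier transform `v̂(τ, n) = f n τ`,
where `v̂(τ, n) = ∫ exp(-itτ) v̂(t, n) dt`, coincides with `u` on `[0, T]`, in the sense of
distributions in time. -/
def IsExtension (T : ℝ) (f : ℤ → ℝ → ℂ) (u : ℝ → ℤ → ℂ) : Prop :=
  ∀ n : ℤ, ∀ θ : ℝ → ℂ, ContDiff ℝ (⊤ : ℕ∞) θ → HasCompactSupport θ →
    tsupport θ ⊆ Set.Ioo 0 T →
    (2 * Real.pi : ℂ)⁻¹ * ∫ τ : ℝ, f n τ * ∫ t : ℝ, θ t * cexp (I * t * τ) =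
      ∫ t : ℝ, θ t * u t n

/-- The norm of `X^{s,b}_p([0, T])`: the infimum of the norms of the extensions (possibly
infinite). -/
def eXT (s b p T : ℝ) (u : ℝ → ℤ → ℂ) : ℝ≥0∞ :=
  ⨅ (f : ℤ → ℝ → ℂ) (_ : ∀ n, AEStronglyMeasurable (f n) volume) (_ : IsExtension T f u),
    eX s b p f

/-- The class `C([0, T]; FL^{s,p}(𝕋)) ∩ X^{s,b}_p([0, T])`. -/
structure InClass (s b p T : ℝ) (u : ℝ → ℤ → ℂ) : Prop where
  mem_FL : ∀ t ∈ Set.Icc 0 T, eFL s p (u t) < ∞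
  continuous : ∀ t ∈ Set.Icc 0 T,
    Tendsto (fun r => eFL s p (u r - u t)) (𝓝[Set.Icc 0 T] t) (𝓝 0)
  mem_X : eXT s b p T u < ∞

/-! ### The equation -/

/-- The Wick ordered nonlinearity `(|g|² - 2 ∫ |g|² dx) g` of a function `g` on `𝕋`. -/
def wick (g : UnitAddCircle → ℂ) (x : UnitAddCircle) : ℂ :=
  ((‖g x‖ ^ 2 - 2 * ∫ y, ‖g y‖ ^ 2 ∂AddCircle.haarAddCircle : ℝ) : ℂ) * g x

/-- The frequency truncation `P_M a = ∑_{|n| ≤ M} a(n) eₙ`, a trigonometric polynomial. -/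
def truncate (M : ℕ) (a : ℤ → ℂ) (x : UnitAddCircle) : ℂ :=
  ∑ n ∈ Finset.Icc (-(M : ℤ)) M, a n * fourier n x

/-- `u` solves, on `[0, T]` and for the path `ψ` of the stochastic convolution, the mild form
`u(t) = S(t) u₀ + i ∫₀ᵗ S(t - r) N(u)(r) dr - i ψ(t)` of the Wick ordered stochastic NLS.
The elements of the function class are not square integrable in space in general; as usual the
nonlinear term is the distributional limit of the nonlinear terms `N(P_M u)` of the frequency
truncations, which are smooth in space and continuous in time. -/
def IsMildSolution (T : ℝ) (u₀ : ℤ → ℂ) (ψ : ℝ≥0 → ℤ → ℂ) (u : ℝ → ℤ → ℂ) : Prop :=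
  ∀ t ∈ Set.Icc 0 T, ∀ n : ℤ,
    Tendsto (fun M : ℕ =>
      cexp (I * t * disp n) * u₀ n
        + I * (∫ r in (0 : ℝ)..t,
            cexp (I * (t - r) * disp n) * fourierCoeff (wick (truncate M (u r))) n)
        - I * ψ t.toNNReal n)
      atTop (𝓝 (u t n))

/-- A solution in `C([0, T]; FL^{s,p}(𝕋)) ∩ X^{s,b}_p([0, T])`. -/
def IsSolutionInClass (s b p T : ℝ) (u₀ : ℤ → ℂ) (ψ : ℝ≥0 → ℤ → ℂ) (u : ℝ → ℤ → ℂ) : Prop :=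
  InClass s b p T u ∧ IsMildSolution T u₀ ψ u

end WickSNLS

end

noncomputable section

namespace WickSNLS

/-! ### Powers of the Japanese bracket -/

/-! Deterministic part. In the interaction picture a(t) = S(-t)u(t) (`inter`) the norm of X^{s,b}_p
is a weighted ℓ^p L^p norm of the Fourier transform of a in time (`nX`). Let F be the transform of a
restricted to [0,T]. The Duhamel term is then an absolutely convergent trilinear form in F: a sum
over n = n₁ - n₂ + n₃ and an integral over three modulations, with kernel `kk`, the time integral of
exp(irμ) at the total modulation μ = τ₁ - τ₂ + τ₃ + `phase`. With q the conjugate exponent of p, the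
condition (b-1)p < -1 reads b < 1/q, which is the range in which the noise can be placed. Below 1/q,
sharp cut-offs in time cost only an arbitrarily small amount of modulation weight, so F itself is
the unknown and no smooth cut-off is needed. The price is that X^{s,b}_p no longer controls
continuity in time; this comes separately, from the ℓ^p norm of the suprema in time (`nS`).

Trilinear estimate. The resonance function is -8π²(n-n₁)(n-n₃), and Wick ordering leaves, besides
the diagonal n₁ = n₂ = n₃ = n, only triples for which it does not vanish. Hölder's inequality
(`tsum_lintegral_triAbs_le`) reduces the estimate to uniform bounds for `kernelSum`. Integrating out
the modulations leaves two lattice sums: one with almost one power of the resonance function, where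
the slight deficit is made up by the frequency weights because s > 0 (`exists_tsum_resonance_le`),
and one over points near a hyperbola, counted by the divisor bound (`exists_tsum_hyperbola_le`). The
kernel `hh`, the transform of the Duhamel kernel over an interval, decays in both of its variables
and gives a power of the length of the interval. Hence the Duhamel operator maps modulation exponent
β to the larger exponent b with a small factor (`exists_triAbs_hh_le`). A contraction in the β norm
gives existence (`exists_interaction_solution`); restarting on short intervals gives uniqueness in
the whole class (`solution_unique`). That the trilinear form is the limit of the Duhamel terms of
the truncations is `tendsto_integral_wick`.

Probabilistic part. It remains to see that almost every path of the stochastic convolution is good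
(`ae_goodPath`). The coefficients are Gaussian. Their suprema in time are bounded by dyadic
chaining. The transform in time of the n-th coefficient is again a Wiener integral, with a kernel of
size 1/⟨τ⟩ (`cutFT_pathInt`), so its p-th moment is integrable against ⟨τ⟩^{bp} exactly in the range
of b above, and the sum over n is finite because the γ-norm is.

The existence time is the infimum of the rational times at which an explicit smallness condition
fails. The condition at time t depends on the path up to t only, which makes the infimum a stopping
time, and lower semicontinuity gives the condition at the existence time itself. -/

lemma one_le_jb (x : ℝ) : 1 ≤ jb x := by
  unfold jb
  rw [Real.one_le_sqrt]
  nlinarith [sq_nonneg x]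

lemma jb_pos (x : ℝ) : 0 < jb x := zero_lt_one.trans_le (one_le_jb x)

lemma jb_sq (x : ℝ) : jb x ^ 2 = 1 + x ^ 2 := Real.sq_sqrt (by positivity)

lemma abs_le_jb (x : ℝ) : |x| ≤ jb x := by
  rw [← abs_of_pos (jb_pos x)]
  refine sq_le_sq.1 ?_
  rw [jb_sq]
  linarith

lemma jb_neg (x : ℝ) : jb (-x) = jb x := by simp [jb]

lemma jb_le_jb {x y : ℝ} (h : |x| ≤ |y|) : jb x ≤ jb y := by
  unfold jb
  have := sq_le_sq.2 h
  gcongr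

lemma jb_add_le (x y : ℝ) : jb (x + y) ≤ jb x + jb y := by
  refine le_of_sq_le_sq ?_ (by linarith [jb_pos x, jb_pos y])
  have h1 : x * y ≤ jb x * jb y := by
    calc x * y ≤ |x * y| := le_abs_self _
      _ = |x| * |y| := abs_mul _ _
      _ ≤ _ := mul_le_mul (abs_le_jb x) (abs_le_jb y) (abs_nonneg _) (jb_pos x).le
  nlinarith [jb_sq x, jb_sq y, jb_sq (x + y)]
where
  le_of_sq_le_sq {a b : ℝ} (h : a ^ 2 ≤ b ^ 2) (hb : 0 ≤ b) : a ≤ b := abs_le_of_sq_le_sq' h hb |>.2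

lemma jb_le_one_add_abs (x : ℝ) : jb x ≤ 1 + |x| := by
  have := sqrt_one_add_norm_sq_le x
  simpa [jb] using this

lemma continuous_jb : Continuous jb := by
  unfold jb
  fun_prop

/-- The weight `⟨x⟩^a` as an extended nonnegative real. -/
def wt (a x : ℝ) : ℝ≥0∞ := ENNReal.ofReal (jb x ^ a)

lemma continuous_wt (a : ℝ) : Continuous (wt a) := by
  unfold wt
  exact ENNReal.continuous_ofReal.comp
    (continuous_jb.rpow_const fun x => Or.inl (jb_pos x).ne')

@[fun_prop]
lemma measurable_wt (a : ℝ) : Measurable (wt a) := (continuous_wt a).measurable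

lemma wt_ne_zero (a x : ℝ) : wt a x ≠ 0 := by
  simp only [wt, ne_eq, ENNReal.ofReal_eq_zero, not_le]
  exact Real.rpow_pos_of_pos (jb_pos x) a

lemma wt_ne_top (a x : ℝ) : wt a x ≠ ∞ := ENNReal.ofReal_ne_top

@[simp] lemma wt_zero (x : ℝ) : wt 0 x = 1 := by simp [wt]

lemma wt_add (a b x : ℝ) : wt (a + b) x = wt a x * wt b x := by
  rw [wt, wt, wt, Real.rpow_add (jb_pos x), ENNReal.ofReal_mul]
  exact (Real.rpow_pos_of_pos (jb_pos x) a).le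

lemma wt_mul_wt_neg (a x : ℝ) : wt a x * wt (-a) x = 1 := by
  rw [← wt_add, add_neg_cancel, wt_zero]

lemma wt_rpow (a q x : ℝ) : wt a x ^ q = wt (a * q) x := by
  rw [wt, wt, ENNReal.ofReal_rpow_of_pos (Real.rpow_pos_of_pos (jb_pos x) a),
    ← Real.rpow_mul (jb_pos x).le]

lemma wt_le_wt {a b : ℝ} (h : a ≤ b) (x : ℝ) : wt a x ≤ wt b x :=
  ENNReal.ofReal_le_ofReal (Real.rpow_le_rpow_of_exponent_le (one_le_jb x) h)

lemma wt_le_one {a : ℝ} (h : a ≤ 0) (x : ℝ) : wt a x ≤ 1 := by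
  simpa using wt_le_wt h x

lemma one_le_wt {a : ℝ} (h : 0 ≤ a) (x : ℝ) : 1 ≤ wt a x := by
  simpa using wt_le_wt h x

lemma wt_neg_arg (a x : ℝ) : wt a (-x) = wt a x := by rw [wt, wt, jb_neg]

lemma wt_le_wt_of_le_jb {a x y : ℝ} (ha : a ≤ 0) (h : jb y ≤ jb x) : wt a x ≤ wt a y :=
  ENNReal.ofReal_le_ofReal (Real.rpow_le_rpow_of_nonpos (jb_pos y) h ha)

lemma wt_le_of_jb_le_mul {a x y C : ℝ} (ha : a ≤ 0) (hC : 0 < C) (h : jb y ≤ C * jb x) :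
    wt a x ≤ ENNReal.ofReal (C ^ (-a)) * wt a y := by
  rw [wt, wt, ← ENNReal.ofReal_mul (by positivity)]
  refine ENNReal.ofReal_le_ofReal ?_
  have h1 : C⁻¹ * jb y ≤ jb x := by
    rw [inv_mul_le_iff₀ hC]; exact h
  have h2 := Real.rpow_le_rpow_of_nonpos (mul_pos (inv_pos.2 hC) (jb_pos y)) h1 ha
  rwa [Real.mul_rpow (inv_pos.2 hC).le (jb_pos y).le, Real.inv_rpow hC.le,
    ← Real.rpow_neg hC.le] at h2

lemma wt_add_arg_le {r : ℝ} (hr : 0 ≤ r) (x y : ℝ) :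
    wt r (x + y) ≤ ENNReal.ofReal (2 ^ r) * (wt r x + wt r y) := by
  wlog h : jb x ≤ jb y generalizing x y
  · rw [add_comm x, add_comm (wt r x)]
    exact this y x (le_of_not_ge h)
  have h1 : wt r (x + y) ≤ ENNReal.ofReal (2 ^ r) * wt r y := by
    rw [wt, wt, ← ENNReal.ofReal_mul (by positivity), ← Real.mul_rpow zero_le_two (jb_pos y).le]
    refine ENNReal.ofReal_le_ofReal (Real.rpow_le_rpow (jb_pos _).le ?_ hr)
    linarith [jb_add_le x y]
  refine h1.trans ?_
  gcongr
  exact le_add_self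

/-- Both negative exponents are moved to the smaller of the two brackets. This decouples the
variables and does the work of Young's inequality below. -/
lemma wt_mul_wt_le {a b : ℝ} (ha : a ≤ 0) (hb : b ≤ 0) (x y : ℝ) :
    wt a x * wt b y ≤ wt (a + b) x + wt (a + b) y := by
  rcases le_total (jb x) (jb y) with h | h
  · refine le_trans ?_ le_self_add
    rw [wt_add]
    gcongr
    exact wt_le_wt_of_le_jb hb h
  · refine le_trans ?_ le_add_self
    rw [wt_add]
    gcongr
    exact wt_le_wt_of_le_jb ha h

lemma lintegral_wt_lt_top {a : ℝ} (ha : a < -1) : ∫⁻ x, wt a x < ∞ := by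
  have h := integrable_rpow_neg_one_add_norm_sq (E := ℝ) (μ := volume) (r := -a)
    (by simp; linarith)
  have h2 : ∫⁻ x, wt a x = ∫⁻ x : ℝ, ‖((1 : ℝ) + ‖x‖ ^ 2) ^ (-(-a) / 2)‖ₑ := by
    refine lintegral_congr fun x => ?_
    rw [Real.enorm_of_nonneg (by positivity), wt, jb, Real.sqrt_eq_rpow, ← Real.rpow_mul
      (by positivity)]
    congr 2
    · simp
    · ring
  rw [h2]
  exact h.2

/-- Convolution of negative powers of the bracket. -/
lemma exists_lintegral_wt_mul_wt_le {α γ r : ℝ} (hr : 0 ≤ r) (hα : r ≤ α) (hγ : r ≤ γ)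
    (h : 1 < α + γ - r) :
    ∃ C : ℝ≥0, ∀ x, ∫⁻ y, wt (-α) (x - y) * wt (-γ) y ≤ C * wt (-r) x := by
  set K := ∫⁻ x, wt (r - α - γ) x with hK
  have hKt : K < ∞ := lintegral_wt_lt_top (by linarith)
  have hCt : ENNReal.ofReal (2 ^ r) * (4 * K) ≠ ∞ :=
    ENNReal.mul_ne_top ENNReal.ofReal_ne_top (ENNReal.mul_ne_top (by simp) hKt.ne)
  refine ⟨(ENNReal.ofReal (2 ^ r) * (4 * K)).toNNReal, fun x => ?_⟩
  rw [ENNReal.coe_toNNReal hCt]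
  have hsub : ∫⁻ y, wt (r - α - γ) (x - y) = K :=
    lintegral_sub_left_eq_self (fun y => wt (r - α - γ) y) x
  -- Distributing ⟨x⟩^r over x - y and y leaves products with nonpositive exponents of total r - α -
  -- γ < -1; after decoupling, each is a translate of an integrable function.
  have key : wt r x * ∫⁻ y, wt (-α) (x - y) * wt (-γ) y ≤ ENNReal.ofReal (2 ^ r) * (4 * K) := by
    rw [← lintegral_const_mul _ (by fun_prop)]
    calc ∫⁻ y, wt r x * (wt (-α) (x - y) * wt (-γ) y)
        ≤ ∫⁻ y, ENNReal.ofReal (2 ^ r) * (2 * wt (r - α - γ) (x - y) + 2 * wt (r - α - γ) y) := by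
          refine lintegral_mono fun y => ?_
          have e1 := wt_add_arg_le hr (x - y) y
          rw [sub_add_cancel] at e1
          have e2 := wt_mul_wt_le (a := r - α) (b := -γ) (by linarith) (by linarith) (x - y) y
          have e3 := wt_mul_wt_le (a := -α) (b := r - γ) (by linarith) (by linarith) (x - y) y
          rw [show r - α + -γ = r - α - γ by ring] at e2
          rw [show -α + (r - γ) = r - α - γ by ring] at e3
          calc wt r x * (wt (-α) (x - y) * wt (-γ) y)
              ≤ ENNReal.ofReal (2 ^ r) * (wt r (x - y) + wt r y) *
                (wt (-α) (x - y) * wt (-γ) y) := by gcongr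
            _ = ENNReal.ofReal (2 ^ r) * (wt (r - α) (x - y) * wt (-γ) y +
                  wt (-α) (x - y) * wt (r - γ) y) := by
                rw [sub_eq_add_neg r α, sub_eq_add_neg r γ, wt_add, wt_add]; ring
            _ ≤ ENNReal.ofReal (2 ^ r) * ((wt (r - α - γ) (x - y) + wt (r - α - γ) y) +
                  (wt (r - α - γ) (x - y) + wt (r - α - γ) y)) := by gcongr
            _ = _ := by ring
      _ = ENNReal.ofReal (2 ^ r) * (4 * K) := by
          rw [lintegral_const_mul _ (by fun_prop), lintegral_add_left (by fun_prop),
            lintegral_const_mul _ (by fun_prop), lintegral_const_mul _ (by fun_prop), hsub, ← hK]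
          ring
  calc ∫⁻ y, wt (-α) (x - y) * wt (-γ) y
      = wt (-r) x * (wt r x * ∫⁻ y, wt (-α) (x - y) * wt (-γ) y) := by
        rw [← mul_assoc, mul_comm (wt (-r) x), wt_mul_wt_neg, one_mul]
    _ ≤ wt (-r) x * (ENNReal.ofReal (2 ^ r) * (4 * K)) := by gcongr
    _ = _ := mul_comm _ _

/-! ### Sums of powers of the bracket -/

lemma tsum_wt_int_lt_top {a : ℝ} (ha : a < -1) : ∑' n : ℤ, wt a n < ∞ := by
  have h : Summable fun n : ℤ => |(n : ℝ)| ^ a := by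
    have := Real.summable_abs_int_rpow (b := -a) (by linarith)
    simpa using this
  have h2 : Summable fun n : ℤ => jb n ^ a := by
    refine Summable.of_norm_bounded_eventually h ?_
    rw [Filter.eventually_cofinite]
    refine (Set.finite_singleton (0 : ℤ)).subset fun n hn => ?_
    by_contra hne
    refine hn ?_
    have hn0 : (0 : ℝ) < |(n : ℝ)| := by
      rw [abs_pos]; exact_mod_cast hne
    rw [Real.norm_of_nonneg (Real.rpow_nonneg (jb_pos _).le _)]
    exact Real.rpow_le_rpow_of_nonpos hn0 (abs_le_jb _) (by linarith)
  simp only [wt]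
  rw [← ENNReal.ofReal_tsum_of_nonneg (fun n => Real.rpow_nonneg (jb_pos _).le _) h2]
  exact ENNReal.ofReal_lt_top

/-- Shifting the summation index by ⌊x⌋ leaves an offset in [0,1), which changes the bracket by a
factor of at most 3. -/
lemma exists_tsum_wt_add_le {a : ℝ} (ha : a < -1) :
    ∃ C : ℝ≥0, ∀ x : ℝ, ∑' n : ℤ, wt a (x + n) ≤ C := by
  set K := ∑' n : ℤ, wt a n with hK
  have hKt : ENNReal.ofReal (3 ^ (-a)) * K ≠ ∞ :=
    ENNReal.mul_ne_top ENNReal.ofReal_ne_top (tsum_wt_int_lt_top ha).ne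
  refine ⟨(ENNReal.ofReal (3 ^ (-a)) * K).toNNReal, fun x => ?_⟩
  rw [ENNReal.coe_toNNReal hKt, hK, ← ENNReal.tsum_mul_left]
  have h1 : ∀ n : ℤ, wt a (x + n) ≤ ENNReal.ofReal (3 ^ (-a)) * wt a ((n + ⌊x⌋ : ℤ) : ℝ) := by
    intro n
    refine wt_le_of_jb_le_mul (by linarith) three_pos ?_
    have h2 : ((n + ⌊x⌋ : ℤ) : ℝ) = (x + n) + (-Int.fract x) := by
      push_cast
      rw [← Int.self_sub_floor]; ring
    rw [h2]
    refine (jb_add_le _ _).trans ?_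
    rw [jb_neg]
    have h3 : jb (Int.fract x) ≤ 2 * 1 := by
      refine (jb_le_one_add_abs _).trans ?_
      rw [abs_of_nonneg (Int.fract_nonneg x)]
      linarith [Int.fract_lt_one x]
    linarith [one_le_jb (x + n)]
  refine (ENNReal.tsum_le_tsum h1).trans ?_
  exact ((Equiv.addRight ⌊x⌋).tsum_eq (fun n : ℤ => ENNReal.ofReal (3 ^ (-a)) * wt a (n : ℝ))).le

lemma exists_tsum_wt_add_mul_le {a L : ℝ} (ha : a < -1) (hL : 1 ≤ L) :
    ∃ C : ℝ≥0, ∀ x : ℝ, ∑' n : ℤ, wt a (x + L * n) ≤ C := by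
  obtain ⟨C, hC⟩ := exists_tsum_wt_add_le ha
  refine ⟨C, fun x => le_trans (ENNReal.tsum_le_tsum fun n => ?_) (hC (x / L))⟩
  refine wt_le_wt_of_le_jb (by linarith) (jb_le_jb ?_)
  have hL0 : 0 < L := by linarith
  have : x + L * n = L * (x / L + n) := by field_simp
  rw [this, abs_mul, abs_of_pos hL0]
  exact le_mul_of_one_le_left (abs_nonneg _) hL

lemma exists_tsum_wt_mul_wt_le {l r : ℝ} (hl : 0 ≤ l) (hr : 0 ≤ r) (h : 1 < l + r) :
    ∃ C : ℝ≥0, ∀ m : ℤ, ∑' a : ℤ, wt (-r) a * wt (-l) ((m - a : ℤ) : ℝ) ≤ C := by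
  set K := ∑' n : ℤ, wt (-r + -l) n with hK
  have hKt : K < ∞ := tsum_wt_int_lt_top (by linarith)
  have hKt2 : K + K ≠ ∞ := ENNReal.add_ne_top.2 ⟨hKt.ne, hKt.ne⟩
  refine ⟨(K + K).toNNReal, fun m => ?_⟩
  rw [ENNReal.coe_toNNReal hKt2]
  calc ∑' a : ℤ, wt (-r) a * wt (-l) ((m - a : ℤ) : ℝ)
      ≤ ∑' a : ℤ, (wt (-r + -l) a + wt (-r + -l) ((m - a : ℤ) : ℝ)) :=
        ENNReal.tsum_le_tsum fun a => wt_mul_wt_le (by linarith) (by linarith) _ _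
    _ = K + K := by
        rw [ENNReal.tsum_add]
        congr 1
        exact (Equiv.subLeft m).tsum_eq (fun n : ℤ => wt (-r + -l) (n : ℝ))

/-! ### The divisor bound -/

lemma exists_add_one_le_mul_rpow {ε : ℝ} (hε : 0 < ε) :
    ∃ K : ℝ, 1 ≤ K ∧ ∀ v : ℕ, ((v : ℝ) + 1) ≤ K * (2 : ℝ) ^ (ε * v) := by
  refine ⟨max 1 (1 / (ε * Real.log 2)), le_max_left _ _, fun v => ?_⟩
  have hl : 0 < ε * Real.log 2 := mul_pos hε (Real.log_pos one_lt_two)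
  have h1 : (2 : ℝ) ^ (ε * v) = Real.exp (ε * Real.log 2 * v) := by
    rw [Real.rpow_def_of_pos two_pos]; ring_nf
  have h2 : ε * Real.log 2 * v + 1 ≤ Real.exp (ε * Real.log 2 * v) := Real.add_one_le_exp _
  rw [h1]
  have h3 : (v : ℝ) ≤ 1 / (ε * Real.log 2) * (ε * Real.log 2 * v) := by
    rw [← mul_assoc, one_div, inv_mul_cancel₀ hl.ne', one_mul]
  have h4 : 0 ≤ ε * Real.log 2 * v := by positivity
  calc (v : ℝ) + 1 ≤ max 1 (1 / (ε * Real.log 2)) * (ε * Real.log 2 * v) +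
        max 1 (1 / (ε * Real.log 2)) := by
        refine add_le_add (h3.trans ?_) (le_max_left _ _)
        gcongr
        exact le_max_right _ _
    _ = max 1 (1 / (ε * Real.log 2)) * (ε * Real.log 2 * v + 1) := by ring
    _ ≤ _ := by gcongr

/-- Both sides are products over the primes dividing n. A prime x with x^ε ≥ 2 satisfies v + 1 ≤ 2^v
≤ x^{εv}; the at most N smaller primes cost a factor K each. -/
lemma exists_card_divisors_le {ε : ℝ} (hε : 0 < ε) :
    ∃ C : ℝ, 0 ≤ C ∧ ∀ n : ℕ, n ≠ 0 → (n.divisors.card : ℝ) ≤ C * (n : ℝ) ^ ε := by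
  obtain ⟨K, hK1, hK⟩ := exists_add_one_le_mul_rpow hε
  set N : ℕ := ⌈(2 : ℝ) ^ (1 / ε)⌉₊ with hN
  refine ⟨K ^ N, by positivity, fun n hn => ?_⟩
  have hprod : (n : ℝ) ^ ε = ∏ x ∈ n.primeFactors, ((x : ℝ) ^ (ε * n.factorization x)) := by
    conv_lhs => rw [← Nat.prod_factorization_pow_eq_self hn, Finsupp.prod]
    push_cast
    rw [← Real.finsetProd_rpow _ _ (fun i _ => by positivity)]
    refine Finset.prod_congr (by simp) fun x _ => ?_
    rw [← Real.rpow_natCast, ← Real.rpow_mul (by positivity), mul_comm]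
  have hcoef : ∏ x ∈ n.primeFactors, (if x < N then K else 1) ≤ K ^ N := by
    rw [Finset.prod_ite, Finset.prod_const_one, mul_one, Finset.prod_const]
    refine pow_le_pow_right₀ hK1 ?_
    calc _ ≤ (Finset.range N).card := Finset.card_le_card fun x hx => by
            simp only [Finset.mem_filter] at hx
            exact Finset.mem_range.2 hx.2
      _ = N := Finset.card_range N
  rw [Nat.card_divisors hn]
  push_cast
  calc ∏ x ∈ n.primeFactors, ((n.factorization x : ℝ) + 1)
      ≤ ∏ x ∈ n.primeFactors, ((if x < N then K else 1) * (x : ℝ) ^ (ε * n.factorization x)) := by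
        refine Finset.prod_le_prod (fun _ _ => by positivity) fun x hx => ?_
        have hx2 : (2 : ℝ) ≤ x := by exact_mod_cast (Nat.prime_of_mem_primeFactors hx).two_le
        split_ifs with h
        · refine (hK _).trans ?_
          gcongr
        · have h1 : (2 : ℝ) ^ (1 / ε) ≤ x := (Nat.le_ceil _).trans (by exact_mod_cast not_lt.1 h)
          have h2 : (2 : ℝ) ≤ (x : ℝ) ^ ε := by
            calc (2 : ℝ) = ((2 : ℝ) ^ (1 / ε)) ^ ε := by
                  rw [← Real.rpow_mul two_pos.le, one_div, inv_mul_cancel₀ hε.ne', Real.rpow_one]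
              _ ≤ _ := by gcongr
          rw [one_mul, Real.rpow_mul (by positivity), Real.rpow_natCast]
          calc (n.factorization x : ℝ) + 1 ≤ 2 ^ (n.factorization x) := by
                exact_mod_cast (Nat.lt_two_pow_self (n := n.factorization x))
            _ ≤ _ := by gcongr
    _ = (∏ x ∈ n.primeFactors, (if x < N then K else 1)) * (n : ℝ) ^ ε := by
        rw [Finset.prod_mul_distrib, hprod]
    _ ≤ _ := by gcongr

lemma tsum_dvd_le {k : ℤ} (hk : k ≠ 0) :
    ∑' a : ℤ, (if a ∣ k then (1 : ℝ≥0∞) else 0) ≤ 2 * (k.natAbs.divisors.card : ℝ≥0∞) := by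
  classical
  set s : Finset ℤ := k.natAbs.divisors.image (fun d : ℕ => (d : ℤ)) ∪
    k.natAbs.divisors.image (fun d : ℕ => -(d : ℤ)) with hs
  have hcard : s.card ≤ 2 * k.natAbs.divisors.card := by
    refine (Finset.card_union_le _ _).trans ?_
    rw [two_mul]
    exact add_le_add Finset.card_image_le Finset.card_image_le
  rw [tsum_eq_sum (s := s)]
  · calc ∑ a ∈ s, (if a ∣ k then (1 : ℝ≥0∞) else 0) ≤ ∑ a ∈ s, 1 :=
          Finset.sum_le_sum fun a _ => by split_ifs <;> simp
      _ = (s.card : ℝ≥0∞) := by simp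
      _ ≤ _ := by exact_mod_cast hcard
  · intro a ha
    rw [if_neg]
    intro hd
    refine ha ?_
    have h1 : a.natAbs ∈ k.natAbs.divisors := by
      rw [Nat.mem_divisors]
      exact ⟨Int.natAbs_dvd_natAbs.2 hd, Int.natAbs_ne_zero.2 hk⟩
    simp only [hs, Finset.mem_union, Finset.mem_image]
    rcases Int.natAbs_eq a with h | h
    · exact Or.inl ⟨_, h1, h.symm⟩
    · exact Or.inr ⟨_, h1, h.symm⟩

/-- A nonzero k factors as a * c in at most 2 d(|k|) ways, since a is a divisor of either sign and
determines c. -/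
lemma tsum_tsum_mul_le (f : ℤ → ℝ≥0∞) :
    ∑' a : ℤ, ∑' c : ℤ, (if a ≠ 0 ∧ c ≠ 0 then f (a * c) else 0) ≤
      ∑' k : ℤ, (if k ≠ 0 then 2 * (k.natAbs.divisors.card : ℝ≥0∞) * f k else 0) := by
  calc ∑' a : ℤ, ∑' c : ℤ, (if a ≠ 0 ∧ c ≠ 0 then f (a * c) else 0)
      ≤ ∑' a : ℤ, ∑' k : ℤ, (if k ≠ 0 ∧ a ∣ k then f k else 0) := by
        refine ENNReal.tsum_le_tsum fun a => ?_
        by_cases ha : a = 0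
        · simp [ha]
        · refine le_trans (ENNReal.tsum_le_tsum fun c => ?_) (ENNReal.tsum_comp_le_tsum_of_injective
            (mul_right_injective₀ ha) (fun k : ℤ => if k ≠ 0 ∧ a ∣ k then f k else 0))
          by_cases hc : c = 0
          · simp [hc]
          · simp [ha, hc]
    _ = ∑' k : ℤ, ∑' a : ℤ, (if k ≠ 0 ∧ a ∣ k then f k else 0) := ENNReal.tsum_comm
    _ ≤ _ := by
        refine ENNReal.tsum_le_tsum fun k => ?_
        by_cases hk : k = 0
        · simp [hk]
        · simp only [ne_eq, hk, not_false_eq_true, true_and, if_true]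
          calc ∑' a : ℤ, (if a ∣ k then f k else 0)
              = ∑' a : ℤ, (if a ∣ k then 1 else 0) * f k := by simp only [ite_mul, one_mul, zero_mul]
            _ = (∑' a : ℤ, (if a ∣ k then 1 else 0)) * f k := ENNReal.tsum_mul_right
            _ ≤ _ := by gcongr; exact tsum_dvd_le hk

/-- Lattice points near a hyperbola, counted with the divisor bound. -/
lemma exists_tsum_hyperbola_le {ν r ε L : ℝ} (hε : 0 < ε) (hεν : ε ≤ ν) (hr : 0 ≤ r)
    (h : 1 < ν - ε + r) (hL : 1 ≤ L) :
    ∃ C : ℝ≥0, ∀ x : ℝ, ∑' a : ℤ, ∑' c : ℤ, (if a ≠ 0 ∧ c ≠ 0 then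
      wt (-ν) (L * (a * c : ℤ)) * wt (-r) (x + L * (a * c : ℤ)) else 0) ≤ C := by
  obtain ⟨C₁, hC₁, hdiv⟩ := exists_card_divisors_le hε
  obtain ⟨C₂, hC₂⟩ := exists_tsum_wt_add_mul_le (a := -(ν - ε) + -r) (by linarith) hL
  set K : ℝ≥0∞ := 2 * ENNReal.ofReal C₁ * (C₂ + C₂) with hK
  have hKt : K ≠ ∞ := ENNReal.mul_ne_top (ENNReal.mul_ne_top (by simp) (by simp)) (by simp)
  refine ⟨K.toNNReal, fun x => ?_⟩
  rw [ENNReal.coe_toNNReal hKt]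
  refine (tsum_tsum_mul_le (fun k : ℤ => wt (-ν) (L * k) * wt (-r) (x + L * k))).trans ?_
  calc ∑' k : ℤ, (if k ≠ 0 then 2 * (k.natAbs.divisors.card : ℝ≥0∞) *
        (wt (-ν) (L * k) * wt (-r) (x + L * k)) else 0)
      ≤ ∑' k : ℤ, 2 * ENNReal.ofReal C₁ * (wt (-(ν - ε) + -r) (0 + L * k) +
          wt (-(ν - ε) + -r) (x + L * k)) := by
        refine ENNReal.tsum_le_tsum fun k => ?_
        split_ifs with hk
        -- The multiplicity costs only ε of the decay ν. What remains is a one-dimensional sum of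
        -- total exponent ν - ε + r > 1, bounded uniformly in x.
        · have h1 : (k.natAbs.divisors.card : ℝ≥0∞) ≤ ENNReal.ofReal C₁ * wt ε (L * k) := by
            rw [wt, ← ENNReal.ofReal_mul hC₁, ← ENNReal.ofReal_natCast]
            refine ENNReal.ofReal_le_ofReal ((hdiv _ (Int.natAbs_ne_zero.2 hk)).trans ?_)
            gcongr
            rw [Nat.cast_natAbs, Int.cast_abs]
            refine le_trans ?_ (abs_le_jb _)
            rw [abs_mul, abs_of_nonneg (by linarith : (0:ℝ) ≤ L)]
            exact le_mul_of_one_le_left (abs_nonneg _) hL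
          calc 2 * (k.natAbs.divisors.card : ℝ≥0∞) * (wt (-ν) (L * k) * wt (-r) (x + L * k))
              ≤ 2 * (ENNReal.ofReal C₁ * wt ε (L * k)) *
                (wt (-ν) (L * k) * wt (-r) (x + L * k)) := by gcongr
            _ = 2 * ENNReal.ofReal C₁ * (wt (-(ν - ε)) (L * k) * wt (-r) (x + L * k)) := by
                rw [show -(ν - ε) = ε + -ν by ring, wt_add]; ring
            _ ≤ _ := by
                gcongr
                rw [zero_add]
                exact wt_mul_wt_le (by linarith) (by linarith) _ _
        · exact zero_le
    _ = 2 * ENNReal.ofReal C₁ * (∑' k : ℤ, wt (-(ν - ε) + -r) (0 + L * k) +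
          ∑' k : ℤ, wt (-(ν - ε) + -r) (x + L * k)) := by
        rw [ENNReal.tsum_mul_left, ENNReal.tsum_add]
    _ ≤ K := by
        rw [hK]
        gcongr
        · exact hC₂ 0
        · exact hC₂ x

/-- The positive power of ⟨x + y - z⟩ is at most a sum of powers of the three brackets, and each of
them cancels one of the decaying weights; two always survive. -/
lemma wt_mul_three_le {l : ℝ} (hl : 0 ≤ l) (x y z : ℝ) :
    wt l (x + y - z) * (wt (-l) x * wt (-l) y * wt (-l) z) ≤
      ENNReal.ofReal (2 ^ l * 2 ^ l) * (wt (-l) y * wt (-l) z + wt (-l) x * wt (-l) z +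
        wt (-l) x * wt (-l) y) := by
  have h2 : (1 : ℝ≥0∞) ≤ ENNReal.ofReal (2 ^ l) := by
    rw [ENNReal.one_le_ofReal]
    exact Real.one_le_rpow one_le_two hl
  have h : wt l (x + y - z) ≤ ENNReal.ofReal (2 ^ l * 2 ^ l) * (wt l x + wt l y + wt l z) := by
    rw [ENNReal.ofReal_mul (by positivity)]
    calc wt l (x + y - z) ≤ ENNReal.ofReal (2 ^ l) * (wt l (x + y) + wt l z) := by
          have := wt_add_arg_le hl (x + y) (-z)
          rwa [wt_neg_arg, ← sub_eq_add_neg] at this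
      _ ≤ ENNReal.ofReal (2 ^ l) * (ENNReal.ofReal (2 ^ l) * (wt l x + wt l y) +
            ENNReal.ofReal (2 ^ l) * wt l z) := by
          gcongr
          · exact wt_add_arg_le hl x y
          · exact le_mul_of_one_le_left (zero_le) h2
      _ = _ := by ring
  calc _ ≤ ENNReal.ofReal (2 ^ l * 2 ^ l) * (wt l x + wt l y + wt l z) *
        (wt (-l) x * wt (-l) y * wt (-l) z) := by gcongr
    _ = ENNReal.ofReal (2 ^ l * 2 ^ l) * ((wt l x * wt (-l) x) * (wt (-l) y * wt (-l) z) +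
          (wt l y * wt (-l) y) * (wt (-l) x * wt (-l) z) +
          (wt l z * wt (-l) z) * (wt (-l) x * wt (-l) y)) := by ring
    _ = _ := by simp only [wt_mul_wt_neg, one_mul]

lemma wt_mul_three_le_const {l : ℝ} (hl : 0 ≤ l) (x y z : ℝ) :
    wt l (x + y - z) * (wt (-l) x * wt (-l) y * wt (-l) z) ≤
      ENNReal.ofReal (2 ^ l * 2 ^ l) * 3 := by
  refine (wt_mul_three_le hl x y z).trans ?_
  have h : ∀ u, wt (-l) u ≤ 1 := wt_le_one (by linarith)
  gcongr
  calc _ ≤ (1 : ℝ≥0∞) * 1 + 1 * 1 + 1 * 1 := by gcongr <;> exact h _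
    _ = 3 := by norm_num

/-- The sum that controls the nonlinearity when the modulations are integrated out. -/
lemma exists_tsum_resonance_le {l r L : ℝ} (hl : 0 ≤ l) (hr : 0 ≤ r) (h : 1 < l + r)
    (hL : 2 ≤ L) :
    ∃ C : ℝ≥0, ∀ n : ℤ, ∑' a : ℤ, ∑' c : ℤ, (if a ≠ 0 ∧ c ≠ 0 then
      wt l n * (wt (-l) (n - a : ℤ) * wt (-l) (n - c : ℤ) * wt (-l) (n - a - c : ℤ)) *
        wt (-r) (L * (a * c : ℤ)) else 0) ≤ C := by
  obtain ⟨K, hK⟩ := exists_tsum_wt_mul_wt_le hl hr h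
  set M : ℝ≥0∞ := ENNReal.ofReal (2 ^ l * 2 ^ l) with hM
  have hMt : M * (K * K + K * K + K * K) ≠ ∞ := ENNReal.mul_ne_top (by simp [hM])
    (by simp [ENNReal.mul_eq_top])
  refine ⟨(M * (K * K + K * K + K * K)).toNNReal, fun n => ?_⟩
  rw [ENNReal.coe_toNNReal hMt]
  have hpt : ∀ a c : ℤ, (if a ≠ 0 ∧ c ≠ 0 then
      wt l n * (wt (-l) (n - a : ℤ) * wt (-l) (n - c : ℤ) * wt (-l) (n - a - c : ℤ)) *
        wt (-r) (L * (a * c : ℤ)) else 0) ≤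
      M * ((wt (-r) c * wt (-l) (n - c : ℤ)) * (wt (-r) a * wt (-l) (n - c - a : ℤ)) +
        (wt (-r) a * wt (-l) (n - a : ℤ)) * (wt (-r) c * wt (-l) (n - a - c : ℤ)) +
        (wt (-r) a * wt (-l) (n - a : ℤ)) * (wt (-r) c * wt (-l) (n - c : ℤ))) := by
    intro a c
    split_ifs with hac
    -- For nonzero integers a² and c² are at least 1, so (1 + a²)(1 + c²) ≤ 1 + 4a²c² ≤ ⟨Lac⟩². This
    -- separates a from c, and each of the three products becomes an iterated sum covered by
    -- `exists_tsum_wt_mul_wt_le`.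
    · have h1 : wt (-r) (L * (a * c : ℤ)) ≤ wt (-r) a * wt (-r) c := by
        have ha : (1 : ℝ) ≤ (a : ℝ) ^ 2 := by
          have := Int.one_le_abs hac.1
          have h2 : (1 : ℝ) ≤ |(a : ℝ)| := by exact_mod_cast this
          nlinarith [sq_abs (a : ℝ)]
        have hc : (1 : ℝ) ≤ (c : ℝ) ^ 2 := by
          have := Int.one_le_abs hac.2
          have h2 : (1 : ℝ) ≤ |(c : ℝ)| := by exact_mod_cast this
          nlinarith [sq_abs (c : ℝ)]
        have h3 : jb a * jb c ≤ jb (L * (a * c : ℤ)) := by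
          refine (abs_le_of_sq_le_sq' ?_ (jb_pos _).le).2
          rw [mul_pow, jb_sq, jb_sq, jb_sq]
          push_cast
          have h4 : (4 : ℝ) ≤ L ^ 2 := by nlinarith
          have h5 : (1 : ℝ) ≤ (a : ℝ) ^ 2 * (c : ℝ) ^ 2 := by nlinarith
          have h6 : (L * ((a : ℝ) * c)) ^ 2 = L ^ 2 * ((a : ℝ) ^ 2 * (c : ℝ) ^ 2) := by ring
          rw [h6]
          nlinarith [mul_nonneg (sub_nonneg.2 ha) (sub_nonneg.2 hc)]
        rw [wt, wt, wt, ← ENNReal.ofReal_mul (Real.rpow_nonneg (jb_pos _).le _),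
          ← Real.mul_rpow (jb_pos _).le (jb_pos _).le]
        exact ENNReal.ofReal_le_ofReal (Real.rpow_le_rpow_of_nonpos
          (mul_pos (jb_pos _) (jb_pos _)) h3 (by linarith))
      have h2 := wt_mul_three_le hl ((n - a : ℤ) : ℝ) ((n - c : ℤ) : ℝ) ((n - a - c : ℤ) : ℝ)
      rw [show ((n - a : ℤ) : ℝ) + ((n - c : ℤ) : ℝ) - ((n - a - c : ℤ) : ℝ) = n by
        push_cast; ring] at h2
      calc _ ≤ _ := mul_le_mul' h2 h1
        _ = _ := by
          rw [show n - c - a = n - a - c by ring]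
          ring
    · exact zero_le
  calc _ ≤ ∑' a : ℤ, ∑' c : ℤ, M *
      ((wt (-r) c * wt (-l) (n - c : ℤ)) * (wt (-r) a * wt (-l) (n - c - a : ℤ)) +
        (wt (-r) a * wt (-l) (n - a : ℤ)) * (wt (-r) c * wt (-l) (n - a - c : ℤ)) +
        (wt (-r) a * wt (-l) (n - a : ℤ)) * (wt (-r) c * wt (-l) (n - c : ℤ))) :=
        ENNReal.tsum_le_tsum fun a => ENNReal.tsum_le_tsum fun c => hpt a c
    _ = M * (∑' c : ℤ, (wt (-r) c * wt (-l) (n - c : ℤ)) *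
            ∑' a : ℤ, (wt (-r) a * wt (-l) (n - c - a : ℤ)) +
          ∑' a : ℤ, (wt (-r) a * wt (-l) (n - a : ℤ)) *
            ∑' c : ℤ, (wt (-r) c * wt (-l) (n - a - c : ℤ)) +
          ∑' a : ℤ, (wt (-r) a * wt (-l) (n - a : ℤ)) *
            ∑' c : ℤ, (wt (-r) c * wt (-l) (n - c : ℤ))) := by
        simp only [ENNReal.tsum_mul_left, ENNReal.tsum_add]
        congr 3
        rw [ENNReal.tsum_comm]
        simp only [ENNReal.tsum_mul_left]
    _ ≤ M * (∑' c : ℤ, (wt (-r) c * wt (-l) (n - c : ℤ)) * K +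
          ∑' a : ℤ, (wt (-r) a * wt (-l) (n - a : ℤ)) * K +
          ∑' a : ℤ, (wt (-r) a * wt (-l) (n - a : ℤ)) * K) := by
        gcongr <;> exact hK _
    _ ≤ _ := by
        simp only [ENNReal.tsum_mul_right]
        gcongr <;> exact hK _

/-! ### Integral operators with a factorized kernel -/

/-- A Schur test: Hölder in x puts κ₂ into L^q for fixed y, and Tonelli then puts κ₁ into L^p in y
for fixed x. In the application x runs over the frequencies and modulations of the three factors and
y over those of the output. -/
lemma lintegral_kernel_rpow_le {X Y : Type*} [MeasurableSpace X] [MeasurableSpace Y]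
    {μ : Measure X} {ν : Measure Y} [SFinite μ] [SFinite ν] {p q : ℝ} (hpq : p.HolderConjugate q)
    {κ₁ κ₂ : Y → X → ℝ≥0∞} (hκ₁ : Measurable (Function.uncurry κ₁))
    (hκ₂ : Measurable (Function.uncurry κ₂)) {g : X → ℝ≥0∞} (hg : Measurable g) {C₁ C₂ : ℝ≥0∞}
    (h₁ : ∀ x, ∫⁻ y, κ₁ y x ^ p ∂ν ≤ C₁) (h₂ : ∀ y, ∫⁻ x, κ₂ y x ^ q ∂μ ≤ C₂) :
    ∫⁻ y, (∫⁻ x, κ₁ y x * κ₂ y x * g x ∂μ) ^ p ∂ν ≤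
      C₂ ^ (p / q) * C₁ * ∫⁻ x, g x ^ p ∂μ := by
  have hp : 0 < p := hpq.pos
  have hq : 0 < q := hpq.symm.pos
  have m₁ : ∀ y, Measurable (κ₁ y) := fun y => hκ₁.comp measurable_prodMk_left
  have m₂ : ∀ y, Measurable (κ₂ y) := fun y => hκ₂.comp measurable_prodMk_left
  have step : ∀ y, (∫⁻ x, κ₁ y x * κ₂ y x * g x ∂μ) ^ p ≤
      C₂ ^ (p / q) * ∫⁻ x, κ₁ y x ^ p * g x ^ p ∂μ := by
    intro y
    have h := ENNReal.lintegral_mul_le_Lp_mul_Lq μ hpq (f := fun x => κ₁ y x * g x)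
      (g := κ₂ y) (((m₁ y).mul hg).aemeasurable) (m₂ y).aemeasurable
    calc (∫⁻ x, κ₁ y x * κ₂ y x * g x ∂μ) ^ p
        = (∫⁻ x, ((fun x => κ₁ y x * g x) * κ₂ y) x ∂μ) ^ p := by
          congr 1
          refine lintegral_congr fun x => ?_
          simp only [Pi.mul_apply]
          ring
      _ ≤ ((∫⁻ x, (κ₁ y x * g x) ^ p ∂μ) ^ (1 / p) * (∫⁻ x, κ₂ y x ^ q ∂μ) ^ (1 / q)) ^ p := by
          gcongr
      _ = (∫⁻ x, κ₂ y x ^ q ∂μ) ^ (p / q) * ∫⁻ x, (κ₁ y x * g x) ^ p ∂μ := by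
          rw [ENNReal.mul_rpow_of_nonneg _ _ hp.le, ← ENNReal.rpow_mul, ← ENNReal.rpow_mul,
            one_div, inv_mul_cancel₀ hp.ne', ENNReal.rpow_one, mul_comm]
          congr 2
          ring
      _ ≤ _ := by
          gcongr with x
          · exact h₂ y
          · rw [ENNReal.mul_rpow_of_nonneg _ _ hp.le]
  calc ∫⁻ y, (∫⁻ x, κ₁ y x * κ₂ y x * g x ∂μ) ^ p ∂ν
      ≤ ∫⁻ y, C₂ ^ (p / q) * ∫⁻ x, κ₁ y x ^ p * g x ^ p ∂μ ∂ν := lintegral_mono step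
    _ = C₂ ^ (p / q) * ∫⁻ y, ∫⁻ x, κ₁ y x ^ p * g x ^ p ∂μ ∂ν := by
        refine lintegral_const_mul _ (Measurable.lintegral_prod_right ?_)
        exact (hκ₁.pow_const p).mul ((hg.comp measurable_snd).pow_const p)
    _ = C₂ ^ (p / q) * ∫⁻ x, ∫⁻ y, κ₁ y x ^ p * g x ^ p ∂ν ∂μ := by
        rw [lintegral_lintegral_swap]
        exact ((hκ₁.pow_const p).mul ((hg.comp measurable_snd).pow_const p)).aemeasurable
    _ = C₂ ^ (p / q) * ∫⁻ x, (∫⁻ y, κ₁ y x ^ p ∂ν) * g x ^ p ∂μ := by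
        congr 1
        refine lintegral_congr fun x => ?_
        rw [lintegral_mul_const]
        exact (hκ₁.comp measurable_prodMk_right).pow_const p
    _ ≤ C₂ ^ (p / q) * ∫⁻ x, C₁ * g x ^ p ∂μ := by
        gcongr with x
        exact h₁ x
    _ = _ := by
        rw [lintegral_const_mul _ (hg.pow_const p), mul_assoc]

/-! ### Exponents -/

/-- Admissible exponents: `δ` is small compared with `s` and with the distance of the conjugate
exponent of `p` to `1`. -/
structure Exponents where
  s : ℝ
  p : ℝ
  δ : ℝ
  s_pos : 0 < s
  one_lt_p : 1 < p
  δ_pos : 0 < δ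
  δ_le : 20 * δ ≤ 1
  δ_le_s : 10 * δ ≤ s * (p / (p - 1))
  δ_le_p : 10 * δ ≤ p / (p - 1) - 1

lemma exists_exponents {s p : ℝ} (hs : 0 < s) (hp : 1 < p) : ∃ e : Exponents, e.s = s ∧ e.p = p := by
  have h1 : 0 < p - 1 := by linarith
  have h2 : 0 < s * (p / (p - 1)) := by positivity
  have h3 : 0 < p / (p - 1) - 1 := by
    rw [sub_pos, lt_div_iff₀ h1]; linarith
  set δ := min (1 / 20) (min (s * (p / (p - 1)) / 10) ((p / (p - 1) - 1) / 10)) with hδ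
  refine ⟨⟨s, p, δ, hs, hp, by positivity, ?_, ?_, ?_⟩, rfl, rfl⟩
  · have : δ ≤ 1 / 20 := min_le_left _ _
    linarith
  · have : δ ≤ s * (p / (p - 1)) / 10 := (min_le_right _ _).trans (min_le_left _ _)
    linarith
  · have : δ ≤ (p / (p - 1) - 1) / 10 := (min_le_right _ _).trans (min_le_right _ _)
    linarith

namespace Exponents

variable (e : Exponents)

/-- The conjugate exponent of `p`. -/
def q : ℝ := e.p / (e.p - 1)

/-- The modulation exponent of the space in which the equation is solved. -/
def β : ℝ := (1 - e.δ) / e.q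

/-- The modulation exponent of the solution class. -/
def b : ℝ := (1 - e.δ / 2) / e.q

/-- A modulation exponent for which the stochastic convolution is still controlled. -/
def b' : ℝ := (1 - e.δ / 4) / e.q

/-- The power of the length of the time interval gained in the trilinear estimate. -/
def θ : ℝ := e.δ / (4 * e.q)

lemma p_pos : 0 < e.p := by linarith [e.one_lt_p]

lemma holder : e.p.HolderConjugate e.q := Real.HolderConjugate.conjExponent e.one_lt_p

lemma one_lt_q : 1 < e.q := e.holder.symm.lt

lemma q_pos : 0 < e.q := by linarith [e.one_lt_q]

lemma inv_p : 1 / e.p = 1 - 1 / e.q := by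
  have := e.holder.inv_add_inv_eq_one
  rw [one_div, one_div]; linarith

lemma δ_le_q : 10 * e.δ ≤ e.q - 1 := e.δ_le_p

lemma β_mul_q : e.β * e.q = 1 - e.δ := by rw [β, div_mul_cancel₀ _ e.q_pos.ne']

lemma b_mul_q : e.b * e.q = 1 - e.δ / 2 := by rw [b, div_mul_cancel₀ _ e.q_pos.ne']

lemma θ_mul_q : e.θ * e.q = e.δ / 4 := by
  have := e.q_pos.ne'
  rw [θ]; field_simp

lemma θ_pos : 0 < e.θ := div_pos e.δ_pos (mul_pos four_pos e.q_pos)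

lemma β_pos : 0 < e.β := div_pos (by linarith [e.δ_le, e.δ_pos]) e.q_pos

lemma β_lt_b : e.β < e.b := by
  unfold β b
  have := e.q_pos
  have := e.δ_pos
  gcongr
  linarith

lemma b_lt_b' : e.b < e.b' := by
  unfold b b'
  have := e.q_pos
  have := e.δ_pos
  gcongr ?_ / _
  linarith

lemma b'_lt : e.b' < 1 / e.q := by
  unfold b'
  have := e.q_pos
  have := e.δ_pos
  gcongr
  linarith

lemma inv_q_lt_one : 1 / e.q < 1 := by
  rw [div_lt_one e.q_pos]; exact e.one_lt_q

lemma b_pos : 0 < e.b := e.β_pos.trans e.β_lt_b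

/-- Since 1/q = 1 - 1/p, this is the same condition in terms of the conjugate exponent. It says that
⟨τ⟩^{a-1} is in L^p: transforms of size 1/⟨τ⟩, such as those of indicator functions, have finite
norm. -/
lemma sub_one_mul_p_lt {a : ℝ} (ha : a < 1 / e.q) : (a - 1) * e.p < -1 := by
  have h := e.inv_p
  have hp := e.p_pos
  have : (1 - a) * e.p > 1 / e.p * e.p := by
    gcongr
    linarith
  rw [one_div, inv_mul_cancel₀ hp.ne'] at this
  linarith

end Exponents

/-- The norm of `X^{s,b}_p` in the interaction picture. -/
def nX (s b p : ℝ) (F : ℤ → ℝ → ℂ) : ℝ≥0∞ :=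
  (∑' n : ℤ, ∫⁻ τ : ℝ, (wt s n * wt b τ * ‖F n τ‖ₑ) ^ p) ^ (1 / p)

lemma nX_rpow {s b p : ℝ} (hp : 0 < p) (F : ℤ → ℝ → ℂ) :
    nX s b p F ^ p = ∑' n : ℤ, ∫⁻ τ : ℝ, (wt s n * wt b τ * ‖F n τ‖ₑ) ^ p := by
  rw [nX, ← ENNReal.rpow_mul, one_div, inv_mul_cancel₀ hp.ne', ENNReal.rpow_one]

/-! ### The trilinear form -/

/-- The coefficients of the Wick ordered cubic nonlinearity in Fourier variables. -/
def coef (n : ℤ) (m : ℤ × ℤ × ℤ) : ℂ :=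
  if m.1 - m.2.1 + m.2.2 = n then
    (if m.1 ≠ n ∧ m.2.2 ≠ n then 1 else if m.1 = n ∧ m.2.2 = n then -1 else 0) else 0

/-- The resonance function. -/
def phase (m : ℤ × ℤ × ℤ) : ℝ :=
  disp m.1 - disp m.2.1 + disp m.2.2 - disp (m.1 - m.2.1 + m.2.2)

/-- The modulation of the product of three waves. -/
def modul (x : (ℤ × ℤ × ℤ) × (ℝ × ℝ × ℝ)) : ℝ := x.2.1 - x.2.2.1 + x.2.2.2 + phase x.1

/-- Counting measure in the frequencies, Lebesgue measure in the modulations. -/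
def μ3 : Measure ((ℤ × ℤ × ℤ) × (ℝ × ℝ × ℝ)) := Measure.count.prod volume

instance : SFinite μ3 := by unfold μ3; infer_instance

lemma enorm_coef_rpow {q : ℝ} (hq : 0 < q) (n : ℤ) (m : ℤ × ℤ × ℤ) :
    ‖coef n m‖ₑ ^ q = ‖coef n m‖ₑ := by
  unfold coef
  split_ifs <;> simp [hq]

lemma measurable_modul : Measurable modul := by
  unfold modul
  have : Measurable fun x : (ℤ × ℤ × ℤ) × (ℝ × ℝ × ℝ) => phase x.1 :=
    (measurable_of_countable phase).comp measurable_fst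
  fun_prop

lemma measurable_coef (n : ℤ) :
    Measurable fun x : (ℤ × ℤ × ℤ) × (ℝ × ℝ × ℝ) => coef n x.1 :=
  (measurable_of_countable (coef n)).comp measurable_fst

/-- The quadratic dispersion makes the resonance function factor. It vanishes only for a = 0 or c =
0, and there `coef` keeps nothing but the diagonal a = c = 0. -/
lemma phase_shift (n a c : ℤ) :
    phase (n - a, n - a - c, n - c) = -(8 * Real.pi ^ 2 * (a * c : ℤ)) := by
  simp only [phase, disp]
  push_cast
  ring

lemma lintegral_μ3 {f : (ℤ × ℤ × ℤ) × (ℝ × ℝ × ℝ) → ℝ≥0∞} (hf : Measurable f) :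
    ∫⁻ x, f x ∂μ3 = ∑' m : ℤ × ℤ × ℤ, ∫⁻ τ : ℝ × ℝ × ℝ, f (m, τ) := by
  rw [μ3, lintegral_prod _ hf.aemeasurable, lintegral_count]

/-- The triples with m₁ - m₂ + m₃ = n are parametrized by a = n - m₁ and c = n - m₃. Wick ordering
removes those with exactly one of a, c equal to zero. -/
lemma tsum_coef_mul_le (n : ℤ) (h : ℤ × ℤ × ℤ → ℝ≥0∞) :
    ∑' m, ‖coef n m‖ₑ * h m ≤ h (n, n, n) +
      ∑' a : ℤ, ∑' c : ℤ, (if a ≠ 0 ∧ c ≠ 0 then h (n - a, n - a - c, n - c) else 0) := by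
  have h1 : ∑' m, ‖coef n m‖ₑ * h m =
      ∑' a : ℤ, ∑' c : ℤ, ‖coef n (n - a, n - a - c, n - c)‖ₑ * h (n - a, n - a - c, n - c) := by
    rw [ENNReal.tsum_prod']
    simp only [ENNReal.tsum_prod']
    rw [← (Equiv.subLeft n).tsum_eq]
    refine tsum_congr fun a => ?_
    rw [ENNReal.tsum_comm, ← (Equiv.subLeft n).tsum_eq]
    refine tsum_congr fun c => ?_
    simp only [Equiv.subLeft_apply]
    rw [tsum_eq_single (n - a - c)]
    intro m hm
    have : coef n (n - a, m, n - c) = 0 := by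
      simp only [coef]
      rw [if_neg]
      intro h
      exact hm (by linarith)
    simp [this]
  have h2 : ∀ a c : ℤ, ‖coef n (n - a, n - a - c, n - c)‖ₑ * h (n - a, n - a - c, n - c) ≤
      (if a ≠ 0 ∧ c ≠ 0 then h (n - a, n - a - c, n - c) else 0) +
        (if a = 0 then (if c = 0 then h (n, n, n) else 0) else 0) := by
    intro a c
    by_cases ha : a = 0 <;> by_cases hc : c = 0 <;> simp [coef, ha, hc]
  rw [h1]
  calc _ ≤ ∑' a : ℤ, ∑' c : ℤ, ((if a ≠ 0 ∧ c ≠ 0 then h (n - a, n - a - c, n - c) else 0) +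
        (if a = 0 then (if c = 0 then h (n, n, n) else 0) else 0)) :=
        ENNReal.tsum_le_tsum fun a => ENNReal.tsum_le_tsum fun c => h2 a c
    _ = _ := by
        simp only [ENNReal.tsum_add]
        rw [add_comm]
        congr 1
        rw [tsum_eq_single 0 (by intro a ha; simp [ha]), tsum_eq_single 0 (by intro a ha; simp [ha])]
        simp

/-- Three modulations are integrated out. -/
lemma exists_lintegral_three_le {δ : ℝ} (hδ : 0 < δ) (hδ' : 20 * δ ≤ 1) :
    ∃ C : ℝ≥0, ∀ (Φ : ℝ) (g : ℝ → ℝ≥0∞), Measurable g →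
      ∫⁻ τ : ℝ × ℝ × ℝ, wt (-(1 - δ)) τ.1 * wt (-(1 - δ)) τ.2.1 * wt (-(1 - δ)) τ.2.2 *
        g (τ.1 - τ.2.1 + τ.2.2 + Φ) ≤ C * ∫⁻ σ, wt (-(1 - 5 * δ)) σ * g (σ + Φ) := by
  -- Exponents below 1 do not reproduce under convolution. Each of the two convolutions loses 2δ,
  -- which keeps α + γ - r equal to 1 + δ.
  obtain ⟨C₁, hC₁⟩ := exists_lintegral_wt_mul_wt_le (α := 1 - δ) (γ := 1 - δ) (r := 1 - 3 * δ)
    (by linarith) (by linarith) (by linarith) (by linarith)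
  obtain ⟨C₂, hC₂⟩ := exists_lintegral_wt_mul_wt_le (α := 1 - 3 * δ) (γ := 1 - δ) (r := 1 - 5 * δ)
    (by linarith) (by linarith) (by linarith) (by linarith)
  refine ⟨C₁ * C₂, fun Φ g hg => ?_⟩
  set w := wt (-(1 - δ)) with hw
  have hwm : Measurable w := measurable_wt _
  have hwneg : ∀ x, w (-x) = w x := wt_neg_arg _
  calc ∫⁻ τ : ℝ × ℝ × ℝ, w τ.1 * w τ.2.1 * w τ.2.2 * g (τ.1 - τ.2.1 + τ.2.2 + Φ)
      = ∫⁻ τ₁ : ℝ, ∫⁻ τ₂ : ℝ, ∫⁻ τ₃ : ℝ, w τ₁ * w τ₂ * w τ₃ * g (τ₁ - τ₂ + τ₃ + Φ) := by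
        rw [Measure.volume_eq_prod, lintegral_prod _ (by fun_prop)]
        refine lintegral_congr fun τ₁ => ?_
        rw [Measure.volume_eq_prod, lintegral_prod _ (by fun_prop)]
    _ = ∫⁻ τ₁ : ℝ, ∫⁻ τ₂ : ℝ, ∫⁻ σ : ℝ, w τ₁ * w τ₂ * w (σ - (τ₁ - τ₂)) * g (σ + Φ) := by
        refine lintegral_congr fun τ₁ => lintegral_congr fun τ₂ => ?_
        rw [← lintegral_add_right_eq_self
          (fun σ => w τ₁ * w τ₂ * w (σ - (τ₁ - τ₂)) * g (σ + Φ)) (τ₁ - τ₂)]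
        refine lintegral_congr fun τ₃ => ?_
        rw [add_sub_cancel_right, add_comm τ₃]
    _ = ∫⁻ σ : ℝ, ∫⁻ τ₁ : ℝ, ∫⁻ τ₂ : ℝ, w τ₁ * w τ₂ * w (σ - (τ₁ - τ₂)) * g (σ + Φ) := by
        refine (lintegral_congr fun τ₁ => lintegral_lintegral_swap
          (f := fun τ₂ σ => w τ₁ * w τ₂ * w (σ - (τ₁ - τ₂)) * g (σ + Φ)) ?_).trans
          (lintegral_lintegral_swap ?_)
        · exact Measurable.aemeasurable (by fun_prop)
        · refine (Measurable.lintegral_prod_right (f := fun (z : ℝ × ℝ) (τ₂ : ℝ) =>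
            w z.1 * w τ₂ * w (z.2 - (z.1 - τ₂)) * g (z.2 + Φ)) ?_).aemeasurable
          fun_prop
    _ ≤ ∫⁻ σ : ℝ, C₁ * C₂ * (wt (-(1 - 5 * δ)) σ * g (σ + Φ)) := by
        refine lintegral_mono fun σ => ?_
        have e1 : ∀ τ₁, ∫⁻ τ₂ : ℝ, w τ₁ * w τ₂ * w (σ - (τ₁ - τ₂)) * g (σ + Φ) ≤
            w τ₁ * (C₁ * wt (-(1 - 3 * δ)) (σ - τ₁)) * g (σ + Φ) := by
          intro τ₁
          calc ∫⁻ τ₂ : ℝ, w τ₁ * w τ₂ * w (σ - (τ₁ - τ₂)) * g (σ + Φ)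
              = ∫⁻ τ₂ : ℝ, w τ₁ * (w ((σ - τ₁) - τ₂) * w τ₂) * g (σ + Φ) := by
                rw [← lintegral_neg_eq_self]
                refine lintegral_congr fun τ₂ => ?_
                rw [hwneg, show σ - (τ₁ - -τ₂) = σ - τ₁ - τ₂ by ring]
                ring
            _ = w τ₁ * (∫⁻ τ₂ : ℝ, w ((σ - τ₁) - τ₂) * w τ₂) * g (σ + Φ) := by
                rw [lintegral_mul_const _ (by fun_prop), lintegral_const_mul _ (by fun_prop)]
            _ ≤ _ := by
                gcongr
                exact hC₁ _
        calc _ ≤ ∫⁻ τ₁, w τ₁ * (C₁ * wt (-(1 - 3 * δ)) (σ - τ₁)) * g (σ + Φ) := lintegral_mono e1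
          _ = ∫⁻ τ₁, C₁ * (wt (-(1 - 3 * δ)) (σ - τ₁) * w τ₁) * g (σ + Φ) := by
              refine lintegral_congr fun τ₁ => ?_
              ring
          _ = C₁ * (∫⁻ τ₁, wt (-(1 - 3 * δ)) (σ - τ₁) * w τ₁) * g (σ + Φ) := by
              rw [lintegral_mul_const _ (by fun_prop), lintegral_const_mul _ (by fun_prop)]
          _ ≤ C₁ * (C₂ * wt (-(1 - 5 * δ)) σ) * g (σ + Φ) := by
              gcongr
              exact hC₂ σ
          _ = _ := by ring
    _ = _ := by
        rw [lintegral_const_mul _ (by fun_prop)]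
        push_cast
        rfl

/-- One of ⟨σ⟩ and ⟨σ + Φ⟩ is at least half of ⟨Φ⟩. If it is ⟨σ + Φ⟩, its power leaves the integral
and the other two factors are convolved with a loss of 2δ. If it is ⟨σ⟩, its power leaves the
integral and the remaining product has total exponent ν + 1 - δ > 1. -/
lemma exists_lintegral_two_le {δ ν : ℝ} (hδ : 0 < δ) (hδ' : 20 * δ ≤ 1) (hν : 2 * δ ≤ ν) :
    ∃ C : ℝ≥0, ∀ Φ x : ℝ, ∫⁻ σ, wt (-(1 - 5 * δ)) σ *
        (wt (-ν) (σ + Φ) * wt (-(1 - δ)) (x - (σ + Φ))) ≤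
      C * (wt (-ν) Φ * wt (-(1 - 7 * δ)) (x - Φ) + wt (-(1 - 5 * δ)) Φ) := by
  obtain ⟨C₁, hC₁⟩ := exists_lintegral_wt_mul_wt_le (α := 1 - δ) (γ := 1 - 5 * δ) (r := 1 - 7 * δ)
    (by linarith) (by linarith) (by linarith) (by linarith)
  set K := ∫⁻ x, wt (-ν + -(1 - δ)) x with hK
  have hKt : K < ∞ := lintegral_wt_lt_top (by linarith)
  set A := ENNReal.ofReal (2 ^ ν) with hA
  set B := ENNReal.ofReal (2 ^ (1 - 5 * δ)) with hB
  have hCt : A * C₁ + B * (K + K) ≠ ∞ := by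
    refine ENNReal.add_ne_top.2 ⟨ENNReal.mul_ne_top (by simp [hA]) (by simp),
      ENNReal.mul_ne_top (by simp [hB]) (ENNReal.add_ne_top.2 ⟨hKt.ne, hKt.ne⟩)⟩
  refine ⟨(A * C₁ + B * (K + K)).toNNReal, fun Φ x => ?_⟩
  rw [ENNReal.coe_toNNReal hCt]
  calc ∫⁻ σ, wt (-(1 - 5 * δ)) σ * (wt (-ν) (σ + Φ) * wt (-(1 - δ)) (x - (σ + Φ)))
      ≤ ∫⁻ σ, (A * wt (-ν) Φ * (wt (-(1 - δ)) (x - Φ - σ) * wt (-(1 - 5 * δ)) σ) +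
          B * wt (-(1 - 5 * δ)) Φ * (wt (-ν + -(1 - δ)) (σ + Φ) +
            wt (-ν + -(1 - δ)) (x - Φ - σ))) := by
        refine lintegral_mono fun σ => ?_
        have hx : x - (σ + Φ) = x - Φ - σ := by ring
        rw [hx]
        have htri : jb Φ ≤ jb (σ + Φ) + jb σ := by
          have := jb_add_le (σ + Φ) (-σ)
          rwa [jb_neg, show σ + Φ + -σ = Φ by ring] at this
        rcases le_total (jb σ) (jb (σ + Φ)) with h | h
        · refine le_trans ?_ le_self_add
          have := wt_le_of_jb_le_mul (a := -ν) (x := σ + Φ) (y := Φ) (by linarith) two_pos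
            (by linarith)
          rw [neg_neg] at this
          calc _ ≤ wt (-(1 - 5 * δ)) σ * ((A * wt (-ν) Φ) * wt (-(1 - δ)) (x - Φ - σ)) := by
                gcongr
            _ = _ := by ring
        · refine le_trans ?_ le_add_self
          have := wt_le_of_jb_le_mul (a := -(1 - 5 * δ)) (x := σ) (y := Φ) (by linarith) two_pos
            (by linarith)
          rw [neg_neg] at this
          refine mul_le_mul' this ?_
          exact wt_mul_wt_le (by linarith) (by linarith) _ _
    _ = A * wt (-ν) Φ * (∫⁻ σ, wt (-(1 - δ)) (x - Φ - σ) * wt (-(1 - 5 * δ)) σ) +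
          B * wt (-(1 - 5 * δ)) Φ * (K + K) := by
        rw [lintegral_add_left (by fun_prop), lintegral_const_mul _ (by fun_prop),
          lintegral_const_mul _ (by fun_prop), lintegral_add_left (by fun_prop),
          lintegral_add_right_eq_self (fun y => wt (-ν + -(1 - δ)) y),
          lintegral_sub_left_eq_self (fun y => wt (-ν + -(1 - δ)) y)]
    _ ≤ A * wt (-ν) Φ * (C₁ * wt (-(1 - 7 * δ)) (x - Φ)) +
          B * wt (-(1 - 5 * δ)) Φ * (K + K) := by
        gcongr
        exact hC₁ _
    _ ≤ _ := by
        rw [mul_add (A * C₁ + B * (K + K))]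
        refine add_le_add ?_ ?_
        · calc _ = A * C₁ * (wt (-ν) Φ * wt (-(1 - 7 * δ)) (x - Φ)) := by ring
            _ ≤ _ := mul_le_mul' le_self_add le_rfl
        · calc _ = B * (K + K) * wt (-(1 - 5 * δ)) Φ := by ring
            _ ≤ _ := mul_le_mul' le_add_self le_rfl

/-! ### The kernel sums -/

/-- The kernel that remains after Hölder's inequality in the trilinear estimates. -/
def kernelSum (l δ : ℝ) (n : ℤ) (g : ℝ → ℝ≥0∞) : ℝ≥0∞ :=
  ∫⁻ x, ‖coef n x.1‖ₑ * (wt l n * (wt (-l) x.1.1 * wt (-l) x.1.2.2 * wt (-l) x.1.2.1)) *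
    (wt (-(1 - δ)) x.2.1 * wt (-(1 - δ)) x.2.2.1 * wt (-(1 - δ)) x.2.2.2) * g (modul x) ∂μ3

lemma measurable_wt_freq (l : ℝ) (f : ℤ × ℤ × ℤ → ℤ) :
    Measurable fun x : (ℤ × ℤ × ℤ) × (ℝ × ℝ × ℝ) => wt l (f x.1) :=
  (measurable_of_countable fun m => wt l (f m)).comp measurable_fst

/-- For fixed frequencies g sees only the sum of the modulations and the resonance function.
Integrating the modulations out leaves a lattice sum in which any bound h for the smeared g is
evaluated at -8π²ac. -/
lemma exists_kernelSum_le {δ l : ℝ} (hδ : 0 < δ) (hδ' : 20 * δ ≤ 1) :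
    ∃ C : ℝ≥0, ∀ (n : ℤ) (g : ℝ → ℝ≥0∞) (h : ℝ → ℝ≥0∞), Measurable g →
      (∀ Φ, ∫⁻ σ, wt (-(1 - 5 * δ)) σ * g (σ + Φ) ≤ h Φ) →
      kernelSum l δ n g ≤ C * (wt l n * (wt (-l) n * wt (-l) n * wt (-l) n) * h 0 +
        ∑' a : ℤ, ∑' c : ℤ, (if a ≠ 0 ∧ c ≠ 0 then
          wt l n * (wt (-l) (n - a : ℤ) * wt (-l) (n - c : ℤ) * wt (-l) (n - a - c : ℤ)) *
            h (-(8 * Real.pi ^ 2 * (a * c : ℤ))) else 0)) := by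
  obtain ⟨C, hC⟩ := exists_lintegral_three_le hδ hδ'
  refine ⟨C, fun n g h hg hh => ?_⟩
  have hm := measurable_modul
  have hc := (measurable_coef n).enorm
  have w1 := measurable_wt_freq (-l) fun m => m.1
  have w2 := measurable_wt_freq (-l) fun m => m.2.1
  have w3 := measurable_wt_freq (-l) fun m => m.2.2
  rw [kernelSum, lintegral_μ3 (by fun_prop)]
  calc _ ≤ ∑' m : ℤ × ℤ × ℤ, ‖coef n m‖ₑ * (C * (wt l n * (wt (-l) m.1 * wt (-l) m.2.2 *
          wt (-l) m.2.1) * h (phase m))) := by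
        refine ENNReal.tsum_le_tsum fun m => ?_
        simp only [modul]
        calc _ = ‖coef n m‖ₑ * (wt l n * (wt (-l) m.1 * wt (-l) m.2.2 * wt (-l) m.2.1)) *
              ∫⁻ τ : ℝ × ℝ × ℝ, wt (-(1 - δ)) τ.1 * wt (-(1 - δ)) τ.2.1 * wt (-(1 - δ)) τ.2.2 *
                g (τ.1 - τ.2.1 + τ.2.2 + phase m) := by
              rw [← lintegral_const_mul _ (by fun_prop)]
              refine lintegral_congr fun τ => ?_
              ring
          _ ≤ ‖coef n m‖ₑ * (wt l n * (wt (-l) m.1 * wt (-l) m.2.2 * wt (-l) m.2.1)) *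
              (C * h (phase m)) := by
              gcongr
              refine (hC (phase m) g hg).trans ?_
              gcongr
              exact hh _
          _ = _ := by ring
    _ ≤ _ := tsum_coef_mul_le n _
    _ = _ := by
        have h0 : phase (n, n, n) = 0 := by simp [phase]
        simp only [h0, phase_shift]
        rw [mul_add, ← ENNReal.tsum_mul_left]
        congr 1
        refine tsum_congr fun a => ?_
        rw [← ENNReal.tsum_mul_left]
        refine tsum_congr fun c => ?_
        split_ifs
        · rfl
        · simp

lemma wt_diagonal_le {l : ℝ} (hl : 0 ≤ l) (x : ℝ) :
    wt l x * (wt (-l) x * wt (-l) x * wt (-l) x) ≤ 1 := by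
  calc _ = (wt l x * wt (-l) x) * (wt (-l) x * wt (-l) x) := by ring
    _ ≤ 1 * (1 * 1) := by
        rw [wt_mul_wt_neg]
        gcongr <;> exact wt_le_one (by linarith) _
    _ = 1 := by norm_num

lemma two_le_eight_pi_sq : (2 : ℝ) ≤ 8 * Real.pi ^ 2 := by
  nlinarith [Real.pi_gt_three]

/-- An integrable weight in the modulation leaves the decay 1 - 5δ in the resonance function. Its
deficit from 1 is covered by the frequency weights, because l + (1 - 5δ) > 1. -/
lemma exists_kernelSum_wt_le {δ l a : ℝ} (hδ : 0 < δ) (hδ' : 20 * δ ≤ 1) (hl : 6 * δ ≤ l)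
    (ha : 1 < a) : ∃ C : ℝ≥0, ∀ n : ℤ, kernelSum l δ n (wt (-a)) ≤ C := by
  obtain ⟨C₁, hC₁⟩ := exists_kernelSum_le (l := l) hδ hδ'
  obtain ⟨C₂, hC₂⟩ := exists_lintegral_wt_mul_wt_le (α := a) (γ := 1 - 5 * δ) (r := 1 - 5 * δ)
    (by linarith) (by linarith) (by linarith) (by linarith)
  obtain ⟨C₃, hC₃⟩ := exists_tsum_resonance_le (l := l) (r := 1 - 5 * δ) (by linarith)
    (by linarith) (by linarith) two_le_eight_pi_sq
  refine ⟨C₁ * (C₂ + C₂ * C₃), fun n => ?_⟩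
  refine (hC₁ n (wt (-a)) (fun Φ => C₂ * wt (-(1 - 5 * δ)) Φ) (by fun_prop) fun Φ => ?_).trans ?_
  · have := hC₂ (-Φ)
    rw [wt_neg_arg] at this
    refine le_trans (le_of_eq (lintegral_congr fun σ => ?_)) this
    rw [← wt_neg_arg (-a), mul_comm]
    congr 2
    ring
  · simp only [ENNReal.coe_mul, ENNReal.coe_add]
    rw [add_comm (C₂ : ℝ≥0∞), add_comm (_ * _)]
    refine mul_le_mul' le_rfl (add_le_add ?_ ?_)
    · calc _ = ∑' a : ℤ, ∑' c : ℤ, C₂ * (if a ≠ 0 ∧ c ≠ 0 then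
          wt l n * (wt (-l) (n - a : ℤ) * wt (-l) (n - c : ℤ) * wt (-l) (n - a - c : ℤ)) *
            wt (-(1 - 5 * δ)) (8 * Real.pi ^ 2 * (a * c : ℤ)) else 0) := by
            refine tsum_congr fun a => tsum_congr fun c => ?_
            rw [wt_neg_arg]
            split_ifs
            · ring
            · simp
        _ = C₂ * ∑' a : ℤ, ∑' c : ℤ, (if a ≠ 0 ∧ c ≠ 0 then
          wt l n * (wt (-l) (n - a : ℤ) * wt (-l) (n - c : ℤ) * wt (-l) (n - a - c : ℤ)) *
            wt (-(1 - 5 * δ)) (8 * Real.pi ^ 2 * (a * c : ℤ)) else 0) := by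
            simp only [ENNReal.tsum_mul_left]
        _ ≤ _ := by
            gcongr
            exact hC₃ n
    · calc _ ≤ 1 * (C₂ * (1 : ℝ≥0∞)) :=
            mul_le_mul' (wt_diagonal_le (by linarith) _)
              (mul_le_mul' le_rfl (wt_le_one (by linarith) _))
        _ = _ := by ring

/-- The weight ⟨x - μ⟩ is large in effect where the resonance function is close to x, that is, near
a hyperbola in the (a, c) lattice. There the frequency weights are bounded by a constant and the
divisor bound counts the points; 9δ ≤ ν gives ν - δ + (1 - 7δ) > 1. The remaining piece is the
resonance sum. -/
lemma exists_kernelSum_two_le {δ l ν : ℝ} (hδ : 0 < δ) (hδ' : 20 * δ ≤ 1) (hl : 6 * δ ≤ l)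
    (hν : 9 * δ ≤ ν) : ∃ C : ℝ≥0, ∀ (n : ℤ) (x : ℝ),
      kernelSum l δ n (fun μ => wt (-ν) μ * wt (-(1 - δ)) (x - μ)) ≤ C := by
  obtain ⟨C₁, hC₁⟩ := exists_kernelSum_le (l := l) hδ hδ'
  obtain ⟨C₂, hC₂⟩ := exists_lintegral_two_le (ν := ν) hδ hδ' (by linarith)
  obtain ⟨C₃, hC₃⟩ := exists_tsum_resonance_le (l := l) (r := 1 - 5 * δ) (by linarith)
    (by linarith) (by linarith) two_le_eight_pi_sq
  obtain ⟨C₄, hC₄⟩ := exists_tsum_hyperbola_le (ν := ν) (r := 1 - 7 * δ) (ε := δ)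
    (L := 8 * Real.pi ^ 2) hδ (by linarith) (by linarith) (by linarith)
    (by linarith [two_le_eight_pi_sq])
  set M : ℝ≥0 := (ENNReal.ofReal (2 ^ l * 2 ^ l) * 3).toNNReal with hM
  have hMe : (M : ℝ≥0∞) = ENNReal.ofReal (2 ^ l * 2 ^ l) * 3 :=
    ENNReal.coe_toNNReal (ENNReal.mul_ne_top (by simp) (by simp))
  refine ⟨C₁ * (C₂ * 2 + C₂ * (M * C₄ + C₃)), fun n x => ?_⟩
  refine (hC₁ n _ (fun Φ => C₂ * (wt (-ν) Φ * wt (-(1 - 7 * δ)) (x - Φ) + wt (-(1 - 5 * δ)) Φ))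
    (by fun_prop) fun Φ => hC₂ Φ x).trans ?_
  simp only [ENNReal.coe_mul, ENNReal.coe_add, ENNReal.coe_ofNat]
  refine mul_le_mul' le_rfl (add_le_add ?_ ?_)
  · calc _ ≤ 1 * (C₂ * ((1 : ℝ≥0∞) * 1 + 1)) :=
          mul_le_mul' (wt_diagonal_le (by linarith) _) (mul_le_mul' le_rfl (add_le_add
            (mul_le_mul' (wt_le_one (by linarith) _) (wt_le_one (by linarith) _))
            (wt_le_one (by linarith) _)))
      _ = _ := by ring
  · calc _ ≤ ∑' a : ℤ, ∑' c : ℤ, (C₂ * (M * (if a ≠ 0 ∧ c ≠ 0 then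
          wt (-ν) (8 * Real.pi ^ 2 * (a * c : ℤ)) *
            wt (-(1 - 7 * δ)) (x + 8 * Real.pi ^ 2 * (a * c : ℤ)) else 0)) +
          C₂ * (if a ≠ 0 ∧ c ≠ 0 then
            wt l n * (wt (-l) (n - a : ℤ) * wt (-l) (n - c : ℤ) * wt (-l) (n - a - c : ℤ)) *
            wt (-(1 - 5 * δ)) (8 * Real.pi ^ 2 * (a * c : ℤ)) else 0)) := by
          refine ENNReal.tsum_le_tsum fun a => ENNReal.tsum_le_tsum fun c => ?_
          split_ifs with h
          · have h2 := wt_mul_three_le_const (l := l) (by linarith) ((n - a : ℤ) : ℝ)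
              ((n - c : ℤ) : ℝ) ((n - a - c : ℤ) : ℝ)
            rw [show ((n - a : ℤ) : ℝ) + ((n - c : ℤ) : ℝ) - ((n - a - c : ℤ) : ℝ) = n by
              push_cast; ring, ← hMe] at h2
            push_cast at h2 ⊢
            simp only [wt_neg_arg, sub_neg_eq_add]
            calc _ = C₂ * (wt l n * (wt (-l) (n - a) * wt (-l) (n - c) * wt (-l) (n - a - c)) *
                  (wt (-ν) (8 * Real.pi ^ 2 * (a * c)) *
                    wt (-(1 - 7 * δ)) (x + 8 * Real.pi ^ 2 * (a * c)))) +
                  C₂ * (wt l n * (wt (-l) (n - a) * wt (-l) (n - c) * wt (-l) (n - a - c)) *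
                    wt (-(1 - 5 * δ)) (8 * Real.pi ^ 2 * (a * c))) := by ring
              _ ≤ _ := by gcongr
          · simp
      _ = C₂ * (M * ∑' a : ℤ, ∑' c : ℤ, (if a ≠ 0 ∧ c ≠ 0 then
          wt (-ν) (8 * Real.pi ^ 2 * (a * c : ℤ)) *
            wt (-(1 - 7 * δ)) (x + 8 * Real.pi ^ 2 * (a * c : ℤ)) else 0) +
          ∑' a : ℤ, ∑' c : ℤ, (if a ≠ 0 ∧ c ≠ 0 then
            wt l n * (wt (-l) (n - a : ℤ) * wt (-l) (n - c : ℤ) * wt (-l) (n - a - c : ℤ)) *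
            wt (-(1 - 5 * δ)) (8 * Real.pi ^ 2 * (a * c : ℤ)) else 0)) := by
          simp only [ENNReal.tsum_mul_left, ENNReal.tsum_add, mul_add]
      _ ≤ _ := by
          gcongr
          · exact hC₄ x
          · exact hC₃ n

/-! ### The oscillatory kernels -/

/-- `∫_{t₀}^t exp(irμ) dr`. -/
def kk (t₀ t μ : ℝ) : ℂ := ∫ r in t₀..t, cexp (I * r * μ)

/-- The Fourier transform of `t ↦ kk t₀ t μ` on `[t₀, t₁]`. -/
def hh (t₀ t₁ τ μ : ℝ) : ℂ := ∫ t in t₀..t₁, cexp (-(I * t * τ)) * kk t₀ t μ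

lemma norm_cexp_I (r μ : ℝ) : ‖cexp (I * r * μ)‖ = 1 := by
  rw [show I * (r : ℂ) * μ = ((r * μ : ℝ) : ℂ) * I by push_cast; ring, norm_exp_ofReal_mul_I]

lemma norm_cexp_neg_I (r μ : ℝ) : ‖cexp (-(I * r * μ))‖ = 1 := by
  rw [show -(I * (r : ℂ) * μ) = ((-(r * μ) : ℝ) : ℂ) * I by push_cast; ring, norm_exp_ofReal_mul_I]

lemma norm_kk_le (t₀ t μ : ℝ) : ‖kk t₀ t μ‖ ≤ |t - t₀| := by
  have := intervalIntegral.norm_integral_le_of_norm_le_const (a := t₀) (b := t) (C := 1)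
    (f := fun r : ℝ => cexp (I * r * μ)) fun r _ => (norm_cexp_I r μ).le
  simpa [kk] using this

lemma kk_identity (t₀ t μ : ℝ) :
    I * μ * kk t₀ t μ = cexp (I * t * μ) - cexp (I * t₀ * μ) := by
  by_cases hμ : μ = 0
  · simp [hμ]
  · have h : (I * μ : ℂ) ≠ 0 := mul_ne_zero I_ne_zero (ofReal_ne_zero.2 hμ)
    have := integral_exp_mul_complex (a := t₀) (b := t) h
    have e : kk t₀ t μ = ∫ x in t₀..t, cexp (I * μ * x) := by
      unfold kk
      refine intervalIntegral.integral_congr fun r _ => ?_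
      ring_nf
    rw [e, this, mul_div_cancel₀ _ h]
    ring_nf

lemma abs_mul_norm_kk_le (t₀ t μ : ℝ) : |μ| * ‖kk t₀ t μ‖ ≤ 2 := by
  have h := congrArg norm (kk_identity t₀ t μ)
  rw [norm_mul, norm_mul, norm_I, one_mul, norm_real, Real.norm_eq_abs] at h
  rw [h]
  refine (norm_sub_le _ _).trans ?_
  rw [norm_cexp_I, norm_cexp_I]
  norm_num

lemma jb_mul_le_of {μ x A B : ℝ} (hx : 0 ≤ x) (h1 : x ≤ A) (h2 : |μ| * x ≤ B) :
    jb μ * x ≤ A + B := by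
  calc jb μ * x ≤ (1 + |μ|) * x := by gcongr; exact jb_le_one_add_abs μ
    _ = x + |μ| * x := by ring
    _ ≤ _ := add_le_add h1 h2

lemma jb_mul_norm_kk_le {t₀ t : ℝ} (h : |t - t₀| ≤ 1) (μ : ℝ) : jb μ * ‖kk t₀ t μ‖ ≤ 3 := by
  have := jb_mul_le_of (norm_nonneg _) ((norm_kk_le t₀ t μ).trans h) (abs_mul_norm_kk_le t₀ t μ)
  linarith

lemma continuous_kk : Continuous fun z : ℝ × ℝ × ℝ => kk z.1 z.2.1 z.2.2 := by
  have h1 : ∀ z : ℝ × ℝ × ℝ, kk z.1 z.2.1 z.2.2 =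
      (∫ r in (0 : ℝ)..z.2.1, cexp (I * r * z.2.2)) - ∫ r in (0 : ℝ)..z.1, cexp (I * r * z.2.2) := by
    intro z
    rw [kk, intervalIntegral.integral_interval_sub_left] <;>
    exact Continuous.intervalIntegrable (by fun_prop) _ _
  simp only [h1]
  refine Continuous.sub ?_ ?_
  · exact intervalIntegral.continuous_parametric_intervalIntegral_of_continuous
      (f := fun (z : ℝ × ℝ × ℝ) (r : ℝ) => cexp (I * r * z.2.2)) (by fun_prop) (by fun_prop)
  · exact intervalIntegral.continuous_parametric_intervalIntegral_of_continuous
      (f := fun (z : ℝ × ℝ × ℝ) (r : ℝ) => cexp (I * r * z.2.2)) (by fun_prop) (by fun_prop)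

lemma continuous_kk_right (t₀ μ : ℝ) : Continuous fun t => kk t₀ t μ :=
  continuous_kk.comp (by fun_prop : Continuous fun t : ℝ => (t₀, t, μ))

lemma continuous_hh (t₀ t₁ : ℝ) : Continuous fun z : ℝ × ℝ => hh t₀ t₁ z.1 z.2 := by
  unfold hh
  refine intervalIntegral.continuous_parametric_intervalIntegral_of_continuous'
    (f := fun (z : ℝ × ℝ) (t : ℝ) => cexp (-(I * t * z.1)) * kk t₀ t z.2) ?_ _ _
  have h : Continuous fun z : (ℝ × ℝ) × ℝ => kk t₀ z.2 z.1.2 :=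
    continuous_kk.comp (by fun_prop : Continuous fun z : (ℝ × ℝ) × ℝ => (t₀, z.2, z.1.2))
  have h2 : Continuous fun z : (ℝ × ℝ) × ℝ => cexp (-(I * z.2 * z.1.1)) := by fun_prop
  exact h2.mul h

lemma norm_hh_le {t₀ t₁ : ℝ} (h0 : t₀ ≤ t₁) (h1 : t₁ - t₀ ≤ 1) (τ μ : ℝ) :
    ‖hh t₀ t₁ τ μ‖ ≤ t₁ - t₀ := by
  have := intervalIntegral.norm_integral_le_of_norm_le_const (a := t₀) (b := t₁) (C := 1)
    (f := fun t : ℝ => cexp (-(I * t * τ)) * kk t₀ t μ) fun r hr => by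
      rw [Set.uIoc_of_le h0] at hr
      rw [norm_mul, norm_cexp_neg_I, one_mul]
      refine (norm_kk_le t₀ r μ).trans ?_
      rw [abs_of_nonneg (by linarith [hr.1])]
      linarith [hr.2]
  rwa [one_mul, abs_of_nonneg (by linarith)] at this

/-- Integration by parts in t. Since `kk` vanishes at t = t₀ only the boundary term at t₁ appears,
and both resulting terms are values of `kk` up to unimodular factors. -/
lemma abs_left_mul_norm_hh_le {t₀ t₁ : ℝ} (h : |t₁ - t₀| ≤ 1) (τ μ : ℝ) :
    |τ| * ‖hh t₀ t₁ τ μ‖ ≤ 2 := by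
  have hd1 : ∀ t : ℝ, HasDerivAt (fun t : ℝ => cexp (-(I * t * τ)))
      (-(I * τ) * cexp (-(I * t * τ))) t := by
    intro t
    have h1 : HasDerivAt (fun t : ℝ => -(I * (t : ℂ) * τ)) (-(I * τ)) t := by
      have := ((ofRealCLM.hasDerivAt (x := t)).const_mul (-(I * τ)))
      simp only [ofRealCLM_apply, ofReal_one, mul_one] at this
      refine this.congr_of_eventuallyEq (Eventually.of_forall fun x => ?_)
      ring
    have := h1.cexp
    convert this using 1
    ring
  have hd2 : ∀ t : ℝ, HasDerivAt (fun t : ℝ => kk t₀ t μ) (cexp (I * t * μ)) t := by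
    intro t
    have hc : Continuous fun r : ℝ => cexp (I * r * μ) := by fun_prop
    exact intervalIntegral.integral_hasDerivAt_right (hc.intervalIntegrable _ _)
      (hc.stronglyMeasurableAtFilter _ _) hc.continuousAt
  have hk0 : kk t₀ t₀ μ = 0 := by simp [kk]
  have hp := intervalIntegral.integral_mul_deriv_eq_deriv_mul (a := t₀) (b := t₁)
    (u := fun t : ℝ => cexp (-(I * t * τ))) (v := fun t => kk t₀ t μ)
    (u' := fun t => -(I * τ) * cexp (-(I * t * τ))) (v' := fun t => cexp (I * t * μ))
    (fun t _ => hd1 t) (fun t _ => hd2 t)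
    (Continuous.intervalIntegrable (by fun_prop) _ _)
    (Continuous.intervalIntegrable (by fun_prop) _ _)
  have e1 : ∫ t in t₀..t₁, cexp (-(I * t * τ)) * cexp (I * t * μ) = kk t₀ t₁ (μ - τ) := by
    unfold kk
    refine intervalIntegral.integral_congr fun r _ => ?_
    rw [← Complex.exp_add]
    congr 1
    push_cast
    ring
  have e2 : ∫ t in t₀..t₁, -(I * τ) * cexp (-(I * t * τ)) * kk t₀ t μ =
      -(I * τ) * hh t₀ t₁ τ μ := by
    rw [hh, ← intervalIntegral.integral_const_mul]
    refine intervalIntegral.integral_congr fun r _ => ?_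
    ring
  rw [e1, e2, hk0, mul_zero, sub_zero] at hp
  have e3 : I * τ * hh t₀ t₁ τ μ = kk t₀ t₁ (μ - τ) - cexp (-(I * t₁ * τ)) * kk t₀ t₁ μ := by
    rw [hp]; ring
  have e4 := congrArg norm e3
  rw [norm_mul, norm_mul, norm_I, one_mul, norm_real, Real.norm_eq_abs] at e4
  rw [e4]
  refine (norm_sub_le _ _).trans ?_
  rw [norm_mul, norm_cexp_neg_I, one_mul]
  linarith [norm_kk_le t₀ t₁ (μ - τ), norm_kk_le t₀ t₁ μ]

/-- By `kk_identity` the factor iμ turns the inner integral into a difference of two exponentials,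
so iμ times `hh` is a difference of values of `kk` at μ - τ and at -τ. -/
lemma abs_right_mul_norm_hh_le (t₀ t₁ τ μ : ℝ) :
    |μ| * ‖hh t₀ t₁ τ μ‖ ≤ ‖kk t₀ t₁ (μ - τ)‖ + ‖kk t₀ t₁ (-τ)‖ := by
  have e : I * μ * hh t₀ t₁ τ μ =
      kk t₀ t₁ (μ - τ) - cexp (I * t₀ * μ) * kk t₀ t₁ (-τ) := by
    rw [hh, ← intervalIntegral.integral_const_mul, kk, kk, ← intervalIntegral.integral_const_mul,
      ← intervalIntegral.integral_sub (Continuous.intervalIntegrable (by fun_prop) _ _)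
        (Continuous.intervalIntegrable (by fun_prop) _ _)]
    refine intervalIntegral.integral_congr fun t _ => ?_
    calc _ = cexp (-(I * t * τ)) * (I * μ * kk t₀ t μ) := by ring
      _ = _ := by
        rw [kk_identity, mul_sub, ← Complex.exp_add, ← Complex.exp_add, ← Complex.exp_add]
        congr 2
        · push_cast; ring
        · push_cast; ring
  have h := congrArg norm e
  rw [norm_mul, norm_mul, norm_I, one_mul, norm_real, Real.norm_eq_abs] at h
  rw [h]
  refine (norm_sub_le _ _).trans ?_
  rw [norm_mul, norm_cexp_I, one_mul]

lemma norm_hh_le_jb {t₀ t₁ : ℝ} (h0 : t₀ ≤ t₁) (h1 : t₁ - t₀ ≤ 1) (τ μ : ℝ) :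
    ‖hh t₀ t₁ τ μ‖ ≤ 6 * ((jb μ)⁻¹ * ((jb τ)⁻¹ + (jb (τ - μ))⁻¹)) := by
  have hI : |t₁ - t₀| ≤ 1 := by rwa [abs_of_nonneg (by linarith)]
  have a1 : ‖hh t₀ t₁ τ μ‖ ≤ 3 * (jb τ)⁻¹ := by
    have := jb_mul_le_of (norm_nonneg _) ((norm_hh_le h0 h1 τ μ).trans h1)
      (abs_left_mul_norm_hh_le hI τ μ)
    rw [← div_eq_mul_inv, le_div_iff₀ (jb_pos _)]
    linarith
  have k1 : ∀ x, ‖kk t₀ t₁ x‖ ≤ 3 * (jb x)⁻¹ := by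
    intro x
    rw [← div_eq_mul_inv, le_div_iff₀ (jb_pos _)]
    linarith [jb_mul_norm_kk_le hI x]
  have a2 : |μ| * ‖hh t₀ t₁ τ μ‖ ≤ 3 * (jb (τ - μ))⁻¹ + 3 * (jb τ)⁻¹ := by
    refine (abs_right_mul_norm_hh_le t₀ t₁ τ μ).trans (add_le_add ?_ ?_)
    · have := k1 (μ - τ)
      rwa [← jb_neg, neg_sub] at this
    · have := k1 (-τ)
      rwa [jb_neg] at this
  have a3 := jb_mul_le_of (norm_nonneg _) a1 a2
  have a4 : ‖hh t₀ t₁ τ μ‖ ≤ (jb μ)⁻¹ * (3 * (jb τ)⁻¹ + (3 * (jb (τ - μ))⁻¹ + 3 * (jb τ)⁻¹)) := by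
    rw [← div_eq_inv_mul, le_div_iff₀ (jb_pos _)]
    linarith
  refine a4.trans ?_
  have p1 := inv_pos.2 (jb_pos μ)
  have p3 := inv_pos.2 (jb_pos (τ - μ))
  nlinarith [mul_pos p1 p3]

/-- Interpolation: the power θ is estimated by the length of the interval and the power 1 - θ by the
decay of `norm_hh_le_jb`. A small loss of decay buys the small factor needed for the contraction. -/
lemma enorm_hh_le {t₀ t₁ θ : ℝ} (h0 : t₀ ≤ t₁) (h1 : t₁ - t₀ ≤ 1) (hθ : 0 ≤ θ) (hθ1 : θ ≤ 1)
    (τ μ : ℝ) : ‖hh t₀ t₁ τ μ‖ₑ ≤ ENNReal.ofReal ((t₁ - t₀) ^ θ) * (6 * (wt (-(1 - θ)) μ *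
      (wt (-(1 - θ)) τ + wt (-(1 - θ)) (τ - μ)))) := by
  have hk : 0 ≤ 1 - θ := by linarith
  have hw : ∀ x, ENNReal.ofReal (jb x)⁻¹ ^ (1 - θ) = wt (-(1 - θ)) x := by
    intro x
    rw [ENNReal.ofReal_rpow_of_pos (inv_pos.2 (jb_pos x)), wt, Real.inv_rpow (jb_pos x).le,
      ← Real.rpow_neg (jb_pos x).le]
  have a1 : ‖hh t₀ t₁ τ μ‖ₑ ≤ ENNReal.ofReal (t₁ - t₀) := by
    rw [← ofReal_norm]
    exact ENNReal.ofReal_le_ofReal (norm_hh_le h0 h1 τ μ)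
  have a2 : ‖hh t₀ t₁ τ μ‖ₑ ≤ 6 * (ENNReal.ofReal (jb μ)⁻¹ * (ENNReal.ofReal (jb τ)⁻¹ +
      ENNReal.ofReal (jb (τ - μ))⁻¹)) := by
    rw [← ofReal_norm]
    refine (ENNReal.ofReal_le_ofReal (norm_hh_le_jb h0 h1 τ μ)).trans (le_of_eq ?_)
    have p1 := inv_pos.2 (jb_pos μ)
    have p2 := inv_pos.2 (jb_pos τ)
    have p3 := inv_pos.2 (jb_pos (τ - μ))
    rw [ENNReal.ofReal_mul (by norm_num), ENNReal.ofReal_mul p1.le,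
      ENNReal.ofReal_add p2.le p3.le]
    norm_num
  calc ‖hh t₀ t₁ τ μ‖ₑ = ‖hh t₀ t₁ τ μ‖ₑ ^ θ * ‖hh t₀ t₁ τ μ‖ₑ ^ (1 - θ) := by
        rw [← ENNReal.rpow_add_of_nonneg _ _ hθ hk, add_sub_cancel, ENNReal.rpow_one]
    _ ≤ ENNReal.ofReal (t₁ - t₀) ^ θ * (6 * (ENNReal.ofReal (jb μ)⁻¹ * (ENNReal.ofReal (jb τ)⁻¹ +
          ENNReal.ofReal (jb (τ - μ))⁻¹))) ^ (1 - θ) := by gcongr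
    _ ≤ _ := by
        rw [ENNReal.ofReal_rpow_of_nonneg (by linarith) hθ]
        gcongr
        rw [ENNReal.mul_rpow_of_nonneg _ _ hk, ENNReal.mul_rpow_of_nonneg _ _ hk, hw]
        gcongr
        · calc (6 : ℝ≥0∞) ^ (1 - θ) ≤ 6 ^ (1 : ℝ) :=
                ENNReal.rpow_le_rpow_of_exponent_le (by norm_num) (by linarith)
            _ = 6 := ENNReal.rpow_one _
        · rw [← hw τ, ← hw (τ - μ)]
          exact ENNReal.rpow_add_le_add_rpow _ _ hk (by linarith)

/-- The kernel bound behind the trilinear estimate. -/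
lemma wt_mul_enorm_hh_le {t₀ t₁ θ b : ℝ} (h0 : t₀ ≤ t₁) (h1 : t₁ - t₀ ≤ 1) (hθ : 0 ≤ θ)
    (hθ1 : θ ≤ 1) (hb : 0 ≤ b) (hb1 : b ≤ 1) (τ μ : ℝ) :
    wt b τ * ‖hh t₀ t₁ τ μ‖ₑ ≤ ENNReal.ofReal ((t₁ - t₀) ^ θ) * 12 *
      (wt (b - (1 - θ)) τ * wt (-(1 - θ)) μ + wt (b - (1 - θ)) (τ - μ) * wt (-(1 - θ)) μ +
        wt (-(1 - θ)) (τ - μ) * wt (b - (1 - θ)) μ) := by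
  have hb2 : wt b τ ≤ 2 * (wt b (τ - μ) + wt b μ) := by
    have := wt_add_arg_le hb (τ - μ) μ
    rw [sub_add_cancel] at this
    refine this.trans ?_
    gcongr
    calc ENNReal.ofReal (2 ^ b) ≤ ENNReal.ofReal (2 ^ (1 : ℝ)) :=
          ENNReal.ofReal_le_ofReal (Real.rpow_le_rpow_of_exponent_le (by norm_num) hb1)
      _ = 2 := by norm_num
  set κ := 1 - θ
  set A := ENNReal.ofReal ((t₁ - t₀) ^ θ)
  calc wt b τ * ‖hh t₀ t₁ τ μ‖ₑ
      ≤ wt b τ * (A * (6 * (wt (-κ) μ * (wt (-κ) τ + wt (-κ) (τ - μ))))) := by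
        gcongr
        exact enorm_hh_le h0 h1 hθ hθ1 τ μ
    _ = A * 6 * (wt b τ * wt (-κ) τ * wt (-κ) μ + wt b τ * (wt (-κ) (τ - μ) * wt (-κ) μ)) := by ring
    _ ≤ A * 6 * (2 * (wt b τ * wt (-κ) τ * wt (-κ) μ) +
          2 * (wt b (τ - μ) + wt b μ) * (wt (-κ) (τ - μ) * wt (-κ) μ)) := by
        gcongr A * 6 * (?_ + ?_)
        · exact le_mul_of_one_le_left zero_le (by norm_num)
        · gcongr
    _ = _ := by
        rw [sub_eq_add_neg b κ, wt_add, wt_add, wt_add]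
        ring

/-! ### The trilinear estimates for absolute values -/

/-- The trilinear form with absolute values and with a kernel in the modulation. -/
def triAbs (n : ℤ) (F G H : ℤ → ℝ → ℂ) (k : ℝ → ℝ≥0∞) : ℝ≥0∞ :=
  ∫⁻ x, ‖coef n x.1‖ₑ * (‖F x.1.1 x.2.1‖ₑ * ‖G x.1.2.1 x.2.2.1‖ₑ * ‖H x.1.2.2 x.2.2.2‖ₑ) *
    k (modul x) ∂μ3

lemma measurable_freq_mod {α : Type*} [MeasurableSpace α] {f : ℤ → ℝ → α}
    (hf : ∀ n, Measurable (f n)) : Measurable fun z : ℤ × ℝ => f z.1 z.2 :=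
  measurable_from_prod_countable_right hf

lemma measurable_freq_mod_fst {α : Type*} [MeasurableSpace α] {f : ℤ → ℝ → α}
    (hf : ∀ n, Measurable (f n)) :
    Measurable fun x : (ℤ × ℤ × ℤ) × (ℝ × ℝ × ℝ) => f x.1.1 x.2.1 :=
  (measurable_freq_mod hf).comp
    (by fun_prop : Measurable fun x : (ℤ × ℤ × ℤ) × (ℝ × ℝ × ℝ) => (x.1.1, x.2.1))

lemma measurable_freq_mod_snd {α : Type*} [MeasurableSpace α] {f : ℤ → ℝ → α}
    (hf : ∀ n, Measurable (f n)) :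
    Measurable fun x : (ℤ × ℤ × ℤ) × (ℝ × ℝ × ℝ) => f x.1.2.1 x.2.2.1 :=
  (measurable_freq_mod hf).comp
    (by fun_prop : Measurable fun x : (ℤ × ℤ × ℤ) × (ℝ × ℝ × ℝ) => (x.1.2.1, x.2.2.1))

lemma measurable_freq_mod_trd {α : Type*} [MeasurableSpace α] {f : ℤ → ℝ → α}
    (hf : ∀ n, Measurable (f n)) :
    Measurable fun x : (ℤ × ℤ × ℤ) × (ℝ × ℝ × ℝ) => f x.1.2.2 x.2.2.2 :=
  (measurable_freq_mod hf).comp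
    (by fun_prop : Measurable fun x : (ℤ × ℤ × ℤ) × (ℝ × ℝ × ℝ) => (x.1.2.2, x.2.2.2))

lemma lintegral_μ3_mul {f g h : ℤ → ℝ → ℝ≥0∞} (hf : ∀ n, Measurable (f n))
    (hg : ∀ n, Measurable (g n)) (hh : ∀ n, Measurable (h n)) :
    ∫⁻ x, f x.1.1 x.2.1 * g x.1.2.1 x.2.2.1 * h x.1.2.2 x.2.2.2 ∂μ3 =
      (∑' n, ∫⁻ τ, f n τ) * (∑' n, ∫⁻ τ, g n τ) * (∑' n, ∫⁻ τ, h n τ) := by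
  rw [lintegral_μ3 (f := fun x => f x.1.1 x.2.1 * g x.1.2.1 x.2.2.1 * h x.1.2.2 x.2.2.2)
    (((measurable_freq_mod_fst hf).mul (measurable_freq_mod_snd hg)).mul
    (measurable_freq_mod_trd hh))]
  have h1 : ∀ m : ℤ × ℤ × ℤ, ∫⁻ τ : ℝ × ℝ × ℝ, f m.1 τ.1 * g m.2.1 τ.2.1 * h m.2.2 τ.2.2 =
      (∫⁻ τ, f m.1 τ) * ((∫⁻ τ, g m.2.1 τ) * ∫⁻ τ, h m.2.2 τ) := by
    intro m
    have mf := hf m.1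
    have mg := hg m.2.1
    have mh := hh m.2.2
    simp only [mul_assoc]
    rw [Measure.volume_eq_prod, lintegral_prod_mul (f := f m.1)
      (g := fun z : ℝ × ℝ => g m.2.1 z.1 * h m.2.2 z.2) mf.aemeasurable (by fun_prop),
      Measure.volume_eq_prod, lintegral_prod_mul mg.aemeasurable mh.aemeasurable]
  simp only [h1, ENNReal.tsum_prod', ENNReal.tsum_mul_left, ENNReal.tsum_mul_right]
  ring

lemma measurable_triAbs_integrand {F G H : ℤ → ℝ → ℂ} (hF : ∀ n, Measurable (F n))
    (hG : ∀ n, Measurable (G n)) (hH : ∀ n, Measurable (H n)) (n : ℤ) :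
    Measurable fun x : (ℤ × ℤ × ℤ) × (ℝ × ℝ × ℝ) => ‖coef n x.1‖ₑ *
      (‖F x.1.1 x.2.1‖ₑ * ‖G x.1.2.1 x.2.2.1‖ₑ * ‖H x.1.2.2 x.2.2.2‖ₑ) := by
  have h0 := (measurable_coef n).enorm
  have h1 := (measurable_freq_mod_fst hF).enorm
  have h2 := (measurable_freq_mod_snd hG).enorm
  have h3 := (measurable_freq_mod_trd hH).enorm
  fun_prop

lemma triAbs_mono {n : ℤ} {F G H : ℤ → ℝ → ℂ} {k k' : ℝ → ℝ≥0∞} (h : ∀ μ, k μ ≤ k' μ) :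
    triAbs n F G H k ≤ triAbs n F G H k' := by
  unfold triAbs
  gcongr
  exact h _

lemma triAbs_const_mul {F G H : ℤ → ℝ → ℂ} (hF : ∀ n, Measurable (F n))
    (hG : ∀ n, Measurable (G n)) (hH : ∀ n, Measurable (H n)) (n : ℤ) {k : ℝ → ℝ≥0∞}
    (hk : Measurable k) (c : ℝ≥0∞) :
    triAbs n F G H (fun μ => c * k μ) = c * triAbs n F G H k := by
  unfold triAbs
  have h := measurable_triAbs_integrand hF hG hH n
  have hm := measurable_modul
  rw [← lintegral_const_mul _ (by fun_prop)]
  refine lintegral_congr fun x => ?_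
  ring

lemma triAbs_add {F G H : ℤ → ℝ → ℂ} (hF : ∀ n, Measurable (F n))
    (hG : ∀ n, Measurable (G n)) (hH : ∀ n, Measurable (H n)) (n : ℤ) {k k' : ℝ → ℝ≥0∞}
    (hk : Measurable k) :
    triAbs n F G H (fun μ => k μ + k' μ) = triAbs n F G H k + triAbs n F G H k' := by
  unfold triAbs
  have h := measurable_triAbs_integrand hF hG hH n
  have hm := measurable_modul
  rw [← lintegral_add_left (by fun_prop)]
  refine lintegral_congr fun x => ?_
  ring

theorem measurable_coef_fst_snd :
    Measurable fun z : (ℤ × ℝ) × ((ℤ × ℤ × ℤ) × (ℝ × ℝ × ℝ)) => coef z.1.1 z.2.1 := by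
  have h : Measurable fun w : ℤ × (ℤ × ℤ × ℤ) => coef w.1 w.2 := measurable_of_countable _
  have h' : Measurable fun z : (ℤ × ℝ) × ((ℤ × ℤ × ℤ) × (ℝ × ℝ × ℝ)) => (z.1.1, z.2.1) :=
    (measurable_fst.comp measurable_fst).prodMk (measurable_fst.comp measurable_snd)
  generalize hc : (fun w : ℤ × (ℤ × ℤ × ℤ) => coef w.1 w.2) = c at h
  have : (fun z : (ℤ × ℝ) × ((ℤ × ℤ × ℤ) × (ℝ × ℝ × ℝ)) => coef z.1.1 z.2.1) = fun z => c (z.1.1, z.2.1) := by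
    subst hc; rfl
  rw [this]
  exact h.comp h'

theorem measurable_coef_mul_wt (a : ℝ) :
    Measurable fun z : (ℤ × ℝ) × ((ℤ × ℤ × ℤ) × (ℝ × ℝ × ℝ)) =>
      ‖coef z.1.1 z.2.1‖ₑ * (wt a z.1.1 *
        (wt (-a) z.2.1.1 * wt (-a) z.2.1.2.2 * wt (-a) z.2.1.2.1)) := by
  refine measurable_coef_fst_snd.enorm.mul ?_
  fun_prop

/-- Hölder's inequality for the trilinear form. -/
lemma tsum_lintegral_triAbs_le (e : Exponents) {κ₁ κ₂ : ℝ → ℝ → ℝ≥0∞}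
    (hκ₁ : Measurable (Function.uncurry κ₁)) (hκ₂ : Measurable (Function.uncurry κ₂))
    {C₁ C₂ : ℝ≥0∞} (h₁ : ∀ μ, ∫⁻ τ, κ₁ τ μ ^ e.p ≤ C₁)
    (h₂ : ∀ n τ, kernelSum (e.s * e.q) e.δ n (fun μ => κ₂ τ μ ^ e.q) ≤ C₂)
    {F G H : ℤ → ℝ → ℂ} (hF : ∀ n, Measurable (F n)) (hG : ∀ n, Measurable (G n))
    (hH : ∀ n, Measurable (H n)) :
    ∑' n : ℤ, ∫⁻ τ, (wt e.s n * triAbs n F G H (fun μ => κ₁ τ μ * κ₂ τ μ)) ^ e.p ≤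
      C₂ ^ (e.p / e.q) * C₁ *
        (nX e.s e.β e.p F * nX e.s e.β e.p G * nX e.s e.β e.p H) ^ e.p := by
  have hp := e.p_pos
  have hq := e.q_pos
  set ρ : (ℤ → ℝ → ℂ) → ℤ → ℝ → ℝ≥0∞ := fun F n τ => wt e.s n * wt e.β τ * ‖F n τ‖ₑ with hρ
  have hρm : ∀ {F : ℤ → ℝ → ℂ}, (∀ n, Measurable (F n)) → ∀ n, Measurable (ρ F n) := by
    intro F hF n
    have := hF n
    simp only [hρ]
    fun_prop
  set g : (ℤ × ℤ × ℤ) × (ℝ × ℝ × ℝ) → ℝ≥0∞ := fun x =>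
    ρ F x.1.1 x.2.1 * ρ G x.1.2.1 x.2.2.1 * ρ H x.1.2.2 x.2.2.2 with hg
  have hgm : Measurable g := ((measurable_freq_mod_fst (hρm hF)).mul
    (measurable_freq_mod_snd (hρm hG))).mul (measurable_freq_mod_trd (hρm hH))
  -- The frequency constraint is carried by this factor: for given inputs a single output frequency
  -- contributes, and the integral over y is one-dimensional in τ.
  set K₁ : ℤ × ℝ → (ℤ × ℤ × ℤ) × (ℝ × ℝ × ℝ) → ℝ≥0∞ := fun y x =>
    if x.1.1 - x.1.2.1 + x.1.2.2 = y.1 then κ₁ y.2 (modul x) else 0 with hK₁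
  -- The weights of the inputs are divided out here. In the q-th power the modulation weights become
  -- ⟨τ⟩^{-(1-δ)} because βq = 1 - δ, the coefficient is unchanged as its modulus is 0 or 1, and the
  -- integral is `kernelSum` with l = sq.
  set K₂ : ℤ × ℝ → (ℤ × ℤ × ℤ) × (ℝ × ℝ × ℝ) → ℝ≥0∞ := fun y x =>
    ‖coef y.1 x.1‖ₑ * (wt e.s y.1 *
      (wt (-e.s) x.1.1 * wt (-e.s) x.1.2.2 * wt (-e.s) x.1.2.1)) *
    (wt (-e.β) x.2.1 * wt (-e.β) x.2.2.1 * wt (-e.β) x.2.2.2) * κ₂ y.2 (modul x) with hK₂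
  have hmod := measurable_modul
  have hK₁m : Measurable (Function.uncurry K₁) := by
    have h1 : Measurable fun z : (ℤ × ℝ) × ((ℤ × ℤ × ℤ) × (ℝ × ℝ × ℝ)) => κ₁ z.1.2 (modul z.2) :=
      hκ₁.comp (by fun_prop :
        Measurable fun z : (ℤ × ℝ) × ((ℤ × ℤ × ℤ) × (ℝ × ℝ × ℝ)) => (z.1.2, modul z.2))
    refine Measurable.ite ?_ h1 measurable_const
    exact measurableSet_eq_fun (by fun_prop) (by fun_prop)
  have hK₂m : Measurable (Function.uncurry K₂) := by
    have h1 : Measurable fun z : (ℤ × ℝ) × ((ℤ × ℤ × ℤ) × (ℝ × ℝ × ℝ)) => κ₂ z.1.2 (modul z.2) :=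
      hκ₂.comp (by fun_prop :
        Measurable fun z : (ℤ × ℝ) × ((ℤ × ℤ × ℤ) × (ℝ × ℝ × ℝ)) => (z.1.2, modul z.2))
    refine ((measurable_coef_mul_wt e.s).mul ?_).mul h1
    fun_prop
  have hkey := lintegral_kernel_rpow_le (μ := μ3) (ν := (Measure.count : Measure ℤ).prod volume)
    e.holder hK₁m hK₂m hgm (C₁ := C₁) (C₂ := C₂) ?_ ?_
  · have hrhs : ∫⁻ x, g x ^ e.p ∂μ3 =
        (nX e.s e.β e.p F * nX e.s e.β e.p G * nX e.s e.β e.p H) ^ e.p := by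
      rw [ENNReal.mul_rpow_of_nonneg _ _ hp.le, ENNReal.mul_rpow_of_nonneg _ _ hp.le,
        nX_rpow hp, nX_rpow hp, nX_rpow hp, ← lintegral_μ3_mul
          (fun n => (hρm hF n).pow_const e.p) (fun n => (hρm hG n).pow_const e.p)
          (fun n => (hρm hH n).pow_const e.p)]
      refine lintegral_congr fun x => ?_
      rw [hg, ENNReal.mul_rpow_of_nonneg _ _ hp.le, ENNReal.mul_rpow_of_nonneg _ _ hp.le]
    rw [← hrhs]
    refine le_trans (le_of_eq ?_) hkey
    rw [lintegral_prod, lintegral_count]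
    · refine tsum_congr fun n => lintegral_congr fun τ => ?_
      congr 1
      have hm := measurable_triAbs_integrand hF hG hH n
      have hκ : Measurable fun μ => κ₁ τ μ * κ₂ τ μ :=
        (hκ₁.comp measurable_prodMk_left).mul (hκ₂.comp measurable_prodMk_left)
      rw [triAbs, ← lintegral_const_mul _ (by fun_prop)]
      refine lintegral_congr fun x => ?_
      simp only [hK₁, hK₂, hg, hρ]
      split_ifs with hx
      · have c : ∀ a y, wt a y * wt (-a) y = 1 := wt_mul_wt_neg
        calc _ = ‖coef n x.1‖ₑ * wt e.s n * (‖F x.1.1 x.2.1‖ₑ * ‖G x.1.2.1 x.2.2.1‖ₑ *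
              ‖H x.1.2.2 x.2.2.2‖ₑ) * (κ₁ τ (modul x) * κ₂ τ (modul x)) *
              ((wt e.s x.1.1 * wt (-e.s) x.1.1) * (wt e.s x.1.2.1 * wt (-e.s) x.1.2.1) *
              (wt e.s x.1.2.2 * wt (-e.s) x.1.2.2) * (wt e.β x.2.1 * wt (-e.β) x.2.1) *
              (wt e.β x.2.2.1 * wt (-e.β) x.2.2.1) * (wt e.β x.2.2.2 * wt (-e.β) x.2.2.2)) := by
              simp only [c]; ring
          _ = _ := by ring
      · have : coef n x.1 = 0 := by simp only [coef]; rw [if_neg hx]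
        simp [this]
    · refine ((Measurable.lintegral_prod_right ?_).pow_const e.p).aemeasurable
      exact (hK₁m.mul hK₂m).mul (hgm.comp measurable_snd)
  · intro x
    have hK₁x : Measurable fun y => K₁ y x ^ e.p :=
      (hK₁m.comp measurable_prodMk_right).pow_const e.p
    rw [lintegral_prod _ hK₁x.aemeasurable, lintegral_count,
      tsum_eq_single (x.1.1 - x.1.2.1 + x.1.2.2)]
    · simp only [hK₁, if_true]
      exact h₁ _
    · intro n hn
      simp only [hK₁, if_neg hn.symm, ENNReal.zero_rpow_of_pos hp, lintegral_zero]
  · rintro ⟨n, τ⟩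
    refine le_trans (le_of_eq (lintegral_congr fun x => ?_)) (h₂ n τ)
    simp only [hK₂, ENNReal.mul_rpow_of_nonneg _ _ hq.le, wt_rpow, enorm_coef_rpow hq]
    simp only [neg_mul, e.β_mul_q]

/-- The kernel `kk` is at most 3/⟨μ⟩ at all times in a unit interval, so this bounds the Duhamel
term uniformly in time. It follows from the Hölder estimate with a dummy output modulation in [0,
1], whose indicator function serves as κ₁; the condition on κ₂ is q > 1. -/
lemma exists_triAbs_sup_le (e : Exponents) : ∃ C : ℝ≥0, ∀ F G H : ℤ → ℝ → ℂ,
    (∀ n, Measurable (F n)) → (∀ n, Measurable (G n)) → (∀ n, Measurable (H n)) →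
    (∑' n : ℤ, (wt e.s n * triAbs n F G H (wt (-1))) ^ e.p) ^ (1 / e.p) ≤
      C * (nX e.s e.β e.p F * nX e.s e.β e.p G * nX e.s e.β e.p H) := by
  have hp := e.p_pos
  obtain ⟨C, hC⟩ := exists_kernelSum_wt_le (δ := e.δ) (l := e.s * e.q) (a := e.q) e.δ_pos e.δ_le
    (by have := e.δ_le_s; have := e.δ_pos; rw [Exponents.q]; linarith) e.one_lt_q
  refine ⟨(C ^ (e.p / e.q)) ^ (1 / e.p), fun F G H hF hG hH => ?_⟩
  have h := tsum_lintegral_triAbs_le e (κ₁ := fun τ _ => (Set.Icc (0 : ℝ) 1).indicator 1 τ)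
    (κ₂ := fun _ μ => wt (-1) μ) (C₁ := 1) (C₂ := C)
    (by
      have : Measurable ((Set.Icc (0 : ℝ) 1).indicator (1 : ℝ → ℝ≥0∞)) :=
        measurable_one.indicator measurableSet_Icc
      exact this.comp measurable_fst)
    ((measurable_wt (-1)).comp measurable_snd)
    (fun μ => by
      have : ∀ τ : ℝ, (Set.Icc (0 : ℝ) 1).indicator (1 : ℝ → ℝ≥0∞) τ ^ e.p =
          (Set.Icc (0 : ℝ) 1).indicator 1 τ := by
        intro τ
        by_cases hτ : τ ∈ Set.Icc (0 : ℝ) 1 <;> simp [hτ, hp]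
      simp only [this]
      rw [lintegral_indicator_one measurableSet_Icc]
      simp)
    (fun n τ => by
      refine le_trans (le_of_eq ?_) (hC n)
      congr 1
      funext μ
      rw [wt_rpow, neg_one_mul]) hF hG hH
  have h2 : ∀ n : ℤ, (wt e.s n * triAbs n F G H (wt (-1))) ^ e.p ≤
      ∫⁻ τ, (wt e.s n * triAbs n F G H (fun μ =>
        (Set.Icc (0 : ℝ) 1).indicator 1 τ * wt (-1) μ)) ^ e.p := by
    intro n
    calc _ = ∫⁻ τ in Set.Icc (0 : ℝ) 1, (wt e.s n * triAbs n F G H (wt (-1))) ^ e.p := by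
          simp
      _ = ∫⁻ τ in Set.Icc (0 : ℝ) 1, (wt e.s n * triAbs n F G H (fun μ =>
        (Set.Icc (0 : ℝ) 1).indicator 1 τ * wt (-1) μ)) ^ e.p := by
          refine setLIntegral_congr_fun measurableSet_Icc fun τ hτ => ?_
          simp [hτ]
      _ ≤ _ := setLIntegral_le_lintegral _ _
  have hr : (((C ^ (e.p / e.q)) ^ (1 / e.p) : ℝ≥0) : ℝ≥0∞) =
      ((C : ℝ≥0∞) ^ (e.p / e.q)) ^ (1 / e.p) := by
    rw [ENNReal.coe_rpow_of_nonneg _ (by positivity), ENNReal.coe_rpow_of_nonneg]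
    exact div_nonneg hp.le e.q_pos.le
  calc _ ≤ ((C : ℝ≥0∞) ^ (e.p / e.q) * 1 *
        (nX e.s e.β e.p F * nX e.s e.β e.p G * nX e.s e.β e.p H) ^ e.p) ^ (1 / e.p) := by
        gcongr
        exact (ENNReal.tsum_le_tsum h2).trans h
    _ = _ := by
        rw [mul_one, ENNReal.mul_rpow_of_nonneg _ _ (by positivity), ← ENNReal.rpow_mul _ e.p,
          mul_one_div_cancel hp.ne', ENNReal.rpow_one, hr]

lemma add_three_rpow_le {p : ℝ} (hp : 1 < p) (a b c : ℝ≥0∞) :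
    (a + b + c) ^ p ≤ 2 ^ (p - 1) * 2 ^ (p - 1) * (a ^ p + b ^ p + c ^ p) := by
  have h2 : (1 : ℝ≥0∞) ≤ 2 ^ (p - 1) := ENNReal.one_le_rpow (by norm_num) (by linarith)
  calc (a + b + c) ^ p ≤ 2 ^ (p - 1) * ((a + b) ^ p + c ^ p) :=
        ENNReal.rpow_add_le_mul_rpow_add_rpow _ _ hp.le
    _ ≤ 2 ^ (p - 1) * (2 ^ (p - 1) * (a ^ p + b ^ p) + 2 ^ (p - 1) * c ^ p) := by
        gcongr
        · exact ENNReal.rpow_add_le_mul_rpow_add_rpow _ _ hp.le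
        · exact le_mul_of_one_le_left zero_le h2
    _ = _ := by ring

namespace Exponents

variable (e : Exponents)

lemma θ_lt_one : e.θ < 1 := by
  have h1 := e.θ_mul_q
  have h2 := e.one_lt_q
  have h3 := e.δ_le
  have h4 := e.θ_pos
  nlinarith

lemma b_lt_one : e.b < 1 := by linarith [e.b_lt_b', e.b'_lt, e.inv_q_lt_one]

lemma sub_mul_q_gt : 1 < (1 - e.θ) * e.q := by
  have := e.θ_mul_q
  have := e.δ_le_q
  have := e.δ_pos
  linarith

lemma sub_b_mul_q : (1 - e.θ - e.b) * e.q = e.q - 1 + e.δ / 4 := by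
  have h1 := e.θ_mul_q
  have h2 := e.b_mul_q
  linarith

lemma sub_b_mul_p_gt : 1 < (1 - e.θ - e.b) * e.p := by
  have hp := e.p_pos
  have h : 1 / e.p < 1 - e.θ - e.b := by
    rw [e.inv_p]
    have hq := e.q_pos
    have : e.θ + e.b < 1 / e.q := by
      rw [lt_div_iff₀ hq]
      linarith [e.θ_mul_q, e.b_mul_q, e.δ_pos]
    linarith
  rwa [div_lt_iff₀ hp] at h

/-- The power of the modulation difference that is integrated in the output variable. -/
def κ' : ℝ := 1 - e.θ - (1 - e.δ) / e.q

/-- The decay 1 - θ in τ - μ is split so that the part κ' is integrable with exponent p, while the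
rest, raised to the power q, is exactly ⟨τ - μ⟩^{-(1-δ)}, as `exists_kernelSum_two_le` requires.
There is room for both since θq = δ/4 < δ. -/
lemma κ'_mul_p_gt : 1 < e.κ' * e.p := by
  have hp := e.p_pos
  have h : 1 / e.p < e.κ' := by
    rw [e.inv_p, κ']
    have hq := e.q_pos
    have : e.θ + (1 - e.δ) / e.q < 1 / e.q := by
      rw [lt_div_iff₀ hq, add_mul, div_mul_cancel₀ _ hq.ne']
      linarith [e.θ_mul_q, e.δ_pos]
    linarith
  rwa [div_lt_iff₀ hp] at h

lemma sub_κ'_mul_q : (1 - e.θ - e.κ') * e.q = 1 - e.δ := by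
  have := e.q_pos.ne'
  rw [κ']
  field_simp
  ring

end Exponents

/-- The trilinear estimate for the kernel of the Duhamel operator. -/
lemma exists_triAbs_hh_le (e : Exponents) : ∃ C : ℝ≥0, ∀ (t₀ t₁ : ℝ) (F G H : ℤ → ℝ → ℂ),
    t₀ ≤ t₁ → t₁ - t₀ ≤ 1 →
    (∀ n, Measurable (F n)) → (∀ n, Measurable (G n)) → (∀ n, Measurable (H n)) →
    (∑' n : ℤ, ∫⁻ τ, (wt e.s n * wt e.b τ *
        triAbs n F G H (fun μ => ‖hh t₀ t₁ τ μ‖ₑ)) ^ e.p) ^ (1 / e.p) ≤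
      C * ENNReal.ofReal ((t₁ - t₀) ^ e.θ) *
        (nX e.s e.β e.p F * nX e.s e.β e.p G * nX e.s e.β e.p H) := by
  have hp := e.p_pos
  have hq := e.q_pos
  have hpq : 0 ≤ e.p / e.q := div_nonneg hp.le hq.le
  set κ := 1 - e.θ with hκ
  have hl : 6 * e.δ ≤ e.s * e.q := by
    have := e.δ_le_s; have := e.δ_pos; rw [Exponents.q]; linarith
  obtain ⟨C₁, hC₁⟩ := exists_kernelSum_wt_le (δ := e.δ) (l := e.s * e.q) (a := κ * e.q) e.δ_pos
    e.δ_le hl e.sub_mul_q_gt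
  obtain ⟨C₂, hC₂⟩ := exists_kernelSum_two_le (δ := e.δ) (l := e.s * e.q)
    (ν := (κ - e.b) * e.q) e.δ_pos e.δ_le hl (by
      rw [e.sub_b_mul_q]; linarith [e.δ_le_q, e.δ_pos])
  set J₁ := ∫⁻ x, wt (-((κ - e.b) * e.p)) x with hJ₁
  have hJ₁t : J₁ < ∞ := lintegral_wt_lt_top (by linarith [e.sub_b_mul_p_gt])
  set J₂ := ∫⁻ x, wt (-(e.κ' * e.p)) x with hJ₂
  have hJ₂t : J₂ < ∞ := lintegral_wt_lt_top (by linarith [e.κ'_mul_p_gt])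
  set D : ℝ≥0∞ := 2 ^ (e.p - 1) * 2 ^ (e.p - 1) * ((C₁ : ℝ≥0∞) ^ (e.p / e.q) * J₁ +
    (C₁ : ℝ≥0∞) ^ (e.p / e.q) * J₁ + (C₂ : ℝ≥0∞) ^ (e.p / e.q) * J₂) with hD
  have hDt : D ≠ ∞ := by
    have h2 : (2 : ℝ≥0∞) ^ (e.p - 1) ≠ ∞ :=
      ENNReal.rpow_ne_top_of_nonneg (by linarith [e.one_lt_p]) (by norm_num)
    have h3 : ∀ C : ℝ≥0, (C : ℝ≥0∞) ^ (e.p / e.q) ≠ ∞ := fun C =>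
      ENNReal.rpow_ne_top_of_nonneg hpq (by simp)
    refine ENNReal.mul_ne_top (ENNReal.mul_ne_top h2 h2) (ENNReal.add_ne_top.2
      ⟨ENNReal.add_ne_top.2 ⟨?_, ?_⟩, ?_⟩)
    · exact ENNReal.mul_ne_top (h3 _) hJ₁t.ne
    · exact ENNReal.mul_ne_top (h3 _) hJ₁t.ne
    · exact ENNReal.mul_ne_top (h3 _) hJ₂t.ne
  have hDt' : 12 * D ^ (1 / e.p) ≠ ∞ :=
    ENNReal.mul_ne_top (by norm_num) (ENNReal.rpow_ne_top_of_nonneg (by positivity) hDt)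
  refine ⟨(12 * D ^ (1 / e.p)).toNNReal, fun t₀ t₁ F G H h0 h1 hF hG hH => ?_⟩
  rw [ENNReal.coe_toNNReal hDt']
  set A := ENNReal.ofReal ((t₁ - t₀) ^ e.θ) with hA
  set N := nX e.s e.β e.p F * nX e.s e.β e.p G * nX e.s e.β e.p H with hN
  -- One term for each product in `wt_mul_enorm_hh_le`. In the first two the factor with b - κ is
  -- p-integrable in τ, and ⟨μ⟩^{-κ} is handled by `exists_kernelSum_wt_le`. In the third the weight
  -- b has fallen on μ, where little decay is left, and ⟨τ - μ⟩^{-κ} must be shared between the two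
  -- exponents; this is the term that needs the divisor bound.
  set T₁ : ℤ → ℝ → ℝ≥0∞ := fun n τ => wt e.s n * triAbs n F G H
    (fun μ => wt (e.b - κ) τ * wt (-κ) μ) with hT₁
  set T₂ : ℤ → ℝ → ℝ≥0∞ := fun n τ => wt e.s n * triAbs n F G H
    (fun μ => wt (e.b - κ) (τ - μ) * wt (-κ) μ) with hT₂
  set T₃ : ℤ → ℝ → ℝ≥0∞ := fun n τ => wt e.s n * triAbs n F G H
    (fun μ => wt (-e.κ') (τ - μ) * (wt (e.b - κ) μ * wt (-(κ - e.κ')) (τ - μ))) with hT₃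
  have eb : ∀ x, wt (e.b - κ) x ^ e.p = wt (-((κ - e.b) * e.p)) x := by
    intro x; rw [wt_rpow]; congr 1; ring
  have b₁ : ∑' n, ∫⁻ τ, T₁ n τ ^ e.p ≤ (C₁ : ℝ≥0∞) ^ (e.p / e.q) * J₁ * N ^ e.p := by
    refine tsum_lintegral_triAbs_le e (κ₁ := fun τ _ => wt (e.b - κ) τ)
      (κ₂ := fun _ μ => wt (-κ) μ) ((measurable_wt _).comp measurable_fst)
      ((measurable_wt _).comp measurable_snd) (fun μ => ?_) (fun n τ => ?_) hF hG hH
    · simp only [eb]; exact le_rfl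
    · refine le_trans (le_of_eq ?_) (hC₁ n)
      congr 1
      funext μ
      rw [wt_rpow, neg_mul]
  have b₂ : ∑' n, ∫⁻ τ, T₂ n τ ^ e.p ≤ (C₁ : ℝ≥0∞) ^ (e.p / e.q) * J₁ * N ^ e.p := by
    refine tsum_lintegral_triAbs_le e (κ₁ := fun τ μ => wt (e.b - κ) (τ - μ))
      (κ₂ := fun _ μ => wt (-κ) μ) ((measurable_wt _).comp (measurable_fst.sub measurable_snd))
      ((measurable_wt _).comp measurable_snd) (fun μ => ?_) (fun n τ => ?_) hF hG hH
    · simp only [eb]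
      rw [lintegral_sub_right_eq_self (fun x => wt (-((κ - e.b) * e.p)) x)]
    · refine le_trans (le_of_eq ?_) (hC₁ n)
      congr 1
      funext μ
      rw [wt_rpow, neg_mul]
  have b₃ : ∑' n, ∫⁻ τ, T₃ n τ ^ e.p ≤ (C₂ : ℝ≥0∞) ^ (e.p / e.q) * J₂ * N ^ e.p := by
    refine tsum_lintegral_triAbs_le e (κ₁ := fun τ μ => wt (-e.κ') (τ - μ))
      (κ₂ := fun τ μ => wt (e.b - κ) μ * wt (-(κ - e.κ')) (τ - μ))
      ((measurable_wt _).comp (measurable_fst.sub measurable_snd))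
      (((measurable_wt _).comp measurable_snd).mul
        ((measurable_wt _).comp (measurable_fst.sub measurable_snd))) (fun μ => ?_)
        (fun n τ => ?_) hF hG hH
    · simp only [wt_rpow, neg_mul]
      rw [lintegral_sub_right_eq_self (fun x => wt (-(e.κ' * e.p)) x)]
    · refine le_trans (le_of_eq ?_) (hC₂ n τ)
      congr 1
      funext μ
      rw [ENNReal.mul_rpow_of_nonneg _ _ hq.le, wt_rpow, wt_rpow]
      congr 2
      · ring
      · rw [neg_mul, e.sub_κ'_mul_q]
  have hpt : ∀ (n : ℤ) (τ : ℝ), wt e.s n * wt e.b τ * triAbs n F G H (fun μ => ‖hh t₀ t₁ τ μ‖ₑ) ≤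
      A * 12 * (T₁ n τ + T₂ n τ + T₃ n τ) := by
    intro n τ
    have hm : Measurable fun μ => ‖hh t₀ t₁ τ μ‖ₑ := by
      have : Continuous fun μ => hh t₀ t₁ τ μ :=
        (continuous_hh t₀ t₁).comp (by fun_prop : Continuous fun μ : ℝ => (τ, μ))
      exact this.measurable.enorm
    have k3 : ∀ μ, wt (-κ) (τ - μ) * wt (e.b - κ) μ =
        wt (-e.κ') (τ - μ) * (wt (e.b - κ) μ * wt (-(κ - e.κ')) (τ - μ)) := by
      intro μ
      rw [show -κ = -e.κ' + -(κ - e.κ') by ring, wt_add]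
      ring
    calc wt e.s n * wt e.b τ * triAbs n F G H (fun μ => ‖hh t₀ t₁ τ μ‖ₑ)
        = wt e.s n * triAbs n F G H (fun μ => wt e.b τ * ‖hh t₀ t₁ τ μ‖ₑ) := by
          rw [triAbs_const_mul hF hG hH n hm, mul_assoc]
      _ ≤ wt e.s n * triAbs n F G H (fun μ => (A * 12) * (wt (e.b - κ) τ * wt (-κ) μ +
            wt (e.b - κ) (τ - μ) * wt (-κ) μ +
            wt (-e.κ') (τ - μ) * (wt (e.b - κ) μ * wt (-(κ - e.κ')) (τ - μ)))) := by
          gcongr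
          refine triAbs_mono fun μ => ?_
          rw [← k3]
          exact wt_mul_enorm_hh_le h0 h1 e.θ_pos.le e.θ_lt_one.le e.b_pos.le e.b_lt_one.le τ μ
      _ = _ := by
          rw [triAbs_const_mul hF hG hH n (by fun_prop), triAbs_add hF hG hH n (by fun_prop),
            triAbs_add hF hG hH n (by fun_prop)]
          simp only [hT₁, hT₂, hT₃]
          ring
  have hTm : ∀ κ₀ : ℝ → ℝ → ℝ≥0∞, Measurable (Function.uncurry κ₀) → ∀ n : ℤ,
      Measurable fun τ => (wt e.s n * triAbs n F G H (κ₀ τ)) ^ e.p := by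
    intro κ₀ hκ₀ n
    refine (measurable_const.mul ?_).pow_const e.p
    unfold triAbs
    refine Measurable.lintegral_prod_right ?_
    have h1 := (measurable_triAbs_integrand hF hG hH n).comp
      (measurable_snd : Measurable (Prod.snd : ℝ × ((ℤ × ℤ × ℤ) × (ℝ × ℝ × ℝ)) → _))
    have h2 : Measurable fun a : ℝ × ((ℤ × ℤ × ℤ) × (ℝ × ℝ × ℝ)) => κ₀ a.1 (modul a.2) :=
      hκ₀.comp (measurable_fst.prodMk (measurable_modul.comp measurable_snd))
    exact h1.mul h2
  have m₁ : ∀ n, Measurable fun τ => T₁ n τ ^ e.p := hTm _ (by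
    exact ((measurable_wt _).comp measurable_fst).mul ((measurable_wt _).comp measurable_snd))
  have m₂ : ∀ n, Measurable fun τ => T₂ n τ ^ e.p := hTm _ (by
    exact ((measurable_wt _).comp (measurable_fst.sub measurable_snd)).mul
      ((measurable_wt _).comp measurable_snd))
  have hp2 : (2 : ℝ≥0∞) ^ (e.p - 1) ≠ ∞ :=
      ENNReal.rpow_ne_top_of_nonneg (by linarith [e.one_lt_p]) (by norm_num)
  calc _ ≤ (∑' n : ℤ, ∫⁻ τ, (A * 12) ^ e.p * (2 ^ (e.p - 1) * 2 ^ (e.p - 1) *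
        (T₁ n τ ^ e.p + T₂ n τ ^ e.p + T₃ n τ ^ e.p))) ^ (1 / e.p) := by
        gcongr with n τ
        calc _ ≤ (A * 12 * (T₁ n τ + T₂ n τ + T₃ n τ)) ^ e.p :=
            ENNReal.rpow_le_rpow (hpt n τ) hp.le
          _ = (A * 12) ^ e.p * (T₁ n τ + T₂ n τ + T₃ n τ) ^ e.p :=
              ENNReal.mul_rpow_of_nonneg _ _ hp.le
          _ ≤ _ := by gcongr; exact add_three_rpow_le e.one_lt_p _ _ _
    _ = ((A * 12) ^ e.p * (2 ^ (e.p - 1) * 2 ^ (e.p - 1) *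
        ((∑' n : ℤ, ∫⁻ τ, T₁ n τ ^ e.p) + (∑' n : ℤ, ∫⁻ τ, T₂ n τ ^ e.p) +
          (∑' n : ℤ, ∫⁻ τ, T₃ n τ ^ e.p)))) ^ (1 / e.p) := by
        congr 1
        rw [← ENNReal.tsum_add, ← ENNReal.tsum_add, ← ENNReal.tsum_mul_left,
          ← ENNReal.tsum_mul_left]
        refine tsum_congr fun n => ?_
        rw [lintegral_const_mul' _ _ (ENNReal.rpow_ne_top_of_nonneg hp.le
            (ENNReal.mul_ne_top (by simp [hA]) (by norm_num))),
          lintegral_const_mul' _ _ (ENNReal.mul_ne_top hp2 hp2),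
          lintegral_add_left (f := fun τ => T₁ n τ ^ e.p + T₂ n τ ^ e.p) ((m₁ n).add (m₂ n)),
          lintegral_add_left (m₁ n)]
    _ ≤ ((A * 12) ^ e.p * (2 ^ (e.p - 1) * 2 ^ (e.p - 1) *
        ((C₁ : ℝ≥0∞) ^ (e.p / e.q) * J₁ * N ^ e.p + (C₁ : ℝ≥0∞) ^ (e.p / e.q) * J₁ * N ^ e.p +
          (C₂ : ℝ≥0∞) ^ (e.p / e.q) * J₂ * N ^ e.p))) ^ (1 / e.p) :=
        ENNReal.rpow_le_rpow (mul_le_mul' le_rfl (mul_le_mul' le_rfl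
          (add_le_add (add_le_add b₁ b₂) b₃))) (by have := e.p_pos; positivity)
    _ = ((A * 12) ^ e.p * (D * N ^ e.p)) ^ (1 / e.p) := by
        congr 2
        rw [hD]; ring
    _ = _ := by
        have hp' : 0 ≤ 1 / e.p := by positivity
        have hc : ∀ x : ℝ≥0∞, (x ^ e.p) ^ (1 / e.p) = x := fun x => by
          rw [← ENNReal.rpow_mul, mul_one_div_cancel hp.ne', ENNReal.rpow_one]
        rw [ENNReal.mul_rpow_of_nonneg _ _ hp', ENNReal.mul_rpow_of_nonneg _ _ hp', hc, hc]
        ring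

/-! ### The trilinear form with a complex kernel -/

/-- The integrand of the trilinear form. -/
def triFun (n : ℤ) (F G H : ℤ → ℝ → ℂ) (k : ℝ → ℂ) (x : (ℤ × ℤ × ℤ) × (ℝ × ℝ × ℝ)) : ℂ :=
  coef n x.1 * (F x.1.1 x.2.1 * starRingEnd ℂ (G x.1.2.1 x.2.2.1) * H x.1.2.2 x.2.2.2) *
    k (modul x)

/-- The trilinear form whose kernel is a function of the modulation of the product. -/
def triForm (n : ℤ) (F G H : ℤ → ℝ → ℂ) (k : ℝ → ℂ) : ℂ := ∫ x, triFun n F G H k x ∂μ3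

lemma enorm_triFun (n : ℤ) (F G H : ℤ → ℝ → ℂ) (k : ℝ → ℂ) (x : (ℤ × ℤ × ℤ) × (ℝ × ℝ × ℝ)) :
    ‖triFun n F G H k x‖ₑ = ‖coef n x.1‖ₑ *
      (‖F x.1.1 x.2.1‖ₑ * ‖G x.1.2.1 x.2.2.1‖ₑ * ‖H x.1.2.2 x.2.2.2‖ₑ) * ‖k (modul x)‖ₑ := by
  have : ∀ z : ℂ, ‖starRingEnd ℂ z‖ₑ = ‖z‖ₑ := fun z => by
    rw [← ofReal_norm, ← ofReal_norm, RCLike.norm_conj]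
  simp only [triFun, enorm_mul, this]

lemma measurable_triFun {F G H : ℤ → ℝ → ℂ} (hF : ∀ n, Measurable (F n))
    (hG : ∀ n, Measurable (G n)) (hH : ∀ n, Measurable (H n)) (n : ℤ) {k : ℝ → ℂ}
    (hk : Measurable k) : Measurable (triFun n F G H k) := by
  have h1 := measurable_coef n
  have h2 := measurable_freq_mod_fst hF
  have h3 : Measurable fun x : (ℤ × ℤ × ℤ) × (ℝ × ℝ × ℝ) => starRingEnd ℂ (G x.1.2.1 x.2.2.1) :=
    continuous_conj.measurable.comp (measurable_freq_mod_snd hG)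
  have h4 := measurable_freq_mod_trd hH
  exact (h1.mul ((h2.mul h3).mul h4)).mul (hk.comp measurable_modul)

lemma lintegral_enorm_triFun (n : ℤ) (F G H : ℤ → ℝ → ℂ) (k : ℝ → ℂ) :
    ∫⁻ x, ‖triFun n F G H k x‖ₑ ∂μ3 = triAbs n F G H (fun μ => ‖k μ‖ₑ) :=
  lintegral_congr fun x => enorm_triFun n F G H k x

lemma enorm_triForm_le (n : ℤ) (F G H : ℤ → ℝ → ℂ) (k : ℝ → ℂ) :
    ‖triForm n F G H k‖ₑ ≤ triAbs n F G H (fun μ => ‖k μ‖ₑ) :=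
  (enorm_integral_le_lintegral_enorm _).trans (lintegral_enorm_triFun n F G H k).le

lemma integrable_triFun {F G H : ℤ → ℝ → ℂ} (hF : ∀ n, Measurable (F n))
    (hG : ∀ n, Measurable (G n)) (hH : ∀ n, Measurable (H n)) {n : ℤ} {k : ℝ → ℂ}
    (hk : Measurable k) (h : triAbs n F G H (fun μ => ‖k μ‖ₑ) < ∞) :
    Integrable (triFun n F G H k) μ3 :=
  ⟨(measurable_triFun hF hG hH n hk).aestronglyMeasurable, by
    rw [HasFiniteIntegral, lintegral_enorm_triFun]; exact h⟩

lemma triForm_sub_fst {F F' G H : ℤ → ℝ → ℂ} {n : ℤ} {k : ℝ → ℂ}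
    (h : Integrable (triFun n F G H k) μ3) (h' : Integrable (triFun n F' G H k) μ3) :
    triForm n F G H k - triForm n F' G H k = triForm n (F - F') G H k := by
  rw [triForm, triForm, triForm, ← integral_sub h h']
  refine integral_congr_ae (.of_forall fun x => ?_)
  simp only [triFun, Pi.sub_apply]
  ring

lemma triForm_sub_snd {F G G' H : ℤ → ℝ → ℂ} {n : ℤ} {k : ℝ → ℂ}
    (h : Integrable (triFun n F G H k) μ3) (h' : Integrable (triFun n F G' H k) μ3) :
    triForm n F G H k - triForm n F G' H k = triForm n F (G - G') H k := by
  rw [triForm, triForm, triForm, ← integral_sub h h']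
  refine integral_congr_ae (.of_forall fun x => ?_)
  simp only [triFun, Pi.sub_apply, map_sub]
  ring

lemma triForm_sub_trd {F G H H' : ℤ → ℝ → ℂ} {n : ℤ} {k : ℝ → ℂ}
    (h : Integrable (triFun n F G H k) μ3) (h' : Integrable (triFun n F G H' k) μ3) :
    triForm n F G H k - triForm n F G H' k = triForm n F G (H - H') k := by
  rw [triForm, triForm, triForm, ← integral_sub h h']
  refine integral_congr_ae (.of_forall fun x => ?_)
  simp only [triFun, Pi.sub_apply]
  ring

/-! ### The norm as an `L^p` norm -/

/-- The measure on frequencies and modulations. -/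
def μ1 : Measure (ℤ × ℝ) := Measure.count.prod volume

/-- The weighted function whose `L^p` norm is `nX`. -/
def weighted (s b : ℝ) (F : ℤ → ℝ → ℂ) (y : ℤ × ℝ) : ℂ :=
  ((jb y.1 ^ s * jb y.2 ^ b : ℝ) : ℂ) * F y.1 y.2

lemma enorm_weighted (s b : ℝ) (F : ℤ → ℝ → ℂ) (y : ℤ × ℝ) :
    ‖weighted s b F y‖ₑ = wt s y.1 * wt b y.2 * ‖F y.1 y.2‖ₑ := by
  have h1 : 0 ≤ jb y.1 ^ s := Real.rpow_nonneg (jb_pos _).le _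
  have h2 : 0 ≤ jb y.2 ^ b := Real.rpow_nonneg (jb_pos _).le _
  rw [weighted, enorm_mul, ← ofReal_norm, Complex.norm_real, Real.norm_eq_abs,
    abs_of_nonneg (by positivity), ENNReal.ofReal_mul h1]
  rfl

lemma measurable_weight (s b : ℝ) :
    Measurable fun y : ℤ × ℝ => ((jb y.1 ^ s * jb y.2 ^ b : ℝ) : ℂ) := by
  have hj : Measurable jb := continuous_jb.measurable
  have h1 : Measurable fun y : ℤ × ℝ => jb y.1 ^ s :=
    (measurable_of_countable fun n : ℤ => jb n ^ s).comp measurable_fst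
  have h2 : Measurable fun y : ℤ × ℝ => jb y.2 ^ b := (hj.comp measurable_snd).pow_const b
  exact Complex.measurable_ofReal.comp (h1.mul h2)

lemma measurable_weighted {F : ℤ → ℝ → ℂ} (hF : ∀ n, Measurable (F n)) (s b : ℝ) :
    Measurable (weighted s b F) :=
  (measurable_weight s b).mul (measurable_from_prod_countable_right hF)

/-- This gives access to Minkowski's inequality, to completeness for the fixed point, and to Fatou's
lemma for the existence time. -/
lemma nX_eq_eLpNorm {F : ℤ → ℝ → ℂ} (hF : ∀ n, Measurable (F n)) (s b : ℝ) {p : ℝ} (hp : 0 < p) :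
    nX s b p F = eLpNorm (weighted s b F) (ENNReal.ofReal p) μ1 := by
  rw [eLpNorm_eq_lintegral_rpow_enorm_toReal (by simpa using hp) (by simp),
    ENNReal.toReal_ofReal hp.le, nX, μ1,
    lintegral_prod _ ((measurable_weighted hF s b).enorm.pow_const p).aemeasurable, lintegral_count]
  simp only [enorm_weighted]

lemma weighted_add (s b : ℝ) (F G : ℤ → ℝ → ℂ) :
    weighted s b (F + G) = weighted s b F + weighted s b G := by
  funext y
  simp only [weighted, Pi.add_apply, mul_add]

lemma weighted_sub (s b : ℝ) (F G : ℤ → ℝ → ℂ) :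
    weighted s b (F - G) = weighted s b F - weighted s b G := by
  funext y
  simp only [weighted, Pi.sub_apply, mul_sub]

lemma nX_add_le {F G : ℤ → ℝ → ℂ} (hF : ∀ n, Measurable (F n)) (hG : ∀ n, Measurable (G n))
    (s b : ℝ) {p : ℝ} (hp : 1 ≤ p) : nX s b p (F + G) ≤ nX s b p F + nX s b p G := by
  have h0 : 0 < p := by linarith
  rw [nX_eq_eLpNorm (F := F + G) (fun n => (hF n).add (hG n)) s b h0, nX_eq_eLpNorm hF s b h0,
    nX_eq_eLpNorm hG s b h0, weighted_add]
  exact eLpNorm_add_le (measurable_weighted hF s b).aestronglyMeasurable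
    (measurable_weighted hG s b).aestronglyMeasurable (by simpa using hp)

lemma nX_congr_enorm {F G : ℤ → ℝ → ℂ} (s b p : ℝ) (h : ∀ (n : ℤ) (τ : ℝ), ‖F n τ‖ₑ = ‖G n τ‖ₑ) :
    nX s b p F = nX s b p G := by
  simp only [nX, h]

lemma nX_mono {F G : ℤ → ℝ → ℂ} {s b b' p : ℝ} (hp : 0 < p) (hb : b ≤ b')
    (h : ∀ n τ, ‖F n τ‖ₑ ≤ ‖G n τ‖ₑ) : nX s b p F ≤ nX s b' p G := by
  refine ENNReal.rpow_le_rpow (ENNReal.tsum_le_tsum fun n => lintegral_mono fun τ => ?_)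
    (by positivity)
  exact ENNReal.rpow_le_rpow (mul_le_mul' (mul_le_mul' le_rfl (wt_le_wt hb _)) (h n τ)) hp.le

lemma nX_neg (F : ℤ → ℝ → ℂ) (s b p : ℝ) : nX s b p (-F) = nX s b p F :=
  nX_congr_enorm s b p fun n τ => by simp

lemma nX_sub_le {F G : ℤ → ℝ → ℂ} (hF : ∀ n, Measurable (F n)) (hG : ∀ n, Measurable (G n))
    (s b : ℝ) {p : ℝ} (hp : 1 ≤ p) : nX s b p (F - G) ≤ nX s b p F + nX s b p G := by
  rw [sub_eq_add_neg, ← nX_neg G]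
  exact nX_add_le hF (fun n => (hG n).neg) s b hp

lemma nX_const_mul {F : ℤ → ℝ → ℂ} (c : ℂ) {s b p : ℝ} (hp : 0 < p) :
    nX s b p (fun n τ => c * F n τ) = ‖c‖ₑ * nX s b p F := by
  have h1 : ∀ (n : ℤ) (τ : ℝ), (wt s n * wt b τ * ‖c * F n τ‖ₑ) ^ p =
      ‖c‖ₑ ^ p * (wt s n * wt b τ * ‖F n τ‖ₑ) ^ p := by
    intro n τ
    rw [← ENNReal.mul_rpow_of_nonneg _ _ hp.le, enorm_mul]
    ring_nf
  simp only [nX, h1]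
  have h2 : ‖c‖ₑ ^ p ≠ ∞ := ENNReal.rpow_ne_top_of_nonneg hp.le enorm_ne_top
  simp only [lintegral_const_mul' _ _ h2, ENNReal.tsum_mul_left]
  rw [ENNReal.mul_rpow_of_nonneg _ _ (by positivity), ← ENNReal.rpow_mul,
    mul_one_div_cancel hp.ne', ENNReal.rpow_one]

/-! ### Fourier transforms on intervals and the Duhamel operator -/

/-- The Fourier transform of `g` restricted to `[t₀, t₁]`. -/
def cutFT (t₀ t₁ : ℝ) (g : ℝ → ℂ) (τ : ℝ) : ℂ := ∫ r in t₀..t₁, cexp (-(I * r * τ)) * g r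

/-- The Duhamel term of the nonlinearity in the interaction picture, in terms of the Fourier
transforms in time of the three factors. -/
def duh (t₀ t : ℝ) (n : ℤ) (F G H : ℤ → ℝ → ℂ) : ℂ :=
  (2 * Real.pi : ℂ)⁻¹ ^ 3 * triForm n F G H (kk t₀ t)

lemma norm_two_pi_inv_le : ‖((2 * Real.pi : ℂ)⁻¹ ^ 3)‖ₑ ≤ 1 := by
  rw [← ofReal_norm, ENNReal.ofReal_le_one, norm_pow, norm_inv]
  have : ‖(2 * Real.pi : ℂ)‖ = 2 * Real.pi := by
    rw [norm_mul, Complex.norm_real, Real.norm_eq_abs, abs_of_pos Real.pi_pos]; simp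
  rw [this]
  refine pow_le_one₀ (by positivity) (inv_le_one_of_one_le₀ ?_)
  linarith [Real.pi_gt_three]

lemma enorm_kk_le {t₀ t : ℝ} (h : |t - t₀| ≤ 1) (μ : ℝ) : ‖kk t₀ t μ‖ₑ ≤ 3 * wt (-1) μ := by
  have h1 := jb_mul_norm_kk_le h μ
  have h2 : ‖kk t₀ t μ‖ ≤ 3 * jb μ ^ (-1 : ℝ) := by
    rw [Real.rpow_neg_one, ← div_eq_mul_inv, le_div_iff₀ (jb_pos μ)]
    linarith
  rw [← ofReal_norm, wt, show (3 : ℝ≥0∞) = ENNReal.ofReal 3 by simp,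
    ← ENNReal.ofReal_mul (by norm_num)]
  exact ENNReal.ofReal_le_ofReal h2

lemma continuous_kk_mod (t₀ t : ℝ) : Continuous (kk t₀ t) :=
  continuous_kk.comp (by fun_prop : Continuous fun μ : ℝ => (t₀, t, μ))

lemma triAbs_kk_le {F G H : ℤ → ℝ → ℂ} (hF : ∀ n, Measurable (F n)) (hG : ∀ n, Measurable (G n))
    (hH : ∀ n, Measurable (H n)) {t₀ t : ℝ} (h : |t - t₀| ≤ 1) (n : ℤ) :
    triAbs n F G H (fun μ => ‖kk t₀ t μ‖ₑ) ≤ 3 * triAbs n F G H (wt (-1)) := by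
  refine (triAbs_mono fun μ => enorm_kk_le h μ).trans (le_of_eq ?_)
  exact triAbs_const_mul hF hG hH n (measurable_wt _) 3

lemma enorm_duh_le {F G H : ℤ → ℝ → ℂ} (hF : ∀ n, Measurable (F n)) (hG : ∀ n, Measurable (G n))
    (hH : ∀ n, Measurable (H n)) {t₀ t : ℝ} (h : |t - t₀| ≤ 1) (n : ℤ) :
    ‖duh t₀ t n F G H‖ₑ ≤ 3 * triAbs n F G H (wt (-1)) := by
  rw [duh, enorm_mul]
  calc _ ≤ 1 * ‖triForm n F G H (kk t₀ t)‖ₑ := mul_le_mul' norm_two_pi_inv_le le_rfl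
    _ ≤ _ := by
      rw [one_mul]
      exact (enorm_triForm_le n F G H _).trans (triAbs_kk_le hF hG hH h n)

lemma triAbs_lt_top (e : Exponents) {F G H : ℤ → ℝ → ℂ} (hF : ∀ n, Measurable (F n))
    (hG : ∀ n, Measurable (G n)) (hH : ∀ n, Measurable (H n)) (nF : nX e.s e.β e.p F < ∞)
    (nG : nX e.s e.β e.p G < ∞) (nH : nX e.s e.β e.p H < ∞) (n : ℤ) :
    triAbs n F G H (wt (-1)) < ∞ := by
  obtain ⟨C, hC⟩ := exists_triAbs_sup_le e
  have h1 := (hC F G H hF hG hH).trans_lt (ENNReal.mul_lt_top ENNReal.coe_lt_top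
    (ENNReal.mul_lt_top (ENNReal.mul_lt_top nF nG) nH))
  have hp := e.p_pos
  rw [ENNReal.rpow_lt_top_iff_of_pos (by positivity)] at h1
  have h2 := (ENNReal.le_tsum n).trans_lt h1
  rw [ENNReal.rpow_lt_top_iff_of_pos hp] at h2
  exact lt_of_le_of_ne le_top fun h => by simp [h, ENNReal.mul_top (wt_ne_zero _ _)] at h2

lemma integrable_triFun_kk {F G H : ℤ → ℝ → ℂ} (hF : ∀ n, Measurable (F n))
    (hG : ∀ n, Measurable (G n)) (hH : ∀ n, Measurable (H n)) {n : ℤ}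
    (hT : triAbs n F G H (wt (-1)) < ∞) {t₀ t : ℝ} (h : |t - t₀| ≤ 1) :
    Integrable (triFun n F G H (kk t₀ t)) μ3 :=
  integrable_triFun hF hG hH (continuous_kk_mod t₀ t).measurable
    ((triAbs_kk_le hF hG hH h n).trans_lt (ENNReal.mul_lt_top (by norm_num) hT))

/-- Dominated convergence with the majorant 3/⟨μ⟩ of `kk`, which does not depend on t. Continuity of
the Duhamel term thus needs no inversion of its Fourier transform. -/
lemma continuousOn_duh {F G H : ℤ → ℝ → ℂ} (hF : ∀ n, Measurable (F n))
    (hG : ∀ n, Measurable (G n)) (hH : ∀ n, Measurable (H n)) {n : ℤ}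
    (hT : triAbs n F G H (wt (-1)) < ∞) {t₀ t₁ : ℝ} (h1 : t₁ - t₀ ≤ 1) :
    ContinuousOn (fun t => duh t₀ t n F G H) (Set.Icc t₀ t₁) := by
  refine ContinuousOn.mul continuousOn_const ?_
  have hb : Integrable (triFun n F G H (fun μ => ((3 * jb μ ^ (-1 : ℝ) : ℝ) : ℂ))) μ3 := by
    have hj : Measurable jb := continuous_jb.measurable
    refine integrable_triFun hF hG hH
      (Complex.measurable_ofReal.comp ((hj.pow_const (-1)).const_mul 3)) ?_
    refine lt_of_le_of_lt ?_ (ENNReal.mul_lt_top (by norm_num : (3 : ℝ≥0∞) < ∞) hT)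
    rw [← triAbs_const_mul hF hG hH n (measurable_wt _) 3]
    refine triAbs_mono fun μ => le_of_eq ?_
    rw [← ofReal_norm, Complex.norm_real, Real.norm_eq_abs, abs_of_nonneg
      (mul_nonneg (by norm_num) (Real.rpow_nonneg (jb_pos μ).le _)),
      ENNReal.ofReal_mul (by norm_num)]
    simp [wt]
  refine continuousOn_of_dominated (bound := fun x =>
    ‖triFun n F G H (fun μ => ((3 * jb μ ^ (-1 : ℝ) : ℝ) : ℂ)) x‖) ?_ ?_ hb.norm ?_
  · intro t _
    exact (measurable_triFun hF hG hH n (continuous_kk_mod t₀ t).measurable).aestronglyMeasurable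
  · intro t ht
    refine .of_forall fun x => ?_
    have hk := jb_mul_norm_kk_le (t₀ := t₀) (t := t)
      (by rw [abs_of_nonneg] <;> linarith [ht.1, ht.2]) (modul x)
    have he : ∀ k : ℝ → ℂ, ‖triFun n F G H k x‖ = ‖coef n x.1 * (F x.1.1 x.2.1 *
      starRingEnd ℂ (G x.1.2.1 x.2.2.1) * H x.1.2.2 x.2.2.2)‖ * ‖k (modul x)‖ :=
      fun k => norm_mul _ _
    rw [he, he]
    refine mul_le_mul_of_nonneg_left ?_ (norm_nonneg _)
    rw [Complex.norm_real, Real.norm_eq_abs]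
    refine le_trans ?_ (le_abs_self _)
    rw [Real.rpow_neg_one, ← div_eq_mul_inv, le_div_iff₀ (jb_pos _)]
    linarith
  · refine .of_forall fun x => ?_
    exact (continuous_const.mul (continuous_kk_right t₀ (modul x))).continuousOn

/-- Fubini: taking the transform in t over the interval replaces the kernel `kk` by `hh`, so both
norms of the Duhamel term are governed by trilinear forms of one type. -/
lemma cutFT_duh {F G H : ℤ → ℝ → ℂ} (hF : ∀ n, Measurable (F n))
    (hG : ∀ n, Measurable (G n)) (hH : ∀ n, Measurable (H n)) {n : ℤ}
    (hT : triAbs n F G H (wt (-1)) < ∞) {t₀ t₁ : ℝ} (h0 : t₀ ≤ t₁) (h1 : t₁ - t₀ ≤ 1) (τ : ℝ) :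
    cutFT t₀ t₁ (fun t => duh t₀ t n F G H) τ =
      (2 * Real.pi : ℂ)⁻¹ ^ 3 * triForm n F G H (hh t₀ t₁ τ) := by
  have e1 : ∀ t : ℝ, cexp (-(I * t * τ)) * duh t₀ t n F G H = (2 * Real.pi : ℂ)⁻¹ ^ 3 *
      ∫ x, cexp (-(I * t * τ)) * triFun n F G H (kk t₀ t) x ∂μ3 := by
    intro t
    rw [duh, triForm, integral_const_mul]
    ring
  simp only [cutFT, e1]
  rw [intervalIntegral.integral_const_mul]
  congr 1
  rw [intervalIntegral.integral_of_le h0, integral_integral_swap]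
  · rw [triForm]
    refine integral_congr_ae (.of_forall fun x => ?_)
    simp only
    rw [← intervalIntegral.integral_of_le h0, triFun, hh, ← intervalIntegral.integral_const_mul]
    refine intervalIntegral.integral_congr fun t _ => ?_
    simp only [triFun]
    ring
  · have hm1 : Measurable fun z : ℝ × ((ℤ × ℤ × ℤ) × (ℝ × ℝ × ℝ)) => kk t₀ z.1 (modul z.2) := by
      have hz : Measurable fun z : ℝ × ((ℤ × ℤ × ℤ) × (ℝ × ℝ × ℝ)) => (t₀, z.1, modul z.2) :=
        measurable_const.prodMk (measurable_fst.prodMk (measurable_modul.comp measurable_snd))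
      exact continuous_kk.measurable.comp hz
    have hm2 : Measurable fun z : ℝ × ((ℤ × ℤ × ℤ) × (ℝ × ℝ × ℝ)) =>
        triFun n F G H (fun _ => 1) z.2 :=
      (measurable_triFun hF hG hH n measurable_const).comp measurable_snd
    have hm : Measurable (Function.uncurry fun (t : ℝ) x =>
        cexp (-(I * t * τ)) * triFun n F G H (kk t₀ t) x) := by
      have h3 : Measurable fun z : ℝ × ((ℤ × ℤ × ℤ) × (ℝ × ℝ × ℝ)) =>
          cexp (-(I * z.1 * τ)) := by fun_prop
      have h4 : (Function.uncurry fun (t : ℝ) x =>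
          cexp (-(I * t * τ)) * triFun n F G H (kk t₀ t) x) = fun z =>
          cexp (-(I * z.1 * τ)) * (triFun n F G H (fun _ => 1) z.2 * kk t₀ z.1 (modul z.2)) := by
        funext z
        simp [Function.uncurry, triFun]
      rw [h4]
      exact h3.mul (hm2.mul hm1)
    refine ⟨hm.aestronglyMeasurable, ?_⟩
    rw [HasFiniteIntegral, lintegral_prod _ hm.enorm.aemeasurable]
    calc _ ≤ ∫⁻ _ in Set.Ioc t₀ t₁, 3 * triAbs n F G H (wt (-1)) := by
          refine setLIntegral_mono measurable_const fun t ht => ?_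
          refine le_trans (le_of_eq ?_) (triAbs_kk_le (t₀ := t₀) (t := t) hF hG hH
            (by rw [abs_of_nonneg] <;> linarith [ht.1, ht.2]) n)
          rw [← lintegral_enorm_triFun]
          refine lintegral_congr fun x => ?_
          simp only [Function.uncurry]
          rw [enorm_mul, ← ofReal_norm, norm_cexp_neg_I, ENNReal.ofReal_one, one_mul]
      _ < ∞ := by
          rw [setLIntegral_const]
          exact ENNReal.mul_lt_top (ENNReal.mul_lt_top (by norm_num) hT) (by simp)

/-- The diagonal of the Duhamel operator. -/
def duh3 (t₀ t : ℝ) (n : ℤ) (F : ℤ → ℝ → ℂ) : ℂ := duh t₀ t n F F F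

/-- The norm of `ℓ^p(⟨n⟩^s; L^∞([t₀, t₁]))`. -/
def nS (s p t₀ t₁ : ℝ) (a : ℝ → ℤ → ℂ) : ℝ≥0∞ :=
  (∑' n : ℤ, (wt s n * ⨆ t ∈ Set.Icc t₀ t₁, ‖a t n‖ₑ) ^ p) ^ (1 / p)

/-! ### Weighted sequence norms and the bounds for the Duhamel operator. -/

lemma lp_add_le {p : ℝ} (hp : 1 ≤ p) (f g : ℤ → ℝ≥0∞) :
    (∑' n, (f n + g n) ^ p) ^ (1 / p) ≤ (∑' n, f n ^ p) ^ (1 / p) + (∑' n, g n ^ p) ^ (1 / p) := by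
  have := ENNReal.lintegral_Lp_add_le (μ := (Measure.count : Measure ℤ)) (f := f) (g := g)
    (measurable_of_countable f).aemeasurable (measurable_of_countable g).aemeasurable hp
  simpa only [lintegral_count, Pi.add_apply] using this

lemma lp_const_mul {p : ℝ} (hp : 0 < p) (c : ℝ≥0∞) (f : ℤ → ℝ≥0∞) :
    (∑' n, (c * f n) ^ p) ^ (1 / p) = c * (∑' n, f n ^ p) ^ (1 / p) := by
  simp only [ENNReal.mul_rpow_of_nonneg _ _ hp.le, ENNReal.tsum_mul_left]
  rw [ENNReal.mul_rpow_of_nonneg _ _ (by positivity), ← ENNReal.rpow_mul,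
    mul_one_div_cancel hp.ne', ENNReal.rpow_one]

lemma lp_mono {p : ℝ} (hp : 0 < p) {f g : ℤ → ℝ≥0∞} (h : ∀ n, f n ≤ g n) :
    (∑' n, f n ^ p) ^ (1 / p) ≤ (∑' n, g n ^ p) ^ (1 / p) :=
  ENNReal.rpow_le_rpow (ENNReal.tsum_le_tsum fun n => ENNReal.rpow_le_rpow (h n) hp.le)
    (by positivity)

lemma nS_add_le {s p t₀ t₁ : ℝ} (hp : 1 ≤ p) (a b : ℝ → ℤ → ℂ) :
    nS s p t₀ t₁ (a + b) ≤ nS s p t₀ t₁ a + nS s p t₀ t₁ b := by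
  refine le_trans (lp_mono (by linarith) fun n => ?_) (lp_add_le hp _ _)
  rw [← mul_add]
  refine mul_le_mul' le_rfl (iSup₂_le fun t ht => ?_)
  exact (enorm_add_le _ _).trans
    (add_le_add (le_iSup₂ (f := fun t _ => ‖a t n‖ₑ) t ht) (le_iSup₂ (f := fun t _ => ‖b t n‖ₑ) t ht))

lemma nS_mono {s p t₀ t₁ : ℝ} (hp : 0 < p) {a b : ℝ → ℤ → ℂ}
    (h : ∀ t ∈ Set.Icc t₀ t₁, ∀ n, ‖a t n‖ₑ ≤ ‖b t n‖ₑ) : nS s p t₀ t₁ a ≤ nS s p t₀ t₁ b :=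
  lp_mono hp fun n => mul_le_mul' le_rfl (iSup₂_mono fun t ht => h t ht n)

lemma exists_nS_duh_le (e : Exponents) : ∃ C : ℝ≥0, ∀ (t₀ t₁ : ℝ) (F G H : ℤ → ℝ → ℂ),
    t₁ - t₀ ≤ 1 → (∀ n, Measurable (F n)) → (∀ n, Measurable (G n)) → (∀ n, Measurable (H n)) →
    nS e.s e.p t₀ t₁ (fun t n => duh t₀ t n F G H) ≤
      C * (nX e.s e.β e.p F * nX e.s e.β e.p G * nX e.s e.β e.p H) := by
  obtain ⟨C, hC⟩ := exists_triAbs_sup_le e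
  refine ⟨3 * C, fun t₀ t₁ F G H h1 hF hG hH => ?_⟩
  have hp := e.p_pos
  calc _ ≤ (∑' n : ℤ, (3 * (wt e.s n * triAbs n F G H (wt (-1)))) ^ e.p) ^ (1 / e.p) := by
        refine lp_mono hp fun n => ?_
        rw [mul_left_comm]
        refine mul_le_mul' le_rfl (iSup₂_le fun t ht => ?_)
        exact enorm_duh_le hF hG hH (by rw [abs_of_nonneg] <;> linarith [ht.1, ht.2]) n
    _ ≤ 3 * (C * (nX e.s e.β e.p F * nX e.s e.β e.p G * nX e.s e.β e.p H)) := by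
        rw [lp_const_mul hp]
        exact mul_le_mul' le_rfl (hC F G H hF hG hH)
    _ = _ := by push_cast; ring

lemma exists_nX_duh_le (e : Exponents) : ∃ C : ℝ≥0, ∀ (t₀ t₁ : ℝ) (F G H : ℤ → ℝ → ℂ),
    t₀ ≤ t₁ → t₁ - t₀ ≤ 1 →
    (∀ n, Measurable (F n)) → (∀ n, Measurable (G n)) → (∀ n, Measurable (H n)) →
    nX e.s e.β e.p F < ∞ → nX e.s e.β e.p G < ∞ → nX e.s e.β e.p H < ∞ →
    nX e.s e.b e.p (fun n => cutFT t₀ t₁ (fun t => duh t₀ t n F G H)) ≤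
      C * ENNReal.ofReal ((t₁ - t₀) ^ e.θ) *
        (nX e.s e.β e.p F * nX e.s e.β e.p G * nX e.s e.β e.p H) := by
  obtain ⟨C, hC⟩ := exists_triAbs_hh_le e
  refine ⟨C, fun t₀ t₁ F G H h0 h1 hF hG hH nF nG nH => le_trans ?_ (hC t₀ t₁ F G H h0 h1 hF hG hH)⟩
  have hp := e.p_pos
  refine ENNReal.rpow_le_rpow (ENNReal.tsum_le_tsum fun n => lintegral_mono fun τ => ?_)
    (by positivity)
  refine ENNReal.rpow_le_rpow (mul_le_mul' le_rfl ?_) hp.le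
  change ‖cutFT t₀ t₁ (fun t => duh t₀ t n F G H) τ‖ₑ ≤ _
  rw [cutFT_duh hF hG hH (triAbs_lt_top e hF hG hH nF nG nH n) h0 h1, enorm_mul]
  calc _ ≤ 1 * ‖triForm n F G H (hh t₀ t₁ τ)‖ₑ := mul_le_mul' norm_two_pi_inv_le le_rfl
    _ ≤ _ := by
      rw [one_mul]
      exact enorm_triForm_le n F G H _

/-- Telescoping, one factor at a time. Additivity in each slot uses that all the mixed trilinear
forms converge absolutely. -/
lemma duh3_sub (e : Exponents) {F G : ℤ → ℝ → ℂ} (hF : ∀ n, Measurable (F n))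
    (hG : ∀ n, Measurable (G n)) (nF : nX e.s e.β e.p F < ∞) (nG : nX e.s e.β e.p G < ∞)
    {t₀ t : ℝ} (h : |t - t₀| ≤ 1) (n : ℤ) :
    duh3 t₀ t n F - duh3 t₀ t n G =
      duh t₀ t n (F - G) F F + duh t₀ t n G (F - G) F + duh t₀ t n G G (F - G) := by
  have hi : ∀ A B D : ℤ → ℝ → ℂ, (∀ n, Measurable (A n)) → (∀ n, Measurable (B n)) →
      (∀ n, Measurable (D n)) → nX e.s e.β e.p A < ∞ → nX e.s e.β e.p B < ∞ →
      nX e.s e.β e.p D < ∞ → Integrable (triFun n A B D (kk t₀ t)) μ3 :=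
    fun A B D hA hB hD nA nB nD => integrable_triFun_kk hA hB hD
      (triAbs_lt_top e hA hB hD nA nB nD n) h
  simp only [duh3, duh]
  rw [← triForm_sub_fst (hi F F F hF hF hF nF nF nF) (hi G F F hG hF hF nG nF nF),
    ← triForm_sub_snd (hi G F F hG hF hF nG nF nF) (hi G G F hG hG hF nG nG nF),
    ← triForm_sub_trd (hi G G F hG hG hF nG nG nF) (hi G G G hG hG hG nG nG nG)]
  ring

lemma trilinear_bound_le (x y d : ℝ≥0∞) :
    d * x * x + y * d * x + y * y * d ≤ (x + y) ^ 2 * d := by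
  calc d * x * x + y * d * x + y * y * d ≤ d * x * x + y * d * x + y * y * d + y * d * x :=
        le_self_add
    _ = _ := by ring

lemma nX_sub_lt_top (e : Exponents) {F G : ℤ → ℝ → ℂ} (hF : ∀ n, Measurable (F n))
    (hG : ∀ n, Measurable (G n)) (nF : nX e.s e.β e.p F < ∞) (nG : nX e.s e.β e.p G < ∞) :
    nX e.s e.β e.p (F - G) < ∞ :=
  (nX_sub_le hF hG _ _ e.one_lt_p.le).trans_lt (ENNReal.add_lt_top.2 ⟨nF, nG⟩)

lemma exists_nS_duh3_sub_le (e : Exponents) : ∃ C : ℝ≥0, ∀ (t₀ t₁ : ℝ) (F G : ℤ → ℝ → ℂ),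
    t₁ - t₀ ≤ 1 → (∀ n, Measurable (F n)) → (∀ n, Measurable (G n)) →
    nX e.s e.β e.p F < ∞ → nX e.s e.β e.p G < ∞ →
    nS e.s e.p t₀ t₁ (fun t n => duh3 t₀ t n F - duh3 t₀ t n G) ≤
      C * ((nX e.s e.β e.p F + nX e.s e.β e.p G) ^ 2 * nX e.s e.β e.p (F - G)) := by
  obtain ⟨C, hC⟩ := exists_nS_duh_le e
  refine ⟨C, fun t₀ t₁ F G h1 hF hG nF nG => ?_⟩
  have hp := e.one_lt_p.le
  have hD : ∀ n, Measurable ((F - G) n) := fun n => (hF n).sub (hG n)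
  calc _ ≤ nS e.s e.p t₀ t₁ (((fun t n => duh t₀ t n (F - G) F F) +
          fun t n => duh t₀ t n G (F - G) F) + fun t n => duh t₀ t n G G (F - G)) := by
        refine nS_mono e.p_pos fun t ht n => le_of_eq ?_
        rw [duh3_sub e hF hG nF nG (by rw [abs_of_nonneg] <;> linarith [ht.1, ht.2])]
        rfl
    _ ≤ _ := (nS_add_le hp _ _).trans (add_le_add (nS_add_le hp _ _) le_rfl)
    _ ≤ _ := add_le_add (add_le_add (hC t₀ t₁ _ _ _ h1 hD hF hF) (hC t₀ t₁ _ _ _ h1 hG hD hF))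
        (hC t₀ t₁ _ _ _ h1 hG hG hD)
    _ ≤ _ := by
      rw [← mul_add, ← mul_add]
      exact mul_le_mul' le_rfl (trilinear_bound_le _ _ _)

/-! ### Elementary properties of the Fourier transform on an interval. -/

lemma continuous_cutFT {t₀ t₁ : ℝ} (h0 : t₀ ≤ t₁) {g : ℝ → ℂ}
    (hg : IntegrableOn g (Set.Ioc t₀ t₁)) : Continuous (cutFT t₀ t₁ g) := by
  have : cutFT t₀ t₁ g = fun τ : ℝ => ∫ r in Set.Ioc t₀ t₁, cexp (-(I * r * τ)) * g r := by
    funext τ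
    rw [cutFT, intervalIntegral.integral_of_le h0]
  rw [this]
  refine continuous_of_dominated (bound := fun r => ‖g r‖) ?_ ?_ hg.norm ?_
  · intro τ
    exact (by fun_prop : Continuous fun r : ℝ => cexp (-(I * r * τ))).aestronglyMeasurable.mul
      hg.aestronglyMeasurable
  · intro τ
    refine .of_forall fun r => ?_
    rw [norm_mul, norm_cexp_neg_I, one_mul]
  · exact .of_forall fun r => by fun_prop

lemma cutFT_add {t₀ t₁ : ℝ} {f g : ℝ → ℂ} (hf : IntervalIntegrable f volume t₀ t₁)
    (hg : IntervalIntegrable g volume t₀ t₁) (τ : ℝ) :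
    cutFT t₀ t₁ (fun t => f t + g t) τ = cutFT t₀ t₁ f τ + cutFT t₀ t₁ g τ := by
  have hc : ContinuousOn (fun r : ℝ => cexp (-(I * r * τ))) (Set.uIcc t₀ t₁) := by fun_prop
  simp only [cutFT, mul_add]
  exact intervalIntegral.integral_add (hf.continuousOn_mul hc) (hg.continuousOn_mul hc)

lemma cutFT_sub {t₀ t₁ : ℝ} {f g : ℝ → ℂ} (hf : IntervalIntegrable f volume t₀ t₁)
    (hg : IntervalIntegrable g volume t₀ t₁) (τ : ℝ) :
    cutFT t₀ t₁ (fun t => f t - g t) τ = cutFT t₀ t₁ f τ - cutFT t₀ t₁ g τ := by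
  have hc : ContinuousOn (fun r : ℝ => cexp (-(I * r * τ))) (Set.uIcc t₀ t₁) := by fun_prop
  simp only [cutFT, mul_sub]
  exact intervalIntegral.integral_sub (hf.continuousOn_mul hc) (hg.continuousOn_mul hc)

lemma cutFT_const_mul (t₀ t₁ : ℝ) (c : ℂ) (f : ℝ → ℂ) (τ : ℝ) :
    cutFT t₀ t₁ (fun t => c * f t) τ = c * cutFT t₀ t₁ f τ := by
  simp only [cutFT, ← intervalIntegral.integral_const_mul]
  refine intervalIntegral.integral_congr fun r _ => ?_
  ring

lemma cutFT_congr {t₀ t₁ : ℝ} (h0 : t₀ ≤ t₁) {f g : ℝ → ℂ} (h : Set.EqOn f g (Set.Icc t₀ t₁)) :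
    cutFT t₀ t₁ f = cutFT t₀ t₁ g := by
  funext τ
  refine intervalIntegral.integral_congr fun r hr => ?_
  rw [Set.uIcc_of_le h0] at hr
  simp only [h hr]

lemma measurable_cutFT_duh (e : Exponents) {t₀ t₁ : ℝ} (h0 : t₀ ≤ t₁) (h1 : t₁ - t₀ ≤ 1)
    {F G H : ℤ → ℝ → ℂ} (hF : ∀ n, Measurable (F n)) (hG : ∀ n, Measurable (G n))
    (hH : ∀ n, Measurable (H n)) (nF : nX e.s e.β e.p F < ∞) (nG : nX e.s e.β e.p G < ∞)
    (nH : nX e.s e.β e.p H < ∞) (n : ℤ) :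
    Measurable (cutFT t₀ t₁ (fun t => duh t₀ t n F G H)) :=
  (continuous_cutFT h0 (((continuousOn_duh hF hG hH (triAbs_lt_top e hF hG hH nF nG nH n)
    h1).integrableOn_Icc).mono_set Set.Ioc_subset_Icc_self)).measurable

lemma exists_nX_duh3_sub_le (e : Exponents) : ∃ C : ℝ≥0, ∀ (t₀ t₁ : ℝ) (F G : ℤ → ℝ → ℂ),
    t₀ ≤ t₁ → t₁ - t₀ ≤ 1 → (∀ n, Measurable (F n)) → (∀ n, Measurable (G n)) →
    nX e.s e.β e.p F < ∞ → nX e.s e.β e.p G < ∞ →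
    nX e.s e.b e.p (fun n => cutFT t₀ t₁ (fun t => duh3 t₀ t n F - duh3 t₀ t n G)) ≤
      C * ENNReal.ofReal ((t₁ - t₀) ^ e.θ) *
        ((nX e.s e.β e.p F + nX e.s e.β e.p G) ^ 2 * nX e.s e.β e.p (F - G)) := by
  obtain ⟨C, hC⟩ := exists_nX_duh_le e
  refine ⟨C, fun t₀ t₁ F G h0 h1 hF hG nF nG => ?_⟩
  have hp := e.one_lt_p.le
  have hD : ∀ n, Measurable ((F - G) n) := fun n => (hF n).sub (hG n)
  have nD := nX_sub_lt_top e hF hG nF nG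
  have hm := fun A B D hA hB hD nA nB nD n => measurable_cutFT_duh e (F := A) (G := B) (H := D)
    h0 h1 hA hB hD nA nB nD n
  have hii : ∀ A B D : ℤ → ℝ → ℂ, (∀ n, Measurable (A n)) → (∀ n, Measurable (B n)) →
      (∀ n, Measurable (D n)) → nX e.s e.β e.p A < ∞ → nX e.s e.β e.p B < ∞ →
      nX e.s e.β e.p D < ∞ → ∀ n, IntervalIntegrable (fun t => duh t₀ t n A B D) volume t₀ t₁ :=
    fun A B D hA hB hD nA nB nD n => ContinuousOn.intervalIntegrable (by
      rw [Set.uIcc_of_le h0]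
      exact continuousOn_duh hA hB hD (triAbs_lt_top e hA hB hD nA nB nD n) h1)
  have i₁ := hii _ _ _ hD hF hF nD nF nF
  have i₂ := hii _ _ _ hG hD hF nG nD nF
  have i₃ := hii _ _ _ hG hG hD nG nG nD
  have m₁ := hm _ _ _ hD hF hF nD nF nF
  have m₂ := hm _ _ _ hG hD hF nG nD nF
  have m₃ := hm _ _ _ hG hG hD nG nG nD
  have e1 : (fun n => cutFT t₀ t₁ (fun t => duh3 t₀ t n F - duh3 t₀ t n G)) =
      ((fun n => cutFT t₀ t₁ (fun t => duh t₀ t n (F - G) F F)) +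
        fun n => cutFT t₀ t₁ (fun t => duh t₀ t n G (F - G) F)) +
        fun n => cutFT t₀ t₁ (fun t => duh t₀ t n G G (F - G)) := by
    funext n τ
    rw [cutFT_congr h0 (g := fun t => duh t₀ t n (F - G) F F + duh t₀ t n G (F - G) F +
      duh t₀ t n G G (F - G)), cutFT_add ((i₁ n).add (i₂ n)) (i₃ n), cutFT_add (i₁ n) (i₂ n)]
    · rfl
    · intro t ht
      exact duh3_sub e hF hG nF nG (by rw [abs_of_nonneg] <;> linarith [ht.1, ht.2]) n
  rw [e1]
  calc _ ≤ _ := (nX_add_le (fun n => (m₁ n).add (m₂ n)) m₃ _ _ hp).trans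
        (add_le_add (nX_add_le m₁ m₂ _ _ hp) le_rfl)
    _ ≤ _ := add_le_add (add_le_add (hC t₀ t₁ _ _ _ h0 h1 hD hF hF nD nF nF)
        (hC t₀ t₁ _ _ _ h0 h1 hG hD hF nG nD nF)) (hC t₀ t₁ _ _ _ h0 h1 hG hG hD nG nG nD)
    _ ≤ _ := by
      rw [← mul_add, ← mul_add]
      exact mul_le_mul' le_rfl (trilinear_bound_le _ _ _)

/-! ### Gaussian regularization of the inverse Fourier transform -/

/-- A Gaussian in the modulation variable which tends to `1` as `c → ∞`. -/
def gaussWt (c τ : ℝ) : ℂ := cexp (-((1 / (4 * Real.pi ^ 2 * c) : ℝ) : ℂ) * τ ^ 2)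

/-- The Gaussian regularization of the inverse Fourier transform of `A`. -/
def gaussInv (c : ℝ) (A : ℝ → ℂ) (r : ℝ) : ℂ :=
  (2 * Real.pi : ℂ)⁻¹ * ∫ τ : ℝ, cexp (I * r * τ) * (gaussWt c τ * A τ)

lemma integrable_gaussWt {c : ℝ} (hc : 0 < c) : Integrable (gaussWt c) := by
  have : 0 < 1 / (4 * Real.pi ^ 2 * c) := by have := Real.pi_pos; positivity
  exact integrable_cexp_neg_mul_sq (by rwa [Complex.ofReal_re])

lemma continuous_gaussWt (c : ℝ) : Continuous (gaussWt c) := by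
  unfold gaussWt; fun_prop

lemma gaussWt_eq_ofReal (c τ : ℝ) :
    gaussWt c τ = ((Real.exp (-(1 / (4 * Real.pi ^ 2 * c)) * τ ^ 2) : ℝ) : ℂ) := by
  rw [gaussWt]; push_cast; rfl

lemma norm_gaussWt_le {c : ℝ} (hc : 0 < c) (τ : ℝ) : ‖gaussWt c τ‖ ≤ 1 := by
  rw [gaussWt_eq_ofReal, Complex.norm_real, Real.norm_eq_abs, Real.abs_exp, Real.exp_le_one_iff]
  have : 0 ≤ 1 / (4 * Real.pi ^ 2 * c) * τ ^ 2 := by positivity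
  linarith

lemma tendsto_gaussWt (τ : ℝ) : Tendsto (fun c => gaussWt c τ) atTop (𝓝 1) := by
  have h1 : Tendsto (fun c : ℝ => 1 / (4 * Real.pi ^ 2 * c)) atTop (𝓝 0) := by
    refine Tendsto.const_div_atTop ?_ 1
    exact tendsto_id.const_mul_atTop (by have := Real.pi_pos; positivity)
  have h2 : Tendsto (fun c : ℝ => -(1 / (4 * Real.pi ^ 2 * c)) * τ ^ 2) atTop (𝓝 0) := by
    simpa using h1.neg.mul_const (τ ^ 2)
  simp only [gaussWt_eq_ofReal]
  have h3 := (Complex.continuous_ofReal.tendsto _).comp ((Real.continuous_exp.tendsto 0).comp h2)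
  rw [Real.exp_zero, Complex.ofReal_one] at h3
  exact h3

/-- Fubini and the transform of a Gaussian: the regularized inversion is the convolution of the
restricted function with a Gaussian approximate identity of width c^{-1/2}. -/
lemma gaussInv_cutFT {t₀ t₁ c : ℝ} (h0 : t₀ ≤ t₁) (hc : 0 < c) {a : ℝ → ℂ}
    (ha : IntegrableOn a (Set.Ioc t₀ t₁)) (r : ℝ) :
    gaussInv c (cutFT t₀ t₁ a) r = ∫ w in Set.Ioc t₀ t₁,
      ((Real.sqrt (Real.pi * c) * Real.exp (-Real.pi ^ 2 * c * (r - w) ^ 2) : ℝ) : ℂ) * a w := by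
  have hπ := Real.pi_pos
  have e1 : ∀ τ : ℝ, cexp (I * r * τ) * (gaussWt c τ * cutFT t₀ t₁ a τ) =
      ∫ w in Set.Ioc t₀ t₁, cexp (I * ((r - w : ℝ) : ℂ) * τ) * (gaussWt c τ * a w) := by
    intro τ
    rw [cutFT, intervalIntegral.integral_of_le h0, ← integral_const_mul, ← integral_const_mul]
    refine integral_congr_ae (.of_forall fun w => ?_)
    simp only
    rw [show I * ((r - w : ℝ) : ℂ) * τ = I * r * τ + -(I * w * τ) by push_cast; ring, Complex.exp_add]
    ring
  have hint : Integrable (Function.uncurry fun (τ w : ℝ) =>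
      cexp (I * ((r - w : ℝ) : ℂ) * τ) * (gaussWt c τ * a w))
      (volume.prod (volume.restrict (Set.Ioc t₀ t₁))) := by
    refine ((integrable_gaussWt hc).mul_prod ha).bdd_mul (c := 1) ?_ (.of_forall fun z => ?_)
    · exact (by fun_prop : Continuous fun z : ℝ × ℝ =>
        cexp (I * ((r - z.2 : ℝ) : ℂ) * z.1)).aestronglyMeasurable
    · exact (norm_cexp_I _ _).le
  simp only [gaussInv, e1]
  rw [integral_integral_swap hint, ← integral_const_mul]
  refine integral_congr_ae (.of_forall fun w => ?_)
  simp only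
  have e2 : ∀ τ : ℝ, cexp (I * ((r - w : ℝ) : ℂ) * τ) * (gaussWt c τ * a w) =
      (cexp (I * ((r - w : ℝ) : ℂ) * τ) * gaussWt c τ) * a w := fun τ => by ring
  simp only [e2]
  rw [integral_mul_const, ← mul_assoc]
  congr 1
  unfold gaussWt
  have hb : 0 < 1 / (4 * Real.pi ^ 2 * c) := by positivity
  rw [fourierIntegral_gaussian (by rwa [Complex.ofReal_re])]
  have e3 : ((Real.pi : ℂ) / ((1 / (4 * Real.pi ^ 2 * c) : ℝ) : ℂ)) ^ (1 / 2 : ℂ) =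
      ((2 * Real.pi * Real.sqrt (Real.pi * c) : ℝ) : ℂ) := by
    rw [← Complex.ofReal_div, show (1 / 2 : ℂ) = ((1 / 2 : ℝ) : ℂ) by push_cast; rfl,
      ← Complex.ofReal_cpow (by positivity), ← Real.sqrt_eq_rpow]
    congr 1
    rw [show Real.pi / (1 / (4 * Real.pi ^ 2 * c)) = (2 * Real.pi) ^ 2 * (Real.pi * c) by
      field_simp; ring, Real.sqrt_mul (by positivity), Real.sqrt_sq (by positivity)]
  have e4 : cexp (-((r - w : ℝ) : ℂ) ^ 2 / (4 * ((1 / (4 * Real.pi ^ 2 * c) : ℝ) : ℂ))) =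
      ((Real.exp (-Real.pi ^ 2 * c * (r - w) ^ 2) : ℝ) : ℂ) := by
    rw [Complex.ofReal_exp]
    congr 1
    have : (Real.pi : ℂ) ≠ 0 := by exact_mod_cast hπ.ne'
    have : (c : ℂ) ≠ 0 := by exact_mod_cast hc.ne'
    push_cast
    field_simp
  rw [e3, e4]
  have : (Real.pi : ℂ) ≠ 0 := by exact_mod_cast hπ.ne'
  push_cast
  field_simp

lemma tendsto_gaussInv_cutFT {t₀ t₁ : ℝ} {a : ℝ → ℂ} (ha : ContinuousOn a (Set.Icc t₀ t₁))
    {r : ℝ} (hr : r ∈ Set.Ioo t₀ t₁) :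
    Tendsto (fun c => gaussInv c (cutFT t₀ t₁ a) r) atTop (𝓝 (a r)) := by
  have h0 : t₀ ≤ t₁ := (hr.1.trans hr.2).le
  have hi : IntegrableOn a (Set.Ioc t₀ t₁) := ha.integrableOn_Icc.mono_set Set.Ioc_subset_Icc_self
  have hc : ContinuousAt ((Set.Ioc t₀ t₁).indicator a) r := by
    have h1 : ContinuousAt a r := ha.continuousAt (Icc_mem_nhds hr.1 hr.2)
    refine h1.congr ?_
    filter_upwards [Ioo_mem_nhds hr.1 hr.2] with w hw
    rw [Set.indicator_of_mem (Set.Ioo_subset_Ioc_self hw)]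
  have h1 := Real.tendsto_integral_gaussian_smul' (V := ℝ)
    ((integrable_indicator_iff measurableSet_Ioc).2 hi) hc
  rw [Set.indicator_of_mem (Set.Ioo_subset_Ioc_self hr)] at h1
  refine h1.congr' ?_
  filter_upwards [eventually_gt_atTop 0] with c hc
  rw [gaussInv_cutFT h0 hc hi, ← integral_indicator measurableSet_Ioc]
  refine integral_congr_ae (.of_forall fun w => ?_)
  simp only [Set.indicator]
  have hπ := Real.pi_pos
  split_ifs
  · rw [smul_eq_mul]
    congr 1
    rw [Module.finrank_self, show ((1 : ℕ) : ℂ) / 2 = ((1 / 2 : ℝ) : ℂ) by push_cast; rfl,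
      ← Complex.ofReal_mul, ← Complex.ofReal_cpow (by positivity), ← Real.sqrt_eq_rpow,
      Real.norm_eq_abs, Complex.ofReal_mul, Complex.ofReal_exp]
    congr 2
    rw [← Complex.ofReal_pow |r - w|, sq_abs]
    push_cast
    ring
  · simp

/-- The Gaussian kernel has mass one. The bound does not depend on c and supplies the majorant for
the limit c → ∞. -/
lemma norm_gaussInv_cutFT_le {t₀ t₁ c M : ℝ} (h0 : t₀ ≤ t₁) (hc : 0 < c) {a : ℝ → ℂ}
    (ha : ContinuousOn a (Set.Icc t₀ t₁)) (hM : ∀ w ∈ Set.Icc t₀ t₁, ‖a w‖ ≤ M) (r : ℝ) :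
    ‖gaussInv c (cutFT t₀ t₁ a) r‖ ≤ M := by
  have hπ := Real.pi_pos
  have hM0 : 0 ≤ M := (norm_nonneg _).trans (hM t₀ ⟨le_rfl, h0⟩)
  have hb : 0 < Real.pi ^ 2 * c := by positivity
  rw [gaussInv_cutFT h0 hc (ha.integrableOn_Icc.mono_set Set.Ioc_subset_Icc_self)]
  have hi : Integrable fun w : ℝ =>
      Real.sqrt (Real.pi * c) * Real.exp (-Real.pi ^ 2 * c * (r - w) ^ 2) := by
    have := ((integrable_exp_neg_mul_sq hb).comp_sub_left r).const_mul (Real.sqrt (Real.pi * c))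
    simpa only [neg_mul] using this
  calc _ ≤ ∫ w in Set.Ioc t₀ t₁,
        (Real.sqrt (Real.pi * c) * Real.exp (-Real.pi ^ 2 * c * (r - w) ^ 2)) * M := by
        refine norm_integral_le_of_norm_le (hi.mul_const M).integrableOn ?_
        filter_upwards [ae_restrict_mem measurableSet_Ioc] with w hw
        rw [norm_mul, Complex.norm_real, Real.norm_eq_abs, abs_of_nonneg (by positivity)]
        exact mul_le_mul_of_nonneg_left (hM w (Set.Ioc_subset_Icc_self hw)) (by positivity)
    _ ≤ ∫ w : ℝ, (Real.sqrt (Real.pi * c) * Real.exp (-Real.pi ^ 2 * c * (r - w) ^ 2)) * M :=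
        setIntegral_le_integral (hi.mul_const M) (.of_forall fun w => by positivity)
    _ = M := by
        rw [integral_mul_const, integral_const_mul]
        have h1 : ∫ w : ℝ, Real.exp (-Real.pi ^ 2 * c * (r - w) ^ 2) =
            ∫ w : ℝ, Real.exp (-(Real.pi ^ 2 * c) * w ^ 2) := by
          rw [← integral_sub_left_eq_self (fun w : ℝ => Real.exp (-(Real.pi ^ 2 * c) * w ^ 2))
            volume r]
          simp only [neg_mul]
        rw [h1, integral_gaussian, ← Real.sqrt_mul (by positivity)]
        rw [show Real.pi * c * (Real.pi / (Real.pi ^ 2 * c)) = 1 by field_simp]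
        simp

/-! ### The time integral of a product in terms of the Fourier transforms -/

lemma norm_cutFT_le {t₀ t₁ M : ℝ} (h0 : t₀ ≤ t₁) {a : ℝ → ℂ}
    (hM : ∀ w ∈ Set.Icc t₀ t₁, ‖a w‖ ≤ M) (τ : ℝ) : ‖cutFT t₀ t₁ a τ‖ ≤ M * (t₁ - t₀) := by
  have := intervalIntegral.norm_integral_le_of_norm_le_const (a := t₀) (b := t₁) (C := M)
    (f := fun r : ℝ => cexp (-(I * r * τ)) * a r) fun r hr => by
      rw [Set.uIoc_of_le h0] at hr
      rw [norm_mul, norm_cexp_neg_I, one_mul]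
      exact hM r (Set.Ioc_subset_Icc_self hr)
  rwa [abs_of_nonneg (by linarith)] at this

lemma conj_gaussInv (c : ℝ) (A : ℝ → ℂ) (r : ℝ) :
    starRingEnd ℂ (gaussInv c A r) = (2 * Real.pi : ℂ)⁻¹ *
      ∫ τ : ℝ, cexp (-(I * r * τ)) * (gaussWt c τ * starRingEnd ℂ (A τ)) := by
  rw [gaussInv, map_mul, ← integral_conj, map_inv₀, map_mul, Complex.conj_ofReal]
  congr 1
  · rw [map_ofNat]
  · refine integral_congr_ae (.of_forall fun τ => ?_)
    simp only [map_mul, gaussWt_eq_ofReal, Complex.conj_ofReal, ← Complex.exp_conj, Complex.conj_I]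
    congr 2
    ring

lemma integral_gaussInv_mul {t₀ t : ℝ} (ht : t₀ ≤ t) {c : ℝ} (hc : 0 < c) {A B D : ℝ → ℂ}
    (hA : Continuous A) (hB : Continuous B) (hD : Continuous D) {M : ℝ} (hA' : ∀ τ, ‖A τ‖ ≤ M)
    (hB' : ∀ τ, ‖B τ‖ ≤ M) (hD' : ∀ τ, ‖D τ‖ ≤ M) (φ : ℝ) :
    ∫ r in t₀..t, cexp (I * r * φ) *
        (gaussInv c A r * starRingEnd ℂ (gaussInv c B r) * gaussInv c D r) =
      (2 * Real.pi : ℂ)⁻¹ ^ 3 * ∫ x : ℝ × ℝ × ℝ, (gaussWt c x.1 * (gaussWt c x.2.1 * gaussWt c x.2.2)) *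
        ((A x.1 * starRingEnd ℂ (B x.2.1) * D x.2.2) * kk t₀ t (x.1 - x.2.1 + x.2.2 + φ)) := by
  have e1 : ∀ r : ℝ, cexp (I * r * φ) *
        (gaussInv c A r * starRingEnd ℂ (gaussInv c B r) * gaussInv c D r) =
      (2 * Real.pi : ℂ)⁻¹ ^ 3 * ∫ x : ℝ × ℝ × ℝ,
        cexp (I * r * ((x.1 - x.2.1 + x.2.2 + φ : ℝ) : ℂ)) *
          ((gaussWt c x.1 * A x.1) * ((gaussWt c x.2.1 * starRingEnd ℂ (B x.2.1)) *
            (gaussWt c x.2.2 * D x.2.2))) := by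
    intro r
    rw [conj_gaussInv, gaussInv, gaussInv]
    have h3 := integral_prod_mul (μ := (volume : Measure ℝ)) (ν := (volume : Measure ℝ))
      (fun τ : ℝ => cexp (-(I * r * τ)) * (gaussWt c τ * starRingEnd ℂ (B τ)))
      (fun τ : ℝ => cexp (I * r * τ) * (gaussWt c τ * D τ))
    have h4 := integral_prod_mul (μ := (volume : Measure ℝ)) (ν := (volume : Measure (ℝ × ℝ)))
      (fun τ : ℝ => cexp (I * r * τ) * (gaussWt c τ * A τ))
      (fun z : ℝ × ℝ => (cexp (-(I * r * z.1)) * (gaussWt c z.1 * starRingEnd ℂ (B z.1))) *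
        (cexp (I * r * z.2) * (gaussWt c z.2 * D z.2)))
    rw [Measure.volume_eq_prod, h3] at h4
    have h5 : ∀ x y z w : ℂ, cexp (I * r * φ) * (w * x * (w * y) * (w * z)) =
        w ^ 3 * (cexp (I * r * φ) * (x * (y * z))) := fun x y z w => by ring
    rw [h5, ← h4, ← integral_const_mul]
    congr 1
    refine integral_congr_ae (.of_forall fun x => ?_)
    simp only
    rw [show I * (r : ℂ) * ((x.1 - x.2.1 + x.2.2 + φ : ℝ) : ℂ) =
      I * r * φ + (I * r * x.1 + (-(I * r * x.2.1) + I * r * x.2.2)) by push_cast; ring,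
      Complex.exp_add, Complex.exp_add, Complex.exp_add]
    ring
  have hcj := Complex.continuous_conj
  have hg : ∀ {E : ℝ → ℂ}, Continuous E → (∀ τ, ‖E τ‖ ≤ M) →
      Integrable fun τ => gaussWt c τ * E τ := by
    intro E hE hE'
    refine ((integrable_gaussWt hc).bdd_mul hE.aestronglyMeasurable (.of_forall hE')).congr ?_
    exact .of_forall fun τ => mul_comm _ _
  have hi3 : Integrable fun x : ℝ × ℝ × ℝ => (gaussWt c x.1 * A x.1) *
      ((gaussWt c x.2.1 * starRingEnd ℂ (B x.2.1)) * (gaussWt c x.2.2 * D x.2.2)) := by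
    refine (hg hA hA').mul_prod (((hg (E := fun τ => starRingEnd ℂ (B τ)) (by fun_prop)
      (fun τ => by rw [RCLike.norm_conj]; exact hB' τ))).mul_prod (hg hD hD'))
  simp only [e1]
  rw [intervalIntegral.integral_const_mul]
  congr 1
  rw [intervalIntegral.integral_of_le ht, integral_integral_swap]
  · refine integral_congr_ae (.of_forall fun x => ?_)
    simp only
    rw [integral_mul_const, ← intervalIntegral.integral_of_le ht, kk]
    ring
  · have h1 : Integrable (fun z : ℝ × (ℝ × ℝ × ℝ) => (1 : ℂ) * ((gaussWt c z.2.1 * A z.2.1) *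
        ((gaussWt c z.2.2.1 * starRingEnd ℂ (B z.2.2.1)) * (gaussWt c z.2.2.2 * D z.2.2.2))))
        ((volume.restrict (Set.Ioc t₀ t)).prod volume) :=
      (integrable_const (1 : ℂ)).mul_prod hi3
    simp only [one_mul] at h1
    refine h1.bdd_mul (c := 1) (f := fun z : ℝ × (ℝ × ℝ × ℝ) =>
        cexp (I * z.1 * ((z.2.1 - z.2.2.1 + z.2.2.2 + φ : ℝ) : ℂ))) ?_ (.of_forall fun z => ?_)
    · exact Continuous.aestronglyMeasurable (by fun_prop)
    · exact (norm_cexp_I _ _).le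

/-- The transform of a sharply restricted function need not be integrable, so Fourier inversion
cannot be inserted directly. The identity holds for Gaussian regularizations and passes to the
limit: on the left by bounded convergence in the interior of the interval, on the right because the
assumed integrability provides a majorant. -/
lemma integral_product_eq {t₀ t₁ t : ℝ} (ht : t ∈ Set.Icc t₀ t₁) {a b d : ℝ → ℂ}
    (ha : ContinuousOn a (Set.Icc t₀ t₁)) (hb : ContinuousOn b (Set.Icc t₀ t₁))
    (hd : ContinuousOn d (Set.Icc t₀ t₁)) (φ : ℝ)
    (hint : Integrable fun x : ℝ × ℝ × ℝ => (cutFT t₀ t₁ a x.1 * starRingEnd ℂ (cutFT t₀ t₁ b x.2.1)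
      * cutFT t₀ t₁ d x.2.2) * kk t₀ t (x.1 - x.2.1 + x.2.2 + φ)) :
    ∫ r in t₀..t, cexp (I * r * φ) * (a r * starRingEnd ℂ (b r) * d r) =
      (2 * Real.pi : ℂ)⁻¹ ^ 3 * ∫ x : ℝ × ℝ × ℝ,
        (cutFT t₀ t₁ a x.1 * starRingEnd ℂ (cutFT t₀ t₁ b x.2.1)
          * cutFT t₀ t₁ d x.2.2) * kk t₀ t (x.1 - x.2.1 + x.2.2 + φ) := by
  have h0 : t₀ ≤ t₁ := ht.1.trans ht.2
  have hio : ∀ {f : ℝ → ℂ}, ContinuousOn f (Set.Icc t₀ t₁) → IntegrableOn f (Set.Ioc t₀ t₁) :=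
    fun hf => hf.integrableOn_Icc.mono_set Set.Ioc_subset_Icc_self
  obtain ⟨M, hM⟩ : ∃ M : ℝ, ∀ f ∈ ({a, b, d} : Set (ℝ → ℂ)), ∀ w ∈ Set.Icc t₀ t₁, ‖f w‖ ≤ M := by
    obtain ⟨M₁, h₁⟩ := isCompact_Icc.exists_bound_of_continuousOn ha
    obtain ⟨M₂, h₂⟩ := isCompact_Icc.exists_bound_of_continuousOn hb
    obtain ⟨M₃, h₃⟩ := isCompact_Icc.exists_bound_of_continuousOn hd
    refine ⟨max M₁ (max M₂ M₃), ?_⟩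
    rintro f (rfl | rfl | rfl) w hw
    · exact (h₁ w hw).trans (le_max_left _ _)
    · exact (h₂ w hw).trans ((le_max_left _ _).trans (le_max_right _ _))
    · exact (h₃ w hw).trans ((le_max_right _ _).trans (le_max_right _ _))
  have hMa := hM a (by simp)
  have hMb := hM b (by simp)
  have hMd := hM d (by simp)
  have hL : Tendsto (fun c : ℝ => ∫ r in t₀..t, cexp (I * r * φ) * (gaussInv c (cutFT t₀ t₁ a) r *
      starRingEnd ℂ (gaussInv c (cutFT t₀ t₁ b) r) * gaussInv c (cutFT t₀ t₁ d) r)) atTop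
      (𝓝 (∫ r in t₀..t, cexp (I * r * φ) * (a r * starRingEnd ℂ (b r) * d r))) := by
    refine intervalIntegral.tendsto_integral_filter_of_dominated_convergence (fun _ => M * M * M)
      ?_ ?_ intervalIntegrable_const ?_
    · filter_upwards [eventually_gt_atTop 0] with c hc
      have hm : ∀ {f : ℝ → ℂ}, IntegrableOn f (Set.Ioc t₀ t₁) →
          Measurable (gaussInv c (cutFT t₀ t₁ f)) := by
        intro f hf
        have hcf := (continuous_cutFT h0 hf)
        refine Measurable.const_mul ?_ _
        refine StronglyMeasurable.measurable (StronglyMeasurable.integral_prod_right'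
          (f := fun z : ℝ × ℝ => cexp (I * z.1 * z.2) * (gaussWt c z.2 * cutFT t₀ t₁ f z.2)) ?_)
        have := continuous_gaussWt c
        exact Continuous.stronglyMeasurable (by fun_prop)
      refine Measurable.aestronglyMeasurable ?_
      exact (by fun_prop : Continuous fun r : ℝ => cexp (I * r * φ)).measurable.mul
        (((hm (hio ha)).mul (Complex.continuous_conj.measurable.comp (hm (hio hb)))).mul (hm (hio hd)))
    · filter_upwards [eventually_gt_atTop 0] with c hc
      refine .of_forall fun r _ => ?_
      rw [norm_mul, norm_cexp_I, one_mul, norm_mul, norm_mul, RCLike.norm_conj]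
      have hM0 : 0 ≤ M := (norm_nonneg _).trans (hMa t₀ ⟨le_rfl, h0⟩)
      gcongr
      · exact norm_gaussInv_cutFT_le h0 hc ha hMa r
      · exact norm_gaussInv_cutFT_le h0 hc hb hMb r
      · exact norm_gaussInv_cutFT_le h0 hc hd hMd r
    · have hne : ∀ᵐ r : ℝ, r ≠ t₁ := by simp [ae_iff]
      filter_upwards [hne] with r hr1 hr
      rw [Set.uIoc_of_le ht.1] at hr
      have hr' : r ∈ Set.Ioo t₀ t₁ := ⟨hr.1, lt_of_le_of_ne (hr.2.trans ht.2) hr1⟩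
      refine Tendsto.const_mul _ (((tendsto_gaussInv_cutFT ha hr').mul ?_).mul
        (tendsto_gaussInv_cutFT hd hr'))
      exact (Complex.continuous_conj.tendsto _).comp (tendsto_gaussInv_cutFT hb hr')
  have hR := tendsto_integral_filter_of_dominated_convergence (l := (atTop : Filter ℝ))
    (F := fun (c : ℝ) (x : ℝ × ℝ × ℝ) => (gaussWt c x.1 * (gaussWt c x.2.1 * gaussWt c x.2.2)) *
      ((cutFT t₀ t₁ a x.1 * starRingEnd ℂ (cutFT t₀ t₁ b x.2.1)
      * cutFT t₀ t₁ d x.2.2) * kk t₀ t (x.1 - x.2.1 + x.2.2 + φ))) _ ?_ ?_ hint.norm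
      (.of_forall fun x => (((tendsto_gaussWt x.1).mul ((tendsto_gaussWt x.2.1).mul
        (tendsto_gaussWt x.2.2))).mul_const _))
  · simp only [mul_one, one_mul] at hR
    refine tendsto_nhds_unique hL ((hR.const_mul ((2 * Real.pi : ℂ)⁻¹ ^ 3)).congr' ?_)
    filter_upwards [eventually_gt_atTop 0] with c hc
    exact (integral_gaussInv_mul ht.1 hc (continuous_cutFT h0 (hio ha)) (continuous_cutFT h0 (hio hb))
      (continuous_cutFT h0 (hio hd)) (norm_cutFT_le h0 hMa) (norm_cutFT_le h0 hMb)
      (norm_cutFT_le h0 hMd) φ).symm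
  · filter_upwards with c
    refine AEStronglyMeasurable.mul ?_ hint.aestronglyMeasurable
    have := continuous_gaussWt c
    exact Continuous.aestronglyMeasurable (by fun_prop)
  · filter_upwards [eventually_gt_atTop 0] with c hc
    refine .of_forall fun x => ?_
    rw [norm_mul]
    refine mul_le_of_le_one_left (norm_nonneg _) ?_
    rw [norm_mul, norm_mul]
    exact mul_le_one₀ (norm_gaussWt_le hc _) (by positivity)
      (mul_le_one₀ (norm_gaussWt_le hc _) (norm_nonneg _) (norm_gaussWt_le hc _))

/-! ### The nonlinearity in Fourier variables -/

lemma fourierCoeff_trig {ι : Type*} (s : Finset ι) (c : ι → ℂ) (k : ι → ℤ) (n : ℤ) :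
    fourierCoeff (fun x : UnitAddCircle => ∑ i ∈ s, c i * fourier (k i) x) n =
      ∑ i ∈ s, if k i = n then c i else 0 := by
  have h := congrFun (fourierCoeff.sum (T := 1) s (fun i x => c i * fourier (k i) x)
    (fun i _ => (Continuous.integrable_of_hasCompactSupport (by fun_prop)
      (HasCompactSupport.of_compactSpace _)))) n
  have e1 : (∑ i ∈ s, fun x : UnitAddCircle => c i * fourier (k i) x) =
      fun x => ∑ i ∈ s, c i * fourier (k i) x := by
    funext x; simp
  rw [e1] at h
  rw [h, Finset.sum_apply]
  refine Finset.sum_congr rfl fun i _ => ?_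
  rw [fourierCoeff.const_mul, fourierCoeff_fourier, Pi.single_apply]
  by_cases hk : k i = n
  · simp [hk]
  · simp [hk, Ne.symm hk]

lemma coef_eq (n : ℤ) (m : ℤ × ℤ × ℤ) : coef n m = if m.1 - m.2.1 + m.2.2 = n then
    (1 - (if m.1 = n then 1 else 0) - (if m.2.2 = n then 1 else 0)) else 0 := by
  unfold coef
  by_cases h1 : m.1 = n <;> by_cases h2 : m.2.2 = n <;> simp [h1, h2]

/-- The box of the frequency triples which are at most `M`. -/
def freqBox (M : ℕ) : Finset (ℤ × ℤ × ℤ) :=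
  Finset.Icc (-(M : ℤ)) M ×ˢ Finset.Icc (-(M : ℤ)) M ×ˢ Finset.Icc (-(M : ℤ)) M

lemma truncate_mul_conj (M : ℕ) (u : ℤ → ℂ) (x : UnitAddCircle) :
    truncate M u x * starRingEnd ℂ (truncate M u x) =
      ∑ z ∈ Finset.Icc (-(M : ℤ)) M ×ˢ Finset.Icc (-(M : ℤ)) M,
        (u z.1 * starRingEnd ℂ (u z.2)) * fourier (z.1 - z.2) x := by
  simp only [truncate, map_sum, map_mul]
  rw [Finset.sum_mul_sum, Finset.sum_product]
  refine Finset.sum_congr rfl fun k _ => Finset.sum_congr rfl fun l _ => ?_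
  rw [← fourier_neg, sub_eq_add_neg, fourier_add]
  ring

lemma integral_truncate_sq (M : ℕ) (u : ℤ → ℂ) :
    ((∫ y, ‖truncate M u y‖ ^ 2 ∂AddCircle.haarAddCircle : ℝ) : ℂ) =
      ∑ k ∈ Finset.Icc (-(M : ℤ)) M, u k * starRingEnd ℂ (u k) := by
  have h1 := fourierCoeff_trig (Finset.Icc (-(M : ℤ)) M ×ˢ Finset.Icc (-(M : ℤ)) M)
    (fun z => u z.1 * starRingEnd ℂ (u z.2)) (fun z => z.1 - z.2) 0
  simp only [← truncate_mul_conj] at h1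
  have h2 : fourierCoeff (fun x => truncate M u x * starRingEnd ℂ (truncate M u x)) 0 =
      ((∫ y, ‖truncate M u y‖ ^ 2 ∂AddCircle.haarAddCircle : ℝ) : ℂ) := by
    refine Eq.trans ?_ integral_complex_ofReal
    refine integral_congr_ae (.of_forall fun x => ?_)
    simp [Complex.mul_conj']
  rw [← h2, h1, Finset.sum_product]
  refine Finset.sum_congr rfl fun k hk => ?_
  rw [Finset.sum_eq_single k]
  · simp
  · intro l _ hl
    rw [if_neg]
    intro h
    exact hl (by linarith)
  · exact fun h => absurd hk h

/-- On m₁ - m₂ + m₃ = n the coefficient is 1 - [m₁ = n] - [m₃ = n]. The condition m₁ = n forces m₂ =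
m₃, and m₃ = n forces m₁ = m₂, so each subtracted sum equals û(n) times the mass of the truncation;
together they are the Wick correction 2∫|u|². -/
lemma fourierCoeff_wick_truncate (M : ℕ) (u : ℤ → ℂ) (n : ℤ) :
    fourierCoeff (wick (truncate M u)) n =
      ∑ m ∈ freqBox M, coef n m * (u m.1 * starRingEnd ℂ (u m.2.1) * u m.2.2) := by
  set B := Finset.Icc (-(M : ℤ)) M with hB
  set S := ∑ k ∈ B, u k * starRingEnd ℂ (u k) with hS
  have e1 : wick (truncate M u) = fun x : UnitAddCircle =>
      ∑ i ∈ (freqBox M).disjSum B, Sum.elim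
        (fun m : ℤ × ℤ × ℤ => u m.1 * starRingEnd ℂ (u m.2.1) * u m.2.2)
        (fun k : ℤ => -(2 * S * u k)) i *
        fourier (Sum.elim (fun m : ℤ × ℤ × ℤ => m.1 - m.2.1 + m.2.2) (fun k : ℤ => k) i) x := by
    funext x
    rw [Finset.sum_disjSum]
    simp only [Sum.elim_inl, Sum.elim_inr, wick]
    push_cast
    rw [integral_truncate_sq, sub_mul, ← Complex.mul_conj', truncate_mul_conj]
    have h1 : (2 * ∑ k ∈ B, u k * starRingEnd ℂ (u k)) * truncate M u x =
        -∑ k ∈ B, -(2 * S * u k) * fourier k x := by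
      rw [truncate, Finset.mul_sum, ← Finset.sum_neg_distrib]
      refine Finset.sum_congr rfl fun k _ => ?_
      ring
    rw [h1, sub_neg_eq_add]
    congr 1
    rw [truncate, Finset.sum_mul_sum, freqBox, ← hB, Finset.sum_product, Finset.sum_product]
    refine Finset.sum_congr rfl fun k _ => ?_
    rw [Finset.sum_product]
    refine Finset.sum_congr rfl fun l _ => Finset.sum_congr rfl fun j _ => ?_
    rw [fourier_add]
    ring
  rw [e1, fourierCoeff_trig, Finset.sum_disjSum]
  change (∑ m ∈ freqBox M, if m.1 - m.2.1 + m.2.2 = n then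
    u m.1 * starRingEnd ℂ (u m.2.1) * u m.2.2 else 0) +
    (∑ k ∈ B, if k = n then -(2 * S * u k) else 0) = _
  have e2 : ∀ m : ℤ × ℤ × ℤ, coef n m * (u m.1 * starRingEnd ℂ (u m.2.1) * u m.2.2) =
      (if m.1 - m.2.1 + m.2.2 = n then u m.1 * starRingEnd ℂ (u m.2.1) * u m.2.2 else 0)
      - (if m.1 = n then u m.1 else 0) *
          (if m.2.1 = m.2.2 then starRingEnd ℂ (u m.2.1) * u m.2.2 else 0)
      - (if m.1 = m.2.1 then u m.1 * starRingEnd ℂ (u m.2.1) else 0) *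
          (if m.2.2 = n then u m.2.2 else 0) := by
    rintro ⟨a, b, c⟩
    rw [coef_eq]
    by_cases h1 : a = n
    · subst h1
      by_cases h2 : c = a
      · subst h2
        by_cases h3 : b = c
        · subst h3; simp [mul_assoc]
        · have h4 : ¬ (c - b + c = c) := fun h => h3 (by linarith)
          simp [h3, Ne.symm h3, h4]
      · by_cases h3 : b = c
        · subst h3; simp [h2, mul_assoc]
        · have h4 : ¬ (a - b + c = a) := fun h => h3 (by linarith)
          simp [h2, h3, h4]
    · by_cases h2 : c = n
      · subst h2
        by_cases h3 : a = b
        · subst h3; simp [h1]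
        · have h4 : ¬ (a - b + c = c) := fun h => h3 (by linarith)
          simp [h1, h3, h4]
      · simp [h1, h2]
  simp only [e2]
  rw [Finset.sum_sub_distrib, Finset.sum_sub_distrib]
  have e3 : ∑ m ∈ freqBox M, (if m.1 = n then u m.1 else 0) *
      (if m.2.1 = m.2.2 then starRingEnd ℂ (u m.2.1) * u m.2.2 else 0) =
      (∑ k ∈ B, if k = n then u k else 0) * S := by
    rw [freqBox, ← hB, Finset.sum_product, Finset.sum_mul]
    refine Finset.sum_congr rfl fun k _ => ?_
    have h1 : S = ∑ y ∈ B ×ˢ B, if y.1 = y.2 then starRingEnd ℂ (u y.1) * u y.2 else 0 := by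
      rw [Finset.sum_product, hS]
      refine Finset.sum_congr rfl fun l hl => ?_
      rw [Finset.sum_ite_eq, if_pos hl, mul_comm]
    rw [h1, Finset.mul_sum]
  have e4 : ∑ m ∈ freqBox M, (if m.1 = m.2.1 then u m.1 * starRingEnd ℂ (u m.2.1) else 0) *
      (if m.2.2 = n then u m.2.2 else 0) =
      S * (∑ k ∈ B, if k = n then u k else 0) := by
    rw [freqBox, ← hB, Finset.sum_product, hS, Finset.sum_mul]
    refine Finset.sum_congr rfl fun k hk => ?_
    rw [Finset.sum_product]
    simp only [← Finset.mul_sum]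
    rw [← Finset.sum_mul, Finset.sum_ite_eq, if_pos hk]
  have e5 : (∑ k ∈ B, if k = n then -(2 * S * u k) else 0) =
      -(2 * S) * ∑ k ∈ B, if k = n then u k else 0 := by
    rw [Finset.mul_sum (f := fun k => if k = n then u k else 0)]
    refine Finset.sum_congr rfl fun k _ => ?_
    split_ifs <;> ring
  rw [e3, e4, e5]
  ring

lemma tendsto_freqBox : Tendsto freqBox atTop atTop := by
  refine tendsto_atTop_finset_of_monotone ?_ ?_
  · intro M M' h
    have : Finset.Icc (-(M : ℤ)) M ⊆ Finset.Icc (-(M' : ℤ)) M' := by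
      have : (M : ℤ) ≤ M' := by exact_mod_cast h
      exact Finset.Icc_subset_Icc (by linarith) this
    exact Finset.product_subset_product this (Finset.product_subset_product this this)
  · rintro ⟨a, b, c⟩
    refine ⟨a.natAbs + b.natAbs + c.natAbs, ?_⟩
    simp only [freqBox, Finset.mem_product, Finset.mem_Icc]
    omega

lemma cexp_neg_mul_product (r : ℝ) (m : ℤ × ℤ × ℤ) (x y z : ℂ) :
    cexp (-(I * r * disp (m.1 - m.2.1 + m.2.2))) * ((cexp (I * r * disp m.1) * x) *
      starRingEnd ℂ (cexp (I * r * disp m.2.1) * y) * (cexp (I * r * disp m.2.2) * z)) =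
    cexp (I * r * phase m) * (x * starRingEnd ℂ y * z) := by
  have h1 : starRingEnd ℂ (cexp (I * r * disp m.2.1)) = cexp (-(I * r * disp m.2.1)) := by
    rw [← Complex.exp_conj]
    congr 1
    simp
  rw [map_mul, h1, show I * (r : ℂ) * phase m = -(I * r * disp (m.1 - m.2.1 + m.2.2)) +
    (I * r * disp m.1 + (-(I * r * disp m.2.1) + I * r * disp m.2.2)) by
      simp only [phase]; push_cast; ring, Complex.exp_add, Complex.exp_add, Complex.exp_add]
  ring

/-- The Duhamel terms of the frequency truncations converge to the Duhamel operator. -/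
lemma tendsto_integral_wick (e : Exponents) {t₀ t₁ : ℝ} (h1 : t₁ - t₀ ≤ 1) {a : ℝ → ℤ → ℂ}
    (ha : ∀ n, ContinuousOn (fun r => a r n) (Set.Icc t₀ t₁))
    (hF : nX e.s e.β e.p (fun n => cutFT t₀ t₁ (fun r => a r n)) < ∞) {t : ℝ}
    (ht : t ∈ Set.Icc t₀ t₁) (n : ℤ) :
    Tendsto (fun M : ℕ => ∫ r in t₀..t, cexp (-(I * r * disp n)) *
      fourierCoeff (wick (truncate M (fun k => cexp (I * r * disp k) * a r k))) n) atTop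
      (𝓝 (duh3 t₀ t n (fun n => cutFT t₀ t₁ (fun r => a r n)))) := by
  set F : ℤ → ℝ → ℂ := fun n => cutFT t₀ t₁ (fun r => a r n) with hFdef
  have h0 : t₀ ≤ t₁ := ht.1.trans ht.2
  have hFm : ∀ n, Measurable (F n) := fun n => (continuous_cutFT h0
    ((ha n).integrableOn_Icc.mono_set Set.Ioc_subset_Icc_self)).measurable
  have hT := triAbs_lt_top e hFm hFm hFm hF hF hF n
  have hint := integrable_triFun_kk hFm hFm hFm hT (t₀ := t₀) (t := t)
    (by rw [abs_of_nonneg] <;> linarith [ht.1, ht.2])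
  rw [μ3] at hint
  have hint1 : ∀ m, Integrable fun τ => triFun n F F F (kk t₀ t) (m, τ) :=
    Measure.ae_count_iff.1 hint.prod_right_ae
  -- Absolute convergence makes the sum over frequency triples unconditional. Hence the partial sums
  -- over the boxes converge, and these are the Duhamel terms of the truncations.
  have hsum : HasSum (fun m => ∫ τ, triFun n F F F (kk t₀ t) (m, τ))
      (triForm n F F F (kk t₀ t)) := by
    have h2 := hint.integral_prod_left
    rw [triForm, μ3, integral_prod _ hint, integral_countable h2]
    simp only [measureReal_def, Measure.count_singleton, ENNReal.toReal_one, one_smul]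
    exact (summable_norm_iff.1 (integrable_count_iff.1 h2)).hasSum
  have hlim := (hsum.comp tendsto_freqBox).const_mul ((2 * Real.pi : ℂ)⁻¹ ^ 3)
  refine hlim.congr fun M => ?_
  simp only [Function.comp]
  rw [Finset.mul_sum]
  have e1 : ∀ r : ℝ, cexp (-(I * r * disp n)) *
      fourierCoeff (wick (truncate M (fun k => cexp (I * r * disp k) * a r k))) n =
      ∑ m ∈ freqBox M, coef n m * (cexp (I * r * phase m) *
        (a r m.1 * starRingEnd ℂ (a r m.2.1) * a r m.2.2)) := by
    intro r
    rw [fourierCoeff_wick_truncate, Finset.mul_sum]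
    refine Finset.sum_congr rfl fun m _ => ?_
    by_cases hm : m.1 - m.2.1 + m.2.2 = n
    · rw [← cexp_neg_mul_product, hm]
      ring
    · simp [coef, hm]
  simp only [e1]
  rw [intervalIntegral.integral_finsetSum]
  · refine Finset.sum_congr rfl fun m _ => ?_
    rw [intervalIntegral.integral_const_mul]
    by_cases hc : coef n m = 0
    · simp [triFun, hc]
    · have hi : Integrable fun x : ℝ × ℝ × ℝ => (F m.1 x.1 * starRingEnd ℂ (F m.2.1 x.2.1)
          * F m.2.2 x.2.2) * kk t₀ t (x.1 - x.2.1 + x.2.2 + phase m) := by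
        refine ((hint1 m).const_mul (coef n m)⁻¹).congr (.of_forall fun x => ?_)
        simp only [triFun, modul]
        field_simp
      rw [integral_product_eq ht (ha m.1) (ha m.2.1) (ha m.2.2) (phase m) hi]
      simp only [triFun, modul, mul_assoc (coef n m)]
      rw [integral_const_mul]
      ring
  · intro m _
    refine ContinuousOn.intervalIntegrable ?_
    rw [Set.uIcc_of_le ht.1]
    have hs : Set.Icc t₀ t ⊆ Set.Icc t₀ t₁ := Set.Icc_subset_Icc_right ht.2
    have c1 := (ha m.1).mono hs
    have c2 := (ha m.2.1).mono hs
    have c3 := (ha m.2.2).mono hs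
    have c4 : ContinuousOn (fun r => starRingEnd ℂ (a r m.2.1)) (Set.Icc t₀ t) :=
      Complex.continuous_conj.comp_continuousOn c2
    exact ContinuousOn.mul continuousOn_const (ContinuousOn.mul (by fun_prop) ((c1.mul c4).mul c3))

/-! ### Smooth approximations of the indicator function of an interval -/

/-- The rising factor of the approximate indicator function of `[t₀, t₁]`. -/
def rampUp (t₀ : ℝ) (j : ℕ) (t : ℝ) : ℝ := Real.smoothTransition (j * (t - t₀) - 1)

/-- The falling factor of the approximate indicator function of `[t₀, t₁]`. -/
def rampDown (t₁ : ℝ) (j : ℕ) (t : ℝ) : ℝ := Real.smoothTransition (j * (t₁ - t) - 1)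

lemma contDiff_rampUp (t₀ : ℝ) (j : ℕ) : ContDiff ℝ (⊤ : ℕ∞) (rampUp t₀ j) :=
  Real.smoothTransition.contDiff.comp (by fun_prop)

lemma contDiff_rampDown (t₁ : ℝ) (j : ℕ) : ContDiff ℝ (⊤ : ℕ∞) (rampDown t₁ j) :=
  Real.smoothTransition.contDiff.comp (by fun_prop)

/-- The shift by -1 in the ramps keeps the support at distance 1/j from the endpoints, so that the
product is an admissible test function on the open interval. -/
lemma ramp_eq_zero {t₀ t₁ : ℝ} {j : ℕ} (hj : 0 < j) {t : ℝ}
    (h : t ∉ Set.Icc (t₀ + 1 / j) (t₁ - 1 / j)) : rampUp t₀ j t * rampDown t₁ j t = 0 := by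
  have hj' : (0 : ℝ) < j := by exact_mod_cast hj
  rw [Set.mem_Icc, not_and_or, not_le, not_le] at h
  rcases h with h | h
  · rw [rampUp, Real.smoothTransition.zero_of_nonpos, zero_mul]
    have : j * (t - t₀) ≤ j * (1 / j) := by gcongr; linarith
    rw [mul_one_div_cancel hj'.ne'] at this
    linarith
  · rw [rampDown, Real.smoothTransition.zero_of_nonpos, mul_zero]
    have : j * (t₁ - t) ≤ j * (1 / j) := by gcongr; linarith
    rw [mul_one_div_cancel hj'.ne'] at this
    linarith

lemma ramp_mem_Icc (t₀ t₁ : ℝ) (j : ℕ) (t : ℝ) :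
    rampUp t₀ j t * rampDown t₁ j t ∈ Set.Icc (0 : ℝ) 1 :=
  ⟨mul_nonneg (Real.smoothTransition.nonneg _) (Real.smoothTransition.nonneg _),
    mul_le_one₀ (Real.smoothTransition.le_one _) (Real.smoothTransition.nonneg _)
      (Real.smoothTransition.le_one _)⟩

lemma tendsto_ramp {t₀ t₁ t : ℝ} (ht : t ∈ Set.Ioo t₀ t₁) :
    Tendsto (fun j : ℕ => rampUp t₀ j t * rampDown t₁ j t) atTop (𝓝 1) := by
  have h : ∀ x : ℝ, 0 < x → ∀ᶠ j : ℕ in atTop, Real.smoothTransition (j * x - 1) = 1 := by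
    intro x hx
    have : Tendsto (fun j : ℕ => (j : ℝ) * x) atTop atTop :=
      tendsto_natCast_atTop_atTop.atTop_mul_const hx
    filter_upwards [this.eventually_ge_atTop 2] with j hj
    exact Real.smoothTransition.one_of_one_le (by linarith)
  refine tendsto_const_nhds.congr' ?_
  filter_upwards [h (t - t₀) (by linarith [ht.1]), h (t₁ - t) (by linarith [ht.2])] with j h1 h2
  rw [rampUp, rampDown, h1, h2, one_mul]

lemma integral_deriv_smoothTransition_le {f : ℝ → ℝ} (hf : ContDiff ℝ (⊤ : ℕ∞) f)
    (h0 : ∀ t, 0 ≤ f t) (h1 : ∀ t, f t ≤ 1) (a b : ℝ) : ∫ t in a..b, deriv f t ≤ 1 := by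
  rw [intervalIntegral.integral_deriv_eq_sub (fun x _ => (hf.differentiable (by simp)) x)
    ((hf.continuous_deriv (by simp)).intervalIntegrable _ _)]
  linarith [h0 a, h1 b]

/-- Integration by parts: one ramp increases and the other decreases, both between 0 and 1, so the
derivative of the product has L¹ norm at most 2 for every j. The smooth cut-offs thus have
transforms with the decay of that of an indicator function, uniformly in j. -/
lemma jb_mul_norm_integral_ramp_le {t₀ t₁ : ℝ} (h01 : t₀ ≤ t₁) (h1 : t₁ - t₀ ≤ 1) {j : ℕ}
    (hj : 0 < j) (x : ℝ) :
    jb x * ‖∫ t in t₀..t₁, ((rampUp t₀ j t * rampDown t₁ j t : ℝ) : ℂ) * cexp (I * t * x)‖ ≤ 3 := by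
  have hd1 : ∀ t, HasDerivAt (rampUp t₀ j) (deriv (rampUp t₀ j) t) t := fun t =>
    ((contDiff_rampUp t₀ j).differentiable (by simp) t).hasDerivAt
  have hd2 : ∀ t, HasDerivAt (rampDown t₁ j) (deriv (rampDown t₁ j) t) t := fun t =>
    ((contDiff_rampDown t₁ j).differentiable (by simp) t).hasDerivAt
  have hc1 := (contDiff_rampUp t₀ j).continuous_deriv (by simp)
  have hc2 := (contDiff_rampDown t₁ j).continuous_deriv (by simp)
  have hm1 : ∀ t, 0 ≤ deriv (rampUp t₀ j) t := fun t => by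
    refine Monotone.deriv_nonneg ?_
    intro x y hxy
    exact Real.smoothTransition.monotone (by gcongr)
  have hm2 : ∀ t, deriv (rampDown t₁ j) t ≤ 0 := fun t => by
    refine Antitone.deriv_nonpos ?_
    intro x y hxy
    exact Real.smoothTransition.monotone (by gcongr)
  have b1 : ‖∫ t in t₀..t₁, ((rampUp t₀ j t * rampDown t₁ j t : ℝ) : ℂ) * cexp (I * t * x)‖ ≤ 1 := by
    refine (intervalIntegral.norm_integral_le_of_norm_le_const (C := 1) fun t _ => ?_).trans ?_
    · rw [norm_mul, norm_cexp_I, mul_one, Complex.norm_real, Real.norm_eq_abs,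
        abs_of_nonneg (ramp_mem_Icc t₀ t₁ j t).1]
      exact (ramp_mem_Icc t₀ t₁ j t).2
    · rw [one_mul, abs_of_nonneg (by linarith)]
      exact h1
  have hj' : (0 : ℝ) < j := by exact_mod_cast hj
  have z0 : rampUp t₀ j t₀ = 0 := Real.smoothTransition.zero_of_nonpos (by simp)
  have z1 : rampDown t₁ j t₁ = 0 := Real.smoothTransition.zero_of_nonpos (by simp)
  have b2 : |x| * ‖∫ t in t₀..t₁, ((rampUp t₀ j t * rampDown t₁ j t : ℝ) : ℂ) *
      cexp (I * t * x)‖ ≤ 2 := by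
    have hu : ∀ t : ℝ, HasDerivAt (fun t => ((rampUp t₀ j t * rampDown t₁ j t : ℝ) : ℂ))
        ((deriv (rampUp t₀ j) t * rampDown t₁ j t + rampUp t₀ j t * deriv (rampDown t₁ j) t : ℝ) : ℂ)
        t := fun t => ((hd1 t).mul (hd2 t)).ofReal_comp
    have hv : ∀ t : ℝ, HasDerivAt (fun t : ℝ => cexp (I * t * x)) (I * x * cexp (I * t * x)) t := by
      intro t
      have h : HasDerivAt (fun t : ℝ => I * (t : ℂ) * x) (I * x) t := by
        simpa using ((Complex.ofRealCLM.hasDerivAt (x := t)).const_mul I).mul_const (x : ℂ)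
      simpa [mul_comm] using h.cexp
    have hp := intervalIntegral.integral_mul_deriv_eq_deriv_mul (a := t₀) (b := t₁)
      (fun t _ => hu t) (fun t _ => hv t) (by
        refine Continuous.intervalIntegrable ?_ _ _
        have := (contDiff_rampUp t₀ j).continuous
        have := (contDiff_rampDown t₁ j).continuous
        fun_prop) (Continuous.intervalIntegrable (by fun_prop) _ _)
    rw [z0, z1, zero_mul, mul_zero, Complex.ofReal_zero, zero_mul, zero_mul, sub_zero, zero_sub] at hp
    have e1 : I * x * ∫ t in t₀..t₁, ((rampUp t₀ j t * rampDown t₁ j t : ℝ) : ℂ) * cexp (I * t * x) =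
        ∫ t in t₀..t₁, ((rampUp t₀ j t * rampDown t₁ j t : ℝ) : ℂ) *
          (I * x * cexp (I * t * x)) := by
      rw [← intervalIntegral.integral_const_mul]
      refine intervalIntegral.integral_congr fun t _ => ?_
      ring
    have e2 := congrArg norm e1
    rw [norm_mul, norm_mul, norm_I, one_mul, Complex.norm_real, Real.norm_eq_abs] at e2
    rw [e2, hp, norm_neg]
    have hi1 : IntervalIntegrable (deriv (rampUp t₀ j)) volume t₀ t₁ := hc1.intervalIntegrable _ _
    have hi2 : IntervalIntegrable (deriv (rampDown t₁ j)) volume t₀ t₁ := hc2.intervalIntegrable _ _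
    calc _ ≤ ∫ t in t₀..t₁, (deriv (rampUp t₀ j) t - deriv (rampDown t₁ j) t) := by
          refine intervalIntegral.norm_integral_le_of_norm_le h01 (.of_forall fun t _ => ?_)
            (hi1.sub hi2)
          rw [norm_mul, norm_cexp_I, mul_one, Complex.norm_real, Real.norm_eq_abs]
          have a1 := Real.smoothTransition.le_one (j * (t - t₀) - 1)
          have a2 := Real.smoothTransition.nonneg (j * (t - t₀) - 1)
          have a3 := Real.smoothTransition.le_one (j * (t₁ - t) - 1)
          have a4 := Real.smoothTransition.nonneg (j * (t₁ - t) - 1)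
          change rampUp t₀ j t ≤ 1 at a1
          change 0 ≤ rampUp t₀ j t at a2
          change rampDown t₁ j t ≤ 1 at a3
          change 0 ≤ rampDown t₁ j t at a4
          rw [abs_le]
          constructor <;> nlinarith [hm1 t, hm2 t]
      _ ≤ 2 := by
          rw [intervalIntegral.integral_sub hi1 hi2]
          have i1 := integral_deriv_smoothTransition_le (contDiff_rampUp t₀ j)
            (fun _ => Real.smoothTransition.nonneg _) (fun _ => Real.smoothTransition.le_one _) t₀ t₁
          have i2 := integral_deriv_smoothTransition_le (contDiff_rampDown t₁ j)
            (fun _ => Real.smoothTransition.nonneg _) (fun _ => Real.smoothTransition.le_one _) t₁ t₀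
          rw [intervalIntegral.integral_symm] at i2
          linarith
  have := jb_mul_le_of (norm_nonneg _) b1 b2
  linarith

lemma integral_eq_intervalIntegral_of_support {t₀ t₁ : ℝ} (h : t₀ ≤ t₁) {f : ℝ → ℂ}
    (hf : ∀ t ∉ Set.Ioc t₀ t₁, f t = 0) : ∫ t, f t = ∫ t in t₀..t₁, f t := by
  rw [intervalIntegral.integral_of_le h, setIntegral_eq_integral_of_forall_compl_eq_zero hf]

/-- The Fourier transform of the restriction of a distribution to an interval. -/
lemma integral_interval_of_isExtension {T t₀ t₁ : ℝ} (h0 : 0 ≤ t₀) (h01 : t₀ ≤ t₁) (hT : t₁ ≤ T)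
    (h1 : t₁ - t₀ ≤ 1) {f : ℤ → ℝ → ℂ} {u : ℝ → ℤ → ℂ} (hext : IsExtension T f u) {n : ℤ}
    (hf : Measurable (f n)) (hu : ContinuousOn (fun t => u t n) (Set.Icc 0 T)) {σ : ℝ}
    (hint : Integrable fun τ => ‖f n τ‖ * (3 * (jb (τ - σ))⁻¹)) :
    ∫ r in t₀..t₁, cexp (-(I * r * σ)) * u r n =
      (2 * Real.pi : ℂ)⁻¹ * ∫ τ, f n τ * kk t₀ t₁ (τ - σ) := by
  rcases h01.eq_or_lt with rfl | hlt
  · simp [kk]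
  set θ : ℕ → ℝ → ℂ := fun j t => ((rampUp t₀ j t * rampDown t₁ j t : ℝ) : ℂ) with hθ
  have hθc : ∀ j, ContDiff ℝ (⊤ : ℕ∞) (θ j) := fun j =>
    Complex.ofRealCLM.contDiff.comp ((contDiff_rampUp t₀ j).mul (contDiff_rampDown t₁ j))
  have hθ0 : ∀ j : ℕ, 0 < j → ∀ t ∉ Set.Icc (t₀ + 1 / (j : ℝ)) (t₁ - 1 / j), θ j t = 0 := by
    intro j hj t ht
    simp only [hθ, ramp_eq_zero hj ht, Complex.ofReal_zero]
  have hθ0' : ∀ j : ℕ, 0 < j → ∀ t ∉ Set.Ioc t₀ t₁, θ j t = 0 := by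
    intro j hj t ht
    refine hθ0 j hj t fun h => ht ?_
    have : (0 : ℝ) < 1 / j := by positivity
    exact ⟨by linarith [h.1], by linarith [h.2]⟩
  have hθ1 : ∀ j t, ‖θ j t‖ ≤ 1 := by
    intro j t
    simp only [hθ]
    rw [Complex.norm_real, Real.norm_eq_abs, abs_of_nonneg (ramp_mem_Icc t₀ t₁ j t).1]
    exact (ramp_mem_Icc t₀ t₁ j t).2
  have hθlim : ∀ᵐ t : ℝ, t ∈ Set.uIoc t₀ t₁ → Tendsto (fun j => θ j t) atTop (𝓝 1) := by
    have hne : ∀ᵐ r : ℝ, r ≠ t₁ := by simp [ae_iff]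
    filter_upwards [hne] with t ht1 ht
    rw [Set.uIoc_of_le h01] at ht
    have := tendsto_ramp (t₀ := t₀) (t₁ := t₁) ⟨ht.1, lt_of_le_of_ne ht.2 ht1⟩
    have h2 := (Complex.continuous_ofReal.tendsto _).comp this
    rw [Complex.ofReal_one] at h2
    exact h2
  have hlimit : ∀ g : ℝ → ℂ, ContinuousOn g (Set.Icc t₀ t₁) →
      Tendsto (fun j => ∫ t in t₀..t₁, θ j t * g t) atTop (𝓝 (∫ t in t₀..t₁, g t)) := by
    intro g hg
    refine intervalIntegral.tendsto_integral_filter_of_dominated_convergence (fun t => ‖g t‖)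
      ?_ ?_ ?_ ?_
    · refine .of_forall fun j => ?_
      rw [Set.uIoc_of_le h01]
      exact ((hθc j).continuous.aestronglyMeasurable).mul
        ((hg.integrableOn_Icc.mono_set Set.Ioc_subset_Icc_self).aestronglyMeasurable)
    · refine .of_forall fun j => .of_forall fun t _ => ?_
      rw [norm_mul]
      exact mul_le_of_le_one_left (norm_nonneg _) (hθ1 j t)
    · refine ContinuousOn.intervalIntegrable ?_
      rw [Set.uIcc_of_le h01]
      exact hg.norm
    · filter_upwards [hθlim] with t ht ht'
      simpa using (ht ht').mul_const (g t)
  have hL := hlimit (fun r => cexp (-(I * r * σ)) * u r n) (ContinuousOn.mul (by fun_prop)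
    (hu.mono (Set.Icc_subset_Icc h0 hT)))
  -- The extension is known only through its pairing with test functions. The uniform decay of the
  -- ramps, with `hint`, allows passing to the indicator function of the interval.
  have hR : Tendsto (fun j => ∫ τ, f n τ * ∫ t in t₀..t₁, θ j t * cexp (I * t * ((τ - σ : ℝ) : ℂ)))
      atTop (𝓝 (∫ τ, f n τ * kk t₀ t₁ (τ - σ))) := by
    refine tendsto_integral_filter_of_dominated_convergence _ ?_ ?_ hint ?_
    · refine .of_forall fun j => hf.aestronglyMeasurable.mul ?_
      refine Continuous.aestronglyMeasurable ?_
      refine intervalIntegral.continuous_parametric_intervalIntegral_of_continuous'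
        (f := fun (τ t : ℝ) => θ j t * cexp (I * t * ((τ - σ : ℝ) : ℂ))) ?_ _ _
      have := (hθc j).continuous
      exact Continuous.mul (this.comp continuous_snd) (by fun_prop)
    · filter_upwards [eventually_gt_atTop 0] with j hj
      refine .of_forall fun τ => ?_
      rw [norm_mul]
      refine mul_le_mul_of_nonneg_left ?_ (norm_nonneg _)
      rw [← div_eq_mul_inv, le_div_iff₀ (jb_pos _), mul_comm]
      exact jb_mul_norm_integral_ramp_le h01 h1 hj (τ - σ)
    · exact .of_forall fun τ => (hlimit (fun t => cexp (I * t * ((τ - σ : ℝ) : ℂ)))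
        (by fun_prop)).const_mul _
  refine tendsto_nhds_unique (hL.congr' ?_) (hR.const_mul ((2 * Real.pi : ℂ)⁻¹))
  filter_upwards [eventually_gt_atTop 0] with j hj
  have hsub : tsupport (fun t : ℝ => θ j t * cexp (-(I * t * σ))) ⊆
      Set.Icc (t₀ + 1 / (j : ℝ)) (t₁ - 1 / j) := by
    refine closure_minimal ?_ isClosed_Icc
    intro t ht
    by_contra hn
    exact ht (by simp only [hθ0 j hj t hn, zero_mul])
  have hj' : (0 : ℝ) < 1 / j := by positivity
  have he := hext n (fun t => θ j t * cexp (-(I * t * σ)))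
    ((hθc j).mul (by
      have : ContDiff ℝ (⊤ : ℕ∞) (fun t : ℝ => (t : ℂ)) := Complex.ofRealCLM.contDiff
      fun_prop))
    (HasCompactSupport.of_support_subset_isCompact isCompact_Icc (subset_closure.trans hsub))
    (hsub.trans fun t ht => ⟨by linarith [ht.1], by linarith [ht.2]⟩)
  have r1 : ∫ t, θ j t * cexp (-(I * t * σ)) * u t n =
      ∫ t in t₀..t₁, θ j t * (cexp (-(I * t * σ)) * u t n) := by
    rw [integral_eq_intervalIntegral_of_support h01 (fun t ht => by
      rw [hθ0' j hj t ht, zero_mul, zero_mul])]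
    refine intervalIntegral.integral_congr fun t _ => ?_
    ring
  have r2 : ∀ τ : ℝ, ∫ t, θ j t * cexp (-(I * t * σ)) * cexp (I * t * τ) =
      ∫ t in t₀..t₁, θ j t * cexp (I * t * ((τ - σ : ℝ) : ℂ)) := by
    intro τ
    rw [integral_eq_intervalIntegral_of_support h01 (fun t ht => by
      rw [hθ0' j hj t ht, zero_mul, zero_mul])]
    refine intervalIntegral.integral_congr fun t _ => ?_
    rw [mul_assoc, ← Complex.exp_add]
    congr 2
    push_cast; ring
  rw [r1] at he
  simp only [r2] at he
  exact he.symm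

/-! ### Fourier inversion for test functions -/

open scoped FourierTransform in
lemma test_fourier_inversion {θ : ℝ → ℂ} (h : ContDiff ℝ (⊤ : ℕ∞) θ) (hs : HasCompactSupport θ) :
    Integrable (fun τ : ℝ => ∫ t : ℝ, θ t * cexp (I * t * τ)) ∧
      ∀ w : ℝ, ∫ τ : ℝ, cexp (-(I * w * τ)) * ∫ t : ℝ, θ t * cexp (I * t * τ) =
        2 * Real.pi * θ w := by
  set S : SchwartzMap ℝ ℂ := hs.toSchwartzMap h with hS
  have hSθ : (S : ℝ → ℂ) = θ := rfl
  have hπ := Real.pi_pos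
  -- The transform with kernel exp(itτ) and the one with kernel exp(-2πitv) are related by τ = -2πv;
  -- the Jacobian produces the factor 2π in the inversion formula.
  have hF : ∀ v : ℝ, 𝓕 θ v = ∫ t : ℝ, θ t * cexp (I * t * ((-(2 * Real.pi) * v : ℝ) : ℂ)) := by
    intro v
    rw [Real.fourier_eq']
    refine integral_congr_ae (.of_forall fun t => ?_)
    simp only [smul_eq_mul, RCLike.inner_apply, conj_trivial]
    rw [mul_comm]
    congr 2
    push_cast
    ring
  have hFi : Integrable (𝓕 θ) := by
    have := (𝓕 S).integrable (μ := volume)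
    rwa [SchwartzMap.fourier_coe, hSθ] at this
  have hinv : ∀ w, 𝓕⁻ (𝓕 θ) w = θ w := fun w =>
    congrFun (h.continuous.fourierInv_fourier_eq (by rw [← hSθ]; exact S.integrable) hFi) w
  set Θ : ℝ → ℂ := fun τ => ∫ t : ℝ, θ t * cexp (I * t * τ) with hΘ
  have hΘF : ∀ v, 𝓕 θ v = Θ (-(2 * Real.pi) * v) := hF
  have hne : -(2 * Real.pi) ≠ 0 := by linarith
  constructor
  · have : Integrable fun v => Θ (-(2 * Real.pi) * v) := by simpa only [← hΘF] using hFi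
    exact (integrable_comp_mul_left_iff Θ hne).1 this
  · intro w
    change ∫ τ : ℝ, cexp (-(I * w * τ)) * Θ τ = _
    have h1 := Measure.integral_comp_mul_left (fun τ : ℝ => cexp (-(I * w * τ)) * Θ τ)
      (-(2 * Real.pi))
    have h2 : ∫ v : ℝ, cexp (-(I * w * ((-(2 * Real.pi) * v : ℝ) : ℂ))) * Θ (-(2 * Real.pi) * v) =
        θ w := by
      rw [← hinv w, Real.fourierInv_eq']
      refine integral_congr_ae (.of_forall fun v => ?_)
      simp only [smul_eq_mul, RCLike.inner_apply, conj_trivial, hΘF]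
      congr 2
      push_cast
      ring
    rw [h2] at h1
    rw [h1, abs_inv, abs_neg, abs_of_pos (by positivity), Complex.real_smul]
    have : (Real.pi : ℂ) ≠ 0 := by exact_mod_cast hπ.ne'
    push_cast
    field_simp

/-- The restriction to `[0, T]` of a continuous function is an extension of it. -/
lemma isExtension_cutFT {T : ℝ} (hT : 0 ≤ T) {u : ℝ → ℤ → ℂ}
    (hu : ∀ n, ContinuousOn (fun t => u t n) (Set.Icc 0 T)) :
    IsExtension T (fun n => cutFT 0 T (fun t => u t n)) u := by
  intro n θ hθ hs hsupp
  obtain ⟨hΘ, hinv⟩ := test_fourier_inversion hθ hs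
  set Θ : ℝ → ℂ := fun τ => ∫ t : ℝ, θ t * cexp (I * t * τ) with hΘd
  have hi : IntegrableOn (fun t => u t n) (Set.Ioc 0 T) :=
    (hu n).integrableOn_Icc.mono_set Set.Ioc_subset_Icc_self
  have e1 : ∀ τ : ℝ, cutFT 0 T (fun t => u t n) τ * Θ τ =
      ∫ w in Set.Ioc 0 T, cexp (-(I * w * τ)) * (Θ τ * u w n) := by
    intro τ
    rw [cutFT, intervalIntegral.integral_of_le hT, ← integral_mul_const]
    refine integral_congr_ae (.of_forall fun w => ?_)
    simp only
    ring
  change _ * ∫ τ : ℝ, cutFT 0 T (fun t => u t n) τ * Θ τ = _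
  simp only [e1]
  rw [integral_integral_swap]
  · have e2 : ∀ w : ℝ, ∫ τ : ℝ, cexp (-(I * w * τ)) * (Θ τ * u w n) =
        2 * Real.pi * (θ w * u w n) := by
      intro w
      have : ∀ τ : ℝ, cexp (-(I * w * τ)) * (Θ τ * u w n) =
        (cexp (-(I * w * τ)) * Θ τ) * u w n := fun τ => by ring
      simp only [this]
      rw [integral_mul_const, hinv w]
      ring
    simp only [e2]
    rw [integral_const_mul, ← mul_assoc, inv_mul_cancel₀, one_mul]
    · refine setIntegral_eq_integral_of_forall_compl_eq_zero fun t ht => ?_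
      rw [image_eq_zero_of_notMem_tsupport fun h => ht (Set.Ioo_subset_Ioc_self (hsupp h)), zero_mul]
    · have := Real.pi_pos.ne'
      simp
  · refine (hΘ.mul_prod hi).bdd_mul (c := 1) ?_ (.of_forall fun z => ?_)
    · exact Continuous.aestronglyMeasurable (by fun_prop)
    · exact (norm_cexp_neg_I _ _).le

/-! ### Restriction to intervals in weighted spaces -/

/-- A sharp cut-off in time acts on the Fourier side like convolution with a kernel of size 1/⟨τ⟩,
which is just not integrable. The gap b - β compensates the logarithmic failure, and b < 1/q ensures
that all exponents in the Schur test stay nonnegative. -/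
lemma exists_lintegral_conv_le (e : Exponents) {β b : ℝ} (hβ : 0 ≤ β) (hβb : β < b)
    (hb : b < 1 / e.q) : ∃ C : ℝ≥0, ∀ F : ℝ → ℝ≥0∞, Measurable F →
      ∫⁻ σ, (wt β σ * ∫⁻ τ, F τ * wt (-1) (τ - σ)) ^ e.p ≤ C * ∫⁻ τ, (wt b τ * F τ) ^ e.p := by
  have hp := e.p_pos
  have hq := e.q_pos
  have hinv := e.inv_p
  set ε : ℝ := (b - β) / 2 with hε
  have hεp : 0 < ε := by rw [hε]; linarith
  -- The unit decay of the kernel is split as c + (1 - c): the part c is p-integrable, while 1 - c =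
  -- 1/q - ε barely fails to be q-integrable, and the failure is made up by b - β = 2ε.
  set c : ℝ := 1 / e.p + ε with hc
  have hcp : 1 < c * e.p := by
    rw [hc, add_mul, one_div, inv_mul_cancel₀ hp.ne']
    nlinarith
  have h1c : (1 - c) * e.q = 1 - ε * e.q := by
    rw [show 1 - c = 1 / e.q - ε by rw [hc]; linarith, sub_mul, one_div, inv_mul_cancel₀ hq.ne']
  have hbq : b * e.q < 1 := by
    calc b * e.q < 1 / e.q * e.q := by gcongr
      _ = 1 := by rw [one_div, inv_mul_cancel₀ hq.ne']
  have hb2 : b * e.q = β * e.q + 2 * (ε * e.q) := by rw [hε]; ring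
  have hβq : 0 ≤ β * e.q := by positivity
  have hεq : 0 < ε * e.q := by positivity
  have hJ : ∫⁻ x, wt (-(c * e.p)) x < ∞ := lintegral_wt_lt_top (by linarith)
  obtain ⟨C₁, hC₁⟩ := exists_lintegral_wt_mul_wt_le (α := (1 - c) * e.q) (γ := (b - β) * e.q)
    (r := 0) le_rfl (by rw [h1c]; linarith) (by nlinarith) (by rw [h1c]; nlinarith)
  obtain ⟨C₂, hC₂⟩ := exists_lintegral_wt_mul_wt_le (α := (1 - β - c) * e.q) (γ := b * e.q)
    (r := 0) le_rfl (by nlinarith) (by nlinarith) (by nlinarith)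
  set J := ∫⁻ x, wt (-(c * e.p)) x with hJd
  set A := ENNReal.ofReal (2 ^ β) with hA
  have key : ∀ (x y : ℝ), (∃ C : ℝ≥0, ∀ z, ∫⁻ t, wt (-(x * e.q)) (z - t) * wt (-(y * e.q)) t ≤
      C * wt (-0) z) → ∃ C : ℝ≥0, ∀ g : ℝ → ℝ≥0∞, Measurable g →
      ∫⁻ σ, (∫⁻ τ, wt (-c) (σ - τ) * (wt (-x) (σ - τ) * wt (-y) τ) * g τ) ^ e.p ≤
        C * ∫⁻ τ, g τ ^ e.p := by
    rintro x y ⟨C, hC⟩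
    refine ⟨((C : ℝ≥0∞) ^ (e.p / e.q) * J).toNNReal, fun g hg => ?_⟩
    rw [ENNReal.coe_toNNReal (ENNReal.mul_ne_top
      (ENNReal.rpow_ne_top_of_nonneg (by positivity) ENNReal.coe_ne_top) hJ.ne)]
    refine lintegral_kernel_rpow_le (μ := volume) (ν := volume) e.holder
      (κ₁ := fun σ τ => wt (-c) (σ - τ)) (κ₂ := fun σ τ => wt (-x) (σ - τ) * wt (-y) τ)
      ?_ ?_ hg (fun τ => ?_) (fun σ => ?_)
    · exact (measurable_wt _).comp (measurable_fst.sub measurable_snd)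
    · exact ((measurable_wt _).comp (measurable_fst.sub measurable_snd)).mul
        ((measurable_wt _).comp measurable_snd)
    · simp only [wt_rpow]
      rw [lintegral_sub_right_eq_self (fun σ => wt (-c * e.p) σ) τ, neg_mul]
    · simp only [ENNReal.mul_rpow_of_nonneg _ _ hq.le, wt_rpow, neg_mul]
      simpa using hC σ
  obtain ⟨D₁, hD₁⟩ := key (1 - c) (b - β) ⟨C₁, hC₁⟩
  obtain ⟨D₂, hD₂⟩ := key (1 - β - c) b ⟨C₂, hC₂⟩
  have hAt : A ^ e.p ≠ ∞ := ENNReal.rpow_ne_top_of_nonneg hp.le (by simp [hA])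
  have h2t : (2 : ℝ≥0∞) ^ (e.p - 1) ≠ ∞ :=
    ENNReal.rpow_ne_top_of_nonneg (by linarith [e.one_lt_p]) (by norm_num)
  refine ⟨(A ^ e.p * (2 ^ (e.p - 1) * (D₁ + D₂))).toNNReal, fun F hF => ?_⟩
  rw [ENNReal.coe_toNNReal (ENNReal.mul_ne_top hAt (ENNReal.mul_ne_top h2t (by simp)))]
  set g : ℝ → ℝ≥0∞ := fun τ => wt b τ * F τ with hg
  have hgm : Measurable g := by fun_prop
  set U₁ : ℝ → ℝ≥0∞ := fun σ =>
    ∫⁻ τ, wt (-c) (σ - τ) * (wt (-(1 - c)) (σ - τ) * wt (-(b - β)) τ) * g τ with hU₁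
  set U₂ : ℝ → ℝ≥0∞ := fun σ =>
    ∫⁻ τ, wt (-c) (σ - τ) * (wt (-(1 - β - c)) (σ - τ) * wt (-b) τ) * g τ with hU₂
  have hUm : ∀ x y, Measurable fun σ => ∫⁻ τ, wt (-c) (σ - τ) * (wt x (σ - τ) * wt y τ) * g τ := by
    intro x y
    refine Measurable.lintegral_prod_right'
      (f := fun z : ℝ × ℝ => wt (-c) (z.1 - z.2) * (wt x (z.1 - z.2) * wt y z.2) * g z.2) ?_
    fun_prop
  have hpt : ∀ σ, wt β σ * ∫⁻ τ, F τ * wt (-1) (τ - σ) ≤ A * (U₁ σ + U₂ σ) := by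
    intro σ
    rw [← lintegral_const_mul _ (by fun_prop), hU₁, hU₂, ← lintegral_add_left (by fun_prop),
      ← lintegral_const_mul _ (by fun_prop)]
    refine lintegral_mono fun τ => ?_
    have w1 : wt β σ ≤ A * (wt β (σ - τ) + wt β τ) := by
      have := wt_add_arg_le hβ (σ - τ) τ
      rwa [sub_add_cancel] at this
    have w2 : wt (-1) (τ - σ) = wt (-1) (σ - τ) := by rw [← wt_neg_arg, neg_sub]
    have w3 : ∀ y, wt (-c) y * wt (-(1 - c)) y = wt (-1) y := fun y => by
      rw [← wt_add]; congr 1; ring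
    have w4 : ∀ y, wt (-c) y * wt (-(1 - β - c)) y = wt β y * wt (-1) y := fun y => by
      rw [← wt_add, ← wt_add]; congr 1; ring
    have w5 : wt (-(b - β)) τ * wt b τ = wt β τ := by rw [← wt_add]; congr 1; ring
    have w6 : wt (-b) τ * wt b τ = 1 := by rw [mul_comm, wt_mul_wt_neg]
    calc wt β σ * (F τ * wt (-1) (τ - σ))
        ≤ A * (wt β (σ - τ) + wt β τ) * (F τ * wt (-1) (σ - τ)) := by
          rw [w2]; exact mul_le_mul' w1 le_rfl
      _ = A * ((wt (-c) (σ - τ) * wt (-(1 - c)) (σ - τ)) * (wt (-(b - β)) τ * wt b τ) * F τ +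
          (wt (-c) (σ - τ) * wt (-(1 - β - c)) (σ - τ)) * (wt (-b) τ * wt b τ) * F τ) := by
          rw [w3, w4, w5, w6]; ring
      _ = _ := by simp only [hg]; ring
  calc _ ≤ ∫⁻ σ, A ^ e.p * (2 ^ (e.p - 1) * (U₁ σ ^ e.p + U₂ σ ^ e.p)) := by
        refine lintegral_mono fun σ => ?_
        refine (ENNReal.rpow_le_rpow (hpt σ) hp.le).trans ?_
        rw [ENNReal.mul_rpow_of_nonneg _ _ hp.le]
        exact mul_le_mul' le_rfl (ENNReal.rpow_add_le_mul_rpow_add_rpow _ _ e.one_lt_p.le)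
    _ = A ^ e.p * (2 ^ (e.p - 1) * ((∫⁻ σ, U₁ σ ^ e.p) + ∫⁻ σ, U₂ σ ^ e.p)) := by
        rw [lintegral_const_mul' _ _ hAt, lintegral_const_mul' _ _ h2t,
          lintegral_add_left ((hUm _ _).pow_const _)]
    _ ≤ A ^ e.p * (2 ^ (e.p - 1) * (D₁ * (∫⁻ τ, g τ ^ e.p) + D₂ * ∫⁻ τ, g τ ^ e.p)) :=
        mul_le_mul' le_rfl (mul_le_mul' le_rfl (add_le_add (hD₁ g hgm) (hD₂ g hgm)))
    _ = _ := by ring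

lemma lintegral_mul_wt_lt_top (e : Exponents) {b : ℝ} (hb : 0 ≤ b) {F : ℝ → ℝ≥0∞}
    (hF : Measurable F) (h : ∫⁻ τ, (wt b τ * F τ) ^ e.p < ∞) (σ : ℝ) :
    ∫⁻ τ, F τ * wt (-1) (τ - σ) < ∞ := by
  have hp := e.p_pos
  have hq := e.q_pos
  have hH := ENNReal.lintegral_mul_le_Lp_mul_Lq volume e.holder (f := fun τ => wt b τ * F τ)
    (g := fun τ => wt (-1) (τ - σ)) (by fun_prop) (by fun_prop)
  refine lt_of_le_of_lt (lintegral_mono fun τ => ?_) (hH.trans_lt (ENNReal.mul_lt_top ?_ ?_))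
  · simp only [Pi.mul_apply]
    refine mul_le_mul' ?_ le_rfl
    calc F τ = 1 * F τ := (one_mul _).symm
      _ ≤ _ := mul_le_mul' (one_le_wt hb τ) le_rfl
  · exact ENNReal.rpow_lt_top_of_nonneg (by positivity) h.ne
  · refine ENNReal.rpow_lt_top_of_nonneg (by positivity) (ne_of_lt ?_)
    simp only [wt_rpow]
    rw [lintegral_sub_right_eq_self (fun τ => wt (-1 * e.q) τ) σ]
    exact lintegral_wt_lt_top (by linarith [e.one_lt_q])

lemma eX_eq_nX (s b p : ℝ) (f : ℤ → ℝ → ℂ) :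
    eX s b p f = nX s b p (fun n τ => f n (τ + disp n)) := by
  unfold eX nX
  congr 1
  refine tsum_congr fun n => ?_
  rw [← lintegral_add_right_eq_self _ (disp n)]
  refine lintegral_congr fun τ => ?_
  rw [ENNReal.ofReal_mul (Real.rpow_nonneg (jb_pos _).le _), add_sub_cancel_right]
  rfl

lemma eX_congr_ae {s b p : ℝ} {f g : ℤ → ℝ → ℂ} (h : ∀ n, f n =ᵐ[volume] g n) :
    eX s b p f = eX s b p g := by
  unfold eX
  congr 1
  refine tsum_congr fun n => lintegral_congr_ae ?_
  filter_upwards [h n] with τ hτ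
  rw [hτ]

lemma cutFT_interaction (t₀ t₁ : ℝ) (u : ℝ → ℤ → ℂ) (n : ℤ) (σ : ℝ) :
    cutFT t₀ t₁ (fun t => cexp (-(I * t * disp n)) * u t n) σ =
      ∫ r in t₀..t₁, cexp (-(I * r * ((σ + disp n : ℝ) : ℂ))) * u r n := by
  refine intervalIntegral.integral_congr fun r _ => ?_
  simp only
  rw [← mul_assoc, ← Complex.exp_add]
  congr 2
  push_cast; ring

/-- The bridge from the solution class to the norm of the fixed point. For any extension, the
transform over [t₀, t₁] in the interaction picture is a convolution of its transform with `kk`, so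
`exists_lintegral_conv_le` applies. The constant does not depend on the subinterval, which
uniqueness relies on. -/
lemma exists_nX_cutFT_le_eXT (e : Exponents) {β b : ℝ} (hβ : 0 ≤ β) (hβb : β < b)
    (hb : b < 1 / e.q) : ∃ C : ℝ≥0, ∀ (T t₀ t₁ : ℝ) (u : ℝ → ℤ → ℂ), 0 ≤ t₀ → t₀ ≤ t₁ → t₁ ≤ T →
      t₁ - t₀ ≤ 1 → (∀ n, ContinuousOn (fun t => u t n) (Set.Icc 0 T)) →
      nX e.s β e.p (fun n => cutFT t₀ t₁ (fun t => cexp (-(I * t * disp n)) * u t n)) ≤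
        C * eXT e.s b e.p T u := by
  obtain ⟨C, hC⟩ := exists_lintegral_conv_le e hβ hβb hb
  have hp := e.p_pos
  have hCt : (3 : ℝ≥0∞) * (C : ℝ≥0∞) ^ (1 / e.p) ≠ ∞ :=
    ENNReal.mul_ne_top (by norm_num)
      (ENNReal.rpow_ne_top_of_nonneg (by positivity) ENNReal.coe_ne_top)
  -- The summand 1 makes K nonzero, so that it may be divided out before passing to the infimum over
  -- the extensions.
  set K := (3 * (C : ℝ≥0∞) ^ (1 / e.p)).toNNReal + 1 with hK
  have hK0 : (K : ℝ≥0∞) ≠ 0 := by rw [hK]; simp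
  refine ⟨K, fun T t₀ t₁ u h0 h01 hT h1 hu => ?_⟩
  set G : ℤ → ℝ → ℂ := fun n => cutFT t₀ t₁ (fun t => cexp (-(I * t * disp n)) * u t n) with hG
  rw [mul_comm, ← ENNReal.div_le_iff_le_mul (.inl hK0) (.inl ENNReal.coe_ne_top)]
  refine le_iInf₂ fun f₀ hf₀ => le_iInf fun hext₀ => ?_
  rw [ENNReal.div_le_iff_le_mul (.inl hK0) (.inl ENNReal.coe_ne_top), mul_comm]
  set f : ℤ → ℝ → ℂ := fun n => (hf₀ n).mk (f₀ n) with hfdef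
  have hff : ∀ n, f₀ n =ᵐ[volume] f n := fun n => (hf₀ n).ae_eq_mk
  have hf : ∀ n, Measurable (f n) := fun n => (hf₀ n).stronglyMeasurable_mk.measurable
  have hext : IsExtension T f u := by
    intro n θ h1 h2 h3
    rw [← hext₀ n θ h1 h2 h3]
    congr 1
    refine integral_congr_ae ?_
    filter_upwards [hff n] with τ hτ
    rw [hτ]
  rw [eX_congr_ae hff]
  by_cases htop : eX e.s b e.p f = ∞
  · rw [htop, ENNReal.mul_top hK0]; exact le_top
  rw [eX_eq_nX] at htop ⊢
  set F : ℤ → ℝ → ℂ := fun n τ => f n (τ + disp n) with hF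
  have hFm : ∀ n, Measurable (F n) := fun n => (hf n).comp (measurable_add_const _)
  have hFp : ∀ n : ℤ, ∫⁻ τ, (wt b τ * ‖F n τ‖ₑ) ^ e.p < ∞ := by
    intro n
    have h2 : (nX e.s b e.p F) ^ e.p < ∞ :=
      ENNReal.rpow_lt_top_of_nonneg hp.le htop
    rw [nX_rpow hp] at h2
    have h3 := (ENNReal.le_tsum n).trans_lt h2
    simp only [mul_assoc, ENNReal.mul_rpow_of_nonneg (wt e.s n) _ hp.le] at h3
    rw [lintegral_const_mul' _ _ (ENNReal.rpow_ne_top_of_nonneg hp.le (wt_ne_top _ _))] at h3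
    refine lt_of_le_of_ne le_top fun h => ?_
    rw [h, ENNReal.mul_top] at h3
    · exact lt_irrefl _ h3
    · rw [wt_rpow]; exact wt_ne_zero _ _
  have hGF : ∀ n σ, ‖G n σ‖ₑ ≤ 3 * ∫⁻ τ, ‖F n τ‖ₑ * wt (-1) (τ - σ) := by
    intro n σ
    have hw : ∀ τ : ℝ, ‖(jb τ)⁻¹‖ₑ = wt (-1) τ := fun τ => by
      rw [Real.enorm_of_nonneg (inv_nonneg.2 (jb_pos _).le), wt, Real.rpow_neg_one]
    have hsh : ∫⁻ τ, ‖f n τ‖ₑ * wt (-1) (τ - (σ + disp n)) =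
        ∫⁻ τ, ‖F n τ‖ₑ * wt (-1) (τ - σ) := by
      rw [← lintegral_add_right_eq_self _ (disp n)]
      simp only [hF, add_sub_add_right_eq_sub]
    have hjm : Measurable jb := continuous_jb.measurable
    have hint : Integrable fun τ => ‖f n τ‖ * (3 * (jb (τ - (σ + disp n)))⁻¹) := by
      refine ⟨?_, ?_⟩
      · exact ((hf n).norm.mul ((hjm.comp (measurable_sub_const _)).inv.const_mul 3)).aestronglyMeasurable
      · rw [HasFiniteIntegral]
        simp only [enorm_mul, enorm_norm, hw]
        have h2 := lintegral_mul_wt_lt_top e (by linarith) (hFm n).enorm (hFp n) σ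
        rw [← hsh] at h2
        simp only [mul_left_comm _ ‖(3 : ℝ)‖ₑ]
        rw [lintegral_const_mul' _ _ enorm_ne_top]
        exact ENNReal.mul_lt_top enorm_lt_top h2
    rw [hG]
    change ‖cutFT t₀ t₁ (fun t => cexp (-(I * t * disp n)) * u t n) σ‖ₑ ≤ _
    rw [cutFT_interaction, integral_interval_of_isExtension h0 h01 hT h1 hext (hf n) (hu n) hint,
      enorm_mul, ← hsh]
    have h2π : ‖(2 * Real.pi : ℂ)⁻¹‖ₑ ≤ 1 := by
      rw [← ofReal_norm, ENNReal.ofReal_le_one, norm_inv, norm_mul, Complex.norm_real,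
        Real.norm_eq_abs, abs_of_pos Real.pi_pos]
      refine inv_le_one_of_one_le₀ ?_
      have := Real.pi_gt_three
      simp; linarith
    calc _ ≤ 1 * ∫⁻ τ, ‖f n τ * kk t₀ t₁ (τ - (σ + disp n))‖ₑ :=
          mul_le_mul' h2π (enorm_integral_le_lintegral_enorm _)
      _ ≤ ∫⁻ τ, 3 * (‖f n τ‖ₑ * wt (-1) (τ - (σ + disp n))) := by
          rw [one_mul]
          refine lintegral_mono fun τ => ?_
          rw [enorm_mul, mul_left_comm]
          exact mul_le_mul' le_rfl (enorm_kk_le (by rwa [abs_of_nonneg (by linarith)]) _)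
      _ = _ := lintegral_const_mul' _ _ (by norm_num)
  calc nX e.s β e.p G ≤ (∑' n : ℤ, ∫⁻ σ, (3 * (wt e.s n * (wt β σ *
        ∫⁻ τ, ‖F n τ‖ₑ * wt (-1) (τ - σ)))) ^ e.p) ^ (1 / e.p) := by
        refine ENNReal.rpow_le_rpow (ENNReal.tsum_le_tsum fun n => lintegral_mono fun σ => ?_)
          (by positivity)
        refine ENNReal.rpow_le_rpow ?_ hp.le
        refine (mul_le_mul' le_rfl (hGF n σ)).trans (le_of_eq ?_)
        ring
    _ ≤ (∑' n : ℤ, 3 ^ e.p * (wt e.s n ^ e.p *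
        (C * ∫⁻ τ, (wt b τ * ‖F n τ‖ₑ) ^ e.p))) ^ (1 / e.p) := by
        refine ENNReal.rpow_le_rpow (ENNReal.tsum_le_tsum fun n => ?_) (by positivity)
        simp only [ENNReal.mul_rpow_of_nonneg 3 _ hp.le, ENNReal.mul_rpow_of_nonneg (wt e.s n) _ hp.le]
        rw [lintegral_const_mul' _ _ (ENNReal.rpow_ne_top_of_nonneg hp.le (by norm_num)),
          lintegral_const_mul' _ _ (ENNReal.rpow_ne_top_of_nonneg hp.le (wt_ne_top _ _))]
        exact mul_le_mul' le_rfl (mul_le_mul' le_rfl (hC _ (hFm n).enorm))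
    _ = (3 ^ e.p * (C * (nX e.s b e.p F) ^ e.p)) ^ (1 / e.p) := by
        rw [nX_rpow hp, ENNReal.tsum_mul_left]
        congr 2
        rw [← ENNReal.tsum_mul_left]
        refine tsum_congr fun n => ?_
        simp only [mul_assoc, ENNReal.mul_rpow_of_nonneg (wt e.s n) _ hp.le]
        rw [lintegral_const_mul' _ _ (ENNReal.rpow_ne_top_of_nonneg hp.le (wt_ne_top _ _))]
        ring
    _ = (3 * (C : ℝ≥0∞) ^ (1 / e.p)) * nX e.s b e.p F := by
        have hp' : 0 ≤ 1 / e.p := by positivity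
        have hc : ∀ x : ℝ≥0∞, (x ^ e.p) ^ (1 / e.p) = x := fun x => by
          rw [← ENNReal.rpow_mul, mul_one_div_cancel hp.ne', ENNReal.rpow_one]
        rw [ENNReal.mul_rpow_of_nonneg _ _ hp', ENNReal.mul_rpow_of_nonneg _ _ hp', hc, hc, mul_assoc]
    _ ≤ K * nX e.s b e.p F := by
        refine mul_le_mul' ?_ le_rfl
        rw [hK, ENNReal.coe_add, ENNReal.coe_toNNReal hCt]
        exact le_self_add

/-- The restriction to [0, T], continued by zero, is one of the extensions in the infimum. -/
lemma eXT_le_nX {s b p T : ℝ} (hT : 0 ≤ T) {u : ℝ → ℤ → ℂ}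
    (hu : ∀ n, ContinuousOn (fun t => u t n) (Set.Icc 0 T)) :
    eXT s b p T u ≤
      nX s b p (fun n => cutFT 0 T (fun t => cexp (-(I * t * disp n)) * u t n)) := by
  refine (iInf₂_le_of_le (fun n => cutFT 0 T (fun t => u t n)) (fun n =>
    (continuous_cutFT hT ((hu n).integrableOn_Icc.mono_set
      Set.Ioc_subset_Icc_self)).aestronglyMeasurable) (iInf_le _ (isExtension_cutFT hT hu))).trans ?_
  rw [eX_eq_nX]
  refine le_of_eq (nX_congr_enorm _ _ _ fun n τ => ?_)
  rw [cutFT_interaction]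
  rfl

/-! ### The linear part of the equation in the interaction picture -/

/-- The path of the stochastic convolution in the interaction picture. -/
def noisePath (ψ : ℝ≥0 → ℤ → ℂ) (t : ℝ) (n : ℤ) : ℂ := cexp (-(I * t * disp n)) * ψ t.toNNReal n

/-- The paths of the stochastic convolution for which the equation can be solved. -/
structure GoodPath (e : Exponents) (ψ : ℝ≥0 → ℤ → ℂ) : Prop where
  continuous : ∀ n, Continuous fun t => ψ t n
  nS_lt_top : nS e.s e.p 0 1 (noisePath ψ) < ∞
  nX_lt_top : nX e.s e.b' e.p (fun n => cutFT 0 1 (fun t => noisePath ψ t n)) < ∞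

/-- The norm of the stochastic convolution on `[0, T]` which decides about the existence time. -/
def noiseNorm (e : Exponents) (T : ℝ) (ψ : ℝ≥0 → ℤ → ℂ) : ℝ≥0∞ :=
  nX e.s e.β e.p (fun n => cutFT 0 T (fun t => noisePath ψ t n))

lemma continuous_noisePath {ψ : ℝ≥0 → ℤ → ℂ} (hψ : ∀ n, Continuous fun t => ψ t n) (n : ℤ) :
    Continuous fun t => noisePath ψ t n :=
  Continuous.mul (by fun_prop) ((hψ n).comp continuous_real_toNNReal)

/-- In the interaction picture the free evolution is constant in time. Its transform over [0, T] has
size |û₀(n)|/⟨τ⟩, and ⟨τ⟩^{β-1} is in L^p. -/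
lemma exists_nX_cutFT_const_le (e : Exponents) {β : ℝ} (hβ : β < 1 / e.q) :
    ∃ C : ℝ≥0, ∀ (T : ℝ) (u₀ : ℤ → ℂ), 0 ≤ T → T ≤ 1 →
      nX e.s β e.p (fun n => cutFT 0 T (fun _ => u₀ n)) ≤ C * eFL e.s e.p u₀ := by
  have hp := e.p_pos
  have hJ : ∫⁻ x, wt ((β - 1) * e.p) x < ∞ := lintegral_wt_lt_top (e.sub_one_mul_p_lt hβ)
  set J := ∫⁻ x, wt ((β - 1) * e.p) x with hJd
  refine ⟨(3 * J ^ (1 / e.p)).toNNReal, fun T u₀ h0 h1 => ?_⟩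
  rw [ENNReal.coe_toNNReal (ENNReal.mul_ne_top (by norm_num)
    (ENNReal.rpow_ne_top_of_nonneg (by positivity) hJ.ne))]
  have hb : ∀ (n : ℤ) (τ : ℝ), wt e.s n * wt β τ * ‖cutFT 0 T (fun _ => u₀ n) τ‖ₑ ≤
      3 * (wt e.s n * ‖u₀ n‖ₑ) * wt (β - 1) τ := by
    intro n τ
    have : cutFT 0 T (fun _ => u₀ n) τ = kk 0 T (-τ) * u₀ n := by
      rw [cutFT, kk, ← intervalIntegral.integral_mul_const]
      refine intervalIntegral.integral_congr fun r _ => ?_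
      congr 2
      push_cast; ring
    rw [this, enorm_mul]
    calc _ ≤ wt e.s n * wt β τ * (3 * wt (-1) (-τ) * ‖u₀ n‖ₑ) :=
          mul_le_mul' le_rfl (mul_le_mul' (enorm_kk_le (by rwa [sub_zero, abs_of_nonneg h0]) _) le_rfl)
      _ = _ := by rw [wt_neg_arg, sub_eq_add_neg, wt_add]; ring
  calc _ ≤ (∑' n : ℤ, ∫⁻ τ, (3 * (wt e.s n * ‖u₀ n‖ₑ) * wt (β - 1) τ) ^ e.p) ^ (1 / e.p) :=
        ENNReal.rpow_le_rpow (ENNReal.tsum_le_tsum fun n => lintegral_mono fun τ =>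
          ENNReal.rpow_le_rpow (hb n τ) hp.le) (by positivity)
    _ = (∑' n : ℤ, (3 * J ^ (1 / e.p) * (wt e.s n * ‖u₀ n‖ₑ)) ^ e.p) ^ (1 / e.p) := by
        congr 1
        refine tsum_congr fun n => ?_
        simp only [ENNReal.mul_rpow_of_nonneg _ _ hp.le, wt_rpow]
        rw [lintegral_const_mul _ (measurable_wt _), ← hJd, ← ENNReal.rpow_mul,
          one_div_mul_cancel hp.ne', ENNReal.rpow_one]
        ring
    _ = _ := by rw [lp_const_mul hp]; rfl

/-! ### The fixed point argument -/

/-- The right hand side of the equation in the interaction picture. -/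
def mildMap (t : ℝ) (n : ℤ) (u₀ : ℤ → ℂ) (ψ : ℝ≥0 → ℤ → ℂ) (F : ℤ → ℝ → ℂ) : ℂ :=
  u₀ n - I * noisePath ψ t n + I * duh3 0 t n F

lemma continuousOn_duh3 (e : Exponents) {T : ℝ} (h1 : T ≤ 1) {F : ℤ → ℝ → ℂ}
    (hF : ∀ n, Measurable (F n)) (nF : nX e.s e.β e.p F < ∞) (n : ℤ) :
    ContinuousOn (fun t => duh3 0 t n F) (Set.Icc 0 T) :=
  continuousOn_duh hF hF hF (triAbs_lt_top e hF hF hF nF nF nF n) (by linarith)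

lemma continuousOn_mildMap (e : Exponents) {T : ℝ} (h1 : T ≤ 1) {ψ : ℝ≥0 → ℤ → ℂ}
    (hψ : ∀ n, Continuous fun t => ψ t n) (u₀ : ℤ → ℂ) {F : ℤ → ℝ → ℂ}
    (hF : ∀ n, Measurable (F n)) (nF : nX e.s e.β e.p F < ∞) (n : ℤ) :
    ContinuousOn (fun t => mildMap t n u₀ ψ F) (Set.Icc 0 T) :=
  (continuousOn_const.sub (continuousOn_const.mul (continuous_noisePath hψ n).continuousOn)).add
    (continuousOn_const.mul (continuousOn_duh3 e h1 hF nF n))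

lemma measurable_cutFT_mildMap (e : Exponents) {T : ℝ} (h0 : 0 ≤ T) (h1 : T ≤ 1)
    {ψ : ℝ≥0 → ℤ → ℂ} (hψ : ∀ n, Continuous fun t => ψ t n) (u₀ : ℤ → ℂ) {F : ℤ → ℝ → ℂ}
    (hF : ∀ n, Measurable (F n)) (nF : nX e.s e.β e.p F < ∞) (n : ℤ) :
    Measurable (cutFT 0 T (fun t => mildMap t n u₀ ψ F)) :=
  (continuous_cutFT h0 ((continuousOn_mildMap e h1 hψ u₀ hF nF n).integrableOn_Icc.mono_set
    Set.Ioc_subset_Icc_self)).measurable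

lemma cutFT_mildMap_sub (e : Exponents) {T : ℝ} (h0 : 0 ≤ T) (h1 : T ≤ 1) {ψ : ℝ≥0 → ℤ → ℂ}
    (hψ : ∀ n, Continuous fun t => ψ t n) (u₀ v₀ : ℤ → ℂ) {F G : ℤ → ℝ → ℂ}
    (hF : ∀ n, Measurable (F n)) (hG : ∀ n, Measurable (G n)) (nF : nX e.s e.β e.p F < ∞)
    (nG : nX e.s e.β e.p G < ∞) (n : ℤ) (τ : ℝ) :
    cutFT 0 T (fun t => mildMap t n u₀ ψ F) τ - cutFT 0 T (fun t => mildMap t n v₀ ψ G) τ =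
      cutFT 0 T (fun _ => u₀ n - v₀ n) τ +
        I * cutFT 0 T (fun t => duh3 0 t n F - duh3 0 t n G) τ := by
  have hi : ∀ {f : ℝ → ℂ}, ContinuousOn f (Set.Icc 0 T) → IntervalIntegrable f volume 0 T :=
    fun hf => ContinuousOn.intervalIntegrable (by rwa [Set.uIcc_of_le h0])
  have c1 := continuousOn_duh3 e h1 hF nF n
  have c2 := continuousOn_duh3 e h1 hG nG n
  rw [← cutFT_sub (hi (continuousOn_mildMap e h1 hψ u₀ hF nF n))
    (hi (continuousOn_mildMap e h1 hψ v₀ hG nG n)), ← cutFT_const_mul,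
    ← cutFT_add (f := fun _ => u₀ n - v₀ n) (g := fun t => I * (duh3 0 t n F - duh3 0 t n G))
    (hi continuousOn_const) (hi (continuousOn_const.mul (c1.sub c2)))]
  congr 1
  funext t
  simp only [mildMap]
  ring

/-- The constant in the difference estimates for the Duhamel operator. -/
def duhConst (e : Exponents) : ℝ≥0 := (exists_nX_duh3_sub_le e).choose

lemma nX_duh3_sub_le (e : Exponents) {T : ℝ} (h0 : 0 ≤ T) (h1 : T ≤ 1) {F G : ℤ → ℝ → ℂ}
    (hF : ∀ n, Measurable (F n)) (hG : ∀ n, Measurable (G n))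
    (nF : nX e.s e.β e.p F < ∞) (nG : nX e.s e.β e.p G < ∞) :
    nX e.s e.b e.p (fun n => cutFT 0 T (fun t => duh3 0 t n F - duh3 0 t n G)) ≤
      duhConst e * ENNReal.ofReal (T ^ e.θ) *
        ((nX e.s e.β e.p F + nX e.s e.β e.p G) ^ 2 * nX e.s e.β e.p (F - G)) := by
  have := (exists_nX_duh3_sub_le e).choose_spec 0 T F G h0 (by linarith) hF hG nF nG
  rwa [sub_zero] at this

/-- The constant in the estimate for the free evolution. -/
def dataConst (e : Exponents) : ℝ≥0 :=
  (exists_nX_cutFT_const_le e (e.β_lt_b.trans (e.b_lt_b'.trans e.b'_lt))).choose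

lemma nX_cutFT_const_le (e : Exponents) {T : ℝ} (h0 : 0 ≤ T) (h1 : T ≤ 1) (u₀ : ℤ → ℂ) :
    nX e.s e.β e.p (fun n => cutFT 0 T (fun _ => u₀ n)) ≤ dataConst e * eFL e.s e.p u₀ :=
  (exists_nX_cutFT_const_le e (e.β_lt_b.trans (e.b_lt_b'.trans e.b'_lt))).choose_spec T u₀ h0 h1

/-- The bound on the size of the linear part of the equation. -/
def linNorm (e : Exponents) (R : ℝ≥0∞) (T : ℝ) (ψ : ℝ≥0 → ℤ → ℂ) : ℝ≥0∞ :=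
  dataConst e * R + noiseNorm e T ψ

/-- The quantity whose smallness allows to solve the equation on `[0, T]`. -/
def smallness (e : Exponents) (R : ℝ≥0∞) (T : ℝ) (ψ : ℝ≥0 → ℤ → ℂ) : ℝ≥0∞ :=
  32 * (duhConst e + 1) * ENNReal.ofReal (T ^ e.θ) * linNorm e R T ψ ^ 2

/-- The summand 1 next to `duhConst` in `smallness` keeps the coefficient of the square positive, so
the condition by itself excludes an infinite norm. -/
lemma linNorm_lt_top {e : Exponents} {R : ℝ≥0∞} {T : ℝ} (hT : 0 < T) {ψ : ℝ≥0 → ℤ → ℂ}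
    (h : smallness e R T ψ ≤ 1) : linNorm e R T ψ < ∞ := by
  refine lt_of_le_of_ne le_top fun h' => ?_
  rw [smallness, h', ENNReal.top_pow (by norm_num), ENNReal.mul_top] at h
  · exact absurd h (by simp)
  · have : ENNReal.ofReal (T ^ e.θ) ≠ 0 := by
      rw [Ne, ENNReal.ofReal_eq_zero, not_le]
      positivity
    simp [this]

lemma contraction_const_le {e : Exponents} {R : ℝ≥0∞} {T : ℝ} {ψ : ℝ≥0 → ℤ → ℂ}
    (h : smallness e R T ψ ≤ 1) {x y : ℝ≥0∞} (hx : x ≤ 2 * linNorm e R T ψ)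
    (hy : y ≤ 2 * linNorm e R T ψ) :
    duhConst e * ENNReal.ofReal (T ^ e.θ) * (x + y) ^ 2 ≤ 2⁻¹ := by
  -- On the ball of radius 2L the sum of two norms is at most 4L, and 2 · 4² = 32 is the constant in
  -- `smallness`.
  have h2 : 2 * (duhConst e * ENNReal.ofReal (T ^ e.θ) * (x + y) ^ 2) ≤ 1 := by
    refine le_trans ?_ h
    calc 2 * (duhConst e * ENNReal.ofReal (T ^ e.θ) * (x + y) ^ 2)
        ≤ 2 * ((duhConst e + 1) * ENNReal.ofReal (T ^ e.θ) *
          (2 * linNorm e R T ψ + 2 * linNorm e R T ψ) ^ 2) := by gcongr; exact le_self_add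
      _ = _ := by rw [smallness]; ring
  rw [← one_div, ENNReal.le_div_iff_mul_le (by simp) (by simp), mul_comm]
  exact h2

/-- Completeness of L^p for the weighted functions; the limit is then divided by the weight, which
vanishes nowhere. -/
lemma exists_limit_of_contraction (e : Exponents) {F : ℕ → ℤ → ℝ → ℂ} {r : ℝ≥0∞} (hr : r < ∞)
    (hF : ∀ k n, Measurable (F k n)) (hn : ∀ k, nX e.s e.β e.p (F k) < ∞)
    (hd : ∀ k, nX e.s e.β e.p (F (k + 1) - F k) ≤ 2⁻¹ ^ k * r) :
    ∃ G : ℤ → ℝ → ℂ, (∀ n, Measurable (G n)) ∧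
      Tendsto (fun k => nX e.s e.β e.p (F k - G)) atTop (𝓝 0) := by
  have hp := e.p_pos
  have hp1 : 1 ≤ ENNReal.ofReal e.p := by simpa using e.one_lt_p.le
  have hm : ∀ k, Measurable (weighted e.s e.β (F k)) := fun k => measurable_weighted (hF k) _ _
  have hlp : ∀ k, MemLp (weighted e.s e.β (F k)) (ENNReal.ofReal e.p) μ1 := fun k =>
    ⟨(hm k).aestronglyMeasurable, by rw [← nX_eq_eLpNorm (hF k) _ _ hp]; exact hn k⟩
  have hsub : ∀ A B : ℤ → ℝ → ℂ, (∀ n, Measurable (A n)) → (∀ n, Measurable (B n)) →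
      eLpNorm (weighted e.s e.β A - weighted e.s e.β B) (ENNReal.ofReal e.p) μ1 =
        nX e.s e.β e.p (A - B) := by
    intro A B hA hB
    rw [← weighted_sub, nX_eq_eLpNorm (F := A - B) (fun n => (hA n).sub (hB n)) _ _ hp]
  have htail : ∀ N j, nX e.s e.β e.p (F (N + j) - F N) ≤ 2⁻¹ ^ N * (2 * r) := by
    intro N j
    have key : nX e.s e.β e.p (F (N + j) - F N) ≤ ∑ i ∈ Finset.range j, 2⁻¹ ^ (N + i) * r := by
      induction j with
      | zero => simp [nX, hp]
      | succ j ih =>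
        rw [Finset.sum_range_succ]
        have : F (N + (j + 1)) - F N = (F (N + j) - F N) + (F (N + j + 1) - F (N + j)) := by
          rw [← add_assoc]; abel
        rw [this]
        exact (nX_add_le (fun n => (hF _ n).sub (hF _ n)) (fun n => (hF _ n).sub (hF _ n)) _ _
          e.one_lt_p.le).trans (add_le_add ih (hd _))
    refine key.trans ?_
    calc _ = 2⁻¹ ^ N * ((∑ i ∈ Finset.range j, 2⁻¹ ^ i) * r) := by
          rw [Finset.sum_mul, Finset.mul_sum]
          refine Finset.sum_congr rfl fun i _ => ?_
          rw [pow_add]; ring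
      _ ≤ 2⁻¹ ^ N * (2 * r) := by
          gcongr
          refine (ENNReal.sum_le_tsum _).trans ?_
          rw [ENNReal.tsum_geometric, ENNReal.one_sub_inv_two, inv_inv]
  obtain ⟨f, hf, hlim⟩ := Lp.cauchy_complete_eLpNorm hp1 hlp
    -- Two tails of size 2^{-N} · 2r add up to 2^{-N} · 4r; the extra 1 makes the required
    -- inequality strict even when r = 0.
    (B := fun N => 2⁻¹ ^ N * (4 * r + 1)) (by
      rw [ENNReal.tsum_mul_right, ENNReal.tsum_geometric, ENNReal.one_sub_inv_two, inv_inv]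
      exact ENNReal.mul_ne_top (by norm_num) (by finiteness)) (by
      intro N n m hn' hm'
      obtain ⟨i, rfl⟩ := Nat.exists_eq_add_of_le hn'
      obtain ⟨j, rfl⟩ := Nat.exists_eq_add_of_le hm'
      rw [hsub _ _ (hF _) (hF _)]
      have : F (N + i) - F (N + j) = (F (N + i) - F N) - (F (N + j) - F N) := by abel
      rw [this]
      refine ((nX_sub_le (fun n => (hF _ n).sub (hF _ n)) (fun n => (hF _ n).sub (hF _ n)) _ _
          e.one_lt_p.le).trans (add_le_add (htail N i) (htail N j))).trans_lt ?_
      rw [← mul_add]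
      refine (ENNReal.mul_lt_mul_iff_right (by simp) (by finiteness)).2 ?_
      rw [← two_mul, ← mul_assoc]
      norm_num
      exact ENNReal.lt_add_right (by finiteness) (by simp))
  set g := hf.1.mk f with hg
  have hgm : Measurable g := hf.1.stronglyMeasurable_mk.measurable
  set G : ℤ → ℝ → ℂ := fun n τ => ((jb n ^ e.s * jb τ ^ e.β : ℝ) : ℂ)⁻¹ * g (n, τ) with hG
  have hGm : ∀ n, Measurable (G n) := fun n => by
    have h1 := (measurable_weight e.s e.β).comp
      (measurable_prodMk_left : Measurable fun τ : ℝ => (n, τ))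
    exact h1.inv.mul (hgm.comp measurable_prodMk_left)
  have hGg : weighted e.s e.β G = g := by
    funext y
    have : ((jb y.1 ^ e.s * jb y.2 ^ e.β : ℝ) : ℂ) ≠ 0 := by
      have a1 := Real.rpow_pos_of_pos (jb_pos y.1) e.s
      have a2 := Real.rpow_pos_of_pos (jb_pos y.2) e.β
      exact_mod_cast (mul_pos a1 a2).ne'
    simp only [weighted, hG]
    rw [mul_inv_cancel_left₀ this]
  refine ⟨G, hGm, hlim.congr fun k => ?_⟩
  rw [← hsub _ _ (hF k) hGm, hGg]
  exact eLpNorm_congr_ae (by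
    filter_upwards [hf.1.ae_eq_mk] with y hy
    simp [hy, hg])

lemma enorm_I : ‖(I : ℂ)‖ₑ = 1 := by rw [← ofReal_norm, norm_I, ENNReal.ofReal_one]

lemma wt_mul_enorm_le_nS {s p t₀ t₁ : ℝ} (hp : 0 < p) (a : ℝ → ℤ → ℂ) {t : ℝ}
    (ht : t ∈ Set.Icc t₀ t₁) (n : ℤ) : wt s n * ‖a t n‖ₑ ≤ nS s p t₀ t₁ a := by
  have h1 : wt s n * ‖a t n‖ₑ ≤ wt s n * ⨆ t ∈ Set.Icc t₀ t₁, ‖a t n‖ₑ :=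
    mul_le_mul' le_rfl (le_iSup₂ (f := fun t (_ : t ∈ Set.Icc t₀ t₁) => ‖a t n‖ₑ) t ht)
  refine h1.trans ?_
  rw [nS, one_div, ENNReal.le_rpow_inv_iff hp]
  exact ENNReal.le_tsum (f := fun n : ℤ => (wt s n * ⨆ t ∈ Set.Icc t₀ t₁, ‖a t n‖ₑ) ^ p) n

lemma eq_zero_of_nS_eq_zero {s p t₀ t₁ : ℝ} (hp : 0 < p) {a : ℝ → ℤ → ℂ}
    (h : nS s p t₀ t₁ a = 0) {t : ℝ} (ht : t ∈ Set.Icc t₀ t₁) (n : ℤ) : a t n = 0 := by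
  have := (wt_mul_enorm_le_nS hp a ht n).trans h.le
  rw [nonpos_iff_eq_zero, mul_eq_zero] at this
  simpa [wt_ne_zero] using this

/-- A fixed point in the norm determines its transform almost everywhere only. The Duhamel term does
not see null sets, so the equation can still be recovered at every time and every frequency. -/
lemma duh3_eq_of_nX_sub_eq_zero (e : Exponents) {t₀ t₁ : ℝ} (h1 : t₁ - t₀ ≤ 1) {F G : ℤ → ℝ → ℂ}
    (hF : ∀ n, Measurable (F n)) (hG : ∀ n, Measurable (G n))
    (nF : nX e.s e.β e.p F < ∞) (nG : nX e.s e.β e.p G < ∞)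
    (h : nX e.s e.β e.p (F - G) = 0) {t : ℝ} (ht : t ∈ Set.Icc t₀ t₁) (n : ℤ) :
    duh3 t₀ t n F = duh3 t₀ t n G := by
  obtain ⟨C, hC⟩ := exists_nS_duh3_sub_le e
  have h2 := hC t₀ t₁ F G h1 hF hG nF nG
  rw [h, mul_zero, mul_zero, nonpos_iff_eq_zero] at h2
  exact sub_eq_zero.1 (eq_zero_of_nS_eq_zero e.p_pos h2 ht n)

lemma nX_mild_sub_le (e : Exponents) {T : ℝ} (h0 : 0 ≤ T) (h1 : T ≤ 1) {ψ : ℝ≥0 → ℤ → ℂ}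
    (hψ : ∀ n, Continuous fun t => ψ t n) (u₀ v₀ : ℤ → ℂ) {F G : ℤ → ℝ → ℂ}
    (hF : ∀ n, Measurable (F n)) (hG : ∀ n, Measurable (G n)) (nF : nX e.s e.β e.p F < ∞)
    (nG : nX e.s e.β e.p G < ∞) (b : ℝ) :
    nX e.s b e.p ((fun n => cutFT 0 T (fun t => mildMap t n u₀ ψ F)) -
        fun n => cutFT 0 T (fun t => mildMap t n v₀ ψ G)) ≤
      nX e.s b e.p (fun n => cutFT 0 T (fun _ => (u₀ - v₀) n)) +
        nX e.s b e.p (fun n => cutFT 0 T (fun t => duh3 0 t n F - duh3 0 t n G)) := by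
  have e1 : ((fun n => cutFT 0 T (fun t => mildMap t n u₀ ψ F)) -
        fun n => cutFT 0 T (fun t => mildMap t n v₀ ψ G)) =
      (fun n => cutFT 0 T (fun _ => (u₀ - v₀) n)) +
        fun n τ => I * cutFT 0 T (fun t => duh3 0 t n F - duh3 0 t n G) τ := by
    funext n τ
    exact cutFT_mildMap_sub e h0 h1 hψ u₀ v₀ hF hG nF nG n τ
  have hm : ∀ n, Measurable (cutFT 0 T (fun t => duh3 0 t n F - duh3 0 t n G)) := fun n =>
    (continuous_cutFT h0 (((continuousOn_duh3 e h1 hF nF n).sub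
      (continuousOn_duh3 e h1 hG nG n)).integrableOn_Icc.mono_set
        Set.Ioc_subset_Icc_self)).measurable
  have hm0 : ∀ n, Measurable (cutFT 0 T (fun _ => (u₀ - v₀) n)) := fun n =>
    (continuous_cutFT h0 (integrableOn_const (by simp))).measurable
  rw [e1]
  refine (nX_add_le hm0 (fun n => (hm n).const_mul I) _ _ e.one_lt_p.le).trans ?_
  rw [nX_const_mul I e.p_pos, enorm_I, one_mul]

lemma nX_zero {s b p : ℝ} (hp : 0 < p) : nX s b p 0 = 0 := by
  simp [nX, hp]

lemma nX_mild_contraction (e : Exponents) {R : ℝ≥0∞} {T : ℝ} (h0 : 0 ≤ T) (h1 : T ≤ 1)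
    {ψ : ℝ≥0 → ℤ → ℂ} (hψ : ∀ n, Continuous fun t => ψ t n) (hs : smallness e R T ψ ≤ 1)
    (u₀ v₀ : ℤ → ℂ) {F G : ℤ → ℝ → ℂ} (hF : ∀ n, Measurable (F n)) (hG : ∀ n, Measurable (G n))
    (hL : linNorm e R T ψ < ∞)
    (nF : nX e.s e.β e.p F ≤ 2 * linNorm e R T ψ) (nG : nX e.s e.β e.p G ≤ 2 * linNorm e R T ψ) :
    nX e.s e.β e.p ((fun n => cutFT 0 T (fun t => mildMap t n u₀ ψ F)) -
        fun n => cutFT 0 T (fun t => mildMap t n v₀ ψ G)) ≤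
      dataConst e * eFL e.s e.p (u₀ - v₀) + 2⁻¹ * nX e.s e.β e.p (F - G) := by
  have nF' : nX e.s e.β e.p F < ∞ := nF.trans_lt (by finiteness)
  have nG' : nX e.s e.β e.p G < ∞ := nG.trans_lt (by finiteness)
  refine (nX_mild_sub_le e h0 h1 hψ u₀ v₀ hF hG nF' nG' e.β).trans
    (add_le_add (nX_cutFT_const_le e h0 h1 _) ?_)
  refine (nX_mono e.p_pos e.β_lt_b.le fun _ _ => le_rfl).trans
    ((nX_duh3_sub_le e h0 h1 hF hG nF' nG').trans ?_)
  rw [← mul_assoc]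
  exact mul_le_mul' (contraction_const_le hs nF nG) le_rfl

lemma duh3_zero (t₀ t : ℝ) (n : ℤ) : duh3 t₀ t n 0 = 0 := by
  simp [duh3, duh, triForm, triFun]

lemma nX_mild_zero_le (e : Exponents) {R : ℝ≥0∞} {T : ℝ} (h0 : 0 ≤ T) (h1 : T ≤ 1)
    {ψ : ℝ≥0 → ℤ → ℂ} (hψ : ∀ n, Continuous fun t => ψ t n) {u₀ : ℤ → ℂ}
    (hu : eFL e.s e.p u₀ ≤ R) :
    nX e.s e.β e.p (fun n => cutFT 0 T (fun t => mildMap t n u₀ ψ 0)) ≤ linNorm e R T ψ := by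
  have hy : ∀ n, IntegrableOn (fun t => noisePath ψ t n) (Set.Ioc 0 T) := fun n =>
    ((continuous_noisePath hψ n).integrableOn_Icc).mono_set Set.Ioc_subset_Icc_self
  have e1 : (fun n => cutFT 0 T (fun t => mildMap t n u₀ ψ 0)) =
      (fun n => cutFT 0 T (fun _ => u₀ n)) - fun n τ => I * cutFT 0 T (fun t => noisePath ψ t n) τ := by
    funext n τ
    have hi : IntervalIntegrable (fun t => I * noisePath ψ t n) volume 0 T :=
      ((continuous_noisePath hψ n).const_mul I).intervalIntegrable _ _
    simp only [Pi.sub_apply, mildMap, duh3_zero, mul_zero, add_zero]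
    rw [← cutFT_const_mul, ← cutFT_sub intervalIntegrable_const hi]
  rw [e1, linNorm, noiseNorm]
  refine (nX_sub_le (fun n => (continuous_cutFT h0 (integrableOn_const (by simp))).measurable)
    (fun n => (continuous_cutFT h0 (hy n)).measurable.const_mul I) _ _ e.one_lt_p.le).trans
    (add_le_add ?_ ?_)
  · exact (nX_cutFT_const_le e h0 h1 u₀).trans (mul_le_mul' le_rfl hu)
  · rw [nX_const_mul I e.p_pos, enorm_I, one_mul]

/-- Picard iteration for the transform, starting from 0, in the ball of radius twice the size of the
linear part. The map is a contraction with factor 1/2 there by the choice of `smallness`. -/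
lemma exists_interaction_solution (e : Exponents) {R : ℝ≥0∞} {T : ℝ} (hT : 0 < T) (h1 : T ≤ 1)
    {ψ : ℝ≥0 → ℤ → ℂ} (hψ : ∀ n, Continuous fun t => ψ t n) (hs : smallness e R T ψ ≤ 1)
    {u₀ : ℤ → ℂ} (hu : eFL e.s e.p u₀ ≤ R) :
    ∃ a : ℝ → ℤ → ℂ, (∀ n, ContinuousOn (fun t => a t n) (Set.Icc 0 T)) ∧
      nX e.s e.β e.p (fun n => cutFT 0 T (fun t => a t n)) ≤ 2 * linNorm e R T ψ ∧
      ∀ t ∈ Set.Icc 0 T, ∀ n, a t n =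
        mildMap t n u₀ ψ (fun n => cutFT 0 T (fun t => a t n)) := by
  have h0 := hT.le
  have hL := linNorm_lt_top hT hs
  set L := linNorm e R T ψ with hLd
  have hL2 : 2 * L < ∞ := by finiteness
  set Φ : (ℤ → ℝ → ℂ) → ℤ → ℝ → ℂ := fun F n => cutFT 0 T (fun t => mildMap t n u₀ ψ F) with hΦ
  have hm : ∀ F, (∀ n, Measurable (F n)) → nX e.s e.β e.p F ≤ 2 * L → ∀ n, Measurable (Φ F n) :=
    fun F hF nF => measurable_cutFT_mildMap e h0 h1 hψ u₀ hF (nF.trans_lt hL2)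
  have hcon : ∀ F G, (∀ n, Measurable (F n)) → (∀ n, Measurable (G n)) →
      nX e.s e.β e.p F ≤ 2 * L → nX e.s e.β e.p G ≤ 2 * L →
      nX e.s e.β e.p (Φ F - Φ G) ≤ 2⁻¹ * nX e.s e.β e.p (F - G) := by
    intro F G hF hG nF nG
    have := nX_mild_contraction e h0 h1 hψ hs u₀ u₀ hF hG hL nF nG
    have hz : eFL e.s e.p (u₀ - u₀) = 0 := by simp [eFL, e.p_pos]
    rwa [hz, mul_zero, zero_add] at this
  have hz : ∀ n : ℤ, Measurable ((0 : ℤ → ℝ → ℂ) n) := fun n => measurable_const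
  have nz : nX e.s e.β e.p 0 ≤ 2 * L := by rw [nX_zero e.p_pos]; exact zero_le
  have hΦ0 : nX e.s e.β e.p (Φ 0) ≤ L := nX_mild_zero_le e h0 h1 hψ hu
  have hball : ∀ F, (∀ n, Measurable (F n)) → nX e.s e.β e.p F ≤ 2 * L →
      nX e.s e.β e.p (Φ F) ≤ 2 * L := by
    intro F hF nF
    have e1 : Φ F = (Φ F - Φ 0) + Φ 0 := by abel
    rw [e1]
    refine (nX_add_le (fun n => (hm F hF nF n).sub (hm 0 hz nz n)) (hm 0 hz nz) _ _
      e.one_lt_p.le).trans ?_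
    refine (add_le_add (hcon F 0 hF hz nF nz) hΦ0).trans ?_
    rw [sub_zero, two_mul]
    refine add_le_add ?_ le_rfl
    calc 2⁻¹ * nX e.s e.β e.p F ≤ 2⁻¹ * (2 * L) := mul_le_mul' le_rfl nF
      _ = L := by rw [← mul_assoc, ENNReal.inv_mul_cancel (by simp) (by simp), one_mul]
  set F : ℕ → ℤ → ℝ → ℂ := fun k => Φ^[k] 0 with hFd
  have hFs : ∀ k, F (k + 1) = Φ (F k) := fun k => Function.iterate_succ_apply' _ _ _
  have hFB : ∀ k, (∀ n, Measurable (F k n)) ∧ nX e.s e.β e.p (F k) ≤ 2 * L := by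
    intro k
    induction k with
    | zero => exact ⟨hz, nz⟩
    | succ k ih => rw [hFs]; exact ⟨hm _ ih.1 ih.2, hball _ ih.1 ih.2⟩
  have hd : ∀ k, nX e.s e.β e.p (F (k + 1) - F k) ≤ 2⁻¹ ^ k * L := by
    intro k
    induction k with
    | zero =>
      rw [hFs]
      change nX e.s e.β e.p (Φ 0 - 0) ≤ _
      simpa using hΦ0
    | succ k ih =>
      rw [hFs (k + 1), hFs k, pow_succ', mul_assoc]
      refine (hcon _ _ (hm _ (hFB k).1 (hFB k).2) (hFB k).1 (hball _ (hFB k).1 (hFB k).2)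
        (hFB k).2).trans (mul_le_mul' le_rfl ?_)
      rw [← hFs]
      exact ih
  obtain ⟨G, hG, hlim⟩ := exists_limit_of_contraction e hL (fun k => (hFB k).1)
    (fun k => (hFB k).2.trans_lt hL2) hd
  have hnG : nX e.s e.β e.p G ≤ 2 * L := by
    have h2 : ∀ k, nX e.s e.β e.p G ≤ 2 * L + nX e.s e.β e.p (F k - G) := by
      intro k
      have e1 : G = F k - (F k - G) := by abel
      conv_lhs => rw [e1]
      exact (nX_sub_le (hFB k).1 (fun n => ((hFB k).1 n).sub (hG n)) _ _ e.one_lt_p.le).trans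
        (add_le_add (hFB k).2 le_rfl)
    have h3 := (tendsto_const_nhds (x := 2 * L)).add hlim
    rw [add_zero] at h3
    exact ge_of_tendsto' h3 h2
  have hfix : nX e.s e.β e.p (G - Φ G) = 0 := by
    have h2 : ∀ k, nX e.s e.β e.p (G - Φ G) ≤
        nX e.s e.β e.p (F k - G) + nX e.s e.β e.p (F (k + 1) - G) := by
      intro k
      have e1 : G - Φ G = (Φ (F k) - Φ G) - (F (k + 1) - G) := by rw [hFs]; abel
      rw [e1]
      refine (nX_sub_le (fun n => (hm _ (hFB k).1 (hFB k).2 n).sub (hm _ hG hnG n))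
        (fun n => ((hFB (k + 1)).1 n).sub (hG n)) _ _ e.one_lt_p.le).trans (add_le_add ?_ le_rfl)
      refine (hcon _ _ (hFB k).1 hG (hFB k).2 hnG).trans ?_
      exact mul_le_of_le_one_left zero_le (by simp)
    have h3 := hlim.add (hlim.comp (tendsto_add_atTop_nat 1))
    rw [add_zero] at h3
    exact le_antisymm (ge_of_tendsto' h3 h2) zero_le
  -- The solution is the right-hand side evaluated at G, not an inverse transform of G: it is
  -- defined and continuous pointwise, and its own transform agrees with G up to null sets.
  refine ⟨fun t n => mildMap t n u₀ ψ G,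
    fun n => continuousOn_mildMap e h1 hψ u₀ hG (hnG.trans_lt hL2) n, hball G hG hnG, ?_⟩
  intro t ht n
  simp only [mildMap]
  congr 2
  exact duh3_eq_of_nX_sub_eq_zero e (t₁ := T) (by linarith) hG (hm G hG hnG) (hnG.trans_lt hL2)
    ((hball G hG hnG).trans_lt hL2) hfix ht n

/-! ### The solution class in the interaction picture -/

/-- The interaction picture of a function of time. -/
def inter (u : ℝ → ℤ → ℂ) (t : ℝ) (n : ℤ) : ℂ := cexp (-(I * t * disp n)) * u t n

lemma cexp_mul_inter (u : ℝ → ℤ → ℂ) (t : ℝ) (n : ℤ) : cexp (I * t * disp n) * inter u t n = u t n := by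
  rw [inter, ← mul_assoc, ← Complex.exp_add, add_neg_cancel, Complex.exp_zero, one_mul]

lemma enorm_inter (u : ℝ → ℤ → ℂ) (t : ℝ) (n : ℤ) : ‖inter u t n‖ₑ = ‖u t n‖ₑ := by
  rw [inter, enorm_mul, ← ofReal_norm (cexp _), norm_cexp_neg_I, ENNReal.ofReal_one, one_mul]

lemma continuousOn_inter {s : Set ℝ} {u : ℝ → ℤ → ℂ} {n : ℤ}
    (h : ContinuousOn (fun t => u t n) s) : ContinuousOn (fun t => inter u t n) s :=
  ContinuousOn.mul (by fun_prop) h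

lemma wt_mul_enorm_le_eFL {s p : ℝ} (hp : 0 < p) (f : ℤ → ℂ) (n : ℤ) :
    wt s n * ‖f n‖ₑ ≤ eFL s p f := by
  rw [eFL, one_div, ENNReal.le_rpow_inv_iff hp]
  exact ENNReal.le_tsum (f := fun n : ℤ => (wt s n * ‖f n‖ₑ) ^ p) n

lemma InClass.continuousOn {s b p T : ℝ} (hp : 0 < p) {u : ℝ → ℤ → ℂ} (h : InClass s b p T u)
    (n : ℤ) : ContinuousOn (fun t => u t n) (Set.Icc 0 T) := by
  intro t ht
  have h1 := h.continuous t ht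
  rw [ContinuousWithinAt, tendsto_iff_edist_tendsto_0]
  have h2 : Tendsto (fun r => (wt s n)⁻¹ * eFL s p (u r - u t)) (𝓝[Set.Icc 0 T] t) (𝓝 0) := by
    have := ENNReal.Tendsto.const_mul (a := (wt s n)⁻¹) h1 (.inr (by simp [wt_ne_zero]))
    rwa [mul_zero] at this
  refine tendsto_of_tendsto_of_tendsto_of_le_of_le tendsto_const_nhds h2 (fun _ => zero_le) ?_
  intro r
  simp only
  rw [edist_eq_enorm_sub, mul_comm, ← div_eq_mul_inv, ENNReal.le_div_iff_mul_le
    (.inl (wt_ne_zero _ _)) (.inl (wt_ne_top _ _)), mul_comm]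
  exact wt_mul_enorm_le_eFL hp (u r - u t) n

/-- The nonlinear term of the frequency truncation in the interaction picture. -/
def wickInter (u : ℝ → ℤ → ℂ) (M : ℕ) (n : ℤ) (r : ℝ) : ℂ :=
  cexp (-(I * r * disp n)) * fourierCoeff (wick (truncate M (u r))) n

lemma continuousOn_wickInter {u : ℝ → ℤ → ℂ} {s : Set ℝ}
    (hu : ∀ n, ContinuousOn (fun t => u t n) s) (M : ℕ) (n : ℤ) :
    ContinuousOn (wickInter u M n) s := by
  unfold wickInter
  simp only [fourierCoeff_wick_truncate]
  refine ContinuousOn.mul (by fun_prop) (continuousOn_finsetSum _ fun m _ => ?_)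
  have c4 : ContinuousOn (fun r => starRingEnd ℂ (u r m.2.1)) s :=
    Complex.continuous_conj.comp_continuousOn (hu m.2.1)
  exact continuousOn_const.mul (((hu m.1).mul c4).mul (hu m.2.2))

lemma tendsto_integral_wickInter (e : Exponents) {t₀ t₁ : ℝ} (h1 : t₁ - t₀ ≤ 1) {u : ℝ → ℤ → ℂ}
    (hu : ∀ n, ContinuousOn (fun r => u r n) (Set.Icc t₀ t₁))
    (hF : nX e.s e.β e.p (fun n => cutFT t₀ t₁ (fun r => inter u r n)) < ∞) {t : ℝ}
    (ht : t ∈ Set.Icc t₀ t₁) (n : ℤ) :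
    Tendsto (fun M : ℕ => ∫ r in t₀..t, wickInter u M n r) atTop
      (𝓝 (duh3 t₀ t n (fun n => cutFT t₀ t₁ (fun r => inter u r n)))) := by
  have := tendsto_integral_wick e h1 (fun n => continuousOn_inter (hu n)) hF ht n
  simp only [cexp_mul_inter] at this
  exact this

lemma cexp_sub_mul (t r : ℝ) (n : ℤ) (z : ℂ) :
    cexp (I * (t - r) * disp n) * z = cexp (I * t * disp n) * (cexp (-(I * r * disp n)) * z) := by
  rw [← mul_assoc, ← Complex.exp_add]
  congr 2
  ring

/-- For these functions the truncated Duhamel terms do converge, to the trilinear form. By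
uniqueness of limits, and after division by the unimodular propagator, the defining limit becomes an
equation. -/
lemma isMildSolution_iff (e : Exponents) {T : ℝ} (h1 : T ≤ 1) {u : ℝ → ℤ → ℂ}
    (hu : ∀ n, ContinuousOn (fun r => u r n) (Set.Icc 0 T))
    (hF : nX e.s e.β e.p (fun n => cutFT 0 T (fun r => inter u r n)) < ∞) (u₀ : ℤ → ℂ)
    (ψ : ℝ≥0 → ℤ → ℂ) :
    IsMildSolution T u₀ ψ u ↔ ∀ t ∈ Set.Icc 0 T, ∀ n, inter u t n =
      mildMap t n u₀ ψ (fun n => cutFT 0 T (fun r => inter u r n)) := by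
  refine forall₂_congr fun t ht => forall_congr' fun n => ?_
  have hlim := tendsto_integral_wickInter e (t₀ := 0) (by linarith) hu hF ht n
  have hint : ∀ M : ℕ, ∫ r in (0 : ℝ)..t,
      cexp (I * (t - r) * disp n) * fourierCoeff (wick (truncate M (u r))) n =
      cexp (I * t * disp n) * ∫ r in (0 : ℝ)..t, wickInter u M n r := by
    intro M
    rw [← intervalIntegral.integral_const_mul]
    refine intervalIntegral.integral_congr fun r _ => ?_
    exact cexp_sub_mul t r n _
  simp only [hint]
  have hlim2 := ((tendsto_const_nhds (x := cexp (I * t * disp n) * u₀ n)).add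
    ((hlim.const_mul (cexp (I * t * disp n))).const_mul I)).sub
    (tendsto_const_nhds (x := I * ψ t.toNNReal n))
  have e1 : cexp (I * t * disp n) * mildMap t n u₀ ψ (fun n => cutFT 0 T (fun r => inter u r n)) =
      cexp (I * t * disp n) * u₀ n + I * (cexp (I * t * disp n) *
        duh3 0 t n (fun n => cutFT 0 T (fun r => inter u r n))) - I * ψ t.toNNReal n := by
    have e2 : cexp (I * t * disp n) * noisePath ψ t n = ψ t.toNNReal n := by
      rw [noisePath, ← mul_assoc, ← Complex.exp_add, add_neg_cancel, Complex.exp_zero, one_mul]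
    rw [mildMap, ← e2]
    ring
  rw [← e1] at hlim2
  constructor
  · intro h
    have h3 := tendsto_nhds_unique h hlim2
    rw [← cexp_mul_inter u t n] at h3
    exact mul_left_cancel₀ (Complex.exp_ne_zero _) h3
  · intro h
    rw [← h, cexp_mul_inter] at hlim2
    exact hlim2

/-- Not visible on the Fourier side, where the terms involve transforms over different intervals.
All of them are limits of ordinary time integrals of the truncations, which are additive in the
interval. -/
lemma duh3_restart (e : Exponents) {T t₀ t₁ t : ℝ} (hT : T ≤ 1) (h0 : 0 ≤ t₀)
    (h1 : t₁ ≤ T) {u : ℝ → ℤ → ℂ} (hu : ∀ n, ContinuousOn (fun r => u r n) (Set.Icc 0 T))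
    (hF : nX e.s e.β e.p (fun n => cutFT 0 T (fun r => inter u r n)) < ∞)
    (hG : nX e.s e.β e.p (fun n => cutFT t₀ t₁ (fun r => inter u r n)) < ∞)
    (ht : t ∈ Set.Icc t₀ t₁) (n : ℤ) :
    duh3 0 t n (fun n => cutFT 0 T (fun r => inter u r n)) =
      duh3 0 t₀ n (fun n => cutFT 0 T (fun r => inter u r n)) +
        duh3 t₀ t n (fun n => cutFT t₀ t₁ (fun r => inter u r n)) := by
  have l1 := tendsto_integral_wickInter e (t₀ := 0) (by linarith) hu hF
    ⟨h0.trans ht.1, ht.2.trans h1⟩ n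
  have l2 := tendsto_integral_wickInter e (t₀ := 0) (by linarith) hu hF
    ⟨h0, ht.1.trans (ht.2.trans h1)⟩ n
  have l3 := tendsto_integral_wickInter e (t₀ := t₀) (by linarith)
    (fun n => (hu n).mono (Set.Icc_subset_Icc h0 h1)) hG ht n
  refine tendsto_nhds_unique l1 ((l2.add l3).congr fun M => ?_)
  have hc := continuousOn_wickInter hu M n
  refine intervalIntegral.integral_add_adjacent_intervals (ContinuousOn.intervalIntegrable ?_)
    (ContinuousOn.intervalIntegrable ?_)
  · rw [Set.uIcc_of_le h0]
    exact hc.mono (Set.Icc_subset_Icc le_rfl (ht.1.trans (ht.2.trans h1)))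
  · rw [Set.uIcc_of_le ht.1]
    exact hc.mono (Set.Icc_subset_Icc h0 (ht.2.trans h1))

/-- Causality of the Duhamel term. The transforms over [0, T] see the future of t₀, but the
truncated time integrals do not. -/
lemma duh3_congr (e : Exponents) {T t₀ : ℝ} (hT : T ≤ 1) (h0 : t₀ ∈ Set.Icc 0 T)
    {u v : ℝ → ℤ → ℂ} (hu : ∀ n, ContinuousOn (fun r => u r n) (Set.Icc 0 T))
    (hv : ∀ n, ContinuousOn (fun r => v r n) (Set.Icc 0 T))
    (hF : nX e.s e.β e.p (fun n => cutFT 0 T (fun r => inter u r n)) < ∞)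
    (hG : nX e.s e.β e.p (fun n => cutFT 0 T (fun r => inter v r n)) < ∞)
    (h : ∀ t ∈ Set.Icc 0 t₀, u t = v t) (n : ℤ) :
    duh3 0 t₀ n (fun n => cutFT 0 T (fun r => inter u r n)) =
      duh3 0 t₀ n (fun n => cutFT 0 T (fun r => inter v r n)) := by
  have l1 := tendsto_integral_wickInter e (t₀ := 0) (by linarith) hu hF h0 n
  have l2 := tendsto_integral_wickInter e (t₀ := 0) (by linarith) hv hG h0 n
  refine tendsto_nhds_unique l1 (l2.congr fun M => ?_)
  refine intervalIntegral.integral_congr fun r hr => ?_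
  rw [Set.uIcc_of_le h0.1] at hr
  simp only [wickInter, h r hr]

/-! ### Uniqueness -/

lemma eq_zero_of_le_half_mul {x : ℝ≥0∞} (hx : x < ∞) (h : x ≤ 2⁻¹ * x) : x = 0 := by
  by_contra h0
  refine absurd h (not_le.2 ?_)
  calc 2⁻¹ * x < 1 * x := by
        refine (ENNReal.mul_lt_mul_iff_left h0 hx.ne).2 ?_
        rw [ENNReal.inv_lt_one]; norm_num
    _ = x := one_mul x

lemma le_two_mul_of_le_add_half {x y : ℝ≥0∞} (hx : x < ∞) (h : x ≤ y + 2⁻¹ * x) : x ≤ 2 * y := by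
  have e1 : x = 2⁻¹ * x + 2⁻¹ * x := by
    rw [← add_mul, ENNReal.inv_two_add_inv_two, one_mul]
  have h2 : 2⁻¹ * x ≤ y := by
    have h3 : 2⁻¹ * x + 2⁻¹ * x ≤ y + 2⁻¹ * x := by rwa [← e1]
    exact (ENNReal.add_le_add_iff_right (by finiteness)).1 h3
  calc x = 2 * (2⁻¹ * x) := by rw [← mul_assoc, ENNReal.mul_inv_cancel (by simp) (by simp), one_mul]
    _ ≤ _ := mul_le_mul' le_rfl h2

lemma exists_step (e : Exponents) {K : ℝ≥0∞} (hK : K < ∞) :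
    ∃ h : ℝ, 0 < h ∧ ∀ x, 0 ≤ x → x ≤ h → K * ENNReal.ofReal (x ^ e.θ) ≤ 2⁻¹ := by
  have h1 : Tendsto (fun x : ℝ => K * ENNReal.ofReal (x ^ e.θ)) (𝓝 0) (𝓝 0) := by
    have h2 : Tendsto (fun x : ℝ => x ^ e.θ) (𝓝 0) (𝓝 0) := by
      have := (Real.continuousAt_rpow_const 0 e.θ (.inr e.θ_pos.le)).tendsto
      rwa [Real.zero_rpow e.θ_pos.ne'] at this
    have h3 := ENNReal.Tendsto.const_mul (a := K) (ENNReal.tendsto_ofReal h2) (.inr hK.ne)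
    simpa using h3
  have h4 := h1.eventually (ge_mem_nhds (by simp : (0 : ℝ≥0∞) < 2⁻¹))
  obtain ⟨h, hh, h5⟩ := Metric.eventually_nhds_iff.1 h4
  refine ⟨h / 2, by positivity, fun x hx hxh => h5 ?_⟩
  rw [Real.dist_eq, sub_zero, abs_of_nonneg hx]
  linarith

/-- The competitors need not lie in the ball of the fixed point argument. Their norms over all
subintervals are bounded by one number N. On intervals of a length h depending on N alone, the
difference is at most half of itself once the solutions agree up to the left endpoint, and finitely
many steps of length h reach T. -/
lemma solution_unique (e : Exponents) {T : ℝ} (h0 : 0 ≤ T) (h1 : T ≤ 1) {ψ : ℝ≥0 → ℤ → ℂ}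
    {u₀ : ℤ → ℂ} {u v : ℝ → ℤ → ℂ}
    (hu : IsSolutionInClass e.s e.b e.p T u₀ ψ u) (hv : IsSolutionInClass e.s e.b e.p T u₀ ψ v) :
    ∀ t ∈ Set.Icc 0 T, u t = v t := by
  obtain ⟨C, hC⟩ := exists_nX_cutFT_le_eXT e e.β_pos.le e.β_lt_b (e.b_lt_b'.trans e.b'_lt)
  obtain ⟨D, hD⟩ := exists_nX_duh3_sub_le e
  have cu := fun n => hu.1.continuousOn e.p_pos n
  have cv := fun n => hv.1.continuousOn e.p_pos n
  set N : ℝ≥0∞ := C * (eXT e.s e.b e.p T u + eXT e.s e.b e.p T v) with hN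
  have hNt : N < ∞ :=
    ENNReal.mul_lt_top ENNReal.coe_lt_top (ENNReal.add_lt_top.2 ⟨hu.1.mem_X, hv.1.mem_X⟩)
  have bu : ∀ t₀ t₁, 0 ≤ t₀ → t₀ ≤ t₁ → t₁ ≤ T →
      nX e.s e.β e.p (fun n => cutFT t₀ t₁ (fun t => inter u t n)) ≤ N := fun t₀ t₁ a b c =>
    (hC T t₀ t₁ u a b c (by linarith) cu).trans (mul_le_mul' le_rfl le_self_add)
  have bv : ∀ t₀ t₁, 0 ≤ t₀ → t₀ ≤ t₁ → t₁ ≤ T →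
      nX e.s e.β e.p (fun n => cutFT t₀ t₁ (fun t => inter v t n)) ≤ N := fun t₀ t₁ a b c =>
    (hC T t₀ t₁ v a b c (by linarith) cv).trans (mul_le_mul' le_rfl le_add_self)
  have mu : ∀ t₀ t₁, 0 ≤ t₀ → t₀ ≤ t₁ → t₁ ≤ T → ∀ n, ∀ w : ℝ → ℤ → ℂ,
      ContinuousOn (fun t => w t n) (Set.Icc 0 T) →
      Measurable (cutFT t₀ t₁ (fun t => inter w t n)) := fun t₀ t₁ a b c n w cw =>
    (continuous_cutFT b (((continuousOn_inter cw).mono (Set.Icc_subset_Icc a c)).integrableOn_Icc.mono_set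
      Set.Ioc_subset_Icc_self)).measurable
  have eu := (isMildSolution_iff e h1 cu ((bu 0 T le_rfl h0 le_rfl).trans_lt hNt) u₀ ψ).1 hu.2
  have ev := (isMildSolution_iff e h1 cv ((bv 0 T le_rfl h0 le_rfl).trans_lt hNt) u₀ ψ).1 hv.2
  obtain ⟨h, hh, hstep⟩ := exists_step e (K := D * (N + N) ^ 2) (by finiteness)
  have step : ∀ t₀ t₁, 0 ≤ t₀ → t₀ ≤ t₁ → t₁ ≤ T → t₁ - t₀ ≤ h →
      (∀ t ∈ Set.Icc 0 t₀, u t = v t) → ∀ t ∈ Set.Icc 0 t₁, u t = v t := by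
    intro t₀ t₁ a b c hsm heq
    set G := fun n => cutFT t₀ t₁ (fun t => inter u t n) with hG
    set G' := fun n => cutFT t₀ t₁ (fun t => inter v t n) with hG'
    have nG := (bu t₀ t₁ a b c)
    have nG' := (bv t₀ t₁ a b c)
    have mG : ∀ n, Measurable (G n) := fun n => mu t₀ t₁ a b c n u (cu n)
    have mG' : ∀ n, Measurable (G' n) := fun n => mu t₀ t₁ a b c n v (cv n)
    have hdiff : ∀ t ∈ Set.Icc t₀ t₁, ∀ n, inter u t n - inter v t n =
        I * (duh3 t₀ t n G - duh3 t₀ t n G') := by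
      intro t ht n
      have ht' : t ∈ Set.Icc 0 T := ⟨a.trans ht.1, ht.2.trans c⟩
      have r1 := duh3_restart e h1 a c cu ((bu 0 T le_rfl h0 le_rfl).trans_lt hNt)
        (nG.trans_lt hNt) ht n
      have r2 := duh3_restart e h1 a c cv ((bv 0 T le_rfl h0 le_rfl).trans_lt hNt)
        (nG'.trans_lt hNt) ht n
      have r3 := duh3_congr e h1 ⟨a, b.trans c⟩ cu cv ((bu 0 T le_rfl h0 le_rfl).trans_lt hNt)
        ((bv 0 T le_rfl h0 le_rfl).trans_lt hNt) heq n
      rw [eu t ht' n, ev t ht' n, mildMap, mildMap, r1, r2, r3]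
      ring
    have hGG : G - G' = fun n τ => I * cutFT t₀ t₁ (fun t => duh3 t₀ t n G - duh3 t₀ t n G') τ := by
      funext n τ
      have hi : ∀ w : ℝ → ℤ → ℂ, ContinuousOn (fun t => w t n) (Set.Icc 0 T) →
          IntervalIntegrable (fun t => inter w t n) volume t₀ t₁ := fun w cw =>
        ContinuousOn.intervalIntegrable (by
          rw [Set.uIcc_of_le b]
          exact (continuousOn_inter cw).mono (Set.Icc_subset_Icc a c))
      simp only [Pi.sub_apply, hG, hG']
      rw [← cutFT_sub (hi u (cu n)) (hi v (cv n)), ← cutFT_const_mul]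
      exact congrFun (cutFT_congr b fun t ht => hdiff t ht n) τ
    have hz : nX e.s e.β e.p (G - G') = 0 := by
      refine eq_zero_of_le_half_mul
        (nX_sub_lt_top e mG mG' (nG.trans_lt hNt) (nG'.trans_lt hNt)) ?_
      conv_lhs => rw [hGG]
      rw [nX_const_mul I e.p_pos, enorm_I, one_mul]
      refine (nX_mono e.p_pos e.β_lt_b.le fun _ _ => le_rfl).trans
        ((hD t₀ t₁ G G' b (by linarith) mG mG' (nG.trans_lt hNt) (nG'.trans_lt hNt)).trans ?_)
      rw [← mul_assoc]
      refine mul_le_mul' (le_trans ?_ (hstep (t₁ - t₀) (by linarith) hsm)) le_rfl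
      rw [mul_right_comm]
      exact mul_le_mul' (mul_le_mul' le_rfl (pow_le_pow_left' (add_le_add nG nG') 2)) le_rfl
    intro t ht
    by_cases htt : t ≤ t₀
    · exact heq t ⟨ht.1, htt⟩
    · funext n
      have ht2 : t ∈ Set.Icc t₀ t₁ := ⟨(not_le.1 htt).le, ht.2⟩
      have h3 := hdiff t ht2 n
      rw [duh3_eq_of_nX_sub_eq_zero e (by linarith) mG mG' (nG.trans_lt hNt) (nG'.trans_lt hNt) hz ht2 n,
        sub_self, mul_zero, sub_eq_zero] at h3
      rw [← cexp_mul_inter u, ← cexp_mul_inter v, h3]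
  have hind : ∀ k : ℕ, ∀ t ∈ Set.Icc 0 (min (k * h) T), u t = v t := by
    intro k
    induction k with
    | zero =>
      refine step 0 _ le_rfl ?_ (min_le_right _ _) ?_ ?_
      · simp [h0]
      · simp [h0, hh.le]
      · intro t ht
        have : t = 0 := le_antisymm ht.2 ht.1
        subst this
        funext n
        have h2 : ∀ w, (∀ n, inter u 0 n = inter w 0 n) → u 0 n = w 0 n := fun w hw => by
          rw [← cexp_mul_inter u, ← cexp_mul_inter w, hw]
        refine h2 v fun n => ?_
        have z : ∀ F, duh3 0 0 n F = 0 := fun F => by simp [duh3, duh, triForm, triFun, kk]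
        rw [eu 0 ⟨le_rfl, h0⟩ n, ev 0 ⟨le_rfl, h0⟩ n, mildMap, mildMap, z, z]
    | succ k ih =>
      refine step _ _ ?_ ?_ (min_le_right _ _) ?_ ih
      · exact le_min (by positivity) h0
      · exact min_le_min_right _ (by push_cast; linarith)
      · push_cast
        rcases le_total (k * h) T with h2 | h2
        · rw [min_eq_left h2]
          linarith [min_le_left ((k + 1 : ℝ) * h) T]
        · rw [min_eq_right h2]
          linarith [min_le_right ((k + 1 : ℝ) * h) T]
  intro t ht
  obtain ⟨k, hk⟩ := exists_nat_ge (T / h)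
  refine hind k t ⟨ht.1, ht.2.trans (le_min ?_ le_rfl)⟩
  rwa [div_le_iff₀ hh] at hk

/-! ### Membership in the class -/

lemma eFL_le_nS {s p t₀ t₁ : ℝ} (hp : 0 < p) (u : ℝ → ℤ → ℂ) {t : ℝ} (ht : t ∈ Set.Icc t₀ t₁) :
    eFL s p (u t) ≤ nS s p t₀ t₁ u :=
  lp_mono hp fun n => mul_le_mul' le_rfl
    (le_iSup₂ (f := fun t (_ : t ∈ Set.Icc t₀ t₁) => ‖u t n‖ₑ) t ht)

lemma nS_const_le (s : ℝ) {p t₀ t₁ : ℝ} (hp : 0 < p) (f : ℤ → ℂ) :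
    nS s p t₀ t₁ (fun _ => f) ≤ eFL s p f :=
  lp_mono hp fun _ => mul_le_mul' le_rfl (iSup₂_le fun _ _ => le_rfl)

lemma nS_mono_interval {s p t₀ t₁ t₂ : ℝ} (hp : 0 < p) (h : t₁ ≤ t₂) (u : ℝ → ℤ → ℂ) :
    nS s p t₀ t₁ u ≤ nS s p t₀ t₂ u :=
  lp_mono hp fun _ => mul_le_mul' le_rfl
    (biSup_mono fun _ ht => ⟨ht.1, ht.2.trans h⟩)

/-- Dominated convergence in ℓ^p: the suprema in time form a summable majorant, so continuity of
each coefficient is enough. This replaces the embedding of X^{s,b}_p into continuous functions,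
which is missing for b < 1/q. -/
lemma tendsto_eFL_of_nS_lt_top {s p T : ℝ} (hp : 0 < p) {u : ℝ → ℤ → ℂ}
    (hS : nS s p 0 T u < ∞) (hc : ∀ n, ContinuousOn (fun t => u t n) (Set.Icc 0 T)) {t : ℝ}
    (ht : t ∈ Set.Icc 0 T) :
    Tendsto (fun r => eFL s p (u r - u t)) (𝓝[Set.Icc 0 T] t) (𝓝 0) := by
  have h1 : Tendsto (fun r => ∫⁻ n : ℤ, (wt s n * ‖u r n - u t n‖ₑ) ^ p ∂Measure.count)
      (𝓝[Set.Icc 0 T] t) (𝓝 (∫⁻ _ : ℤ, 0 ∂Measure.count)) := by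
    refine tendsto_lintegral_filter_of_dominated_convergence
      (fun n : ℤ => (2 * (wt s n * ⨆ t ∈ Set.Icc 0 T, ‖u t n‖ₑ)) ^ p) ?_ ?_ ?_ ?_
    · exact .of_forall fun r => measurable_of_countable _
    · filter_upwards [self_mem_nhdsWithin] with r hr
      refine .of_forall fun n => ENNReal.rpow_le_rpow ?_ hp.le
      rw [mul_left_comm]
      refine mul_le_mul' le_rfl ?_
      rw [two_mul]
      exact (enorm_sub_le).trans (add_le_add
        (le_iSup₂ (f := fun t (_ : t ∈ Set.Icc 0 T) => ‖u t n‖ₑ) r hr)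
        (le_iSup₂ (f := fun t (_ : t ∈ Set.Icc 0 T) => ‖u t n‖ₑ) t ht))
    · rw [lintegral_count]
      simp only [ENNReal.mul_rpow_of_nonneg 2 _ hp.le]
      rw [ENNReal.tsum_mul_left]
      refine ENNReal.mul_ne_top (ENNReal.rpow_ne_top_of_nonneg hp.le (by norm_num)) ?_
      have := ENNReal.rpow_lt_top_of_nonneg hp.le hS.ne
      rw [nS, ← ENNReal.rpow_mul, one_div_mul_cancel hp.ne', ENNReal.rpow_one] at this
      exact this.ne
    · refine .of_forall fun n => ?_
      have h2 : Tendsto (fun r => ‖u r n - u t n‖ₑ) (𝓝[Set.Icc 0 T] t) (𝓝 0) := by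
        have := (tendsto_iff_edist_tendsto_0.1 ((hc n) t ht))
        simpa only [edist_eq_enorm_sub] using this
      have h3 := (ENNReal.continuous_rpow_const (y := p)).tendsto _ |>.comp
        (ENNReal.Tendsto.const_mul (a := wt s n) h2 (.inr (wt_ne_top _ _)))
      simpa [hp, Function.comp_def] using h3
  simp only [lintegral_count, lintegral_zero] at h1
  have h4 := (ENNReal.continuous_rpow_const (y := 1 / p)).tendsto _ |>.comp h1
  rw [ENNReal.zero_rpow_of_pos (by positivity)] at h4
  exact h4

/-- Restriction from [0, 1] to [0, T] loses a little modulation weight. This is why good paths are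
required to have the exponent b', above both b and β. -/
lemma nX_noisePath_lt_top (e : Exponents) {ψ : ℝ≥0 → ℤ → ℂ} (hg : GoodPath e ψ) {β : ℝ}
    (hβ : 0 ≤ β) (hβ' : β < e.b') : ∃ C : ℝ≥0, ∀ T, 0 ≤ T → T ≤ 1 →
    nX e.s β e.p (fun n => cutFT 0 T (fun t => noisePath ψ t n)) ≤ C := by
  obtain ⟨C, hC⟩ := exists_nX_cutFT_le_eXT e hβ hβ' e.b'_lt
  have hc : ∀ n, Continuous fun t : ℝ => ψ t.toNNReal n := fun n =>
    (hg.continuous n).comp continuous_real_toNNReal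
  refine ⟨(C * nX e.s e.b' e.p (fun n => cutFT 0 1 (fun t => noisePath ψ t n))).toNNReal,
    fun T h0 h1 => ?_⟩
  rw [ENNReal.coe_toNNReal (ENNReal.mul_ne_top ENNReal.coe_ne_top hg.nX_lt_top.ne)]
  refine (hC 1 0 T (fun t n => ψ t.toNNReal n) le_rfl h0 h1 (by linarith)
    fun n => (hc n).continuousOn).trans (mul_le_mul' le_rfl ?_)
  exact eXT_le_nX zero_le_one fun n => (hc n).continuousOn

lemma inter_cexp_mul (a : ℝ → ℤ → ℂ) :
    inter (fun t n => cexp (I * t * disp n) * a t n) = a := by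
  funext t n
  rw [inter, ← mul_assoc, ← Complex.exp_add, neg_add_cancel, Complex.exp_zero, one_mul]

/-- The fixed point has only the weight β. The missing weight up to b comes from the equation: the
Duhamel term maps β to b, and the data and the noise already have weight b. The supremum norm is
bounded term by term in the same way. -/
lemma isSolutionInClass_of_interaction (e : Exponents) {T : ℝ} (hT : 0 ≤ T) (h1 : T ≤ 1)
    {ψ : ℝ≥0 → ℤ → ℂ} (hg : GoodPath e ψ) {u₀ : ℤ → ℂ} (hu : eFL e.s e.p u₀ < ∞)
    {a : ℝ → ℤ → ℂ} (hc : ∀ n, ContinuousOn (fun t => a t n) (Set.Icc 0 T))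
    (hF : nX e.s e.β e.p (fun n => cutFT 0 T (fun t => a t n)) < ∞)
    (ha : ∀ t ∈ Set.Icc 0 T, ∀ n, a t n =
        mildMap t n u₀ ψ (fun n => cutFT 0 T (fun t => a t n))) :
    IsSolutionInClass e.s e.b e.p T u₀ ψ (fun t n => cexp (I * t * disp n) * a t n) := by
  set F := fun n => cutFT 0 T (fun t => a t n) with hFd
  set u : ℝ → ℤ → ℂ := fun t n => cexp (I * t * disp n) * a t n with hud
  have hua : inter u = a := inter_cexp_mul a
  have hp := e.p_pos
  have hmF : ∀ n, Measurable (F n) := fun n => (continuous_cutFT hT ((hc n).integrableOn_Icc.mono_set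
    Set.Ioc_subset_Icc_self)).measurable
  have hcu : ∀ n, ContinuousOn (fun t => u t n) (Set.Icc 0 T) := fun n =>
    ContinuousOn.mul (by fun_prop) (hc n)
  have hSa : nS e.s e.p 0 T u < ∞ := by
    obtain ⟨C, hC⟩ := exists_nS_duh_le e
    have b1 : nS e.s e.p 0 T u ≤ nS e.s e.p 0 T (((fun _ n => u₀ n) +
        fun t n => -I * noisePath ψ t n) + fun t n => I * duh 0 t n F F F) := by
      refine nS_mono hp fun t ht n => ?_
      rw [← enorm_inter u, hua, ha t ht n]
      refine le_of_eq (congrArg _ ?_)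
      simp only [mildMap, duh3, Pi.add_apply]
      ring
    refine b1.trans_lt ((nS_add_le e.one_lt_p.le _ _).trans_lt (ENNReal.add_lt_top.2
      ⟨(nS_add_le e.one_lt_p.le _ _).trans_lt (ENNReal.add_lt_top.2 ⟨?_, ?_⟩), ?_⟩))
    · exact (nS_const_le _ hp u₀).trans_lt hu
    · refine ((nS_mono hp fun t _ n => ?_).trans (nS_mono_interval hp h1 _)).trans_lt hg.nS_lt_top
      rw [enorm_mul, enorm_neg, enorm_I, one_mul]
    · refine ((nS_mono hp fun t _ n => ?_).trans (hC 0 T F F F (by linarith) hmF hmF hmF)).trans_lt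
        (by finiteness)
      rw [enorm_mul, enorm_I, one_mul]
  refine ⟨⟨fun t ht => (eFL_le_nS hp u ht).trans_lt hSa,
    fun t ht => tendsto_eFL_of_nS_lt_top hp hSa hcu ht, ?_⟩, ?_⟩
  · refine (eXT_le_nX hT hcu).trans_lt ?_
    obtain ⟨C, hC⟩ := exists_nX_cutFT_const_le e (e.b_lt_b'.trans e.b'_lt)
    obtain ⟨D, hD⟩ := nX_noisePath_lt_top e hg e.b_pos.le e.b_lt_b'
    have e1 : (fun n => cutFT 0 T (fun t => cexp (-(I * t * disp n)) * u t n)) =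
        fun n => cutFT 0 T (fun t => mildMap t n u₀ ψ F) := by
      funext n
      refine cutFT_congr hT fun t ht => ?_
      have := ha t ht n
      rw [← hua] at this
      exact this
    have n0 : nX e.s e.β e.p (0 : ℤ → ℝ → ℂ) < ∞ := by rw [nX_zero hp]; simp
    have m0 : ∀ n, Measurable ((0 : ℤ → ℝ → ℂ) n) := fun _ => measurable_const
    have mA := measurable_cutFT_mildMap e hT h1 hg.continuous u₀ hmF hF
    have mB := measurable_cutFT_mildMap e hT h1 hg.continuous 0 m0 n0
    have e2 : (fun n => cutFT 0 T (fun t => mildMap t n 0 ψ 0)) =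
        fun n τ => -I * cutFT 0 T (fun t => noisePath ψ t n) τ := by
      funext n τ
      rw [← cutFT_const_mul]
      simp [mildMap, duh3_zero]
    rw [e1]
    have e3 := sub_add_cancel (fun n => cutFT 0 T (fun t => mildMap t n u₀ ψ F))
      (fun n => cutFT 0 T (fun t => mildMap t n 0 ψ 0))
    rw [← e3]
    refine (nX_add_le (fun n => (mA n).sub (mB n)) mB _ _ e.one_lt_p.le).trans_lt
      (ENNReal.add_lt_top.2 ⟨?_, ?_⟩)
    · refine (nX_mild_sub_le e hT h1 hg.continuous u₀ 0 hmF m0 hF n0 e.b).trans_lt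
        (ENNReal.add_lt_top.2 ⟨?_, ?_⟩)
      · rw [sub_zero]
        exact (hC T u₀ hT h1).trans_lt (ENNReal.mul_lt_top ENNReal.coe_lt_top hu)
      · refine (nX_duh3_sub_le e hT h1 hmF m0 hF n0).trans_lt ?_
        have := nX_sub_lt_top e hmF m0 hF n0
        finiteness
    · rw [e2, nX_const_mul _ hp, enorm_neg, enorm_I, one_mul]
      exact (hD T hT h1).trans_lt ENNReal.coe_lt_top
  · refine (isMildSolution_iff e h1 hcu (by rw [hua]; exact hF) u₀ ψ).2 ?_
    rw [hua]
    exact ha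

/-! ### Well-posedness for a good path -/

lemma exists_unique_solution (e : Exponents) {R : ℝ≥0∞} (hR : R < ∞) {T : ℝ} (hT : 0 < T)
    (h1 : T ≤ 1) {ψ : ℝ≥0 → ℤ → ℂ} (hg : GoodPath e ψ) (hs : smallness e R T ψ ≤ 1)
    {u₀ : ℤ → ℂ} (hu : eFL e.s e.p u₀ ≤ R) :
    ∃ u, (IsSolutionInClass e.s e.b e.p T u₀ ψ u ∧
      ∀ v, IsSolutionInClass e.s e.b e.p T u₀ ψ v → ∀ t ∈ Set.Icc (0 : ℝ) T, v t = u t) ∧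
      nX e.s e.β e.p (fun n => cutFT 0 T (fun t => inter u t n)) ≤ 2 * linNorm e R T ψ := by
  obtain ⟨a, hc, hF, ha⟩ := exists_interaction_solution e hT h1 hg.continuous hs hu
  have hL := linNorm_lt_top hT hs
  have hsol := isSolutionInClass_of_interaction e hT.le h1 hg (hu.trans_lt hR) hc
    (hF.trans_lt (by finiteness)) ha
  refine ⟨_, ⟨hsol, fun v hv => solution_unique e hT.le h1 hv hsol⟩, ?_⟩
  rw [inter_cexp_mul]
  exact hF

/-- By uniqueness, an arbitrary solution in the class inherits the ball estimate of the constructed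
one. -/
lemma solution_interaction (e : Exponents) {R : ℝ≥0∞} (hR : R < ∞) {T : ℝ} (hT : 0 < T)
    (h1 : T ≤ 1) {ψ : ℝ≥0 → ℤ → ℂ} (hg : GoodPath e ψ) (hs : smallness e R T ψ ≤ 1)
    {u₀ : ℤ → ℂ} (hu : eFL e.s e.p u₀ ≤ R) {u : ℝ → ℤ → ℂ}
    (hsol : IsSolutionInClass e.s e.b e.p T u₀ ψ u) :
    ∃ F : ℤ → ℝ → ℂ, (∀ n, Measurable (F n)) ∧ nX e.s e.β e.p F ≤ 2 * linNorm e R T ψ ∧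
      (∀ t ∈ Set.Icc 0 T, ∀ n, inter u t n = mildMap t n u₀ ψ F) ∧
      F = fun n => cutFT 0 T (fun t => inter u t n) := by
  have hL := linNorm_lt_top hT hs
  obtain ⟨v, ⟨-, hv⟩, hF⟩ := exists_unique_solution e hR hT h1 hg hs hu
  have e1 : (fun n => cutFT 0 T (fun t => inter u t n)) =
      fun n => cutFT 0 T (fun t => inter v t n) := by
    funext n
    refine cutFT_congr hT.le fun t ht => ?_
    simp only [inter, hv u hsol t ht]
  rw [← e1] at hF
  have hc := fun n => hsol.1.continuousOn e.p_pos n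
  exact ⟨_, fun n => (continuous_cutFT hT.le ((continuousOn_inter (hc n)).integrableOn_Icc.mono_set
    Set.Ioc_subset_Icc_self)).measurable, hF,
    (isMildSolution_iff e h1 hc (hF.trans_lt (by finiteness)) u₀ ψ).1 hsol.2, rfl⟩

/-- The contraction absorbs half of the difference in the β norm, which is therefore Lipschitz in
the data. The difference estimates for the Duhamel term carry this over to the supremum norm and to
the weight b; the noise cancels. -/
lemma exists_lipschitz (e : Exponents) {R : ℝ≥0∞} (hR : R < ∞) {T : ℝ} (hT : 0 < T)
    (h1 : T ≤ 1) {ψ : ℝ≥0 → ℤ → ℂ} (hg : GoodPath e ψ) (hs : smallness e R T ψ ≤ 1) :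
    ∃ K : ℝ≥0∞, K ≠ ∞ ∧ ∀ (u₀ v₀ : ℤ → ℂ) (u v : ℝ → ℤ → ℂ),
      eFL e.s e.p u₀ ≤ R → eFL e.s e.p v₀ ≤ R → IsSolutionInClass e.s e.b e.p T u₀ ψ u →
      IsSolutionInClass e.s e.b e.p T v₀ ψ v →
      (⨆ t ∈ Set.Icc (0 : ℝ) T, eFL e.s e.p (v t - u t)) ≤ K * eFL e.s e.p (v₀ - u₀) ∧
      eXT e.s e.b e.p T (v - u) ≤ K * eFL e.s e.p (v₀ - u₀) := by
  have hL := linNorm_lt_top hT hs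
  have hp := e.p_pos
  obtain ⟨C, hC⟩ := exists_nX_cutFT_const_le e (e.b_lt_b'.trans e.b'_lt)
  obtain ⟨D, hD⟩ := exists_nS_duh3_sub_le e
  set L := linNorm e R T ψ with hLd
  set M := (2 * L + 2 * L) ^ 2 * (2 * dataConst e) with hM
  refine ⟨(1 + D * M) + (C + duhConst e * ENNReal.ofReal (T ^ e.θ) * M), by finiteness,
    fun u₀ v₀ u v bu bv hu hv => ?_⟩
  obtain ⟨F, mF, nF, iF, eF⟩ := solution_interaction e hR hT h1 hg hs bu hu
  obtain ⟨G, mG, nG, iG, eG⟩ := solution_interaction e hR hT h1 hg hs bv hv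
  set d := eFL e.s e.p (v₀ - u₀) with hd
  have nF' : nX e.s e.β e.p F < ∞ := nF.trans_lt (by finiteness)
  have nG' : nX e.s e.β e.p G < ∞ := nG.trans_lt (by finiteness)
  have eF' : F = fun n => cutFT 0 T (fun t => mildMap t n u₀ ψ F) := by
    conv_lhs => rw [eF]
    exact funext fun n => cutFT_congr hT.le fun t ht => iF t ht n
  have eG' : G = fun n => cutFT 0 T (fun t => mildMap t n v₀ ψ G) := by
    conv_lhs => rw [eG]
    exact funext fun n => cutFT_congr hT.le fun t ht => iG t ht n
  have hGF : nX e.s e.β e.p (G - F) ≤ 2 * dataConst e * d := by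
    rw [mul_assoc]
    refine le_two_mul_of_le_add_half (nX_sub_lt_top e mG mF nG' nF') ?_
    have := nX_mild_contraction e hT.le h1 hg.continuous hs v₀ u₀ mG mF hL nG nF
    rwa [← eF', ← eG'] at this
  have hprod : (nX e.s e.β e.p G + nX e.s e.β e.p F) ^ 2 * nX e.s e.β e.p (G - F) ≤ M * d := by
    rw [hM, mul_assoc]
    exact mul_le_mul' (pow_le_pow_left' (add_le_add nG nF) 2) hGF
  constructor
  · have b0 : (⨆ t ∈ Set.Icc (0 : ℝ) T, eFL e.s e.p (v t - u t)) ≤ nS e.s e.p 0 T (v - u) :=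
      iSup₂_le fun t ht => eFL_le_nS hp (v - u) ht
    refine b0.trans ?_
    have b1 : nS e.s e.p 0 T (v - u) ≤ nS e.s e.p 0 T ((fun _ n => v₀ n - u₀ n) +
        fun t n => I * (duh3 0 t n G - duh3 0 t n F)) := by
      refine nS_mono hp fun t ht n => ?_
      rw [← enorm_inter (v - u)]
      refine le_of_eq (congrArg _ ?_)
      have e1 : inter (v - u) t n = inter v t n - inter u t n := by
        simp [inter, mul_sub]
      rw [e1, iF t ht n, iG t ht n]
      simp only [mildMap, Pi.add_apply]
      ring
    have b2 : d + D * (M * d) ≤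
        ((1 + D * M) + (C + duhConst e * ENNReal.ofReal (T ^ e.θ) * M)) * d := by
      rw [← mul_assoc]
      conv_lhs => rw [← one_mul d]
      rw [← mul_assoc, mul_one, ← add_mul]
      exact mul_le_mul' le_self_add le_rfl
    refine b1.trans ((nS_add_le e.one_lt_p.le _ _).trans ?_)
    refine le_trans (add_le_add (nS_const_le _ hp _) ((nS_mono hp fun t _ n => ?_).trans
      ((hD 0 T G F (by linarith) mG mF nG' nF').trans (mul_le_mul' le_rfl hprod)))) b2
    rw [enorm_mul, enorm_I, one_mul]
  · have hc : ∀ n, ContinuousOn (fun t => (v - u) t n) (Set.Icc 0 T) := fun n =>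
      (hv.1.continuousOn hp n).sub (hu.1.continuousOn hp n)
    refine (eXT_le_nX hT.le hc).trans ?_
    have e2 : (fun n => cutFT 0 T (fun t => cexp (-(I * t * disp n)) * (v - u) t n)) = G - F := by
      funext n τ
      have hi : ∀ w : ℝ → ℤ → ℂ, ContinuousOn (fun t => w t n) (Set.Icc 0 T) →
          IntervalIntegrable (fun t => inter w t n) volume 0 T := fun w cw =>
        ContinuousOn.intervalIntegrable (by
          rw [Set.uIcc_of_le hT.le]
          exact continuousOn_inter cw)
      rw [eF, eG]
      simp only [Pi.sub_apply]
      rw [← cutFT_sub (hi v (hv.1.continuousOn hp n)) (hi u (hu.1.continuousOn hp n))]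
      simp only [inter, mul_sub]
    rw [e2]
    conv_lhs => rw [eF', eG']
    refine (nX_mild_sub_le e hT.le h1 hg.continuous v₀ u₀ mG mF nG' nF' e.b).trans ?_
    refine le_trans (add_le_add (hC T (v₀ - u₀) hT.le h1) ((nX_duh3_sub_le e hT.le h1 mG mF nG'
      nF').trans (mul_le_mul' le_rfl hprod))) ?_
    rw [← mul_assoc _ M d, ← add_mul]
    exact mul_le_mul' le_add_self le_rfl

lemma tendsto_zero_of_le_mul {K : ℝ≥0∞} (hK : K ≠ ∞) {x y : ℕ → ℝ≥0∞} (h : ∀ j, x j ≤ K * y j)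
    (hy : Tendsto y atTop (𝓝 0)) : Tendsto x atTop (𝓝 0) := by
  have h1 := ENNReal.Tendsto.const_mul (a := K) hy (.inr hK)
  rw [mul_zero] at h1
  exact tendsto_of_tendsto_of_tendsto_of_le_of_le tendsto_const_nhds h1 (fun _ => zero_le) h

/-! ### The existence time -/

lemma tendsto_cutFT_right {T : ℝ} {g : ℝ → ℂ} (hg : Continuous g) {x : ℕ → ℝ}
    (hx : Tendsto x atTop (𝓝 T)) (τ : ℝ) :
    Tendsto (fun k => cutFT 0 (x k) g τ) atTop (𝓝 (cutFT 0 T g τ)) := by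
  have hc : Continuous fun r : ℝ => cexp (-(I * r * τ)) * g r := by fun_prop
  exact ((intervalIntegral.continuous_primitive (fun a b => hc.intervalIntegrable a b) 0).tendsto
    T).comp hx

/-- Fatou's lemma, since the transform over [0, T] is continuous in T at each frequency and
modulation. Lower semicontinuity suffices for the existence time. -/
lemma noiseNorm_le_liminf (e : Exponents) {T : ℝ} (hT : 0 < T) {ψ : ℝ≥0 → ℤ → ℂ}
    (hψ : ∀ n, Continuous fun t => ψ t n) {x : ℕ → ℝ} (hx : Tendsto x atTop (𝓝 T))
    (h0 : ∀ k, 0 ≤ x k) :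
    noiseNorm e T ψ ≤ liminf (fun k => noiseNorm e (x k) ψ) atTop := by
  have hm : ∀ y, 0 ≤ y → ∀ n, Measurable (cutFT 0 y (fun t => noisePath ψ t n)) := fun y hy n =>
    (continuous_cutFT hy ((continuous_noisePath hψ n).integrableOn_Icc.mono_set
      Set.Ioc_subset_Icc_self)).measurable
  simp only [noiseNorm]
  rw [nX_eq_eLpNorm (hm T hT.le) _ _ e.p_pos]
  simp only [fun k => nX_eq_eLpNorm (hm (x k) (h0 k)) e.s e.β e.p_pos]
  refine Lp.eLpNorm_lim_le_liminf_eLpNorm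
    (fun k => (measurable_weighted (hm (x k) (h0 k)) _ _).aestronglyMeasurable) _
    (.of_forall fun y => ?_)
  exact (tendsto_cutFT_right (continuous_noisePath hψ y.1) hx y.2).const_mul _

lemma smallness_le_of_lt (e : Exponents) {R : ℝ≥0∞} {T : ℝ} (hT : 0 < T)
    {ψ : ℝ≥0 → ℤ → ℂ} (hψ : ∀ n, Continuous fun t => ψ t n)
    (h : ∀ q : ℚ, 0 < (q : ℝ) → (q : ℝ) < T → smallness e R q ψ ≤ 1) : smallness e R T ψ ≤ 1 := by
  obtain ⟨x, hx1, hx2⟩ : ∃ x : ℕ → ℚ, (∀ k, 0 < (x k : ℝ) ∧ (x k : ℝ) < T) ∧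
      Tendsto (fun k => (x k : ℝ)) atTop (𝓝 T) := by
    have hex : ∀ k : ℕ, ∃ q : ℚ, max 0 (T - 1 / (k + 1)) < (q : ℝ) ∧ (q : ℝ) < T := fun k =>
      exists_rat_btwn (max_lt hT (by have : (0 : ℝ) < 1 / (k + 1) := by positivity
                                     linarith))
    choose x hx using hex
    refine ⟨x, fun k => ⟨(le_max_left _ _).trans_lt (hx k).1, (hx k).2⟩, ?_⟩
    refine tendsto_of_tendsto_of_tendsto_of_le_of_le (g := fun k : ℕ => T - 1 / ((k : ℝ) + 1)) ?_
      tendsto_const_nhds (fun k => ((le_max_right _ _).trans_lt (hx k).1).le) fun k => (hx k).2.le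
    have := tendsto_one_div_add_atTop_nhds_zero_nat (𝕜 := ℝ)
    simpa using tendsto_const_nhds.sub this
  have hl := noiseNorm_le_liminf e hT hψ hx2 fun k => (hx1 k).1.le
  -- Freezing the factor T^θ at some c < T separates it from the lower limit of the norms;
  -- afterwards c tends to T along the sequence.
  have key : ∀ c : ℝ, 0 < c → c < T →
      32 * (duhConst e + 1) * ENNReal.ofReal (c ^ e.θ) * (dataConst e * R + noiseNorm e T ψ) ^ 2
        ≤ 1 := by
    intro c hc hcT
    set f : ℝ≥0∞ → ℝ≥0∞ := fun y =>
      32 * (duhConst e + 1) * ENNReal.ofReal (c ^ e.θ) * (dataConst e * R + y) ^ 2 with hf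
    have hfm : Monotone f := fun a b hab =>
      mul_le_mul' le_rfl (pow_le_pow_left' (add_le_add le_rfl hab) 2)
    have hfc : Continuous f := by
      refine (ENNReal.continuous_const_mul (by finiteness)).comp
        ((ENNReal.continuous_pow 2).comp (by fun_prop))
    refine (hfm hl).trans ?_
    rw [hfm.map_liminf_of_continuousAt _ hfc.continuousAt]
    have he : ∀ᶠ k in atTop, (f ∘ fun k => noiseNorm e (x k) ψ) k ≤ 1 := by
      filter_upwards [hx2.eventually (lt_mem_nhds hcT)] with k hk
      refine le_trans ?_ (h (x k) (hx1 k).1 (hx1 k).2)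
      refine mul_le_mul' (mul_le_mul' le_rfl (ENNReal.ofReal_le_ofReal ?_)) le_rfl
      exact Real.rpow_le_rpow hc.le hk.le e.θ_pos.le
    exact (liminf_le_liminf he).trans (by simp)
  have hlim : Tendsto (fun k : ℕ => 32 * (duhConst e + 1) * ENNReal.ofReal ((x k : ℝ) ^ e.θ) *
      (dataConst e * R + noiseNorm e T ψ) ^ 2) atTop (𝓝 (smallness e R T ψ)) := by
    have h1 : Tendsto (fun k => 32 * ((duhConst e : ℝ≥0∞) + 1) * ENNReal.ofReal ((x k : ℝ) ^ e.θ)) atTop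
        (𝓝 (32 * (duhConst e + 1) * ENNReal.ofReal (T ^ e.θ))) :=
      ENNReal.Tendsto.const_mul (ENNReal.tendsto_ofReal
        (((Real.continuousAt_rpow_const T e.θ (.inl hT.ne')).tendsto).comp hx2))
        (.inr (by finiteness))
    refine ENNReal.Tendsto.mul_const h1 (.inl ?_)
    have : 0 < ENNReal.ofReal (T ^ e.θ) := ENNReal.ofReal_pos.2 (Real.rpow_pos_of_pos hT _)
    simp only [ne_eq, mul_eq_zero, not_or]
    exact ⟨⟨by norm_num, by simp⟩, this.ne'⟩
  exact le_of_tendsto' hlim fun k => key _ (hx1 k).1 (hx1 k).2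

/-- The rational times at which the smallness condition fails, together with `1`. -/
def badTimes (e : Exponents) (R : ℝ≥0) (ψ : ℝ≥0 → ℤ → ℂ) : Set ℝ≥0 :=
  insert 1 {t | ∃ q : ℚ, (t : ℝ) = q ∧ 0 < t ∧ 1 < smallness e R t ψ}

/-- The local existence time, as a function of a bound for the data and of the path of the
stochastic convolution. -/
def existTime (e : Exponents) (R : ℝ≥0) (ψ : ℝ≥0 → ℤ → ℂ) : ℝ≥0 := sInf (badTimes e R ψ)

lemma existTime_le_one (e : Exponents) (R : ℝ≥0) (ψ : ℝ≥0 → ℤ → ℂ) : existTime e R ψ ≤ 1 :=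
  csInf_le (OrderBot.bddBelow _) (Set.mem_insert _ _)

/-- Only countably many conditions, each at a time before t: the form needed for the stopping time
property. -/
lemma existTime_lt_iff (e : Exponents) (R : ℝ≥0) (ψ : ℝ≥0 → ℤ → ℂ) (t : ℝ≥0) :
    existTime e R ψ < t ↔ 1 < t ∨
      ∃ q : ℚ, 0 < (q : ℝ) ∧ (q : ℝ) < t ∧ 1 < smallness e R q ψ := by
  have hne : (badTimes e R ψ).Nonempty := ⟨1, Set.mem_insert _ _⟩
  rw [existTime, csInf_lt_iff (OrderBot.bddBelow _) hne]
  constructor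
  · rintro ⟨x, rfl | ⟨q, hq, h0, hs⟩, hx⟩
    · exact .inl hx
    · exact .inr ⟨q, by rw [← hq]; exact_mod_cast h0, by rw [← hq]; exact_mod_cast hx, hq ▸ hs⟩
  · rintro (h | ⟨q, h0, hq, hs⟩)
    · exact ⟨1, Set.mem_insert _ _, h⟩
    · refine ⟨⟨q, h0.le⟩, .inr ⟨q, rfl, h0, hs⟩, hq⟩

/-- For a good path the noise norm is bounded uniformly in T ≤ 1, so the factor T^θ alone makes
`smallness` small near 0. -/
lemma existTime_pos (e : Exponents) (R : ℝ≥0) {ψ : ℝ≥0 → ℤ → ℂ} (hg : GoodPath e ψ) :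
    0 < existTime e R ψ := by
  obtain ⟨C, hC⟩ := nX_noisePath_lt_top e hg e.β_pos.le (e.β_lt_b.trans e.b_lt_b')
  obtain ⟨h, hh, hs⟩ := exists_step e
    (K := 32 * (duhConst e + 1) * (dataConst e * R + C) ^ 2) (by finiteness)
  refine lt_of_lt_of_le (b := min 1 h.toNNReal) (by simpa using hh) ?_
  refine not_lt.1 fun hlt => ?_
  rcases (existTime_lt_iff e R ψ _).1 hlt with h1 | ⟨q, h0, hq, h1⟩
  · exact absurd h1 (not_lt.2 (min_le_left _ _))
  · have hq1 : (q : ℝ) ≤ 1 := hq.le.trans (by exact_mod_cast min_le_left _ _)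
    have hqh : (q : ℝ) ≤ h := by
      refine hq.le.trans (le_trans (NNReal.coe_le_coe.2 (min_le_right _ _)) ?_)
      rw [Real.coe_toNNReal _ hh.le]
    refine absurd h1 (not_lt.2 ?_)
    have h2 := hs q h0.le hqh
    calc smallness e R q ψ ≤ 32 * (duhConst e + 1) * ENNReal.ofReal ((q : ℝ) ^ e.θ) *
          (dataConst e * R + C) ^ 2 :=
          mul_le_mul' le_rfl (pow_le_pow_left' (add_le_add le_rfl (hC q h0.le hq1)) 2)
      _ = 32 * (duhConst e + 1) * (dataConst e * R + C) ^ 2 * ENNReal.ofReal ((q : ℝ) ^ e.θ) := by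
          ring
      _ ≤ 1 := h2.trans (by simp)

lemma smallness_existTime_le (e : Exponents) (R : ℝ≥0) {ψ : ℝ≥0 → ℤ → ℂ} (hg : GoodPath e ψ) :
    smallness e R (existTime e R ψ) ψ ≤ 1 := by
  refine smallness_le_of_lt e (existTime_pos e R hg) hg.continuous
    fun q h0 hq => not_lt.1 fun hs => ?_
  have := (existTime_lt_iff e R ψ (existTime e R ψ)).2 (.inr ⟨q, h0, hq, hs⟩)
  exact lt_irrefl _ this

theorem wellPosed_of_goodPath (e : Exponents) (R : ℝ≥0) {ψ : ℝ≥0 → ℤ → ℂ} (hg : GoodPath e ψ) :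
    0 < existTime e R ψ ∧
    (∀ u₀ : ℤ → ℂ, eFL e.s e.p u₀ ≤ R →
      ∃ u, IsSolutionInClass e.s e.b e.p (existTime e R ψ) u₀ ψ u ∧
        ∀ v, IsSolutionInClass e.s e.b e.p (existTime e R ψ) u₀ ψ v →
          ∀ t ∈ Set.Icc (0 : ℝ) (existTime e R ψ), v t = u t) ∧
    (∀ (u₀ : ℤ → ℂ) (u : ℝ → ℤ → ℂ) (v₀ : ℕ → ℤ → ℂ) (v : ℕ → ℝ → ℤ → ℂ),
      eFL e.s e.p u₀ ≤ R → (∀ j, eFL e.s e.p (v₀ j) ≤ R) →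
      IsSolutionInClass e.s e.b e.p (existTime e R ψ) u₀ ψ u →
      (∀ j, IsSolutionInClass e.s e.b e.p (existTime e R ψ) (v₀ j) ψ (v j)) →
      Tendsto (fun j => eFL e.s e.p (v₀ j - u₀)) atTop (𝓝 0) →
      Tendsto (fun j => ⨆ t ∈ Set.Icc (0 : ℝ) (existTime e R ψ), eFL e.s e.p (v j t - u t))
        atTop (𝓝 0) ∧
      Tendsto (fun j => eXT e.s e.b e.p (existTime e R ψ) (v j - u)) atTop (𝓝 0)) := by
  have hT := existTime_pos e R hg
  have hT' : (0 : ℝ) < existTime e R ψ := hT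
  have h1 : (existTime e R ψ : ℝ) ≤ 1 := existTime_le_one e R ψ
  have hs := smallness_existTime_le e R hg
  refine ⟨hT, fun u₀ hu => ?_, fun u₀ u v₀ v hu hv su sv hlim => ?_⟩
  · obtain ⟨u, hu', -⟩ := exists_unique_solution e ENNReal.coe_lt_top hT' h1 hg hs hu
    exact ⟨u, hu'⟩
  · obtain ⟨K, hK, hKb⟩ := exists_lipschitz e ENNReal.coe_lt_top hT' h1 hg hs
    exact ⟨tendsto_zero_of_le_mul hK (fun j => (hKb u₀ (v₀ j) u (v j) hu (hv j) su (sv j)).1) hlim,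
      tendsto_zero_of_le_mul hK (fun j => (hKb u₀ (v₀ j) u (v j) hu (hv j) su (sv j)).2) hlim⟩

/-! ### Measurability of the existence time -/

lemma stronglyMeasurable_cutFT {Ω : Type*} [MeasurableSpace Ω] {q : ℝ} (hq : 0 ≤ q)
    {Y : ℝ → Ω → ℂ} (hm : ∀ r, Measurable (Y r)) (hc : ∀ ω, Continuous fun r => Y r ω) :
    StronglyMeasurable fun y : Ω × ℝ => cutFT 0 q (fun r => Y r y.1) y.2 := by
  have h1 : StronglyMeasurable (Function.uncurry Y) :=
    stronglyMeasurable_uncurry_of_continuous_of_stronglyMeasurable hc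
      fun r => (hm r).stronglyMeasurable
  have h5 : Measurable fun x : (Ω × ℝ) × ℝ => cexp (-(I * x.2 * x.1.2)) := by fun_prop
  have h6 : Measurable fun x : (Ω × ℝ) × ℝ => (x.2, x.1.1) := by fun_prop
  have h4 := (h5.stronglyMeasurable.mul (h1.comp_measurable h6)).integral_prod_right'
    (ν := volume.restrict (Set.Ioc 0 q))
  convert h4 using 2 with y
  rw [cutFT, intervalIntegral.integral_of_le hq]
  rfl

lemma measurable_nX {Ω : Type*} [MeasurableSpace Ω] (s b p : ℝ) {G : Ω → ℤ → ℝ → ℂ}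
    (hG : ∀ n, Measurable fun y : Ω × ℝ => G y.1 n y.2) : Measurable fun ω => nX s b p (G ω) := by
  refine (Measurable.tsum fun n => ?_).pow_const _
  refine Measurable.lintegral_prod_right' (f := fun y : Ω × ℝ => (wt s n * wt b y.2 *
    ‖G y.1 n y.2‖ₑ) ^ p) ?_
  exact ((((measurable_wt b).comp measurable_snd).const_mul (wt s n)).mul (hG n).enorm).pow_const p

lemma measurable_noiseNorm {Ω : Type*} [MeasurableSpace Ω] (e : Exponents) {q : ℝ} (hq : 0 ≤ q)
    {Ψ : ℝ≥0 → Ω → ℤ → ℂ} (hm : ∀ t : ℝ≥0, t ≤ q → ∀ n, Measurable fun ω => Ψ t ω n)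
    (hc : ∀ ω n, Continuous fun t => Ψ t ω n) :
    Measurable fun ω => noiseNorm e q (fun t => Ψ t ω) := by
  -- Clamping the time to [0, q] changes nothing under the integral and ensures that the process is
  -- evaluated only at times up to q, where it is measurable for the given σ-algebra.
  have h2 : ∀ n, StronglyMeasurable fun y : Ω × ℝ =>
      cutFT 0 q (fun r => noisePath (fun t => Ψ t y.1) (max 0 (min r q)) n) y.2 := by
    intro n
    refine stronglyMeasurable_cutFT hq
      (Y := fun (r : ℝ) (ω : Ω) => noisePath (fun t => Ψ t ω) (max 0 (min r q)) n)
      (fun r => Measurable.const_mul (hm _ ?_ n) _) fun ω => ?_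
    · rw [Real.coe_toNNReal _ (le_max_left _ _)]
      exact max_le hq (min_le_right _ _)
    · exact (continuous_noisePath (hc ω) n).comp (by fun_prop)
  have h3 : ∀ ω n, cutFT 0 q (fun t => noisePath (fun t => Ψ t ω) t n) =
      cutFT 0 q (fun r => noisePath (fun t => Ψ t ω) (max 0 (min r q)) n) := fun ω n =>
    cutFT_congr hq fun r hr => by
      rw [min_eq_left hr.2, max_eq_right hr.1]
  simp only [noiseNorm, h3]
  exact measurable_nX e.s e.β e.p fun n => (h2 n).measurable

/-! ### Riemann sums for Wiener integrals -/

/-- The `j`-th point of the partition of `[s, t]` into `N` intervals of equal length. -/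
def grid (s t : ℝ) (N j : ℕ) : ℝ := s + j * ((t - s) / N)

lemma grid_zero (s t : ℝ) (N : ℕ) : grid s t N 0 = s := by simp [grid]

lemma grid_self (s t : ℝ) {N : ℕ} (hN : 0 < N) : grid s t N N = t := by
  have : (N : ℝ) ≠ 0 := by positivity
  rw [grid]; field_simp; ring

lemma grid_succ (s t : ℝ) (N j : ℕ) : grid s t N (j + 1) = grid s t N j + (t - s) / N := by
  rw [grid, grid]; push_cast; ring

lemma grid_mono {s t : ℝ} (h : s ≤ t) (N : ℕ) : Monotone (grid s t N) := by
  refine monotone_nat_of_le_succ fun j => ?_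
  rw [grid_succ]
  have : 0 ≤ (t - s) / N := div_nonneg (by linarith) (by positivity)
  linarith

lemma grid_mem {s t : ℝ} (h : s ≤ t) {N j : ℕ} (hN : 0 < N) (hj : j ≤ N) :
    grid s t N j ∈ Set.Icc s t :=
  ⟨(grid_zero s t N).symm.le.trans (grid_mono h N (Nat.zero_le j)),
    (grid_mono h N hj).trans (grid_self s t hN).le⟩

/-- The Riemann sum for the integral of `G` with respect to the path `b`. -/
def rsum (G b : ℝ → ℂ) (s t : ℝ) (N : ℕ) : ℂ :=
  ∑ j ∈ Finset.range N, G (grid s t N j) * (b (grid s t N (j + 1)) - b (grid s t N j))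

lemma norm_sum_integral_sub_le {H b : ℝ → ℂ} (hH : Continuous H) (hb : Continuous b) {s t : ℝ}
    (h : s ≤ t) {M ε δ : ℝ} (hM : ∀ r ∈ Set.Icc s t, ‖H r‖ ≤ M) (hM0 : 0 ≤ M)
    (hδ : ∀ x ∈ Set.Icc s t, ∀ y ∈ Set.Icc s t, dist x y ≤ δ → dist (b x) (b y) ≤ ε)
    {N : ℕ} (hN : 0 < N) (hNδ : (t - s) / N ≤ δ) :
    ‖(∫ r in s..t, H r * b r) - ∑ j ∈ Finset.range N,
      (∫ r in grid s t N j..grid s t N (j + 1), H r) * b (grid s t N (j + 1))‖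
      ≤ M * ε * (t - s) := by
  have hi : ∀ j < N, IntervalIntegrable (fun r => H r * b r) volume (grid s t N j)
      (grid s t N (j + 1)) := fun j _ => (hH.mul hb).intervalIntegrable _ _
  have e1 := intervalIntegral.sum_integral_adjacent_intervals hi
  rw [grid_zero, grid_self s t hN] at e1
  rw [← e1, ← Finset.sum_sub_distrib]
  have hN' : (N : ℝ) ≠ 0 := by positivity
  calc _ ≤ ∑ _j ∈ Finset.range N, M * ε * ((t - s) / N) := by
        refine norm_sum_le_of_le _ fun j hj => ?_
        have hj' : j < N := Finset.mem_range.1 hj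
        have g1 := grid_mem h hN hj'.le
        have g2 := grid_mem h hN (Nat.succ_le_of_lt hj')
        have g3 : grid s t N j ≤ grid s t N (j + 1) := grid_mono h N (Nat.le_succ j)
        rw [← intervalIntegral.integral_mul_const, ← intervalIntegral.integral_sub
          (hi j hj') ((by fun_prop : Continuous fun r => H r *
            b (grid s t N (j + 1))).intervalIntegrable _ _)]
        refine (intervalIntegral.norm_integral_le_of_norm_le_const (C := M * ε) fun r hr => ?_).trans
          (le_of_eq ?_)
        · rw [Set.uIoc_of_le g3] at hr
          have hr' : r ∈ Set.Icc s t := ⟨g1.1.trans hr.1.le, hr.2.trans g2.2⟩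
          rw [← mul_sub, norm_mul]
          refine mul_le_mul (hM r hr') ?_ (norm_nonneg _) hM0
          rw [← dist_eq_norm]
          refine hδ r hr' _ g2 ?_
          rw [Real.dist_eq, abs_sub_comm, abs_of_nonneg (by linarith [hr.2])]
          refine le_trans ?_ hNδ
          rw [grid_succ]
          linarith [hr.1]
        · rw [grid_succ, add_sub_cancel_left, abs_of_nonneg (div_nonneg (by linarith) (by positivity))]
    _ = _ := by
        rw [Finset.sum_const, Finset.card_range, nsmul_eq_mul]
        field_simp

/-- Summation by parts shifts the increments to G, after which uniform continuity of b is enough.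
This connects the pathwise definition of the Wiener integral with Gaussian sums of increments. -/
lemma tendsto_rsum {G G' b : ℝ → ℂ} (hG : ∀ r, HasDerivAt G (G' r) r) (hG' : Continuous G')
    (hb : Continuous b) {s t : ℝ} (h : s ≤ t) :
    Tendsto (rsum G b s t) atTop (𝓝 (G t * b t - G s * b s - ∫ r in s..t, G' r * b r)) := by
  have e1 : ∀ N : ℕ, 0 < N → rsum G b s t N = G t * b t - G s * b s - ∑ j ∈ Finset.range N,
      (∫ r in grid s t N j..grid s t N (j + 1), G' r) * b (grid s t N (j + 1)) := by
    intro N hN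
    have e2 := Finset.sum_range_sub (fun j => G (grid s t N j) * b (grid s t N j)) N
    rw [grid_zero, grid_self s t hN] at e2
    rw [← e2, rsum, ← Finset.sum_sub_distrib]
    refine Finset.sum_congr rfl fun j _ => ?_
    rw [intervalIntegral.integral_eq_sub_of_hasDerivAt (fun r _ => hG r)
      (hG'.intervalIntegrable _ _)]
    ring
  obtain ⟨M, hM⟩ := isCompact_Icc.exists_bound_of_continuousOn (s := Set.Icc s t) hG'.continuousOn
  have hM0 : 0 ≤ max M 0 := le_max_right _ _
  rw [Metric.tendsto_atTop]
  intro ε hε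
  have huc := isCompact_Icc.uniformContinuousOn_of_continuous (s := Set.Icc s t) hb.continuousOn
  set ε' := ε / (2 * (max M 0 + 1) * (t - s + 1)) with hε'
  have hts : 0 < t - s + 1 := by linarith
  obtain ⟨δ, hδ, hu⟩ := Metric.uniformContinuousOn_iff_le.1 huc ε' (by positivity)
  obtain ⟨N₀, hN₀⟩ := exists_nat_gt ((t - s) / δ)
  refine ⟨max N₀ 1, fun N hN => ?_⟩
  have hN1 : 0 < N := lt_of_lt_of_le one_pos ((le_max_right _ _).trans hN)
  have hN2 : (N₀ : ℝ) ≤ N := by exact_mod_cast (le_max_left _ _).trans hN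
  have hN3 : (0 : ℝ) < N := by exact_mod_cast hN1
  have key := norm_sum_integral_sub_le hG' hb h (M := max M 0)
    (fun r hr => (hM r hr).trans (le_max_left _ _)) hM0 hu hN1
    (by rw [div_le_iff₀ hN3, mul_comm, ← div_le_iff₀ hδ]; linarith)
  rw [e1 N hN1, dist_eq_norm, sub_sub_sub_cancel_left]
  refine key.trans_lt ?_
  rw [hε']
  have h1 : max M 0 * (t - s) < (max M 0 + 1) * (t - s + 1) := by nlinarith
  calc max M 0 * (ε / (2 * (max M 0 + 1) * (t - s + 1))) * (t - s)
      = ε / (2 * ((max M 0 + 1) * (t - s + 1))) * (max M 0 * (t - s)) := by ring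
    _ ≤ ε / (2 * ((max M 0 + 1) * (t - s + 1))) * ((max M 0 + 1) * (t - s + 1)) :=
        mul_le_mul_of_nonneg_left h1.le (by positivity)
    _ = ε / 2 := by field_simp
    _ < ε := by linarith

/-! ### Sums of independent Gaussian variables -/

section Gaussian

variable {Ω : Type*} {m : MeasurableSpace Ω} {P : Measure Ω}

lemma hasLaw_sum_gaussian [IsProbabilityMeasure P] {ι : Type*} {ξ : ι → Ω → ℝ} {v : ι → ℝ≥0}
    (hi : iIndepFun ξ P) (h : ∀ i, HasLaw (ξ i) (gaussianReal 0 (v i)) P) (S : Finset ι) :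
    HasLaw (∑ i ∈ S, ξ i) (gaussianReal 0 (∑ i ∈ S, v i)) P := by
  classical
  induction S using Finset.induction_on with
  | empty =>
    rw [Finset.sum_empty, Finset.sum_empty, gaussianReal_zero_var]
    exact ⟨aemeasurable_const, by
      change P.map (fun _ => (0 : ℝ)) = _
      simp [Measure.map_const]⟩
  | insert i S hiS ih =>
    rw [Finset.sum_insert hiS, Finset.sum_insert hiS]
    have hind : IndepFun (ξ i) (∑ j ∈ S, ξ j) P :=
      (hi.indepFun_finsetSum_of_notMem₀ (fun j => (h j).aemeasurable) hiS).symm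
    refine ⟨(h i).aemeasurable.add ih.aemeasurable, ?_⟩
    have := gaussianReal_add_gaussianReal_of_indepFun hind (h i).map_eq ih.map_eq
    rwa [add_zero] at this

/-- The absolute moments of the standard normal distribution. -/
def gaussMoment (q : ℝ) : ℝ≥0∞ := ∫⁻ x, ‖x‖ₑ ^ q ∂gaussianReal 0 1

lemma gaussMoment_lt_top {q : ℝ} (hq : 0 < q) : gaussMoment q < ∞ := by
  have := (memLp_id_gaussianReal' (μ := 0) (v := 1) (ENNReal.ofReal q) ENNReal.ofReal_ne_top).2
  rw [eLpNorm_lt_top_iff_lintegral_rpow_enorm_lt_top (by simpa using hq) ENNReal.ofReal_ne_top,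
    ENNReal.toReal_ofReal hq.le] at this
  exact this

lemma lintegral_rpow_of_hasLaw_gaussian {X : Ω → ℝ} {v : ℝ≥0} (h : HasLaw X (gaussianReal 0 v) P)
    {q : ℝ} (hq : 0 < q) : ∫⁻ ω, ‖X ω‖ₑ ^ q ∂P = (v : ℝ≥0∞) ^ (q / 2) * gaussMoment q := by
  have h1 : gaussianReal 0 v = (gaussianReal 0 1).map (fun x => Real.sqrt v * x) := by
    rw [gaussianReal_map_const_mul, mul_zero, mul_one]
    congr 1
    ext
    simp [Real.sq_sqrt]
  have h2 : ∫⁻ ω, ‖X ω‖ₑ ^ q ∂P = ∫⁻ x, ‖x‖ₑ ^ q ∂(P.map X) :=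
    (lintegral_map' (f := fun x : ℝ => ‖x‖ₑ ^ q) (by fun_prop) h.aemeasurable).symm
  rw [h2, h.map_eq, h1, lintegral_map (by fun_prop) (by fun_prop), gaussMoment,
    ← lintegral_const_mul _ (by fun_prop)]
  refine lintegral_congr fun x => ?_
  rw [enorm_mul, ENNReal.mul_rpow_of_nonneg _ _ hq.le]
  congr 1
  rw [Real.enorm_of_nonneg (Real.sqrt_nonneg _), Real.sqrt_eq_rpow,
    ← ENNReal.ofReal_rpow_of_nonneg v.coe_nonneg (by norm_num), ← ENNReal.rpow_mul, ENNReal.ofReal_coe_nnreal]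
  congr 1
  ring

end Gaussian

/-! ### Moments of Wiener integrals -/

section Moments

variable {Ω : Type*} {m : MeasurableSpace Ω} {P : Measure Ω}

lemma lintegral_rpow_le_of_tendsto {Z : ℕ → Ω → ℂ} {Y : Ω → ℂ} {q : ℝ} {K : ℝ≥0∞}
    (hZ : ∀ N, AEMeasurable (Z N) P) (hlim : ∀ᵐ ω ∂P, Tendsto (fun N => Z N ω) atTop (𝓝 (Y ω)))
    (hK : ∀ᶠ N in atTop, ∫⁻ ω, ‖Z N ω‖ₑ ^ q ∂P ≤ K) : ∫⁻ ω, ‖Y ω‖ₑ ^ q ∂P ≤ K := by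
  calc ∫⁻ ω, ‖Y ω‖ₑ ^ q ∂P = ∫⁻ ω, liminf (fun N => ‖Z N ω‖ₑ ^ q) atTop ∂P := by
        refine lintegral_congr_ae ?_
        filter_upwards [hlim] with ω hω
        refine (Tendsto.liminf_eq ?_).symm
        exact ((ENNReal.continuous_rpow_const (y := q)).tendsto _).comp
          ((continuous_enorm.tendsto _).comp hω)
    _ ≤ liminf (fun N => ∫⁻ ω, ‖Z N ω‖ₑ ^ q ∂P) atTop :=
        lintegral_liminf_le' fun N => (hZ N).enorm.pow_const q
    _ ≤ K := (liminf_le_liminf hK).trans (by simp)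

lemma hasLaw_sum_increments [IsProbabilityMeasure P] {X : ℝ≥0 → Ω → ℝ} (hX : IsPreBrownianReal X P)
    {t : ℕ → ℝ≥0} (ht : Monotone t) (g : ℕ → ℝ) (N : ℕ) :
    HasLaw (fun ω => ∑ j ∈ Finset.range N, g j * (X (t (j + 1)) ω - X (t j) ω))
      (gaussianReal 0 (∑ j ∈ Finset.range N,
        .mk (g j ^ 2) (sq_nonneg _) * nndist (t (j + 1)).1 (t j).1)) P := by
  have h1 := hX.hasIndepIncrements.nat ht
  have h2 := h1.comp (fun j x => g j * x) (fun j => by fun_prop)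
  have h3 := hasLaw_sum_gaussian h2 (v := fun j =>
    .mk (g j ^ 2) (sq_nonneg _) * nndist (t (j + 1)).1 (t j).1) (fun j => by
      have := gaussianReal_const_mul (hX.hasLaw_sub (t (j + 1)) (t j)) (g j)
      rw [mul_zero] at this
      exact this) (Finset.range N)
  convert h3 using 1
  funext ω
  simp [Finset.sum_apply]

/-- The real and imaginary parts of the coordinates of a cylindrical Wiener process. -/
def coordPart (β : ℤ → ℝ≥0 → Ω → ℂ) (i : ℤ × Bool) (t : ℝ≥0) (ω : Ω) : ℝ :=
  if i.2 then (β i.1 t ω).re else (β i.1 t ω).im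

lemma IsCylindricalWiener.isBrownianReal {β : ℤ → ℝ≥0 → Ω → ℂ} (hW : IsCylindricalWiener β P)
    (i : ℤ × Bool) : IsBrownianReal (fun t ω => Real.sqrt 2 * coordPart β i t ω) P := by
  obtain ⟨k, b⟩ := i
  cases b
  · exact hW.im_brownian k
  · exact hW.re_brownian k

lemma IsCylindricalWiener.aemeasurable {β : ℤ → ℝ≥0 → Ω → ℂ} (hW : IsCylindricalWiener β P)
    (k : ℤ) (t : ℝ≥0) : AEMeasurable (β k t) P := by
  have h : ∀ b, AEMeasurable (coordPart β (k, b) t) P := fun b => by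
    have h1 := ((hW.isBrownianReal (k, b)).toIsPreBrownianReal.aemeasurable t).const_mul
      (Real.sqrt 2)⁻¹
    refine h1.congr (.of_forall fun ω => ?_)
    have : Real.sqrt 2 ≠ 0 := by positivity
    simp [this]
  have h1 : AEMeasurable (fun ω => (β k t ω).re) P := h true
  have h2 : AEMeasurable (fun ω => (β k t ω).im) P := h false
  refine ((Complex.measurable_ofReal.comp_aemeasurable h1).add
    ((Complex.measurable_ofReal.comp_aemeasurable h2).mul_const I)).congr (.of_forall fun ω => ?_)
  exact Complex.re_add_im _

lemma IsCylindricalWiener.ae_continuous {β : ℤ → ℝ≥0 → Ω → ℂ} (hW : IsCylindricalWiener β P) :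
    ∀ᵐ ω ∂P, ∀ k, Continuous fun t => β k t ω := by
  rw [ae_all_iff]
  intro k
  have h : ∀ b, ∀ᵐ ω ∂P, Continuous fun t => coordPart β (k, b) t ω := fun b => by
    filter_upwards [(hW.isBrownianReal (k, b)).cont] with ω hω
    have h1 := hω.const_mul (Real.sqrt 2)⁻¹
    have : Real.sqrt 2 ≠ 0 := by positivity
    simpa [← mul_assoc, this] using h1
  filter_upwards [h true, h false] with ω h1 h2
  have h1' : Continuous fun t => (β k t ω).re := h1
  have h2' : Continuous fun t => (β k t ω).im := h2
  have : (fun t => β k t ω) = fun t => ((β k t ω).re : ℂ) + (β k t ω).im * I :=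
    funext fun t => (Complex.re_add_im _).symm
  rw [this]
  fun_prop

lemma IsCylindricalWiener.ae_zero {β : ℤ → ℝ≥0 → Ω → ℂ} (hW : IsCylindricalWiener β P) :
    ∀ᵐ ω ∂P, ∀ k, β k 0 ω = 0 := by
  rw [ae_all_iff]
  intro k
  filter_upwards [(hW.isBrownianReal (k, true)).toIsPreBrownianReal.eval_zero_ae_eq_zero,
    (hW.isBrownianReal (k, false)).toIsPreBrownianReal.eval_zero_ae_eq_zero] with ω h1 h2
  simp [coordPart] at h1 h2
  exact Complex.ext h1 h2

/-- The real part is a sum, over k and over the two real coordinates of βₖ, of independent centred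
Gaussian variables, each in turn a sum of independent increments. The variance is half of the bound
because E|βₖ(t)|² = t is shared by the two coordinates. -/
lemma lintegral_rpow_re_sum_le [IsProbabilityMeasure P] {β : ℤ → ℝ≥0 → Ω → ℂ}
    (hW : IsCylindricalWiener β P) (F : Finset ℤ) (c : ℤ → ℂ) (γ : ℕ → ℂ) {t : ℕ → ℝ≥0}
    (ht : Monotone t) (N : ℕ) :
    ∃ v : ℝ≥0, (v : ℝ) ≤ (∑ k ∈ F, ‖c k‖ ^ 2) *
        ∑ j ∈ Finset.range N, ‖γ j‖ ^ 2 * ((t (j + 1) : ℝ) - t j) ∧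
      HasLaw (fun ω => (∑ k ∈ F, c k * ∑ j ∈ Finset.range N,
        γ j * (β k (t (j + 1)) ω - β k (t j) ω)).re) (gaussianReal 0 v) P := by
  set g : ℤ × Bool → ℕ → ℝ := fun i j =>
    (if i.2 then (c i.1 * γ j).re else -(c i.1 * γ j).im) / Real.sqrt 2 with hg
  set Φ : ℤ × Bool → (ℝ≥0 → ℝ) → ℝ := fun i x =>
    ∑ j ∈ Finset.range N, g i j * (Real.sqrt 2 * x (t (j + 1)) - Real.sqrt 2 * x (t j)) with hΦ
  have h1 : iIndepFun (fun i ω => Φ i (fun t => coordPart β i t ω)) P :=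
    hW.indep.comp Φ fun i => by fun_prop
  have h2 := hasLaw_sum_gaussian h1 (fun i => hasLaw_sum_increments
    (hW.isBrownianReal i).toIsPreBrownianReal ht (g i) N) (F ×ˢ Finset.univ)
  have e1 : (fun ω => (∑ k ∈ F, c k * ∑ j ∈ Finset.range N,
        γ j * (β k (t (j + 1)) ω - β k (t j) ω)).re) =
      ∑ i ∈ F ×ˢ Finset.univ, fun ω => Φ i fun t => coordPart β i t ω := by
    funext ω
    simp only [Finset.sum_apply, Finset.sum_product, Fintype.sum_bool, Complex.re_sum]
    refine Finset.sum_congr rfl fun k _ => ?_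
    rw [Finset.mul_sum, Complex.re_sum, hΦ, ← Finset.sum_add_distrib]
    refine Finset.sum_congr rfl fun j _ => ?_
    have h3 : Real.sqrt 2 ≠ 0 := by positivity
    simp only [hg, coordPart, if_true, Bool.false_eq_true, if_false]
    rw [← mul_assoc, Complex.mul_re, Complex.sub_re, Complex.sub_im]
    field_simp
    ring
  rw [e1]
  refine ⟨_, ?_, h2⟩
  · push_cast
    rw [Finset.sum_product, Finset.sum_mul]
    refine Finset.sum_le_sum fun k _ => ?_
    rw [Fintype.sum_bool, ← Finset.sum_add_distrib, Finset.mul_sum]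
    refine Finset.sum_le_sum fun j _ => ?_
    have h4 : (t j : ℝ) ≤ t (j + 1) := ht (Nat.le_succ j)
    have h5 : dist (t (j + 1) : ℝ) (t j) = t (j + 1) - t j := by
      rw [Real.dist_eq, abs_of_nonneg (by linarith)]
    have h6 : ‖c k‖ ^ 2 * ‖γ j‖ ^ 2 = (c k * γ j).re ^ 2 + (c k * γ j).im ^ 2 := by
      rw [← mul_pow, ← norm_mul, Complex.sq_norm, Complex.normSq_apply]; ring
    have h7 : ∀ a : ℝ, (a / Real.sqrt 2) ^ 2 = a ^ 2 / 2 := fun a => by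
      rw [div_pow, Real.sq_sqrt (by norm_num)]
    simp only [hg, if_true, Bool.false_eq_true, if_false, NNReal.val_eq_coe, h5,
      h7]
    rw [← mul_assoc, h6, ← add_mul]
    refine mul_le_mul_of_nonneg_right ?_ (by linarith)
    nlinarith [sq_nonneg (c k * γ j).re, sq_nonneg (c k * γ j).im]

/-- The constant in the moment estimate for complex Gaussian sums. -/
def momConst (q : ℝ) : ℝ≥0∞ := 2 ^ (q - 1) * (gaussMoment q + gaussMoment q)

lemma momConst_lt_top {q : ℝ} (hq : 1 ≤ q) : momConst q < ∞ := by
  have h1 := gaussMoment_lt_top (q := q) (by linarith)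
  have h2 : (2 : ℝ≥0∞) ^ (q - 1) < ∞ := ENNReal.rpow_lt_top_of_nonneg (by linarith) (by simp)
  rw [momConst]
  finiteness

lemma lintegral_rpow_sum_le [IsProbabilityMeasure P] {β : ℤ → ℝ≥0 → Ω → ℂ}
    (hW : IsCylindricalWiener β P) (F : Finset ℤ) (c : ℤ → ℂ) (γ : ℕ → ℂ) {t : ℕ → ℝ≥0}
    (ht : Monotone t) (N : ℕ) {q : ℝ} (hq : 1 ≤ q) :
    ∫⁻ ω, ‖∑ k ∈ F, c k * ∑ j ∈ Finset.range N, γ j * (β k (t (j + 1)) ω - β k (t j) ω)‖ₑ ^ q ∂P ≤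
      momConst q * ENNReal.ofReal ((∑ k ∈ F, ‖c k‖ ^ 2) *
        ∑ j ∈ Finset.range N, ‖γ j‖ ^ 2 * ((t (j + 1) : ℝ) - t j)) ^ (q / 2) := by
  have hq0 : 0 < q := by linarith
  obtain ⟨v, hv, lv⟩ := lintegral_rpow_re_sum_le hW F c γ ht N
  -- Im z = Re(-iz), so the imaginary part is covered by the same lemma with rotated coefficients.
  obtain ⟨w, hw, lw⟩ := lintegral_rpow_re_sum_le hW F (fun k => -I * c k) γ ht N
  simp only [norm_mul, norm_neg, norm_I, one_mul] at hw
  set Z : Ω → ℂ := fun ω =>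
    ∑ k ∈ F, c k * ∑ j ∈ Finset.range N, γ j * (β k (t (j + 1)) ω - β k (t j) ω) with hZ
  set V := (∑ k ∈ F, ‖c k‖ ^ 2) * ∑ j ∈ Finset.range N, ‖γ j‖ ^ 2 * ((t (j + 1) : ℝ) - t j)
  have hw' : ∀ ω, (∑ k ∈ F, -I * c k * ∑ j ∈ Finset.range N,
      γ j * (β k (t (j + 1)) ω - β k (t j) ω)).re = (Z ω).im := by
    intro ω
    have : ∑ k ∈ F, -I * c k * ∑ j ∈ Finset.range N,
        γ j * (β k (t (j + 1)) ω - β k (t j) ω) = -I * Z ω := by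
      rw [hZ, Finset.mul_sum]
      exact Finset.sum_congr rfl fun k _ => by ring
    rw [this]
    simp
  simp only [hw'] at lw
  have lv' : HasLaw (fun ω => (Z ω).re) (gaussianReal 0 v) P := lv
  have hvV : ∀ x : ℝ≥0, (x : ℝ) ≤ V → (x : ℝ≥0∞) ^ (q / 2) ≤ ENNReal.ofReal V ^ (q / 2) :=
    fun x hx => ENNReal.rpow_le_rpow (by
      rw [← ENNReal.ofReal_coe_nnreal]; exact ENNReal.ofReal_le_ofReal hx) (by linarith)
  calc ∫⁻ ω, ‖Z ω‖ₑ ^ q ∂P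
      ≤ ∫⁻ ω, 2 ^ (q - 1) * (‖(Z ω).re‖ₑ ^ q + ‖(Z ω).im‖ₑ ^ q) ∂P := by
        refine lintegral_mono fun ω => ?_
        refine le_trans (ENNReal.rpow_le_rpow (z := q) (y := ‖(Z ω).re‖ₑ + ‖(Z ω).im‖ₑ) ?_ hq0.le)
          (ENNReal.rpow_add_le_mul_rpow_add_rpow _ _ hq)
        rw [← ofReal_norm, ← ofReal_norm, ← ofReal_norm,
          ← ENNReal.ofReal_add (norm_nonneg _) (norm_nonneg _)]
        exact ENNReal.ofReal_le_ofReal (Complex.norm_le_abs_re_add_abs_im _)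
    _ = 2 ^ (q - 1) * ((v : ℝ≥0∞) ^ (q / 2) * gaussMoment q +
          (w : ℝ≥0∞) ^ (q / 2) * gaussMoment q) := by
        rw [lintegral_const_mul' _ _ (ENNReal.rpow_lt_top_of_nonneg (by linarith) (by simp)).ne,
          lintegral_add_left' (lv'.aemeasurable.enorm.pow_const q),
          lintegral_rpow_of_hasLaw_gaussian lv' hq0, lintegral_rpow_of_hasLaw_gaussian lw hq0]
    _ ≤ 2 ^ (q - 1) * (ENNReal.ofReal V ^ (q / 2) * gaussMoment q +
          ENNReal.ofReal V ^ (q / 2) * gaussMoment q) :=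
        mul_le_mul' le_rfl (add_le_add (mul_le_mul' (hvV v hv) le_rfl)
          (mul_le_mul' (hvV w hw) le_rfl))
    _ = _ := by rw [momConst]; ring

lemma lintegral_rpow_rsum_le [IsProbabilityMeasure P] {β : ℤ → ℝ≥0 → Ω → ℂ}
    (hW : IsCylindricalWiener β P) (F : Finset ℤ) (c : ℤ → ℂ) {G : ℝ → ℂ} {s t M : ℝ} (hs : 0 ≤ s)
    (hst : s ≤ t) (hG : ∀ r ∈ Set.Icc s t, ‖G r‖ ≤ M) {N : ℕ} (hN : 0 < N) {q : ℝ} (hq : 1 ≤ q) :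
    ∫⁻ ω, ‖∑ k ∈ F, c k * rsum G (fun r => β k r.toNNReal ω) s t N‖ₑ ^ q ∂P ≤
      momConst q * ENNReal.ofReal ((∑ k ∈ F, ‖c k‖ ^ 2) * (M ^ 2 * (t - s))) ^ (q / 2) := by
  have hm : Monotone fun j => (grid s t N j).toNNReal := fun i j h =>
    Real.toNNReal_le_toNNReal (grid_mono hst N h)
  refine (lintegral_rpow_sum_le hW F c (fun j => G (grid s t N j)) hm N hq).trans
    (mul_le_mul' le_rfl (ENNReal.rpow_le_rpow (ENNReal.ofReal_le_ofReal ?_) (by linarith)))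
  refine mul_le_mul_of_nonneg_left ?_ (Finset.sum_nonneg fun _ _ => sq_nonneg _)
  have hpos : ∀ j, 0 ≤ grid s t N j := fun j =>
    hs.trans ((grid_zero s t N).symm.le.trans (grid_mono hst N (Nat.zero_le j)))
  calc _ ≤ ∑ j ∈ Finset.range N, M ^ 2 * (grid s t N (j + 1) - grid s t N j) := by
        refine Finset.sum_le_sum fun j hj => ?_
        rw [Real.coe_toNNReal _ (hpos _), Real.coe_toNNReal _ (hpos _)]
        refine mul_le_mul_of_nonneg_right ?_ (sub_nonneg.2 (grid_mono hst N (Nat.le_succ j)))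
        exact pow_le_pow_left₀ (norm_nonneg _) (hG _ (grid_mem hst hN (Finset.mem_range.1 hj).le)) 2
    _ = _ := by
        rw [← Finset.mul_sum, Finset.sum_range_sub (grid s t N), grid_zero, grid_self s t hN]

lemma IsCylindricalWiener.aemeasurable_rsum {β : ℤ → ℝ≥0 → Ω → ℂ} (hW : IsCylindricalWiener β P)
    (F : Finset ℤ) (c : ℤ → ℂ) (G : ℝ → ℂ) (s t : ℝ) (N : ℕ) :
    AEMeasurable (fun ω => ∑ k ∈ F, c k * rsum G (fun r => β k r.toNNReal ω) s t N) P :=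
  Finset.aemeasurable_fun_sum _ fun k _ => (Finset.aemeasurable_fun_sum _ fun _ _ =>
    ((hW.aemeasurable k _).sub (hW.aemeasurable k _)).const_mul _).const_mul _

/-- The integral of `G` along the path `b` over `[s, t]`, by partial integration. -/
def pathInt (G b : ℝ → ℂ) (s t : ℝ) : ℂ := G t * b t - G s * b s - ∫ r in s..t, deriv G r * b r

lemma IsCylindricalWiener.tendsto_rsum {β : ℤ → ℝ≥0 → Ω → ℂ} (hW : IsCylindricalWiener β P)
    (F : Finset ℤ) (c : ℤ → ℂ) {G : ℝ → ℂ} (hG : ContDiff ℝ 1 G) {s t : ℝ} (hst : s ≤ t) :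
    ∀ᵐ ω ∂P, Tendsto (fun N => ∑ k ∈ F, c k * rsum G (fun r => β k r.toNNReal ω) s t N) atTop
      (𝓝 (∑ k ∈ F, c k * pathInt G (fun r => β k r.toNNReal ω) s t)) := by
  filter_upwards [hW.ae_continuous] with ω hω
  refine tendsto_finsetSum _ fun k _ => Tendsto.const_mul _ ?_
  exact WickSNLS.tendsto_rsum (fun r => (hG.differentiable one_ne_zero r).hasDerivAt)
    (hG.continuous_deriv le_rfl) ((hω k).comp continuous_real_toNNReal) hst

lemma IsCylindricalWiener.aemeasurable_pathInt {β : ℤ → ℝ≥0 → Ω → ℂ} (hW : IsCylindricalWiener β P)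
    (F : Finset ℤ) (c : ℤ → ℂ) {G : ℝ → ℂ} (hG : ContDiff ℝ 1 G) {s t : ℝ} (hst : s ≤ t) :
    AEMeasurable (fun ω => ∑ k ∈ F, c k * pathInt G (fun r => β k r.toNNReal ω) s t) P :=
  aemeasurable_of_tendsto_metrizable_ae atTop (fun N => hW.aemeasurable_rsum F c G s t N)
    (hW.tendsto_rsum F c hG hst)

/-- Fatou's lemma along the Riemann sums. Although the Wiener integral is defined by parts, only the
size of G enters, not that of its derivative; hence the bounds below do not depend on the frequency
of the oscillating factor. -/
theorem lintegral_rpow_pathInt_le [IsProbabilityMeasure P] {β : ℤ → ℝ≥0 → Ω → ℂ}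
    (hW : IsCylindricalWiener β P) (F : Finset ℤ) (c : ℤ → ℂ) {G : ℝ → ℂ} (hG : ContDiff ℝ 1 G)
    {s t M : ℝ} (hs : 0 ≤ s) (hst : s ≤ t) (hM : ∀ r ∈ Set.Icc s t, ‖G r‖ ≤ M)
    {q : ℝ} (hq : 1 ≤ q) :
    ∫⁻ ω, ‖∑ k ∈ F, c k * pathInt G (fun r => β k r.toNNReal ω) s t‖ₑ ^ q ∂P ≤
      momConst q * ENNReal.ofReal ((∑ k ∈ F, ‖c k‖ ^ 2) * (M ^ 2 * (t - s))) ^ (q / 2) :=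
  lintegral_rpow_le_of_tendsto (fun N => hW.aemeasurable_rsum F c G s t N)
    (hW.tendsto_rsum F c hG hst) (by
      filter_upwards [eventually_gt_atTop 0] with N hN
      exact lintegral_rpow_rsum_le hW F c hs hst hM hN hq)

end Moments

/-! ### Chaining -/

/-- The weighted sum of the `q`-th powers of the dyadic increments of a path on `[0, 1]`. -/
def dyadSum (q : ℝ) (x : ℝ → ℂ) : ℝ≥0∞ :=
  ∑' m : ℕ, 2 ^ m * ∑ j ∈ Finset.range (2 ^ m), ‖x ((j + 1 : ℕ) / 2 ^ m) - x (j / 2 ^ m)‖ₑ ^ q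

/-- The ratio of the geometric series in the chaining argument. -/
def chainRatio (q : ℝ) : ℝ≥0∞ := 2 ^ (-(1 / q))

/-- The weight 2^m in `dyadSum` is what gives a single increment at level m the geometric factor
2^{-m/q}. -/
lemma enorm_dyadic_increment_le {q : ℝ} (hq : 0 < q) (x : ℝ → ℂ) {m j : ℕ} (hj : j < 2 ^ m) :
    ‖x ((j + 1 : ℕ) / 2 ^ m) - x (j / 2 ^ m)‖ₑ ≤ chainRatio q ^ m * dyadSum q x ^ (1 / q) := by
  set y := ‖x ((j + 1 : ℕ) / 2 ^ m) - x (j / 2 ^ m)‖ₑ with hy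
  have h1 : 2 ^ m * y ^ q ≤ dyadSum q x := by
    refine le_trans ?_ (ENNReal.le_tsum m)
    refine mul_le_mul' le_rfl ?_
    exact Finset.single_le_sum (f := fun j : ℕ => ‖x ((j + 1 : ℕ) / 2 ^ m) - x (j / 2 ^ m)‖ₑ ^ q)
      (fun _ _ => zero_le) (Finset.mem_range.2 hj)
  rw [ENNReal.mul_le_iff_le_inv (by simp) (by simp)] at h1
  have h2 := ENNReal.rpow_le_rpow h1 (by positivity : 0 ≤ 1 / q)
  rw [← ENNReal.rpow_mul, mul_one_div_cancel hq.ne', ENNReal.rpow_one,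
    ENNReal.mul_rpow_of_nonneg _ _ (by positivity : 0 ≤ 1 / q)] at h2
  refine h2.trans (le_of_eq ?_)
  congr 1
  rw [chainRatio, ← ENNReal.rpow_natCast, ← ENNReal.rpow_natCast, ← ENNReal.rpow_mul,
    ← ENNReal.rpow_neg, ← ENNReal.rpow_mul]
  congr 1
  ring

/-- The dyadic approximation of `t` from below. -/
def dyad (t : ℝ) (m : ℕ) : ℝ := (⌊t * 2 ^ m⌋₊ : ℝ) / 2 ^ m

lemma tendsto_dyad {t : ℝ} (ht : 0 ≤ t) : Tendsto (dyad t) atTop (𝓝 t) :=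
  (tendsto_nat_floor_mul_div_atTop ht).comp (tendsto_pow_atTop_atTop_of_one_lt one_lt_two)

/-- Successive dyadic approximations from below either coincide or are neighbours on the finer
level. -/
lemma enorm_dyad_succ_sub_le {q : ℝ} (hq : 0 < q) (x : ℝ → ℂ) {t : ℝ} (ht : t ∈ Set.Icc (0 : ℝ) 1)
    (m : ℕ) :
    ‖x (dyad t (m + 1)) - x (dyad t m)‖ₑ ≤ chainRatio q ^ (m + 1) * dyadSum q x ^ (1 / q) := by
  set a := ⌊t * 2 ^ m⌋₊ with ha
  set b := ⌊t * 2 ^ (m + 1)⌋₊ with hb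
  have hp : (0 : ℝ) < 2 ^ m := by positivity
  have a1 : (a : ℝ) ≤ t * 2 ^ m := Nat.floor_le (mul_nonneg ht.1 hp.le)
  have a2 : t * 2 ^ m < a + 1 := Nat.lt_floor_add_one _
  have hb1 : b ≤ t * 2 ^ (m + 1) := Nat.floor_le (mul_nonneg ht.1 (by positivity))
  have hb2 : 2 * a ≤ b := Nat.le_floor (by push_cast; rw [pow_succ]; linarith)
  have hb3 : b < 2 * a + 2 := by
    have : (b : ℝ) < 2 * a + 2 := by rw [pow_succ] at hb1; linarith
    exact_mod_cast this
  have e1 : dyad t m = ((2 * a : ℕ) : ℝ) / 2 ^ (m + 1) := by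
    rw [dyad, pow_succ]
    push_cast
    rw [← ha]
    field_simp
  have e2 : dyad t (m + 1) = (b : ℝ) / 2 ^ (m + 1) := rfl
  rcases (by omega : b = 2 * a ∨ b = 2 * a + 1) with h | h
  · rw [e1, e2, h, sub_self]
    simp
  · rw [e1, e2, h]
    refine enorm_dyadic_increment_le hq x ?_
    have h1 : (b : ℝ) ≤ 2 ^ (m + 1) := by
      have : (0 : ℝ) < 2 ^ (m + 1) := by positivity
      nlinarith [ht.2]
    have h2 : b ≤ 2 ^ (m + 1) := by exact_mod_cast h1
    omega

lemma enorm_dyad_sub_le {q : ℝ} (hq : 0 < q) (x : ℝ → ℂ) {t : ℝ} (ht : t ∈ Set.Icc (0 : ℝ) 1)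
    (m : ℕ) : ‖x (dyad t m) - x 0‖ₑ ≤
      (∑ i ∈ Finset.range (m + 1), chainRatio q ^ i) * dyadSum q x ^ (1 / q) := by
  induction m with
  | zero =>
    have h1 : ⌊t * 2 ^ 0⌋₊ ≤ 1 := by
      have : (⌊t * 2 ^ 0⌋₊ : ℝ) ≤ t * 2 ^ 0 := Nat.floor_le (mul_nonneg ht.1 (by positivity))
      have h2 : (⌊t * 2 ^ 0⌋₊ : ℝ) ≤ 1 := by linarith [ht.2]
      exact_mod_cast h2
    have h3 := enorm_dyadic_increment_le hq x (m := 0) (j := 0) (by norm_num)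
    rcases (by omega : ⌊t * 2 ^ 0⌋₊ = 0 ∨ ⌊t * 2 ^ 0⌋₊ = 1) with h | h
    · rw [dyad, h]; simp
    · rw [dyad, h]; simpa using h3
  | succ m ih =>
    rw [Finset.sum_range_succ, add_mul]
    have h1 : x (dyad t (m + 1)) - x 0 =
        (x (dyad t m) - x 0) + (x (dyad t (m + 1)) - x (dyad t m)) := by ring
    rw [h1]
    exact (enorm_add_le _ _).trans (add_le_add ih (enorm_dyad_succ_sub_le hq x ht m))

/-- The constant in the chaining argument. -/
def chainSup (q : ℝ) : ℝ≥0∞ := ∑' i : ℕ, chainRatio q ^ i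

lemma chainSup_lt_top {q : ℝ} (hq : 0 < q) : chainSup q < ∞ := by
  rw [chainSup, ENNReal.tsum_geometric]
  refine ENNReal.inv_lt_top.2 (tsub_pos_of_lt ?_)
  exact ENNReal.rpow_lt_one_of_one_lt_of_neg (by norm_num)
    (by have : 0 < 1 / q := by positivity
        linarith)

/-- Kolmogorov's chaining: the increments along the dyadic approximations of t form a geometric
series, and continuity passes to t. A single random variable with computable mean thus controls the
supremum of the path. -/
theorem enorm_sub_le_dyadSum {q : ℝ} (hq : 0 < q) {x : ℝ → ℂ} (hx : Continuous x) {t : ℝ}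
    (ht : t ∈ Set.Icc (0 : ℝ) 1) : ‖x t - x 0‖ₑ ≤ chainSup q * dyadSum q x ^ (1 / q) := by
  have h1 : Tendsto (fun m => ‖x (dyad t m) - x 0‖ₑ) atTop (𝓝 ‖x t - x 0‖ₑ) :=
    (continuous_enorm.tendsto _).comp (((hx.tendsto t).comp (tendsto_dyad ht.1)).sub_const _)
  exact le_of_tendsto' h1 fun m => (enorm_dyad_sub_le hq x ht m).trans
    (mul_le_mul' (ENNReal.sum_le_tsum _) le_rfl)

/-- The constant in the moment estimate for the sum of the dyadic increments. -/
def chainMean (q : ℝ) : ℝ≥0∞ := ∑' m : ℕ, ((2 : ℝ≥0∞) ^ (2 - q / 2)) ^ m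

lemma chainMean_lt_top {q : ℝ} (hq : 4 < q) : chainMean q < ∞ := by
  rw [chainMean, ENNReal.tsum_geometric]
  refine ENNReal.inv_lt_top.2 (tsub_pos_of_lt ?_)
  exact ENNReal.rpow_lt_one_of_one_lt_of_neg (by norm_num) (by linarith)

section Mean

variable {Ω : Type*} {m : MeasurableSpace Ω} {P : Measure Ω}

lemma aemeasurable_dyadSum {X : ℝ → Ω → ℂ} (hX : ∀ t, 0 ≤ t → AEMeasurable (X t) P) (q : ℝ) :
    AEMeasurable (fun ω => dyadSum q (fun t => X t ω)) P :=
  AEMeasurable.tsum fun _ => (Finset.aemeasurable_fun_sum _ fun _ _ =>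
    ((hX _ (by positivity)).sub (hX _ (by positivity))).enorm.pow_const q).const_mul _

/-- At level m there are 2^m increments, with weight 2^m and q-th moment at most A 2^{-mq/2}. This
gives the ratio 2^{2-q/2} and explains the condition q > 4 for a finite bound. -/
lemma lintegral_dyadSum_le {X : ℝ → Ω → ℂ} (hX : ∀ t, 0 ≤ t → AEMeasurable (X t) P) {q : ℝ}
    {A : ℝ≥0∞} (hA : ∀ s t, 0 ≤ s → s ≤ t → t ≤ 1 →
      ∫⁻ ω, ‖X t ω - X s ω‖ₑ ^ q ∂P ≤ A * ENNReal.ofReal (t - s) ^ (q / 2)) :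
    ∫⁻ ω, dyadSum q (fun t => X t ω) ∂P ≤ chainMean q * A := by
  have hm : ∀ (m j : ℕ), AEMeasurable (fun ω =>
      ‖X ((j + 1 : ℕ) / 2 ^ m) ω - X (j / 2 ^ m) ω‖ₑ ^ q) P := fun m j =>
    ((hX _ (by positivity)).sub (hX _ (by positivity))).enorm.pow_const q
  simp only [dyadSum]
  rw [lintegral_tsum fun m => (Finset.aemeasurable_fun_sum _ fun j _ => hm m j).const_mul _,
    chainMean, ← ENNReal.tsum_mul_right]
  refine ENNReal.tsum_le_tsum fun m => ?_
  rw [lintegral_const_mul'' _ (Finset.aemeasurable_fun_sum _ fun j _ => hm m j),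
    lintegral_finsetSum' _ fun j _ => hm m j]
  calc (2 : ℝ≥0∞) ^ m * ∑ j ∈ Finset.range (2 ^ m),
        ∫⁻ ω, ‖X ((j + 1 : ℕ) / 2 ^ m) ω - X (j / 2 ^ m) ω‖ₑ ^ q ∂P
      ≤ 2 ^ m * ∑ _j ∈ Finset.range (2 ^ m), A * ((2 : ℝ≥0∞) ^ m)⁻¹ ^ (q / 2) := by
        refine mul_le_mul' le_rfl (Finset.sum_le_sum fun j hj => ?_)
        have hp : (0 : ℝ) < 2 ^ m := by positivity
        have hj' : ((j + 1 : ℕ) : ℝ) ≤ 2 ^ m := by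
          exact_mod_cast Nat.succ_le_of_lt (Finset.mem_range.1 hj)
        refine (hA _ _ (by positivity) ?_ ?_).trans (le_of_eq ?_)
        · gcongr; simp
        · rwa [div_le_one hp]
        · have h1 : ((j + 1 : ℕ) : ℝ) / 2 ^ m - j / 2 ^ m = (2 ^ m)⁻¹ := by
            push_cast; field_simp; ring
          rw [h1, ENNReal.ofReal_inv_of_pos hp, ENNReal.ofReal_pow (by norm_num)]
          simp
    _ = _ := by
        rw [Finset.sum_const, Finset.card_range, nsmul_eq_mul]
        push_cast
        have h2 : ((2 : ℝ≥0∞) ^ m)⁻¹ ^ (q / 2) * (2 ^ m * 2 ^ m) = (2 ^ (2 - q / 2)) ^ m := by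
          have e2 : (2 : ℝ≥0∞) ^ m = 2 ^ (m : ℝ) := (ENNReal.rpow_natCast _ _).symm
          rw [e2, ← ENNReal.rpow_neg, ← ENNReal.rpow_mul, ← ENNReal.rpow_add _ _ (by simp) (by simp),
            ← ENNReal.rpow_add _ _ (by simp) (by simp), ← ENNReal.rpow_natCast, ← ENNReal.rpow_mul]
          congr 1
          ring
        rw [← h2]
        ring

lemma lintegral_rpow_le_rpow_lintegral [IsProbabilityMeasure P] {f : Ω → ℝ≥0∞}
    (hf : AEMeasurable f P) {r : ℝ} (hr : 0 < r) (hr1 : r ≤ 1) :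
    ∫⁻ ω, f ω ^ r ∂P ≤ (∫⁻ ω, f ω ∂P) ^ r := by
  have h := eLpNorm'_le_eLpNorm'_of_exponent_le hr hr1 P hf.aestronglyMeasurable
  simp only [eLpNorm', enorm_eq_self, ENNReal.rpow_one, div_one] at h
  have h2 := ENNReal.rpow_le_rpow h hr.le
  rwa [← ENNReal.rpow_mul, one_div_mul_cancel hr.ne', ENNReal.rpow_one] at h2

/-! ### Modifications -/

/-- A process with almost surely continuous paths is indistinguishable from a measurable process
all of whose paths are continuous. -/
lemma exists_continuous_modification {X : ℝ≥0 → Ω → ℤ → ℂ}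
    (hX : ∀ t n, AEStronglyMeasurable (fun ω => X t ω n) P)
    (hc : ∀ᵐ ω ∂P, ∀ n, Continuous fun t => X t ω n) :
    ∃ Y : ℝ≥0 → Ω → ℤ → ℂ, (∀ t n, Measurable fun ω => Y t ω n) ∧
      (∀ ω n, Continuous fun t => Y t ω n) ∧ ∀ᵐ ω ∂P, ∀ t, Y t ω = X t ω := by
  classical
  have hq : ∀ᵐ ω ∂P, ∀ (r : ℚ≥0) n, X (r : ℝ≥0) ω n = (hX (r : ℝ≥0) n).mk _ ω := by
    rw [ae_all_iff]; intro r
    rw [ae_all_iff]; intro n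
    exact (hX r n).ae_eq_mk
  obtain ⟨N, hN, hNm, hN0⟩ := exists_measurable_superset_of_null (ae_iff.1 (hc.and hq))
  have hgood : ∀ ω ∉ N, (∀ n, Continuous fun t => X t ω n) ∧
      ∀ (r : ℚ≥0) n, X (r : ℝ≥0) ω n = (hX (r : ℝ≥0) n).mk _ ω := fun ω hω => by
    by_contra h
    exact hω (hN h)
  refine ⟨fun t ω => if ω ∈ N then 0 else X t ω, fun t n => ?_, fun ω n => ?_, ?_⟩
  -- At the rational dyadic times a measurable version is available off N; right there it equals X,
  -- and continuity of the paths carries measurability to all t.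
  · have hd : ∀ m : ℕ, Measurable fun ω =>
        Set.indicator Nᶜ ((hX (((⌊(t : ℝ) * 2 ^ m⌋₊ / 2 ^ m : ℚ≥0)) : ℝ≥0) n).mk _) ω := fun m =>
      ((hX _ n).stronglyMeasurable_mk.measurable).indicator hNm.compl
    refine measurable_of_tendsto_metrizable hd (tendsto_pi_nhds.2 fun ω => ?_)
    by_cases hω : ω ∈ N
    · simp [hω]
    · simp only [Set.indicator_of_mem (show ω ∈ Nᶜ from hω), if_neg hω]
      simp only [← (hgood ω hω).2]
      refine (((hgood ω hω).1 n).tendsto t).comp ?_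
      have := tendsto_dyad t.2
      rw [← NNReal.tendsto_coe]
      refine this.congr fun m => ?_
      simp [dyad]
  · by_cases hω : ω ∈ N
    · simp only [if_pos hω]
      exact continuous_const
    · simp only [if_neg hω]
      exact (hgood ω hω).1 n
  · filter_upwards [measure_eq_zero_iff_ae_notMem.1 hN0] with ω hω t
    rw [if_neg hω]

end Mean

/-! ### The coefficients of the stochastic convolution in the interaction picture -/

/-- The oscillating factor of the free evolution. -/
def osc (D r : ℝ) : ℂ := cexp (-(I * r * D))

lemma contDiff_osc (D : ℝ) : ContDiff ℝ 1 (osc D) := by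
  have : ContDiff ℝ 1 fun r : ℝ => (r : ℂ) := Complex.ofRealCLM.contDiff
  unfold osc
  fun_prop

lemma norm_osc (D r : ℝ) : ‖osc D r‖ = 1 := norm_cexp_neg_I r D

lemma hasDerivAt_osc (D r : ℝ) : HasDerivAt (osc D) (-(I * D) * osc D r) r := by
  have h1 : HasDerivAt (fun r : ℝ => -(I * (r : ℂ) * D)) (-(I * 1 * D)) r :=
    (((Complex.ofRealCLM.hasDerivAt (x := r)).const_mul I).mul_const (D : ℂ)).neg
  refine h1.cexp.congr_deriv ?_
  change _ = -(I * (D : ℂ)) * cexp _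
  ring

lemma continuous_pathInt {G b : ℝ → ℂ} (hG : ContDiff ℝ 1 G) (hb : Continuous b) (s : ℝ) :
    Continuous fun t => pathInt G b s t := by
  have hc : Continuous fun r => deriv G r * b r := (hG.continuous_deriv le_rfl).mul hb
  exact ((hG.continuous.mul hb).sub continuous_const).sub
    (intervalIntegral.continuous_primitive (fun a b => hc.intervalIntegrable a b) s)

lemma pathInt_sub {G b : ℝ → ℂ} (hG : ContDiff ℝ 1 G) (hb : Continuous b) (r s t : ℝ) :
    pathInt G b r t - pathInt G b r s = pathInt G b s t := by
  have hc : Continuous fun r => deriv G r * b r := (hG.continuous_deriv le_rfl).mul hb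
  rw [pathInt, pathInt, pathInt, ← intervalIntegral.integral_add_adjacent_intervals (b := s)
    (hc.intervalIntegrable r s) (hc.intervalIntegrable s t)]
  ring

section Noise

variable {Ω : Type*} {m : MeasurableSpace Ω} {P : Measure Ω}

/-- The partial sums of a coefficient of the stochastic convolution. -/
def partConv (β : ℤ → ℝ≥0 → Ω → ℂ) (c : ℤ → ℂ) (D : ℝ) (F : Finset ℤ) (t : ℝ) (ω : Ω) : ℂ :=
  ∑ k ∈ F, c k * pathInt (osc D) (fun r => β k r.toNNReal ω) 0 t

/-- The tail of the series of the squares of the coefficients. -/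
def tailSq (c : ℤ → ℂ) (F : Finset ℤ) : ℝ≥0∞ := ∑' k : {k // k ∉ F}, ‖c k‖ₑ ^ 2

/-- A process whose values are the sums in `L²` of Wiener integrals of the oscillating factor. -/
structure IsConvCoeff (β : ℤ → ℝ≥0 → Ω → ℂ) (P : Measure Ω) (c : ℤ → ℂ) (D : ℝ) (Y : ℝ → Ω → ℂ) :
    Prop where
  aestronglyMeasurable : ∀ t, AEStronglyMeasurable (Y t) P
  tendsto_L2 : ∀ t, 0 ≤ t → Tendsto (fun F : Finset ℤ =>
    eLpNorm (fun ω => Y t ω - partConv β c D F t ω) 2 P) atTop (𝓝 0)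
  continuous : ∀ᵐ ω ∂P, Continuous fun t => Y t ω

lemma wienerIntegral_eq (D : ℝ) {B : ℝ≥0 → ℂ} (h0 : B 0 = 0) (t : ℝ≥0) :
    wienerIntegral (fun r => cexp (I * (t - r) * D)) B t =
      cexp (I * t * D) * pathInt (osc D) (fun r => B r.toNNReal) 0 t := by
  have e1 : (fun r : ℝ => cexp (I * (t - r) * D)) = fun r => cexp (I * t * D) * osc D r := by
    funext r
    rw [osc, ← Complex.exp_add]
    congr 1
    ring
  rw [e1, wienerIntegral, pathInt, mul_sub, mul_sub]
  simp only [Real.toNNReal_zero, h0, mul_zero, sub_zero, Real.toNNReal_coe]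
  rw [← mul_assoc, ← intervalIntegral.integral_const_mul]
  congr 1
  refine intervalIntegral.integral_congr fun r _ => ?_
  rw [deriv_const_mul _ (hasDerivAt_osc D r).differentiableAt, mul_assoc]

lemma eLpNorm_noisePath_sub_partConv {β : ℤ → ℝ≥0 → Ω → ℂ} (hW : IsCylindricalWiener β P)
    (c : ℤ → ℂ) (Ψ : ℝ≥0 → Ω → ℤ → ℂ) (n : ℤ) (t : ℝ≥0) (F : Finset ℤ) :
    eLpNorm (fun ω => noisePath (fun t => Ψ t ω) t n - partConv β c (disp n) F t ω) 2 P =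
      eLpNorm (fun ω => Ψ t ω n - ∑ k ∈ F, c k *
        wienerIntegral (fun r => cexp (I * (t - r) * disp n)) (fun r => β k r ω) t) 2 P := by
  refine eLpNorm_congr_norm_ae ?_
  filter_upwards [hW.ae_zero] with ω hω
  have h1 : ∀ k, wienerIntegral (fun r => cexp (I * (t - r) * disp n)) (fun r => β k r ω) t =
      cexp (I * t * disp n) * pathInt (osc (disp n)) (fun r => β k r.toNNReal ω) 0 t := fun k =>
    wienerIntegral_eq (B := fun r => β k r ω) (disp n) (hω k) t
  have h2 : noisePath (fun t => Ψ t ω) t n - partConv β c (disp n) F t ω =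
      cexp (-(I * (t : ℝ) * disp n)) * (Ψ t ω n - ∑ k ∈ F, c k *
        wienerIntegral (fun r => cexp (I * (t - r) * disp n)) (fun r => β k r ω) t) := by
    simp only [h1]
    rw [noisePath, mul_sub, Finset.mul_sum, partConv, Real.toNNReal_coe]
    congr 1
    refine Finset.sum_congr rfl fun k _ => ?_
    have : cexp (-(I * (t : ℝ) * disp n)) * cexp (I * (t : ℝ) * disp n) = 1 := by
      rw [← Complex.exp_add, neg_add_cancel, Complex.exp_zero]
    linear_combination (-(c k *
      pathInt (osc (disp n)) (fun r => β k r.toNNReal ω) 0 t)) * this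
  rw [h2, norm_mul, norm_cexp_neg_I, one_mul]

lemma IsStochasticConvolution.isConvCoeff {φ : L2Torus →ₗ[ℂ] (ℤ → ℂ)} {β : ℤ → ℝ≥0 → Ω → ℂ}
    (hW : IsCylindricalWiener β P) {Ψ : ℝ≥0 → Ω → ℤ → ℂ} (hΨ : IsStochasticConvolution φ β P Ψ)
    (n : ℤ) : IsConvCoeff β P (fun k => φ (fourierLp 2 k) n) (disp n)
      (fun t ω => noisePath (fun t => Ψ t ω) t n) where
  aestronglyMeasurable t := (hΨ.aestronglyMeasurable _ n).const_mul _
  continuous := by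
    filter_upwards [hΨ.continuous_paths] with ω hω
    exact continuous_noisePath hω n
  tendsto_L2 t ht := by
    lift t to ℝ≥0 using ht
    exact (hΨ.tendsto_L2 t n).congr fun F => (eLpNorm_noisePath_sub_partConv hW _ Ψ n t F).symm

lemma ofReal_sum_sq_le_tailSq (c : ℤ → ℂ) {F F' : Finset ℤ} :
    ENNReal.ofReal (∑ k ∈ F' \ F, ‖c k‖ ^ 2) ≤ tailSq c F := by
  rw [ENNReal.ofReal_sum_of_nonneg fun _ _ => sq_nonneg _]
  have h1 : ∀ k, ENNReal.ofReal (‖c k‖ ^ 2) = ‖c k‖ₑ ^ 2 := fun k => by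
    rw [ENNReal.ofReal_pow (norm_nonneg _), ofReal_norm]
  simp only [h1]
  have h2 : tailSq c F = ∑' k : ((F : Set ℤ)ᶜ : Set ℤ), ‖c k‖ₑ ^ 2 := rfl
  rw [h2, tsum_subtype (F : Set ℤ)ᶜ fun k => ‖c k‖ₑ ^ 2]
  calc _ = ∑ k ∈ F' \ F, Set.indicator (F : Set ℤ)ᶜ (fun k => ‖c k‖ₑ ^ 2) k :=
        Finset.sum_congr rfl fun k hk => by
          rw [Set.indicator_of_mem]
          simpa using (Finset.mem_sdiff.1 hk).2
    _ ≤ _ := ENNReal.sum_le_tsum _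

lemma tendsto_tailSq {c : ℤ → ℂ} (hc : ∑' k, ‖c k‖ₑ ^ 2 ≠ ∞) :
    Tendsto (tailSq c) atTop (𝓝 0) := ENNReal.tendsto_tsum_compl_atTop_zero hc

lemma tailSq_empty (c : ℤ → ℂ) : tailSq c ∅ = ∑' k, ‖c k‖ₑ ^ 2 := by
  have h2 : tailSq c ∅ = ∑' k : (((∅ : Finset ℤ) : Set ℤ)ᶜ : Set ℤ), ‖c k‖ₑ ^ 2 := rfl
  rw [h2, tsum_subtype (((∅ : Finset ℤ) : Set ℤ)ᶜ) fun k => ‖c k‖ₑ ^ 2]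
  simp

lemma sum_sub_sum_of_subset {F F' : Finset ℤ} (h : F ⊆ F') (f : ℤ → ℂ) :
    ∑ k ∈ F', f k - ∑ k ∈ F, f k = ∑ k ∈ F' \ F, f k := by
  rw [← Finset.sum_sdiff h, add_sub_cancel_right]

lemma lintegral_rpow_pathInt_sub_le [IsProbabilityMeasure P] {β : ℤ → ℝ≥0 → Ω → ℂ}
    (hW : IsCylindricalWiener β P) (c : ℤ → ℂ) {G : ℝ → ℂ} (hG : ContDiff ℝ 1 G)
    {s t M : ℝ} (hs : 0 ≤ s) (hst : s ≤ t) (hM : ∀ r ∈ Set.Icc s t, ‖G r‖ ≤ M)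
    {q : ℝ} (hq : 1 ≤ q) {F F' : Finset ℤ} (hF : F ⊆ F') :
    ∫⁻ ω, ‖∑ k ∈ F', c k * pathInt G (fun r => β k r.toNNReal ω) s t -
        ∑ k ∈ F, c k * pathInt G (fun r => β k r.toNNReal ω) s t‖ₑ ^ q ∂P ≤
      momConst q * (tailSq c F * ENNReal.ofReal (M ^ 2 * (t - s))) ^ (q / 2) := by
  simp only [sum_sub_sum_of_subset hF]
  refine (lintegral_rpow_pathInt_le hW (F' \ F) c hG hs hst hM hq).trans
    (mul_le_mul' le_rfl (ENNReal.rpow_le_rpow ?_ (by linarith)))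
  rw [ENNReal.ofReal_mul (Finset.sum_nonneg fun _ _ => sq_nonneg _)]
  exact mul_le_mul' (ofReal_sum_sq_le_tailSq c) le_rfl

/-- The moment estimate passes to limits in `L²`. -/
lemma lintegral_rpow_sub_pathInt_le [IsProbabilityMeasure P] {β : ℤ → ℝ≥0 → Ω → ℂ}
    (hW : IsCylindricalWiener β P) (c : ℤ → ℂ) {G : ℝ → ℂ} (hG : ContDiff ℝ 1 G)
    {s t M : ℝ} (hs : 0 ≤ s) (hst : s ≤ t) (hM : ∀ r ∈ Set.Icc s t, ‖G r‖ ≤ M)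
    {q : ℝ} (hq : 1 ≤ q) {Z : Ω → ℂ} (hZ : AEStronglyMeasurable Z P)
    (hlim : Tendsto (fun F : Finset ℤ => eLpNorm (fun ω => Z ω -
      ∑ k ∈ F, c k * pathInt G (fun r => β k r.toNNReal ω) s t) 2 P) atTop (𝓝 0))
    (F : Finset ℤ) :
    ∫⁻ ω, ‖Z ω - ∑ k ∈ F, c k * pathInt G (fun r => β k r.toNNReal ω) s t‖ₑ ^ q ∂P ≤
      momConst q * (tailSq c F * ENNReal.ofReal (M ^ 2 * (t - s))) ^ (q / 2) := by
  have hm : ∀ F : Finset ℤ, AEMeasurable (fun ω =>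
      ∑ k ∈ F, c k * pathInt G (fun r => β k r.toNNReal ω) s t) P := fun F =>
    hW.aemeasurable_pathInt F c hG hst
  have h1 : TendstoInMeasure P (fun (F : Finset ℤ) ω =>
      ∑ k ∈ F, c k * pathInt G (fun r => β k r.toNNReal ω) s t) atTop Z := by
    refine tendstoInMeasure_of_tendsto_eLpNorm two_ne_zero (fun F => (hm F).aestronglyMeasurable) hZ
      (hlim.congr fun F => ?_)
    exact eLpNorm_sub_comm _ _ _ _
  obtain ⟨ns, hns, hae⟩ := h1.exists_seq_tendsto_ae'
  refine lintegral_rpow_le_of_tendsto (fun j => (hm (ns j)).sub (hm F)) ?_ ?_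
  · filter_upwards [hae] with ω hω
    exact hω.sub_const _
  · filter_upwards [hns.eventually (eventually_ge_atTop F)] with j hj
    exact lintegral_rpow_pathInt_sub_le hW c hG hs hst hM hq hj

lemma IsConvCoeff.tendsto_L2_sub {β : ℤ → ℝ≥0 → Ω → ℂ} (hW : IsCylindricalWiener β P) {c : ℤ → ℂ}
    {D : ℝ} {Y : ℝ → Ω → ℂ} (hY : IsConvCoeff β P c D Y) {s t : ℝ} (hs : 0 ≤ s) (hst : s ≤ t) :
    Tendsto (fun F : Finset ℤ => eLpNorm (fun ω => (Y t ω - Y s ω) -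
      ∑ k ∈ F, c k * pathInt (osc D) (fun r => β k r.toNNReal ω) s t) 2 P) atTop (𝓝 0) := by
  have h1 := (hY.tendsto_L2 t (hs.trans hst)).add (hY.tendsto_L2 s hs)
  rw [add_zero] at h1
  refine tendsto_of_tendsto_of_tendsto_of_le_of_le tendsto_const_nhds h1 (fun _ => zero_le)
    fun F => ?_
  have hm : ∀ t, 0 ≤ t → AEStronglyMeasurable (fun ω => Y t ω - partConv β c D F t ω) P :=
    fun t ht => (hY.aestronglyMeasurable t).sub
      (hW.aemeasurable_pathInt F c (contDiff_osc D) ht).aestronglyMeasurable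
  refine le_trans (le_of_eq (eLpNorm_congr_ae ?_))
    (eLpNorm_sub_le (hm t (hs.trans hst)) (hm s hs) (by norm_num))
  filter_upwards [hW.ae_continuous] with ω hω
  have h2 : ∀ k, pathInt (osc D) (fun r => β k r.toNNReal ω) s t =
      pathInt (osc D) (fun r => β k r.toNNReal ω) 0 t -
        pathInt (osc D) (fun r => β k r.toNNReal ω) 0 s := fun k =>
    (pathInt_sub (contDiff_osc D) ((hω k).comp continuous_real_toNNReal) 0 s t).symm
  simp only [Pi.sub_apply, h2, partConv, mul_sub, Finset.sum_sub_distrib]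
  ring

lemma IsCylindricalWiener.ae_continuous_partConv {β : ℤ → ℝ≥0 → Ω → ℂ}
    (hW : IsCylindricalWiener β P) (c : ℤ → ℂ) (D : ℝ) :
    ∀ᵐ ω ∂P, ∀ F, Continuous fun t => partConv β c D F t ω := by
  filter_upwards [hW.ae_continuous] with ω hω F
  exact continuous_finsetSum _ fun k _ => continuous_const.mul
    (continuous_pathInt (contDiff_osc D) ((hω k).comp continuous_real_toNNReal) 0)

lemma IsCylindricalWiener.ae_partConv_zero {β : ℤ → ℝ≥0 → Ω → ℂ}
    (hW : IsCylindricalWiener β P) (c : ℤ → ℂ) (D : ℝ) :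
    ∀ᵐ ω ∂P, ∀ F, partConv β c D F 0 ω = 0 := by
  filter_upwards [hW.ae_zero] with ω hω F
  simp [partConv, pathInt, hω]

lemma IsConvCoeff.ae_zero [IsProbabilityMeasure P] {β : ℤ → ℝ≥0 → Ω → ℂ}
    (hW : IsCylindricalWiener β P) {c : ℤ → ℂ} {D : ℝ} {Y : ℝ → Ω → ℂ}
    (hY : IsConvCoeff β P c D Y) : ∀ᵐ ω ∂P, Y 0 ω = 0 := by
  have h1 : ∀ F, eLpNorm (fun ω => Y 0 ω - partConv β c D F 0 ω) 2 P = eLpNorm (Y 0) 2 P :=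
    fun F => eLpNorm_congr_ae (by
      filter_upwards [hW.ae_partConv_zero c D] with ω hω
      rw [hω F, sub_zero])
  have h2 := hY.tendsto_L2 0 le_rfl
  simp only [h1] at h2
  have h3 := tendsto_nhds_unique h2 tendsto_const_nhds
  exact (eLpNorm_eq_zero_iff (hY.aestronglyMeasurable 0) two_ne_zero).1 h3.symm

/-- The maximal estimate for the remainders of the stochastic convolution. -/
theorem IsConvCoeff.lintegral_dyadSum_sub_le [IsProbabilityMeasure P] {β : ℤ → ℝ≥0 → Ω → ℂ}
    (hW : IsCylindricalWiener β P) {c : ℤ → ℂ} {D : ℝ} {Y : ℝ → Ω → ℂ}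
    (hY : IsConvCoeff β P c D Y) {q : ℝ} (hq : 1 ≤ q) (F : Finset ℤ) :
    ∫⁻ ω, dyadSum q (fun t => Y t ω - partConv β c D F t ω) ∂P ≤
      chainMean q * (momConst q * tailSq c F ^ (q / 2)) := by
  refine lintegral_dyadSum_le (X := fun t ω => Y t ω - partConv β c D F t ω)
    (fun t ht => ((hY.aestronglyMeasurable t).aemeasurable).sub
      (hW.aemeasurable_pathInt F c (contDiff_osc D) ht)) fun s t hs hst _ => ?_
  have h1 := lintegral_rpow_sub_pathInt_le hW c (contDiff_osc D) hs hst
    (fun r _ => (norm_osc D r).le) hq ((hY.aestronglyMeasurable t).sub (hY.aestronglyMeasurable s))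
    (hY.tendsto_L2_sub hW hs hst) F
  rw [one_pow, one_mul, ENNReal.mul_rpow_of_nonneg _ _ (by linarith), ← mul_assoc] at h1
  refine le_trans (le_of_eq (lintegral_congr_ae ?_)) h1
  filter_upwards [hW.ae_continuous] with ω hω
  congr 2
  have h2 : ∀ k, pathInt (osc D) (fun r => β k r.toNNReal ω) s t =
      pathInt (osc D) (fun r => β k r.toNNReal ω) 0 t -
        pathInt (osc D) (fun r => β k r.toNNReal ω) 0 s := fun k =>
    (pathInt_sub (contDiff_osc D) ((hω k).comp continuous_real_toNNReal) 0 s t).symm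
  simp only [Pi.sub_apply, h2, partConv, mul_sub, Finset.sum_sub_distrib]
  ring

/-! ### The Fourier transform in time of the stochastic convolution -/

/-- The integrand of the Wiener integral which represents the Fourier transform in time of the
stochastic convolution, up to the sign. -/
def ftKernel (D τ t : ℝ) : ℂ := osc D t * kk 1 t (-τ)

lemma hasDerivAt_kk (μ t : ℝ) : HasDerivAt (fun t => kk 1 t μ) (cexp (I * t * μ)) t := by
  have hc : Continuous fun r : ℝ => cexp (I * r * μ) := by fun_prop
  exact intervalIntegral.integral_hasDerivAt_right (hc.intervalIntegrable _ _)
    hc.stronglyMeasurable.stronglyMeasurableAtFilter hc.continuousAt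

lemma hasDerivAt_ftKernel (D τ t : ℝ) : HasDerivAt (ftKernel D τ)
    (-(I * D) * osc D t * kk 1 t (-τ) + osc D t * cexp (I * t * (-τ : ℝ))) t :=
  (hasDerivAt_osc D t).mul (hasDerivAt_kk (-τ) t)

lemma contDiff_ftKernel (D τ : ℝ) : ContDiff ℝ 1 (ftKernel D τ) := by
  refine contDiff_one_iff_deriv.2 ⟨fun t => (hasDerivAt_ftKernel D τ t).differentiableAt, ?_⟩
  have h1 : deriv (ftKernel D τ) = fun t : ℝ =>
      -(I * D) * osc D t * kk 1 t (-τ) + osc D t * cexp (I * t * (-τ : ℝ)) :=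
    funext fun t => (hasDerivAt_ftKernel D τ t).deriv
  rw [h1]
  have h2 := (contDiff_osc D).continuous
  have h3 := continuous_kk_right 1 (-τ)
  fun_prop

lemma norm_ftKernel_le (D τ : ℝ) {t : ℝ} (ht : t ∈ Set.Icc (0 : ℝ) 1) :
    ‖ftKernel D τ t‖ ≤ 3 / jb τ := by
  rw [ftKernel, norm_mul, norm_osc, one_mul, le_div_iff₀ (jb_pos τ), mul_comm, ← jb_neg]
  refine jb_mul_norm_kk_le ?_ (-τ)
  rw [abs_le]
  constructor <;> linarith [ht.1, ht.2]

/-- A pathwise form of the stochastic Fubini theorem, by integration by parts. The primitive of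
exp(-itτ) is chosen to vanish at t = 1, which removes the boundary term. The result is again a
Wiener integral, with a kernel of size 3/⟨τ⟩ uniformly in D. -/
lemma cutFT_pathInt (D τ : ℝ) {b : ℝ → ℂ} (hb : Continuous b) (h0 : b 0 = 0) :
    cutFT 0 1 (fun t => pathInt (osc D) b 0 t) τ = -pathInt (ftKernel D τ) b 0 1 := by
  set A : ℝ → ℂ := fun t => ∫ r in (0 : ℝ)..t, deriv (osc D) r * b r with hA
  have hc : Continuous fun r => deriv (osc D) r * b r :=
    ((contDiff_osc D).continuous_deriv le_rfl).mul hb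
  have hA' : ∀ t, HasDerivAt A (deriv (osc D) t * b t) t := fun t =>
    intervalIntegral.integral_hasDerivAt_right (hc.intervalIntegrable _ _)
      hc.stronglyMeasurable.stronglyMeasurableAtFilter hc.continuousAt
  have hAc : Continuous A := continuous_iff_continuousAt.2 fun t => (hA' t).continuousAt
  have ho := (contDiff_osc D).continuous
  have hk := continuous_kk_right 1 (-τ)
  have he : Continuous fun t : ℝ => cexp (I * t * (-τ : ℝ)) := by fun_prop
  have hk1 : kk 1 1 (-τ) = 0 := by simp [kk]
  have hparts := intervalIntegral.integral_mul_deriv_eq_deriv_mul (a := 0) (b := 1)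
    (u := fun t => kk 1 t (-τ)) (v := A) (fun t _ => hasDerivAt_kk (-τ) t) (fun t _ => hA' t)
    (he.intervalIntegrable _ _) (hc.intervalIntegrable _ _)
  have hA0 : A 0 = 0 := by simp [hA]
  rw [hk1, hA0, zero_mul, mul_zero, sub_zero, zero_sub] at hparts
  have e1 : cutFT 0 1 (fun t => pathInt (osc D) b 0 t) τ =
      ∫ t in (0 : ℝ)..1, (cexp (I * t * (-τ : ℝ)) * (osc D t * b t) - cexp (I * t * (-τ : ℝ)) * A t) := by
    refine intervalIntegral.integral_congr fun t _ => ?_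
    have : cexp (-(I * t * τ)) = cexp (I * t * (-τ : ℝ)) := by
      congr 1
      push_cast
      ring
    simp only [pathInt, h0, mul_zero, sub_zero, this, hA]
    ring
  have e2 : pathInt (ftKernel D τ) b 0 1 = -∫ t in (0 : ℝ)..1,
      (kk 1 t (-τ) * (deriv (osc D) t * b t) + cexp (I * t * (-τ : ℝ)) * (osc D t * b t)) := by
    rw [pathInt, h0, ftKernel, hk1]
    simp only [mul_zero, zero_mul, sub_zero, zero_sub]
    congr 1
    refine intervalIntegral.integral_congr fun t _ => ?_
    simp only [(hasDerivAt_ftKernel D τ t).deriv, (hasDerivAt_osc D t).deriv]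
    ring
  have i1 : IntervalIntegrable (fun t : ℝ => cexp (I * t * (-τ : ℝ)) * (osc D t * b t)) volume 0 1 :=
    (he.mul (ho.mul hb)).intervalIntegrable _ _
  have i2 : IntervalIntegrable (fun t : ℝ => cexp (I * t * (-τ : ℝ)) * A t) volume 0 1 :=
    (he.mul hAc).intervalIntegrable _ _
  have i3 : IntervalIntegrable (fun t => kk 1 t (-τ) * (deriv (osc D) t * b t)) volume 0 1 :=
    (hk.mul hc).intervalIntegrable _ _
  rw [e1, e2, neg_neg, intervalIntegral.integral_sub i1 i2, intervalIntegral.integral_add i3 i1,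
    hparts]
  ring

/-! ### Almost sure finiteness of the norms of the stochastic convolution -/

/-- Almost sure statements need countably many indices. Convergence along all finite sets is reduced
to an increasing sequence with a geometric rate; the intervals in the union make it exhaust ℤ. -/
lemma exists_seq_le_of_tendsto {f : Finset ℤ → ℝ≥0∞} (hf : Tendsto f atTop (𝓝 0)) :
    ∃ F : ℕ → Finset ℤ, Monotone F ∧ Tendsto F atTop atTop ∧ ∀ j, f (F j) ≤ 2⁻¹ ^ j := by
  have h1 : ∀ j : ℕ, ∃ F₀ : Finset ℤ, ∀ F, F₀ ⊆ F → f F ≤ 2⁻¹ ^ j := fun j => by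
    have h0 : (0 : ℝ≥0∞) < 2⁻¹ ^ j :=
      pos_iff_ne_zero.2 (pow_ne_zero j (ENNReal.inv_ne_zero.2 ENNReal.ofNat_ne_top))
    have h2 := hf.eventually (ge_mem_nhds h0)
    exact (eventually_atTop.1 h2)
  choose F₀ hF₀ using h1
  set F : ℕ → Finset ℤ := fun j => Finset.Icc (-(j : ℤ)) j ∪ (Finset.range (j + 1)).biUnion F₀ with hF
  have hm : Monotone F := fun i j hij => by
    refine Finset.union_subset_union (Finset.Icc_subset_Icc (by simpa using hij) (by simpa using hij))
      (Finset.biUnion_subset_biUnion_of_subset_left _ (Finset.range_mono (by omega)))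
  refine ⟨F, hm, tendsto_atTop_finset_of_monotone hm fun k => ⟨k.natAbs, ?_⟩, fun j => hF₀ j _ ?_⟩
  · refine Finset.mem_union_left _ (Finset.mem_Icc.2 ?_)
    omega
  · exact (Finset.subset_biUnion_of_mem F₀ (Finset.self_mem_range_succ j)).trans
      Finset.subset_union_right

lemma ae_tendsto_zero_of_lintegral_le {f : ℕ → Ω → ℝ≥0∞} (hf : ∀ j, AEMeasurable (f j) P)
    {K : ℝ≥0∞} (hK : K ≠ ∞) (h : ∀ j, ∫⁻ ω, f j ω ∂P ≤ K * 2⁻¹ ^ j) :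
    ∀ᵐ ω ∂P, ∑' j, f j ω ≠ ∞ := by
  have h1 : ∫⁻ ω, ∑' j, f j ω ∂P ≠ ∞ := by
    rw [lintegral_tsum hf]
    refine ne_top_of_le_ne_top ?_ (ENNReal.tsum_le_tsum h)
    rw [ENNReal.tsum_mul_left, ENNReal.tsum_geometric]
    exact ENNReal.mul_ne_top hK (by simp [ENNReal.one_sub_inv_two])
  filter_upwards [ae_lt_top' (AEMeasurable.tsum hf) h1] with ω hω using hω.ne

lemma enorm_cutFT_le {f : ℝ → ℂ} {B : ℝ≥0∞} (h : ∀ t ∈ Set.Icc (0 : ℝ) 1, ‖f t‖ₑ ≤ B) (τ : ℝ) :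
    ‖cutFT 0 1 f τ‖ₑ ≤ B := by
  rcases eq_or_ne B ∞ with rfl | hB
  · exact le_top
  have h1 := norm_cutFT_le (t₀ := 0) (t₁ := 1) (M := B.toReal) zero_le_one (a := f) (fun w hw => by
    have := ENNReal.toReal_mono hB (h w hw)
    simpa using this) τ
  rw [sub_zero, mul_one] at h1
  rw [← ofReal_norm, ← ENNReal.ofReal_toReal hB]
  exact ENNReal.ofReal_le_ofReal h1

lemma cutFT_partConv {β : ℤ → ℝ≥0 → Ω → ℂ} {ω : Ω} (hc : ∀ k, Continuous fun t => β k t ω)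
    (h0 : ∀ k, β k 0 ω = 0) (c : ℤ → ℂ) (D : ℝ) (F : Finset ℤ) (τ : ℝ) :
    cutFT 0 1 (fun t => partConv β c D F t ω) τ =
      -∑ k ∈ F, c k * pathInt (ftKernel D τ) (fun r => β k r.toNNReal ω) 0 1 := by
  have hb : ∀ k, Continuous fun r : ℝ => β k r.toNNReal ω := fun k =>
    (hc k).comp continuous_real_toNNReal
  simp only [cutFT, partConv, Finset.mul_sum]
  rw [intervalIntegral.integral_finsetSum, ← Finset.sum_neg_distrib]
  · refine Finset.sum_congr rfl fun k _ => ?_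
    rw [← mul_neg, ← cutFT_pathInt D τ (hb k) (by simp [h0 k]), cutFT,
      ← intervalIntegral.integral_const_mul]
    refine intervalIntegral.integral_congr fun t _ => ?_
    ring
  · intro k _
    have h1 := continuous_pathInt (contDiff_osc D) (hb k) 0
    exact Continuous.intervalIntegrable (by fun_prop) _ _

/-- Along a suitable sequence of finite sets the partial sums converge uniformly on [0, 1] almost
surely, by the chaining bound with exponent 5 (anything above 4 would do). Their transforms in time
therefore converge as well; these are Wiener integrals of `ftKernel`, and the moment bound passes to
the limit by Fatou's lemma. -/
lemma IsConvCoeff.lintegral_cutFT_le [IsProbabilityMeasure P] {β : ℤ → ℝ≥0 → Ω → ℂ}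
    (hW : IsCylindricalWiener β P) {c : ℤ → ℂ} (hc : ∑' k, ‖c k‖ₑ ^ 2 ≠ ∞) {D : ℝ}
    {Y : ℝ → Ω → ℂ} (hY : IsConvCoeff β P c D Y) {p : ℝ} (hp : 1 ≤ p) (τ : ℝ) :
    ∫⁻ ω, ‖cutFT 0 1 (fun t => Y t ω) τ‖ₑ ^ p ∂P ≤
      momConst p * (tailSq c ∅ ^ (1 / 2 : ℝ) * (3 * wt (-1) τ)) ^ p := by
  have hq : (4 : ℝ) < 5 := by norm_num
  have hq0 : (0 : ℝ) < 5 := by norm_num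
  have hlim : Tendsto (fun F => (tailSq c F) ^ ((5 : ℝ) / 2)) atTop (𝓝 0) := by
    have := ((ENNReal.continuous_rpow_const (y := (5 : ℝ) / 2)).tendsto 0).comp (tendsto_tailSq hc)
    rwa [ENNReal.zero_rpow_of_pos (by norm_num)] at this
  obtain ⟨F, -, -, hF⟩ := exists_seq_le_of_tendsto hlim
  have hmeas : ∀ j, AEMeasurable (fun ω => dyadSum 5 (fun t => Y t ω - partConv β c D (F j) t ω)) P :=
    fun j => aemeasurable_dyadSum (X := fun t ω => Y t ω - partConv β c D (F j) t ω)
      (fun t ht => ((hY.aestronglyMeasurable t).aemeasurable).sub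
        (hW.aemeasurable_pathInt _ c (contDiff_osc D) ht)) 5
  have hae := ae_tendsto_zero_of_lintegral_le hmeas (K := chainMean 5 * momConst 5)
    (ENNReal.mul_ne_top (chainMean_lt_top hq).ne (momConst_lt_top (by norm_num)).ne) fun j =>
      (hY.lintegral_dyadSum_sub_le hW (by norm_num) (F j)).trans (by
        rw [← mul_assoc]; exact mul_le_mul' le_rfl (hF j))
  refine lintegral_rpow_le_of_tendsto (Z := fun j ω =>
    -∑ k ∈ F j, c k * pathInt (ftKernel D τ) (fun r => β k r.toNNReal ω) 0 1)
    (fun j => (hW.aemeasurable_pathInt (F j) c (contDiff_ftKernel D τ) zero_le_one).neg) ?_ ?_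
  · filter_upwards [hae, hW.ae_continuous, hW.ae_zero, hY.continuous, hY.ae_zero hW,
      hW.ae_continuous_partConv c D, hW.ae_partConv_zero c D] with ω h1 h2 h3 h4 h5 h6 h7
    simp only [← cutFT_partConv h2 h3]
    rw [tendsto_iff_edist_tendsto_0]
    have h8 : Tendsto (fun j => chainSup 5 *
        dyadSum 5 (fun t => Y t ω - partConv β c D (F j) t ω) ^ (1 / (5 : ℝ))) atTop (𝓝 0) := by
      have h9 := ((ENNReal.continuous_rpow_const (y := 1 / (5 : ℝ))).tendsto 0).comp
        (ENNReal.tendsto_atTop_zero_of_tsum_ne_top h1)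
      have h10 := ENNReal.Tendsto.const_mul (a := chainSup 5) h9 (.inr (chainSup_lt_top hq0).ne)
      rwa [ENNReal.zero_rpow_of_pos (by norm_num), mul_zero] at h10
    refine tendsto_of_tendsto_of_tendsto_of_le_of_le tendsto_const_nhds h8 (fun _ => zero_le)
      fun j => ?_
    rw [edist_comm, edist_eq_enorm_sub, ← cutFT_sub (h4.intervalIntegrable _ _)
      ((h6 (F j)).intervalIntegrable _ _)]
    refine enorm_cutFT_le (fun t ht => ?_) τ
    have h11 := enorm_sub_le_dyadSum hq0 (h4.sub (h6 (F j))) ht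
    simp only [Pi.sub_apply, h5, h7, sub_zero] at h11
    exact h11
  · refine .of_forall fun j => ?_
    simp only [enorm_neg]
    refine (lintegral_rpow_pathInt_le hW (F j) c (contDiff_ftKernel D τ) le_rfl zero_le_one
      (fun r hr => norm_ftKernel_le D τ hr) hp).trans (mul_le_mul' le_rfl ?_)
    have h1 : ENNReal.ofReal (∑ k ∈ F j, ‖c k‖ ^ 2) ≤ tailSq c ∅ := by
      have := ofReal_sum_sq_le_tailSq c (F := ∅) (F' := F j)
      rwa [Finset.sdiff_empty] at this
    have h2 : ENNReal.ofReal ((3 / jb τ) ^ 2 * (1 - 0)) = (3 * wt (-1) τ) ^ (2 : ℝ) := by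
      rw [sub_zero, mul_one, ENNReal.ofReal_pow (by have := jb_pos τ; positivity), div_eq_mul_inv,
        ENNReal.ofReal_mul (by norm_num), wt, Real.rpow_neg_one, ENNReal.rpow_two]
      simp
    rw [ENNReal.ofReal_mul (Finset.sum_nonneg fun _ _ => sq_nonneg _), h2]
    calc _ ≤ (tailSq c ∅ * (3 * wt (-1) τ) ^ (2 : ℝ)) ^ (p / 2) :=
          ENNReal.rpow_le_rpow (mul_le_mul' h1 le_rfl) (by linarith)
      _ = _ := by
          generalize 3 * wt (-1) τ = x
          rw [ENNReal.mul_rpow_of_nonneg _ _ (by linarith), ← ENNReal.rpow_mul,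
            ENNReal.mul_rpow_of_nonneg _ _ (by linarith), ← ENNReal.rpow_mul]
          congr 2 <;> ring

lemma tsum_rpow_eq_of_gammaNorm (s : ℝ) {p : ℝ} (hp : 0 < p) (φ : L2Torus →ₗ[ℂ] (ℤ → ℂ)) :
    gammaNorm s p φ ^ p = ∑' n : ℤ, (wt s n *
      tailSq (fun k => φ (fourierLp 2 k) n) ∅ ^ (1 / 2 : ℝ)) ^ p := by
  rw [gammaNorm, ← ENNReal.rpow_mul, one_div_mul_cancel hp.ne', ENNReal.rpow_one]
  refine tsum_congr fun n => ?_
  congr 1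
  rw [tailSq_empty]
  have h1 : ∀ k : ℤ, (ENNReal.ofReal (jb n ^ s) * ‖φ (fourierLp 2 k) n‖ₑ) ^ (2 : ℝ) =
      wt s n ^ (2 : ℝ) * ‖φ (fourierLp 2 k) n‖ₑ ^ 2 := fun k => by
    rw [ENNReal.mul_rpow_of_nonneg _ _ (by norm_num), ENNReal.rpow_two ‖_‖ₑ]
    rfl
  simp only [h1]
  rw [ENNReal.tsum_mul_left, ENNReal.mul_rpow_of_nonneg _ _ (by norm_num), ← ENNReal.rpow_mul]
  norm_num

lemma tsum_rpow_lt_top_of_gammaNorm {s p : ℝ} (hp : 0 < p) {φ : L2Torus →ₗ[ℂ] (ℤ → ℂ)}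
    (h : gammaNorm s p φ < ∞) : ∑' n : ℤ, (wt s n *
      tailSq (fun k => φ (fourierLp 2 k) n) ∅ ^ (1 / 2 : ℝ)) ^ p < ∞ := by
  rw [← tsum_rpow_eq_of_gammaNorm s hp]
  exact ENNReal.rpow_lt_top_of_nonneg hp.le h.ne

lemma tsum_sq_ne_top_of_gammaNorm {s p : ℝ} (hp : 0 < p) {φ : L2Torus →ₗ[ℂ] (ℤ → ℂ)}
    (h : gammaNorm s p φ < ∞) (n : ℤ) : ∑' k, ‖φ (fourierLp 2 k) n‖ₑ ^ 2 ≠ ∞ := by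
  have h1 := ENNReal.ne_top_of_tsum_ne_top (tsum_rpow_lt_top_of_gammaNorm hp h).ne n
  intro h2
  rw [tailSq_empty, h2, ENNReal.top_rpow_of_pos (by norm_num), ENNReal.mul_top (wt_ne_zero s n),
    ENNReal.top_rpow_of_pos hp] at h1
  exact h1 rfl

/-- The p-th moment of the supremum of the n-th coefficient is at most a constant times the p-th
power of the ℓ² norm in k of its coefficients, and the weighted sum over n is a power of the γ-norm.
-/
lemma ae_nS_lt_top [IsProbabilityMeasure P] {β : ℤ → ℝ≥0 → Ω → ℂ}
    (hW : IsCylindricalWiener β P) {s p : ℝ} (hp : 0 < p) {φ : L2Torus →ₗ[ℂ] (ℤ → ℂ)}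
    (h : gammaNorm s p φ < ∞) {Ψ : ℝ≥0 → Ω → ℤ → ℂ} (hΨ : IsStochasticConvolution φ β P Ψ) :
    ∀ᵐ ω ∂P, nS s p 0 1 (noisePath fun t => Ψ t ω) < ∞ := by
  -- Chaining needs q > 4, and Jensen's inequality with exponent p/q ≤ 1 recovers the p-th moment
  -- from the mean of `dyadSum`.
  set q := p + 4 with hq
  have hq4 : 4 < q := by linarith
  have hY := hΨ.isConvCoeff hW
  set d : ℤ → Ω → ℝ≥0∞ := fun n ω => dyadSum q fun t => noisePath (fun t => Ψ t ω) t n with hd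
  have hdm : ∀ n, AEMeasurable (d n) P := fun n =>
    aemeasurable_dyadSum (X := fun t ω => noisePath (fun t => Ψ t ω) t n)
      (fun t _ => ((hY n).aestronglyMeasurable t).aemeasurable) q
  have hdE : ∀ n, ∫⁻ ω, d n ω ∂P ≤ chainMean q * (momConst q *
      tailSq (fun k => φ (fourierLp 2 k) n) ∅ ^ (q / 2)) := fun n => by
    have := (hY n).lintegral_dyadSum_sub_le hW (q := q) (by linarith) ∅
    simpa [partConv] using this
  have hfin : ∫⁻ ω, ∑' n : ℤ, (wt s n * (chainSup q * d n ω ^ (1 / q))) ^ p ∂P ≠ ∞ := by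
    have hm : ∀ n : ℤ, AEMeasurable (fun ω => (wt s n * (chainSup q * d n ω ^ (1 / q))) ^ p) P :=
      fun n => ((((hdm n).pow_const _).const_mul _).const_mul _).pow_const p
    rw [lintegral_tsum hm]
    set K : ℝ≥0∞ := chainSup q ^ p * (chainMean q * momConst q) ^ (p / q) with hK
    have hKt : K ≠ ∞ := by
      have h1 := chainSup_lt_top (q := q) (by linarith)
      have h2 := chainMean_lt_top hq4
      have h3 := momConst_lt_top (q := q) (by linarith)
      exact ENNReal.mul_ne_top (ENNReal.rpow_ne_top_of_nonneg hp.le h1.ne)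
        (ENNReal.rpow_ne_top_of_nonneg (by positivity) (ENNReal.mul_ne_top h2.ne h3.ne))
    refine ne_top_of_le_ne_top
      (ENNReal.mul_ne_top hKt (tsum_rpow_lt_top_of_gammaNorm hp h).ne) ?_
    rw [← ENNReal.tsum_mul_left]
    refine ENNReal.tsum_le_tsum fun n => ?_
    have e1 : ∀ ω, (wt s n * (chainSup q * d n ω ^ (1 / q))) ^ p =
        (wt s n * chainSup q) ^ p * d n ω ^ (p / q) := fun ω => by
      rw [← mul_assoc, ENNReal.mul_rpow_of_nonneg _ _ hp.le, ← ENNReal.rpow_mul]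
      congr 2
      ring
    simp only [e1]
    rw [lintegral_const_mul'' _ ((hdm n).pow_const _)]
    have h4 : ∫⁻ ω, d n ω ^ (p / q) ∂P ≤ (chainMean q * momConst q) ^ (p / q) *
        (tailSq (fun k => φ (fourierLp 2 k) n) ∅ ^ (1 / 2 : ℝ)) ^ p := by
      refine (lintegral_rpow_le_rpow_lintegral (hdm n) (by positivity)
        (by rw [div_le_one (by linarith)]; linarith)).trans ?_
      refine (ENNReal.rpow_le_rpow (hdE n) (by positivity)).trans (le_of_eq ?_)
      rw [← mul_assoc, ENNReal.mul_rpow_of_nonneg _ _ (by positivity), ← ENNReal.rpow_mul,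
        ← ENNReal.rpow_mul]
      congr 2
      field_simp
    refine (mul_le_mul' le_rfl h4).trans (le_of_eq ?_)
    rw [ENNReal.mul_rpow_of_nonneg _ _ hp.le, ENNReal.mul_rpow_of_nonneg _ _ hp.le, hK]
    ring
  have hfin' := ae_lt_top' (AEMeasurable.tsum fun n =>
    ((((hdm n).pow_const _).const_mul _).const_mul _).pow_const p) hfin
  filter_upwards [hfin', ae_all_iff.2 fun n => (hY n).continuous,
    ae_all_iff.2 fun n => (hY n).ae_zero hW] with ω h1 h2 h3
  refine lt_of_le_of_lt (lp_mono hp (g := fun n : ℤ => wt s n * (chainSup q * d n ω ^ (1 / q)))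
    fun n => mul_le_mul' le_rfl (iSup₂_le fun t ht => ?_))
    (ENNReal.rpow_lt_top_of_nonneg (by positivity) h1.ne)
  have h4 := enorm_sub_le_dyadSum (q := q) (by linarith) (h2 n) ht
  rwa [h3 n, sub_zero] at h4

/-- Tonelli: the p-th moment at modulation τ decays like ⟨τ⟩^{-p}, so the weight b leaves
⟨τ⟩^{(b-1)p}, integrable by hypothesis. Joint measurability in ω and τ is the reason for assuming
measurable coefficients and continuous paths everywhere. -/
lemma ae_nX_lt_top [IsProbabilityMeasure P] {β : ℤ → ℝ≥0 → Ω → ℂ}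
    (hW : IsCylindricalWiener β P) {s p b : ℝ} (hp : 1 ≤ p) (hb : (b - 1) * p < -1)
    {φ : L2Torus →ₗ[ℂ] (ℤ → ℂ)} (h : gammaNorm s p φ < ∞) {Ψ : ℝ≥0 → Ω → ℤ → ℂ}
    (hΨ : IsStochasticConvolution φ β P Ψ) (hm : ∀ t n, Measurable fun ω => Ψ t ω n)
    (hc : ∀ ω n, Continuous fun t => Ψ t ω n) :
    ∀ᵐ ω ∂P, nX s b p (fun n => cutFT 0 1 (fun t => noisePath (fun t => Ψ t ω) t n)) < ∞ := by
  have hp0 : 0 < p := by linarith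
  have hY := hΨ.isConvCoeff hW
  set Z : Ω → ℤ → ℝ → ℂ := fun ω n => cutFT 0 1 (fun t => noisePath (fun t => Ψ t ω) t n) with hZ
  have hZm : ∀ n, Measurable fun y : Ω × ℝ => Z y.1 n y.2 := fun n =>
    (stronglyMeasurable_cutFT zero_le_one (Y := fun r ω => noisePath (fun t => Ψ t ω) r n)
      (fun r => (hm _ n).const_mul _) fun ω => continuous_noisePath (hc ω) n).measurable
  have hfm : ∀ n : ℤ, Measurable fun y : Ω × ℝ => (wt s n * wt b y.2 * ‖Z y.1 n y.2‖ₑ) ^ p :=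
    fun n => ((((measurable_wt b).comp measurable_snd).const_mul (wt s n)).mul
      (hZm n).enorm).pow_const p
  have hfin : ∫⁻ ω, nX s b p (Z ω) ^ p ∂P ≠ ∞ := by
    simp only [nX_rpow hp0]
    have hm' : ∀ n : ℤ, AEMeasurable (fun ω => ∫⁻ τ, (wt s n * wt b τ * ‖Z ω n τ‖ₑ) ^ p) P :=
      fun n => (Measurable.lintegral_prod_right' (hfm n)).aemeasurable
    rw [lintegral_tsum hm']
    set J := ∫⁻ x, wt ((b - 1) * p) x with hJ
    have hJt : J < ∞ := lintegral_wt_lt_top hb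
    refine ne_top_of_le_ne_top (ENNReal.mul_ne_top (a := momConst p * 3 ^ p * J)
      (ENNReal.mul_ne_top (ENNReal.mul_ne_top (momConst_lt_top hp).ne
        (ENNReal.rpow_ne_top_of_nonneg hp0.le (by norm_num))) hJt.ne)
      (tsum_rpow_lt_top_of_gammaNorm hp0 h).ne) ?_
    rw [← ENNReal.tsum_mul_left]
    refine ENNReal.tsum_le_tsum fun n => ?_
    rw [lintegral_lintegral_swap (hfm n).aemeasurable]
    set σ := tailSq (fun k => φ (fourierLp 2 k) n) ∅ ^ (1 / 2 : ℝ) with hσ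
    calc ∫⁻ τ, ∫⁻ ω, (wt s n * wt b τ * ‖Z ω n τ‖ₑ) ^ p ∂P
        ≤ ∫⁻ τ, (momConst p * 3 ^ p * (wt s n * σ) ^ p) * wt ((b - 1) * p) τ := by
          refine lintegral_mono fun τ => ?_
          have e1 : ∀ ω, (wt s n * wt b τ * ‖Z ω n τ‖ₑ) ^ p =
              (wt s n * wt b τ) ^ p * ‖Z ω n τ‖ₑ ^ p := fun ω =>
            ENNReal.mul_rpow_of_nonneg _ _ hp0.le
          simp only [e1]
          rw [lintegral_const_mul' _ _ (ENNReal.rpow_ne_top_of_nonneg hp0.le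
            (ENNReal.mul_ne_top (wt_ne_top _ _) (wt_ne_top _ _)))]
          refine (mul_le_mul' le_rfl ((hY n).lintegral_cutFT_le hW
            (tsum_sq_ne_top_of_gammaNorm hp0 h n) hp τ)).trans (le_of_eq ?_)
          rw [← hσ, ← wt_rpow, sub_eq_add_neg, wt_add]
          simp only [ENNReal.mul_rpow_of_nonneg _ _ hp0.le]
          ring
      _ = _ := by
          rw [lintegral_const_mul _ (measurable_wt _)]
          ring
  filter_upwards [ae_lt_top ((measurable_nX s b p hZm).pow_const p) hfin] with ω hω
  by_contra hn
  rw [not_lt, top_le_iff] at hn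
  rw [hn, ENNReal.top_rpow_of_pos hp0] at hω
  exact lt_irrefl _ hω

lemma IsStochasticConvolution.congr {φ : L2Torus →ₗ[ℂ] (ℤ → ℂ)} {β : ℤ → ℝ≥0 → Ω → ℂ}
    {Ψ Φ : ℝ≥0 → Ω → ℤ → ℂ} (hΨ : IsStochasticConvolution φ β P Ψ)
    (h : ∀ᵐ ω ∂P, ∀ t, Φ t ω = Ψ t ω) : IsStochasticConvolution φ β P Φ where
  aestronglyMeasurable t n := (hΨ.aestronglyMeasurable t n).congr (by
    filter_upwards [h] with ω hω using by rw [hω])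
  tendsto_L2 t n := (hΨ.tendsto_L2 t n).congr fun F => eLpNorm_congr_ae (by
    filter_upwards [h] with ω hω using by rw [hω])
  continuous_paths := by
    filter_upwards [h, hΨ.continuous_paths] with ω hω hc n
    simpa only [hω] using hc n

/-- Almost every path of the stochastic convolution is good. -/
theorem ae_goodPath [IsProbabilityMeasure P] (e : Exponents) {β : ℤ → ℝ≥0 → Ω → ℂ}
    (hW : IsCylindricalWiener β P) {φ : L2Torus →ₗ[ℂ] (ℤ → ℂ)} (h : gammaNorm e.s e.p φ < ∞)
    {Ψ : ℝ≥0 → Ω → ℤ → ℂ} (hΨ : IsStochasticConvolution φ β P Ψ) :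
    ∀ᵐ ω ∂P, GoodPath e fun t => Ψ t ω := by
  obtain ⟨Φ, hm, hc, hΦ⟩ := exists_continuous_modification hΨ.aestronglyMeasurable
    hΨ.continuous_paths
  have hΦ' := hΨ.congr hΦ
  filter_upwards [hΦ, ae_nS_lt_top hW e.p_pos h hΦ', ae_nX_lt_top hW e.one_lt_p.le
    (e.sub_one_mul_p_lt e.b'_lt) h hΦ' hm hc] with ω h1 h2 h3
  have h4 : (fun t => Ψ t ω) = fun t => Φ t ω := funext fun t => (h1 t).symm
  rw [h4]
  exact ⟨hc ω, h2, h3⟩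

/-! ### Adaptedness and the stopping time property -/

/-- A σ-algebra that contains all null sets is closed under almost sure limits; this is how
completeness of the filtration enters. -/
lemma measurable_of_ae_tendsto {m' : MeasurableSpace Ω}
    (hN : ∀ N : Set Ω, P N = 0 → MeasurableSet[m'] N) {f : ℕ → Ω → ℂ} {g : Ω → ℂ}
    (hf : ∀ j, Measurable[m'] (f j)) (hlim : ∀ᵐ ω ∂P, Tendsto (fun j => f j ω) atTop (𝓝 (g ω))) :
    Measurable[m'] g := by
  set N : Set Ω := {ω | ¬Tendsto (fun j => f j ω) atTop (𝓝 (g ω))} with hNd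
  have hN0 : P N = 0 := hlim
  have h1 : Measurable[m'] (Nᶜ.indicator g) := by
    refine measurable_of_tendsto_metrizable (f := fun j => Nᶜ.indicator (f j))
      (fun j => (hf j).indicator (hN N hN0).compl) (tendsto_pi_nhds.2 fun ω => ?_)
    by_cases hω : ω ∈ N
    · simp [hω]
    · have hω' : ω ∈ Nᶜ := hω
      simp only [Set.indicator_of_mem hω']
      simpa [hNd] using hω
  intro S hS
  have h2 : g ⁻¹' S = (g ⁻¹' S ∩ N) ∪ (Nᶜ.indicator g ⁻¹' S ∩ Nᶜ) := by
    ext ω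
    by_cases hω : ω ∈ N
    · simp [hω]
    · simp [hω]
  rw [h2]
  exact (hN _ (measure_mono_null Set.inter_subset_right hN0)).union ((h1 hS).inter (hN N hN0).compl)

/-- The Riemann sums over [0, t] use the Brownian motions at times up to t only. -/
lemma measurable_filtration_partConv {𝓕 : Filtration ℝ≥0 m} (hU : UsualConditions 𝓕 P)
    {β : ℤ → ℝ≥0 → Ω → ℂ} (hW : IsCylindricalWiener β P) (hβ : ∀ k, StronglyAdapted 𝓕 (β k))
    (c : ℤ → ℂ) (D : ℝ) (F : Finset ℤ) (t : ℝ≥0) :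
    Measurable[𝓕 t] (fun ω => partConv β c D F t ω) := by
  have hcompl : ∀ N : Set Ω, P N = 0 → MeasurableSet[𝓕 t] N := fun N hN =>
    𝓕.mono (zero_le) _ (hU.complete N hN)
  refine measurable_of_ae_tendsto hcompl (f := fun N ω =>
    ∑ k ∈ F, c k * rsum (osc D) (fun r => β k r.toNNReal ω) 0 t N) (fun N => ?_)
    (hW.tendsto_rsum F c (contDiff_osc D) t.2)
  have hb : ∀ k j, j ≤ N → Measurable[𝓕 t] (β k (grid 0 t N j).toNNReal) := fun k j hj => by
    have h1 : (grid 0 t N j).toNNReal ≤ t := by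
      rcases Nat.eq_zero_or_pos N with rfl | hN
      · simp [grid]
      · rw [Real.toNNReal_le_iff_le_coe]
        exact (grid_mem t.2 hN hj).2
    exact ((hβ k _).mono (𝓕.mono h1)).measurable
  refine Finset.measurable_fun_sum _ fun k _ => Measurable.const_mul
    (Finset.measurable_fun_sum _ fun j hj => Measurable.const_mul ?_ _) _
  have hj' := Finset.mem_range.1 hj
  exact (hb k (j + 1) hj').sub (hb k j hj'.le)

lemma IsStochasticConvolution.measurable_filtration {φ : L2Torus →ₗ[ℂ] (ℤ → ℂ)}
    {β : ℤ → ℝ≥0 → Ω → ℂ} (hW : IsCylindricalWiener β P) {Ψ : ℝ≥0 → Ω → ℤ → ℂ}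
    (hΨ : IsStochasticConvolution φ β P Ψ) {𝓕 : Filtration ℝ≥0 m} (hU : UsualConditions 𝓕 P)
    (hβ : ∀ k, StronglyAdapted 𝓕 (β k)) (t : ℝ≥0) (n : ℤ) :
    Measurable[𝓕 t] (fun ω => Ψ t ω n) := by
  have hcompl : ∀ N : Set Ω, P N = 0 → MeasurableSet[𝓕 t] N := fun N hN =>
    𝓕.mono (zero_le) _ (hU.complete N hN)
  have hY := hΨ.isConvCoeff hW n
  set c : ℤ → ℂ := fun k => φ (fourierLp 2 k) n with hc
  have h1 : TendstoInMeasure P (fun (F : Finset ℤ) ω => partConv β c (disp n) F t ω) atTop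
      (fun ω => noisePath (fun t => Ψ t ω) t n) := by
    refine tendstoInMeasure_of_tendsto_eLpNorm two_ne_zero
      (fun F => (hW.aemeasurable_pathInt F c (contDiff_osc _) t.2).aestronglyMeasurable)
      (hY.aestronglyMeasurable t) ((hY.tendsto_L2 t t.2).congr fun F => ?_)
    exact eLpNorm_sub_comm _ _ _ _
  obtain ⟨ns, -, hae⟩ := h1.exists_seq_tendsto_ae'
  have h2 := measurable_of_ae_tendsto hcompl
    (fun j => measurable_filtration_partConv hU hW hβ c (disp n) (ns j) t) hae
  have h3 : (fun ω => Ψ t ω n) = fun ω => cexp (I * (t : ℝ) * disp n) *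
      noisePath (fun t => Ψ t ω) t n := by
    funext ω
    rw [noisePath, ← mul_assoc, ← Complex.exp_add, add_neg_cancel, Complex.exp_zero, one_mul,
      Real.toNNReal_coe]
  rw [h3]
  exact h2.const_mul _

/-- The existence time is a stopping time. -/
theorem isStoppingTime_existTime (e : Exponents) {𝓕 : Filtration ℝ≥0 m}
    (hU : UsualConditions 𝓕 P) {Ψ : ℝ≥0 → Ω → ℤ → ℂ}
    (hm : ∀ t n, Measurable[𝓕 t] (fun ω => Ψ t ω n))
    (hc : ∀ᵐ ω ∂P, ∀ n, Continuous fun t => Ψ t ω n) (R : ℝ≥0) :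
    IsStoppingTime 𝓕 (fun ω => ((existTime e R (fun t => Ψ t ω) : ℝ≥0) : WithTop ℝ≥0)) := by
  classical
  have := hU.right_cont
  -- Right continuity reduces the claim to strict inequalities, for which `existTime_lt_iff` gives a
  -- countable union of conditions at times before t.
  refine isStoppingTime_of_measurableSet_lt_of_isRightContinuous fun t => ?_
  have hcompl : ∀ (t : ℝ≥0) (N : Set Ω), P N = 0 → MeasurableSet[𝓕 t] N := fun t N hN =>
    𝓕.mono (zero_le) _ (hU.complete N hN)
  set N : Set Ω := {ω | ¬∀ n, Continuous fun t => Ψ t ω n} with hN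
  have hN0 : P N = 0 := hc
  -- Discontinuous paths are set to zero on a null set, which belongs to every 𝓕 t;
  -- `measurable_noiseNorm` needs continuity for every ω.
  set Φ : ℝ≥0 → Ω → ℤ → ℂ := fun t ω => if ω ∈ N then 0 else Ψ t ω with hΦ
  have hΦm : ∀ s n, Measurable[𝓕 s] (fun ω => Φ s ω n) := fun s n => by
    have h1 : (fun ω => Φ s ω n) = Nᶜ.indicator fun ω => Ψ s ω n := by
      funext ω
      by_cases hω : ω ∈ N
      · simp [hΦ, hω]
      · simp [hΦ, hω]
    rw [h1]
    exact (hm s n).indicator (hcompl s N hN0).compl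
  have hΦc : ∀ ω n, Continuous fun t => Φ t ω n := fun ω n => by
    by_cases hω : ω ∈ N
    · simp only [hΦ, if_pos hω]
      exact continuous_const
    · simp only [hΦ, if_neg hω]
      have h2 : ∀ n, Continuous fun t => Ψ t ω n := by simpa [hN] using hω
      exact h2 n
  have hS : MeasurableSet[𝓕 t] {ω | existTime e R (fun t => Φ t ω) < t} := by
    have h3 : {ω | existTime e R (fun t => Φ t ω) < t} = {_ω : Ω | 1 < t} ∪
        ⋃ q : ℚ, ⋃ (_ : 0 < (q : ℝ) ∧ (q : ℝ) < t),
          {ω | 1 < smallness e R q (fun t => Φ t ω)} := by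
      ext ω
      simp only [Set.mem_ofPred_eq, existTime_lt_iff, Set.mem_union, Set.mem_iUnion, exists_prop,
        and_assoc]
    rw [h3]
    refine MeasurableSet.union (MeasurableSet.const _) (MeasurableSet.iUnion fun q =>
      MeasurableSet.iUnion fun hq => ?_)
    have h4 := @measurable_noiseNorm Ω (𝓕 t) e q hq.1.le Φ (fun s hs n =>
      (hΦm s n).mono (𝓕.mono (show s ≤ t from NNReal.coe_le_coe.1 (hs.trans hq.2.le))) le_rfl) hΦc
    have h5 : Measurable[𝓕 t] fun ω => smallness e R q (fun t => Φ t ω) :=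
      ((h4.const_add _).pow_const 2).const_mul _
    exact measurableSet_lt (measurable_const) h5
  have h6 : {ω | ((existTime e R (fun t => Ψ t ω) : ℝ≥0) : WithTop ℝ≥0) < t} =
      ({ω | ((existTime e R (fun t => Ψ t ω) : ℝ≥0) : WithTop ℝ≥0) < t} ∩ N) ∪
        ({ω | existTime e R (fun t => Φ t ω) < t} ∩ Nᶜ) := by
    ext ω
    by_cases hω : ω ∈ N
    · simp [hω]
    · have h7 : (fun t => Φ t ω) = fun t => Ψ t ω := by simp [hΦ, hω]
      simp only [Set.mem_union, Set.mem_inter_iff, Set.mem_ofPred_eq, Set.mem_compl_iff, hω, h7,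
        WithTop.coe_lt_coe, and_false, false_or, not_false_eq_true, and_true]
  rw [h6]
  exact (hcompl t _ (measure_mono_null Set.inter_subset_right hN0)).union
    (hS.inter (hcompl t N hN0).compl)

/-! ### Existence of the stochastic convolution -/

lemma lintegral_dyadSum_partConv_le [IsProbabilityMeasure P] {β : ℤ → ℝ≥0 → Ω → ℂ}
    (hW : IsCylindricalWiener β P) (c : ℤ → ℂ) (D : ℝ) {q : ℝ} (hq : 1 ≤ q) {L : ℝ} (hL : 0 ≤ L)
    {F F' : Finset ℤ} (hF : F ⊆ F') :
    ∫⁻ ω, dyadSum q (fun t => partConv β c D F' (L * t) ω - partConv β c D F (L * t) ω) ∂P ≤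
      chainMean q * (momConst q * (tailSq c F * ENNReal.ofReal L) ^ (q / 2)) := by
  refine lintegral_dyadSum_le
    (X := fun t ω => partConv β c D F' (L * t) ω - partConv β c D F (L * t) ω)
    (fun t ht => (hW.aemeasurable_pathInt F' c (contDiff_osc D) (mul_nonneg hL ht)).sub
      (hW.aemeasurable_pathInt F c (contDiff_osc D) (mul_nonneg hL ht))) fun s t hs hst _ => ?_
  have h1 := lintegral_rpow_pathInt_sub_le hW c (contDiff_osc D) (mul_nonneg hL hs)
    (mul_le_mul_of_nonneg_left hst hL) (fun r _ => (norm_osc D r).le) hq hF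
  rw [one_pow, one_mul, ← mul_sub, ENNReal.ofReal_mul hL, ← mul_assoc,
    ENNReal.mul_rpow_of_nonneg _ (ENNReal.ofReal (t - s)) (by linarith), ← mul_assoc] at h1
  refine le_trans (le_of_eq (lintegral_congr_ae ?_)) h1
  filter_upwards [hW.ae_continuous] with ω hω
  congr 2
  have h2 : ∀ k, pathInt (osc D) (fun r => β k r.toNNReal ω) (L * s) (L * t) =
      pathInt (osc D) (fun r => β k r.toNNReal ω) 0 (L * t) -
        pathInt (osc D) (fun r => β k r.toNNReal ω) 0 (L * s) := fun k =>
    (pathInt_sub (contDiff_osc D) ((hω k).comp continuous_real_toNNReal) 0 _ _).symm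
  simp only [h2, partConv, mul_sub, Finset.sum_sub_distrib]
  ring

/-- The Weierstrass test on every [0, L] at once. After rescaling time to [0, 1], chaining bounds
the supremum of each difference, and the sequence is chosen so that the means of these bounds decay
geometrically. -/
lemma exists_ae_summable_partConv [IsProbabilityMeasure P] {β : ℤ → ℝ≥0 → Ω → ℂ}
    (hW : IsCylindricalWiener β P) {c : ℤ → ℂ} (hc : ∑' k, ‖c k‖ₑ ^ 2 ≠ ∞) (D : ℝ) :
    ∃ F : ℕ → Finset ℤ, Tendsto F atTop atTop ∧ ∀ᵐ ω ∂P, ∀ L : ℕ, ∃ u : ℕ → ℝ, Summable u ∧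
      ∀ j, ∀ t ∈ Set.Icc (0 : ℝ) L,
        ‖partConv β c D (F (j + 1)) t ω - partConv β c D (F j) t ω‖ ≤ u j := by
  have hlim : Tendsto (fun F => (tailSq c F) ^ (1 / 2 : ℝ)) atTop (𝓝 0) := by
    have := ((ENNReal.continuous_rpow_const (y := (1 / 2 : ℝ))).tendsto 0).comp (tendsto_tailSq hc)
    rwa [ENNReal.zero_rpow_of_pos (by norm_num)] at this
  obtain ⟨F, hmono, hF, hFj⟩ := exists_seq_le_of_tendsto hlim
  refine ⟨F, hF, ?_⟩
  rw [ae_all_iff]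
  intro L
  have hL : (0 : ℝ) ≤ L := Nat.cast_nonneg L
  set d : ℕ → Ω → ℝ≥0∞ := fun j ω => dyadSum 5 (fun t =>
    partConv β c D (F (j + 1)) (L * t) ω - partConv β c D (F j) (L * t) ω) with hd
  have hdm : ∀ j, AEMeasurable (d j) P := fun j => aemeasurable_dyadSum
    (X := fun t ω => partConv β c D (F (j + 1)) (L * t) ω - partConv β c D (F j) (L * t) ω)
    (fun t ht => (hW.aemeasurable_pathInt _ c (contDiff_osc D) (mul_nonneg hL ht)).sub
      (hW.aemeasurable_pathInt _ c (contDiff_osc D) (mul_nonneg hL ht))) 5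
  set K : ℝ≥0∞ := (chainMean 5 * (momConst 5 * ENNReal.ofReal L ^ ((5 : ℝ) / 2))) ^ (1 / (5 : ℝ))
    with hK
  have hKt : K ≠ ∞ := by
    refine ENNReal.rpow_ne_top_of_nonneg (by norm_num) (ENNReal.mul_ne_top
      (chainMean_lt_top (by norm_num)).ne (ENNReal.mul_ne_top (momConst_lt_top (by norm_num)).ne
      (ENNReal.rpow_ne_top_of_nonneg (by norm_num) ENNReal.ofReal_ne_top)))
  have hae := ae_tendsto_zero_of_lintegral_le (f := fun j ω => d j ω ^ (1 / (5 : ℝ)))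
    (fun j => (hdm j).pow_const _) hKt fun j => by
      refine (lintegral_rpow_le_rpow_lintegral (hdm j) (by norm_num) (by norm_num)).trans ?_
      refine (ENNReal.rpow_le_rpow (lintegral_dyadSum_partConv_le hW c D (by norm_num) hL
        (hmono (Nat.le_succ j))) (by norm_num)).trans ?_
      refine le_trans (le_of_eq ?_) (mul_le_mul' (le_refl K) (hFj j))
      have e1 : tailSq c (F j) ^ (1 / 2 : ℝ) = (tailSq c (F j) ^ ((5 : ℝ) / 2)) ^ (1 / (5 : ℝ)) := by
        rw [← ENNReal.rpow_mul]
        norm_num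
      rw [e1, hK, ← ENNReal.mul_rpow_of_nonneg _ _ (by norm_num),
        ENNReal.mul_rpow_of_nonneg _ _ (by norm_num : (0 : ℝ) ≤ 5 / 2)]
      congr 1
      ring
  filter_upwards [hae, hW.ae_continuous_partConv c D, hW.ae_partConv_zero c D] with ω h1 h2 h3
  have h4 : ∑' j, chainSup 5 * d j ω ^ (1 / (5 : ℝ)) ≠ ∞ := by
    rw [ENNReal.tsum_mul_left]
    exact ENNReal.mul_ne_top (chainSup_lt_top (by norm_num)).ne h1
  refine ⟨fun j => (chainSup 5 * d j ω ^ (1 / (5 : ℝ))).toReal, ENNReal.summable_toReal h4,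
    fun j t ht => ?_⟩
  have h5 := ENNReal.ne_top_of_tsum_ne_top h4 j
  rw [← toReal_enorm]
  refine ENNReal.toReal_mono h5 ?_
  have h6 : Continuous fun t : ℝ =>
      partConv β c D (F (j + 1)) (L * t) ω - partConv β c D (F j) (L * t) ω := by
    have a1 := h2 (F (j + 1))
    have a2 := h2 (F j)
    exact (a1.comp (continuous_const.mul continuous_id)).sub
      (a2.comp (continuous_const.mul continuous_id))
  rcases hL.eq_or_lt with h0 | h0
  · have : t = 0 := le_antisymm (h0 ▸ ht.2) ht.1
    rw [this, h3, h3]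
    simp
  · have h7 := enorm_sub_le_dyadSum (q := 5) (by norm_num) h6 (t := t / L)
      ⟨div_nonneg ht.1 hL, by rw [div_le_one h0]; exact ht.2⟩
    rw [mul_div_cancel₀ _ h0.ne', mul_zero, h3, h3, sub_self, sub_zero] at h7
    exact h7

/-- The process is a telescoping series. Its locally uniform convergence gives continuous paths, and
Fatou's lemma bounds the second moment of each remainder by the tail of the square sum; hence
convergence in L² holds along all finite sets, not just along the sequence. -/
lemma exists_isConvCoeff [IsProbabilityMeasure P] {β : ℤ → ℝ≥0 → Ω → ℂ}
    (hW : IsCylindricalWiener β P) {c : ℤ → ℂ} (hc : ∑' k, ‖c k‖ₑ ^ 2 ≠ ∞) (D : ℝ) :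
    ∃ Y : ℝ≥0 → Ω → ℂ, (∀ t, AEStronglyMeasurable (Y t) P) ∧
      (∀ t : ℝ≥0, Tendsto (fun F : Finset ℤ =>
        eLpNorm (fun ω => Y t ω - partConv β c D F t ω) 2 P) atTop (𝓝 0)) ∧
      ∀ᵐ ω ∂P, Continuous fun t => Y t ω := by
  obtain ⟨F, hF, hae⟩ := exists_ae_summable_partConv hW hc D
  set g : ℕ → ℝ → Ω → ℂ := fun j t ω =>
    partConv β c D (F (j + 1)) t ω - partConv β c D (F j) t ω with hg
  set X : ℝ → Ω → ℂ := fun t ω => partConv β c D (F 0) t ω + ∑' j, g j t ω with hX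
  have hlim : ∀ᵐ ω ∂P, ∀ t, 0 ≤ t →
      Tendsto (fun j => partConv β c D (F j) t ω) atTop (𝓝 (X t ω)) := by
    filter_upwards [hae] with ω hω t ht
    obtain ⟨L, hL⟩ := exists_nat_ge t
    obtain ⟨u, hu, hb⟩ := hω L
    have h1 : Summable fun j => g j t ω := Summable.of_norm_bounded hu fun j => hb j t ⟨ht, hL⟩
    refine (h1.hasSum.tendsto_sum_nat.const_add (partConv β c D (F 0) t ω)).congr fun j => ?_
    rw [Finset.sum_range_sub (fun j => partConv β c D (F j) t ω)]
    ring
  have hm : ∀ t : ℝ≥0, ∀ F, AEMeasurable (fun ω => partConv β c D F t ω) P := fun t F =>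
    hW.aemeasurable_pathInt F c (contDiff_osc D) t.2
  refine ⟨fun t => X t, fun t => ?_, fun t => ?_, ?_⟩
  · refine (aemeasurable_of_tendsto_metrizable_ae atTop (fun j => hm t (F j)) ?_).aestronglyMeasurable
    filter_upwards [hlim] with ω hω using hω t t.2
  · have h1 : ∀ G : Finset ℤ, ∫⁻ ω, ‖X t ω - partConv β c D G t ω‖ₑ ^ (2 : ℝ) ∂P ≤
        momConst 2 * (tailSq c G * ENNReal.ofReal t) := fun G => by
      refine lintegral_rpow_le_of_tendsto
        (Z := fun j ω => partConv β c D (F j) t ω - partConv β c D G t ω)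
        (fun j => (hm t (F j)).sub (hm t G)) ?_ ?_
      · filter_upwards [hlim] with ω hω using (hω t t.2).sub_const _
      · filter_upwards [hF.eventually (eventually_ge_atTop G)] with j hj
        have := lintegral_rpow_pathInt_sub_le hW c (contDiff_osc D) le_rfl t.2
          (fun r _ => (norm_osc D r).le) (q := 2) (by norm_num) hj
        rw [one_pow, one_mul, sub_zero, div_self two_ne_zero, ENNReal.rpow_one] at this
        exact this
    have h2 : Tendsto (fun G => (momConst 2 * (tailSq c G * ENNReal.ofReal t)) ^ (1 / 2 : ℝ)) atTop
        (𝓝 0) := by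
      have h3 := ENNReal.Tendsto.const_mul (a := momConst 2)
        (ENNReal.Tendsto.mul_const (b := ENNReal.ofReal t) (tendsto_tailSq hc)
          (.inr ENNReal.ofReal_ne_top)) (.inr (momConst_lt_top (by norm_num)).ne)
      rw [zero_mul, mul_zero] at h3
      have h4 := ((ENNReal.continuous_rpow_const (y := (1 / 2 : ℝ))).tendsto 0).comp h3
      rwa [ENNReal.zero_rpow_of_pos (by norm_num)] at h4
    refine tendsto_of_tendsto_of_tendsto_of_le_of_le tendsto_const_nhds h2 (fun _ => zero_le)
      fun G => ?_
    rw [eLpNorm_eq_lintegral_rpow_enorm_toReal two_ne_zero (by norm_num)]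
    exact ENNReal.rpow_le_rpow (by simpa using h1 G) (by norm_num)
  · filter_upwards [hae, hW.ae_continuous_partConv c D] with ω hω hcont
    have hcX : ∀ L : ℕ, ContinuousOn (fun t => X t ω) (Set.Icc 0 L) := fun L => by
      obtain ⟨u, hu, hb⟩ := hω L
      exact (hcont (F 0)).continuousOn.add
        (continuousOn_tsum (fun j => ((hcont _).sub (hcont _)).continuousOn) hu hb)
    refine continuous_iff_continuousAt.2 fun t => ?_
    obtain ⟨L, hL⟩ := exists_nat_gt (t : ℝ)
    have h5 : ContinuousOn (fun t : ℝ≥0 => X t ω) {t : ℝ≥0 | (t : ℝ) < L} :=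
      (hcX L).comp NNReal.continuous_coe.continuousOn fun t ht => ⟨t.2, le_of_lt ht⟩
    exact h5.continuousAt ((isOpen_lt NNReal.continuous_coe continuous_const).mem_nhds hL)

theorem exists_isStochasticConvolution [IsProbabilityMeasure P] {β : ℤ → ℝ≥0 → Ω → ℂ}
    (hW : IsCylindricalWiener β P) {φ : L2Torus →ₗ[ℂ] (ℤ → ℂ)}
    (hφ : ∀ n : ℤ, ∑' k, ‖φ (fourierLp 2 k) n‖ₑ ^ 2 ≠ ∞) :
    ∃ Ψ, IsStochasticConvolution φ β P Ψ := by
  choose Y hm hlim hc using fun n : ℤ => exists_isConvCoeff hW (hφ n) (disp n)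
  refine ⟨fun t ω n => cexp (I * (t : ℝ) * disp n) * Y n t ω, fun t n => (hm n t).const_mul _,
    fun t n => ?_, ?_⟩
  · refine (hlim n t).congr fun F => ?_
    refine Eq.trans ?_ (eLpNorm_noisePath_sub_partConv hW (fun k => φ (fourierLp 2 k) n)
      (fun t ω n => cexp (I * (t : ℝ) * disp n) * Y n t ω) n t F)
    refine eLpNorm_congr_norm_ae (.of_forall fun ω => ?_)
    rw [noisePath, Real.toNNReal_coe, ← mul_assoc, ← Complex.exp_add, neg_add_cancel,
      Complex.exp_zero, one_mul]
  · filter_upwards [ae_all_iff.2 hc] with ω hω n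
    exact Continuous.mul (by fun_prop) (hω n)

end Noise

/-! ### Bessel potentials -/

lemma enorm_jb_rpow (α x : ℝ) : ‖((jb x ^ α : ℝ) : ℂ)‖ₑ = wt α x := by
  rw [← ofReal_norm, Complex.norm_real, Real.norm_of_nonneg (Real.rpow_nonneg (jb_pos x).le α), wt]

lemma wt_mul_enorm_besselPotential (α s : ℝ) (f : L2Torus) (n : ℤ) :
    wt s n * ‖besselPotential α f n‖ₑ = wt (s - α) n * ‖fourierCoeff f n‖ₑ := by
  have h1 : besselPotential α f n = ((jb n ^ (-α) : ℝ) : ℂ) * fourierCoeff f n := rfl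
  rw [h1, enorm_mul, enorm_jb_rpow, ← mul_assoc, ← wt_add, sub_eq_add_neg]

lemma enorm_fourierCoeff_le (f : L2Torus) (n : ℤ) : ‖fourierCoeff f n‖ₑ ≤ ‖f‖ₑ := by
  rw [← fourierBasis_repr, ← ofReal_norm, ← ofReal_norm,
    ← (fourierBasis (T := (1 : ℝ))).repr.norm_map f]
  exact ENNReal.ofReal_le_ofReal (lp.norm_apply_le_norm two_ne_zero _ n)

lemma fourierCoeff_fourierLp (k n : ℤ) :
    fourierCoeff (fourierLp 2 k : L2Torus) n = if k = n then 1 else 0 := by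
  rw [fourierCoeff_congr_ae (coeFn_fourierLp 2 k), fourierCoeff_fourier, Pi.single_apply]
  simp only [eq_comm]

/-- A Fourier multiplier is diagonal, so in the inner sum only k = n contributes. -/
lemma gammaNorm_besselPotential (α s p : ℝ) :
    gammaNorm s p (besselPotential α) = (∑' n : ℤ, wt ((s - α) * p) n) ^ (1 / p) := by
  rw [gammaNorm]
  congr 1
  refine tsum_congr fun n => ?_
  rw [tsum_eq_single n]
  · change (((wt s n * _) ^ (2 : ℝ)) ^ (1 / 2 : ℝ)) ^ p = _
    rw [wt_mul_enorm_besselPotential, fourierCoeff_fourierLp, if_pos rfl, enorm_one, mul_one,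
      wt_rpow, wt_rpow, wt_rpow]
    congr 1
    ring
  · intro k hk
    change (wt s n * _) ^ (2 : ℝ) = 0
    rw [wt_mul_enorm_besselPotential, fourierCoeff_fourierLp, if_neg hk, enorm_zero, mul_zero,
      ENNReal.zero_rpow_of_pos two_pos]

lemma tsum_wt_int_lt_top_iff (a : ℝ) : ∑' n : ℤ, wt a n < ∞ ↔ a < -1 := by
  refine ⟨fun h => ?_, tsum_wt_int_lt_top⟩
  by_contra! ha
  have h1 : ∑' n : ℕ, wt (-1) n < ∞ := by
    refine lt_of_le_of_lt ?_ h
    refine (ENNReal.tsum_le_tsum fun n : ℕ => wt_le_wt ha n).trans ?_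
    simpa using ENNReal.tsum_comp_le_tsum_of_injective (Nat.cast_injective (R := ℤ))
      fun n : ℤ => wt a n
  have h2 : Summable fun n : ℕ => jb n ^ (-1 : ℝ) := by
    refine (ENNReal.summable_toReal h1.ne).congr fun n => ?_
    rw [wt, ENNReal.toReal_ofReal (Real.rpow_nonneg (jb_pos _).le _)]
  refine mt (summable_nat_add_iff 1).1 Real.not_summable_one_div_natCast ?_
  refine Summable.of_nonneg_of_le (fun n => by positivity) (fun n => ?_) h2
  rw [Real.rpow_neg_one, one_div]
  refine inv_anti₀ (jb_pos _) ?_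
  have := jb_le_one_add_abs (n : ℝ)
  rw [Nat.abs_cast] at this
  push_cast
  linarith

/-- The γ-norm is a sum of ⟨n⟩^{(s-α)p} over the integers, finite exactly for exponents below -1.
Boundedness then comes for free, with the γ-norm as constant, because |f̂(n)| ≤ ‖f‖. -/
theorem isGammaRadonifying_besselPotential_iff {α s p : ℝ} (hp : 1 ≤ p) :
    IsGammaRadonifying s p (besselPotential α) ↔ s < α - 1 / p := by
  have hp0 : 0 < p := by linarith
  have key : gammaNorm s p (besselPotential α) < ∞ ↔ s < α - 1 / p := by
    rw [gammaNorm_besselPotential, ENNReal.rpow_lt_top_iff_of_pos (by positivity),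
      tsum_wt_int_lt_top_iff, ← lt_div_iff₀ hp0, neg_div]
    constructor <;> intro h <;> linarith
  refine ⟨fun h => key.1 h.finite_norm, fun h => ⟨?_, key.2 h⟩⟩
  have hfin := key.2 h
  refine ⟨(gammaNorm s p (besselPotential α)).toNNReal, fun f => ?_⟩
  rw [ENNReal.coe_toNNReal hfin.ne, gammaNorm_besselPotential, eFL,
    ← ENNReal.rpow_le_rpow_iff hp0, ENNReal.mul_rpow_of_nonneg _ _ hp0.le, ← ENNReal.rpow_mul,
    ← ENNReal.rpow_mul, one_div_mul_cancel hp0.ne', ENNReal.rpow_one, ENNReal.rpow_one,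
    ← ENNReal.tsum_mul_right]
  refine ENNReal.tsum_le_tsum fun n => ?_
  change (wt s n * _) ^ p ≤ _
  rw [wt_mul_enorm_besselPotential, ← wt_rpow, ENNReal.mul_rpow_of_nonneg _ _ hp0.le]
  exact mul_le_mul' le_rfl (ENNReal.rpow_le_rpow (enorm_fourierCoeff_le f n) hp0.le)

/-- With s = α/4 and p ≥ 4/α one has s + 1/p ≤ α/2 < α; the maximum with 2 ensures p > 1. -/
theorem exists_isGammaRadonifying_besselPotential {α : ℝ} (hα : 0 < α) :
    ∃ s p : ℝ, 0 < s ∧ 1 < p ∧ IsGammaRadonifying s p (besselPotential α) := by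
  have h2 : (2 : ℝ) ≤ max 2 (4 / α) := le_max_left _ _
  have hp : 1 / max 2 (4 / α) ≤ α / 4 := by
    rw [div_le_iff₀ (by linarith)]
    have := mul_le_mul_of_nonneg_left (le_max_right 2 (4 / α)) (by positivity : 0 ≤ α / 4)
    rwa [div_mul_div_cancel₀ (by norm_num), div_self hα.ne'] at this
  refine ⟨α / 4, max 2 (4 / α), by positivity, by linarith, ?_⟩
  rw [isGammaRadonifying_besselPotential_iff (by linarith)]
  linarith

end WickSNLS

end

/-! ### Assembly of the theorem. -/

theorem theorem1p1 :
    -- pathwise local well-posedness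
    (∀ s p : ℝ, 0 < s → 1 < p →
      ∃ b : ℝ, 0 < b ∧ (b - 1) * p < -1 ∧
      -- the local existence time, a function of a bound on the data and of the path `Ψ` only
      ∃ 𝒯 : ℝ≥0 → (ℝ≥0 → ℤ → ℂ) → ℝ≥0,
      ∀ φ : WickSNLS.L2Torus →ₗ[ℂ] (ℤ → ℂ), WickSNLS.IsGammaRadonifying s p φ →
      ∀ (Ω : Type*) (m : MeasurableSpace Ω) (P : Measure Ω) (_ : IsProbabilityMeasure P)
        (β : ℤ → ℝ≥0 → Ω → ℂ), WickSNLS.IsCylindricalWiener β P →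
      (∃ Ψ, WickSNLS.IsStochasticConvolution φ β P Ψ) ∧
      ∀ Ψ, WickSNLS.IsStochasticConvolution φ β P Ψ →
        (∀ 𝓕 : Filtration ℝ≥0 m, WickSNLS.UsualConditions 𝓕 P →
          (∀ k, StronglyAdapted 𝓕 (β k)) →
          ∀ R : ℝ≥0, IsStoppingTime 𝓕
            (fun ω => ((𝒯 R (fun t => Ψ t ω) : ℝ≥0) : WithTop ℝ≥0))) ∧
        ∀ᵐ ω ∂P, ∀ (R T : ℝ≥0), T = 𝒯 R (fun t => Ψ t ω) →
          0 < T ∧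
          -- existence and uniqueness
          (∀ u₀ : ℤ → ℂ, WickSNLS.eFL s p u₀ ≤ R →
            ∃ u, WickSNLS.IsSolutionInClass s b p T u₀ (fun t => Ψ t ω) u ∧
              ∀ v, WickSNLS.IsSolutionInClass s b p T u₀ (fun t => Ψ t ω) v →
                ∀ t ∈ Set.Icc (0 : ℝ) T, v t = u t) ∧
          -- continuous dependence on the initial data
          (∀ (u₀ : ℤ → ℂ) (u : ℝ → ℤ → ℂ) (v₀ : ℕ → ℤ → ℂ) (v : ℕ → ℝ → ℤ → ℂ),
            WickSNLS.eFL s p u₀ ≤ R → (∀ j, WickSNLS.eFL s p (v₀ j) ≤ R) →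
            WickSNLS.IsSolutionInClass s b p T u₀ (fun t => Ψ t ω) u →
            (∀ j, WickSNLS.IsSolutionInClass s b p T (v₀ j) (fun t => Ψ t ω) (v j)) →
            Tendsto (fun j => WickSNLS.eFL s p (v₀ j - u₀)) atTop (𝓝 0) →
            Tendsto (fun j => ⨆ t ∈ Set.Icc (0 : ℝ) T, WickSNLS.eFL s p (v j t - u t))
              atTop (𝓝 0) ∧
            Tendsto (fun j => WickSNLS.eXT s b p T (v j - u)) atTop (𝓝 0))) ∧
    -- the Bessel potentials, and almost space-time white noise
    (∀ α s p : ℝ, 1 ≤ p →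
      (WickSNLS.IsGammaRadonifying s p (WickSNLS.besselPotential α) ↔ s < α - 1 / p)) ∧
    (∀ α : ℝ, 0 < α → ∃ s p : ℝ, 0 < s ∧ 1 < p ∧
      WickSNLS.IsGammaRadonifying s p (WickSNLS.besselPotential α)) := by

  refine ⟨fun s p hs hp => ?_, fun α s p hp => WickSNLS.isGammaRadonifying_besselPotential_iff hp,
    fun α hα => WickSNLS.exists_isGammaRadonifying_besselPotential hα⟩
  obtain ⟨e, rfl, rfl⟩ := WickSNLS.exists_exponents hs hp
  -- Both b and the existence time as a function of the path depend on s and p only; they are fixed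
  -- before φ and the noise.
  refine ⟨e.b, e.b_pos, e.sub_one_mul_p_lt (e.b_lt_b'.trans e.b'_lt), WickSNLS.existTime e, ?_⟩
  intro φ hφ Ω m P _ β hW
  refine ⟨WickSNLS.exists_isStochasticConvolution hW
    (WickSNLS.tsum_sq_ne_top_of_gammaNorm (zero_lt_one.trans hp) hφ.finite_norm), fun Ψ hΨ =>
    ⟨fun 𝓕 hU hβ R => WickSNLS.isStoppingTime_existTime e hU
      (hΨ.measurable_filtration hW hU hβ) hΨ.continuous_paths R, ?_⟩⟩
  filter_upwards [WickSNLS.ae_goodPath e hW hφ.finite_norm hΨ] with ω hω R T hT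
  subst hT
  exact WickSNLS.wellPosed_of_goodPath e R hω
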